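/- **Setting.** Let $D$ be an oriented planar rectangular diagram of complexity $n\ge 2$: an $n\times n$ grid with exactly one $O$ and one $X$ in each row and each column (never in the same square); in each column the $X$ is joined to the $O$ by a vertical segment, oriented from $X$ to $O$, in each row the $O$ is joined to the $X$ by a horizontal segment, oriented from $O$ to $X$, and vertical segments pass over horizontal ones. Let $n_\pm$ be the numbers of positive and negative crossings, $w(D)=n_+-n_-$, and let $\mathrm{rot}$ of a family of oriented circles be the number of counterclockwise circles minus the number of clockwise ones; $\mathrm{rot}(D)$ is $\mathrm{rot}$ of the Seifert circles. *Bigelow generators.* Around each vertical segment draw a narrow figure-eight, with one self-intersection (between any two consecutive rows met by the segment), winding clockwise around the upper end and counterclockwise around the lower end. $\mathcal G$ is the set of $n$-tuples of intersection points of figure-eights and horizontal segments with exactly one point on each figure-eight and one on each horizontal segment; $\mathbf x\in\mathcal G$ consists of the points nearest to the $X$'s. For $g\in\mathcal G$ let $\overline P(g)$ be the number of points of $g$ at which the figure-eight is oriented upward, $T(g)$ the number of pairs of points of $g$ with the second one to the right of and above the first, and $Q(g)$ the sum of the winding numbers around all $X$'s and $O$'s of the loops going from $g$ along the horizontal segments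 to $\mathbf x$ and back to $g$ along the figure-eights. Put $$J(g)=2(T(g)-Q(g))-2T(\mathbf x)+\mathrm{rot}(D)+w(D),\qquad P(g)=\overline P(g)-\overline P(\mathbf x)-\mathrm{rot}(D)-w(D).$$ *Khovanov complex.* $\mathcal K$ is the set of enhanced Kauffman states: a smoothing of each crossing together with an orientation of each resulting circle (counterclockwise stands for $1$, clockwise for $x$). With $\overline i(s)$ the number of $1$-smoothings, $i(s)=\overline i(s)-n_-$ and $j(s)=\mathrm{rot}(s)+\overline i(s)+n_+-2n_-$. Let $d$ be the Khovanov differential on $\mathbb Q\mathcal K$ and $\mathrm{Kh}^{i,j}(D)$ its homology. Let $R(s)$ be the sum of the winding numbers of the circles of $s$ around points chosen one in each component of the complement of the underlying graph of $D$, let $d_0$ be the part of $d$ that preserves $R$, and $d_1=d-d_0$. A crossing is forbidden in $s$ if both vertical half-edges are oriented towards it and both horizontal ones away from it; $\mathcal H\subset\mathcal K$ is the set of states without forbidden crossings. The states that differ from $s\in\mathcal K\setminus\mathcal H$ only in the smoothings of its forbidden crossings (with the same orientations of all edges) form a hypercube. For a forbidden crossing $c$, let $h_c$ be the map on this hypercube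 that is minus the inverse of $d_0$ from the half with $0$-smoothing at $c$ to the half with $1$-smoothing at $c$ (and zero on the former half). Let $h$ be, on each hypercube, the average of the $h_c$ over its forbidden crossings $c$, and $h=0$ on $\mathcal H$. *The differential.* Each $g\in\mathcal G$ gives a state $\phi(g)$: vertical edges are oriented away from, and horizontal edges towards, the point of $g$ in their column or row; a crossing with a nearby point of $g$ gets the $0$-smoothing if the figure-eight is oriented upward at this point and the $1$-smoothing otherwise; all other crossings get the smoothing compatible with the orientation. On the $\mathbb Q$-vector space $B$ with basis $\mathcal G$, let $\delta$ be the linear map whose coefficient from $g$ to $g'$ is the coefficient from $\phi(g)$ to $\phi(g')$ of the finite sum $$d_1+d_1hd_1+d_1hd_1hd_1+\cdots .$$ **Statement.** 1. $d_0$ is a differential, all of whose non-zero coefficients are between elements of $\mathcal K\setminus\mathcal H$; on each hypercube, $h_cd_0+d_0h_c=-\mathrm{Id}$ for every forbidden crossing $c$; and $hd_0+d_0h=-\mathrm{Id}$ on $\mathbb Q(\mathcal K\setminus\mathcal H)$. 2. $\delta^2=0$; $\delta$ respects $J$ and increases $P$ by $1$; and the homology of $(B,\delta)$ is Khovanov homology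 over $\mathbb Q$: for all $i,j\in\mathbb Z$ its part with $P=i-j$ and $J=j$ is isomorphic to $\mathrm{Kh}^{i,j}(D)$. 3. $\delta$ is canonical: if an orientation-preserving diffeomorphism of the plane sends $D$ to an oriented rectangular diagram $D'$, horizontal segments to horizontal segments, vertical ones to vertical ones, $X$'s to $X$'s and $O$'s to $O$'s, then for any choices of the figure-eights there are a bijection $\mathcal G(D)\to\mathcal G(D')$ preserving $J$ and $P$, and signs $u:\mathcal G(D)\to\{\pm1\}$, such that $g\mapsto u(g)\,g'$ (where $g'$ is the image of $g$) is an isomorphism of chain complexes $(B(D),\delta)\cong(B(D'),\delta)$. -/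

import Mathlib

open scoped Manifold ContDiff

noncomputable section

namespace GridKh

/-! ## Grid diagrams and planar rectangular diagrams -/

/-- A grid diagram of size `n`: column `c` carries its `O` in row `o c` and its `X` in row `x c`.
Columns are numbered from left to right and rows from bottom to top. -/
structure GridDiagram (n : ℕ) where
  o : Equiv.Perm (Fin n)
  x : Equiv.Perm (Fin n)
  ne : ∀ c, o c ≠ x c

/-- The four half-edges at a point of the grid: north, south, east, west. -/
inductive Dir
  | N | S | E | W
  deriving DecidableEq

/-- The half-edge joined to a given one in the smoothing of a crossing whose vertical strand is
the overstrand. The `0`-smoothing (`false`) merges the two regions swept out when the overstrand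
is rotated counterclockwise, that is the north-west and the south-east one, so its arcs join N to E
and S to W. The `1`-smoothing (`true`) joins N to W and S to E. -/
def Dir.partner : Bool → Dir → Dir
  | false, .N => .E
  | false, .E => .N
  | false, .S => .W
  | false, .W => .S
  | true, .N => .W
  | true, .W => .N
  | true, .S => .E
  | true, .E => .S

/-- Edges are oriented by a Boolean: `true` is rightward or upward. This says whether the
half-edge in direction `d`, with orientation `b`, points away from its base point. -/
def Dir.outward : Dir → Bool → Bool
  | .N, b => b
  | .E, b => b
  | .S, b => !b
  | .W, b => !b

namespace GridDiagram

variable {n : ℕ} (D : GridDiagram n)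

/-- Lowest row of the vertical segment of column `c`. -/
def bot (c : Fin n) : Fin n := min (D.o c) (D.x c)

/-- Highest row of the vertical segment of column `c`. -/
def top (c : Fin n) : Fin n := max (D.o c) (D.x c)

/-- Leftmost column of the horizontal segment of row `r`. -/
def left (r : Fin n) : Fin n := min (D.o.symm r) (D.x.symm r)

/-- Rightmost column of the horizontal segment of row `r`. -/
def right (r : Fin n) : Fin n := max (D.o.symm r) (D.x.symm r)

/-- The vertical and the horizontal segment through `v = (column, row)` cross there. At a crossing
the vertical strand passes over the horizontal one. -/
def IsCrossing (v : Fin n × Fin n) : Prop :=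
  D.left v.2 < v.1 ∧ v.1 < D.right v.2 ∧ D.bot v.1 < v.2 ∧ v.2 < D.top v.1

def Crossing : Type := {v : Fin n × Fin n // D.IsCrossing v}

instance : Finite D.Crossing := inferInstanceAs (Finite {v : Fin n × Fin n // D.IsCrossing v})
instance : Fintype D.Crossing := Fintype.ofFinite _
instance : DecidableEq D.Crossing := Classical.decEq _

/-- Unit pieces of horizontal segments; `(c, r)` stands for the piece from `(c, r)` to
`(c + 1, r)`. -/
def HEdge : Type := {p : Fin n × Fin n // D.left p.2 ≤ p.1 ∧ p.1 < D.right p.2}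

/-- Unit pieces of vertical segments; `(c, r)` stands for the piece from `(c, r)` to
`(c, r + 1)`. -/
def VEdge : Type := {p : Fin n × Fin n // D.bot p.1 ≤ p.2 ∧ p.2 < D.top p.1}

instance : Finite D.HEdge :=
  inferInstanceAs (Finite {p : Fin n × Fin n // D.left p.2 ≤ p.1 ∧ p.1 < D.right p.2})
instance : Finite D.VEdge :=
  inferInstanceAs (Finite {p : Fin n × Fin n // D.bot p.1 ≤ p.2 ∧ p.2 < D.top p.1})
instance : Fintype D.HEdge := Fintype.ofFinite _
instance : Fintype D.VEdge := Fintype.ofFinite _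

/-- Unit pieces of the rectangular diagram, horizontal (`inl`) or vertical (`inr`). -/
abbrev Edge : Type := D.HEdge ⊕ D.VEdge

/-- The edge `e` leaves the grid point `v` in direction `d`. -/
def IsAt (v : Fin n × Fin n) : Dir → D.Edge → Prop
  | .N, .inr e => e.1 = v
  | .S, .inr e => e.1.1 = v.1 ∧ e.1.2.val + 1 = v.2.val
  | .E, .inl e => e.1 = v
  | .W, .inl e => e.1.2 = v.2 ∧ e.1.1.val + 1 = v.1.val
  | _, _ => False

/-! ## Resolutions, circles, enhanced Kauffman states -/

/-- A choice of smoothing for each crossing. -/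
abbrev Resolution : Type := D.Crossing → Bool

variable {D} in
/-- At the grid point `v`, the resolved diagram continues from direction `d` to direction `d'`
(if there are edges in these directions). -/
def Linked (ρ : D.Resolution) (v : Fin n × Fin n) (d d' : Dir) : Prop :=
  (∃ h : D.IsCrossing v, d' = Dir.partner (ρ ⟨v, h⟩) d) ∨ (¬ D.IsCrossing v ∧ d ≠ d')

variable {D} in
/-- Two edges are consecutive on a circle of the resolved diagram. -/
def Consecutive (ρ : D.Resolution) (e e' : D.Edge) : Prop :=
  ∃ v d d', D.IsAt v d e ∧ D.IsAt v d' e' ∧ Linked ρ v d d'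

variable {D} in
/-- The circles of the resolved diagram. -/
def Circle (ρ : D.Resolution) : Type := Quot (Consecutive ρ)

variable {D} in
/-- The circle containing an edge. -/
def circleOf (ρ : D.Resolution) (e : D.Edge) : Circle ρ := Quot.mk _ e

instance (ρ : D.Resolution) : Finite (Circle ρ) := inferInstanceAs (Finite (Quot (Consecutive ρ)))
instance (ρ : D.Resolution) : Fintype (Circle ρ) := Fintype.ofFinite _
instance (ρ : D.Resolution) : DecidableEq (Circle ρ) := Classical.decEq _

variable {D} in
/-- An orientation of the edges which is consistent along each circle of the resolved diagram. -/
def Coherent (ρ : D.Resolution) (ε : D.Edge → Bool) : Prop :=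
  ∀ v d d' e e', D.IsAt v d e → D.IsAt v d' e' → Linked ρ v d d' →
    d.outward (ε e) = !d'.outward (ε e')

/-- Enhanced Kauffman states: a resolution and an orientation of each of its circles. -/
def EState : Type := {s : D.Resolution × (D.Edge → Bool) // Coherent s.1 s.2}

instance : Finite D.EState :=
  inferInstanceAs (Finite {s : D.Resolution × (D.Edge → Bool) // Coherent s.1 s.2})
instance : Fintype D.EState := Fintype.ofFinite _
instance : DecidableEq D.EState := Classical.decEq _

variable {D}

/-- The resolution of an enhanced state. -/
def EState.res (s : D.EState) : D.Resolution := s.1.1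

/-- The orientation of the edges in an enhanced state. -/
def EState.ori (s : D.EState) : D.Edge → Bool := s.1.2

/-- The signed area `∮ x dy` enclosed by an oriented circle. -/
def signedArea (ρ : D.Resolution) (ε : D.Edge → Bool) (C : Circle ρ) : ℤ :=
  ∑ e : D.VEdge, if circleOf ρ (.inr e) = C then
    (if ε (.inr e) then (e.1.1.val : ℤ) else -(e.1.1.val : ℤ)) else 0

/-- The circle is oriented counterclockwise, i.e. it encloses a positive signed area. -/
def IsCCW (ρ : D.Resolution) (ε : D.Edge → Bool) (C : Circle ρ) : Prop := 0 < signedArea ρ ε C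

open Classical in
/-- The rotation number: number of counterclockwise circles minus number of the other ones. -/
def rot (ρ : D.Resolution) (ε : D.Edge → Bool) : ℤ :=
  ∑ C : Circle ρ, if IsCCW ρ ε C then 1 else -1

variable (D)

/-- The orientation of the link: from `O` to `X` on rows, from `X` to `O` on columns. -/
def linkOri : D.Edge → Bool
  | .inl e => decide (D.o.symm e.1.2 < D.x.symm e.1.2)
  | .inr e => decide (D.x e.1.1 < D.o e.1.1)

/-- A crossing is positive iff its overstrand points up and its understrand points left, or its
overstrand points down and its understrand points right. -/
def IsPositive (c : D.Crossing) : Prop :=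
  ¬ (D.x c.1.1 < D.o c.1.1 ↔ D.o.symm c.1.2 < D.x.symm c.1.2)

open Classical in
/-- Number of positive crossings. -/
def nPos : ℤ := ∑ c : D.Crossing, if D.IsPositive c then 1 else 0

open Classical in
/-- Number of negative crossings. -/
def nNeg : ℤ := ∑ c : D.Crossing, if D.IsPositive c then 0 else 1

def writhe : ℤ := D.nPos - D.nNeg

open Classical in
/-- The oriented resolution: `0`-smoothing at positive crossings, `1`-smoothing at negative ones. -/
def seifertRes : D.Resolution := fun c => decide (¬ D.IsPositive c)

/-- The rotation number of the oriented diagram, computed from its Seifert circles. -/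
def rotD : ℤ := rot D.seifertRes D.linkOri

variable {D}

/-! ## The Khovanov complex -/

/-- Number of `1`-smoothings. -/
def EState.ibar (s : D.EState) : ℤ := ∑ c : D.Crossing, if s.res c then 1 else 0

/-- Khovanov's homological grading. -/
def EState.i (s : D.EState) : ℤ := s.ibar - D.nNeg

/-- Khovanov's quantum grading. -/
def EState.j (s : D.EState) : ℤ := rot s.res s.ori + s.ibar + D.nPos - 2 * D.nNeg

open Classical in
/-- The basis element of `V = ⟨1, x⟩` on the circle through `e`: `true` stands for `1` (the circle is
counterclockwise), `false` for `x` (clockwise). -/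
def EState.label (s : D.EState) (e : D.Edge) : Bool :=
  decide (IsCCW s.res s.ori (circleOf s.res e))

/-- Coefficient of `c` in the product `a * b` of `V`: `1 * 1 = 1`, `1 * x = x * 1 = x`, `x * x = 0`. -/
def mulCoeff : (a b c : Bool) → ℚ
  | true, true, true => 1
  | true, false, false => 1
  | false, true, false => 1
  | _, _, _ => 0

/-- Coefficient of `b ⊗ c` in the coproduct of `a`: `1 ↦ 1 ⊗ x + x ⊗ 1`, `x ↦ x ⊗ x`. -/
def comulCoeff : (a b c : Bool) → ℚ
  | true, true, false => 1
  | true, false, true => 1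
  | false, false, false => 1
  | _, _, _ => 0

/-- The edge north of a crossing. -/
def Crossing.north (c : D.Crossing) : D.Edge := .inr ⟨c.1, c.2.2.2.1.le, c.2.2.2.2⟩

/-- The edge south of a crossing. -/
def Crossing.south (c : D.Crossing) : D.Edge :=
  .inr ⟨(c.1.1, ⟨c.1.2.val - 1, by omega⟩), by
    have h := c.2.2.2.1
    have h' := c.2.2.2.2
    simp only [Fin.lt_def, Fin.le_def] at *
    omega⟩

/-- The sign of the edge of the cube at the crossing `c`: the parity of the number of
`1`-smoothings before `c` in the lexicographic order. -/
def cubeSign (ρ : D.Resolution) (c : D.Crossing) : ℚ :=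
  ∏ c' : D.Crossing, if toLex c'.1 < toLex c.1 ∧ ρ c' = true then -1 else 1

/-- Coefficient of `t` in the image of `s` under multiplication or comultiplication, when `t` is
obtained from `s` by changing the smoothing of `c` from `0` to `1`. The two arcs of the smoothing at
`c` are the one through the edge north of `c` and the one through the edge south of `c`. -/
def edgeCoeff (s t : D.EState) (c : D.Crossing) : ℚ :=
  if circleOf s.res c.north = circleOf s.res c.south then
    comulCoeff (s.label c.north) (t.label c.north) (t.label c.south)
  else mulCoeff (s.label c.north) (s.label c.south) (t.label c.north)

open Classical in
variable (D) in
/-- The Khovanov differential; the entry `(t, s)` is the coefficient of `t` in the differential of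
`s`. The circles which do not pass by the crossing `c` keep their orientations. -/
def khovanov : Matrix D.EState D.EState ℚ := fun t s =>
  ∑ c : D.Crossing,
    if s.res c = false ∧ t.res = Function.update s.res c true ∧
        ∀ e, circleOf s.res e ≠ circleOf s.res c.north →
          circleOf s.res e ≠ circleOf s.res c.south → t.ori e = s.ori e
    then cubeSign s.res c * edgeCoeff s t c else 0

/-! ## The grading `R` and the hypercube complexes -/

/-- The unit cells of the plane around the diagram; the centre of the cell `(a, b)` is
`(a - 1/2, b - 1/2)`. -/
abbrev Cell (n : ℕ) : Type := Fin (n + 1) × Fin (n + 1)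

variable (D) in
/-- `q` is the right or upper neighbour of `p` and the diagram does not separate them. -/
def CellAdj (p q : Cell n) : Prop :=
  (q.1.val = p.1.val + 1 ∧ q.2 = p.2 ∧
      ¬ ∃ e : D.VEdge, e.1.1.val = p.1.val ∧ e.1.2.val + 1 = p.2.val) ∨
  (q.2.val = p.2.val + 1 ∧ q.1 = p.1 ∧
      ¬ ∃ e : D.HEdge, e.1.1.val + 1 = p.1.val ∧ e.1.2.val = p.2.val)

variable (D) in
/-- The connected components of the complement of the diagram in the plane. -/
def Region : Type := Quot D.CellAdj

instance : Finite D.Region := inferInstanceAs (Finite (Quot D.CellAdj))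
instance : Fintype D.Region := Fintype.ofFinite _

/-- The total winding number of the oriented circles of `s` around the centre of the cell `p`:
signed number of times the circles cross the vertical ray upwards from the centre. -/
def EState.winding (s : D.EState) (p : Cell n) : ℤ :=
  ∑ e : D.HEdge, if e.1.1.val + 1 = p.1.val ∧ p.2.val ≤ e.1.2.val then
    (if s.ori (.inl e) then -1 else 1) else 0

/-- The grading `R`: a point is chosen in each component of the complement of the diagram, and the
winding numbers around these points are added. -/
def EState.R (s : D.EState) : ℤ := ∑ q : D.Region, s.winding (Quot.out q)

/-- Forbidden orientation at a crossing: both vertical edges point to the crossing and both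
horizontal ones point away from it. -/
def EState.Forbidden (s : D.EState) (c : D.Crossing) : Prop :=
  ∀ d e, D.IsAt c.1 d e → (d.outward (s.ori e) = true ↔ d = .E ∨ d = .W)

/-- The states without forbidden crossings. -/
def EState.InH (s : D.EState) : Prop := ∀ c, ¬ s.Forbidden c

variable (D) in
/-- The part of the Khovanov differential that preserves `R`. -/
def khovanovR : Matrix D.EState D.EState ℚ := fun t s =>
  if t.R = s.R then D.khovanov t s else 0

variable (D) in
/-- The part of the Khovanov differential that changes `R`. -/
def khovanovRest : Matrix D.EState D.EState ℚ := D.khovanov - D.khovanovR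

open Classical in
/-- The hypercube of a state with forbidden crossings consists of all states with the same oriented
edges and the same smoothings outside the forbidden crossings. A forbidden crossing `c` splits the
hypercube into two halves, and the homotopy belonging to this splitting is minus the inverse of the
differential from the half with `0`-smoothing at `c` to the half with `1`-smoothing at `c`. -/
def splitHomotopy (c : D.Crossing) : Matrix D.EState D.EState ℚ := fun t s =>
  if s.Forbidden c ∧ s.res c = true ∧ t.res = Function.update s.res c false ∧ t.ori = s.ori
  then -(D.khovanovR s t)⁻¹ else 0

open Classical in
/-- The dimension of the hypercube of a state: its number of forbidden crossings. -/
def EState.cubeDim (s : D.EState) : ℕ :=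
  (Finset.univ.filter fun c : D.Crossing => s.Forbidden c).card

open Classical in
variable (D) in
/-- On each hypercube, the average of the homotopies of all its splittings; zero on the states
without forbidden crossings. -/
def averageHomotopy : Matrix D.EState D.EState ℚ := fun t s =>
  (1 / (s.cubeDim : ℚ)) *
    ∑ c ∈ Finset.univ.filter (fun c : D.Crossing => s.Forbidden c), splitHomotopy c t s

variable (D) in
/-- The result of cancelling the hypercube complexes by means of the averaged homotopy `h`:
`d + d h d + d h d h d + ⋯`, where `d` is the part of the differential that changes `R`. The terms
from `(h d) ^ (number of states)` on vanish, since `h` preserves `R` and `d` strictly decreases it. -/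
def cancelled : Matrix D.EState D.EState ℚ :=
  ∑ k ∈ Finset.range (Fintype.card D.EState),
    D.khovanovRest * (D.averageHomotopy * D.khovanovRest) ^ k

/-! ## Bigelow's generators -/

variable (D) in
/-- A choice of figure-eights: the self-intersection of the figure-eight of column `c` lies between
the rows `split c` and `split c + 1`. -/
structure FigureEights where
  split : Fin n → Fin n
  bot_le : ∀ c, D.bot c ≤ split c
  lt_top : ∀ c, split c < D.top c

variable (D) in
/-- Intersection points of figure-eights and horizontal segments. `((c, r), true)` is the
intersection of the horizontal segment of row `r` with the right side of the figure-eight of column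
`c`, `((c, r), false)` is the intersection with its left side. -/
def ZPoint : Type := {z : (Fin n × Fin n) × Bool //
  D.bot z.1.1 ≤ z.1.2 ∧ z.1.2 ≤ D.top z.1.1 ∧
  (z.2 = true → D.left z.1.2 ≤ z.1.1 ∧ z.1.1 < D.right z.1.2) ∧
  (z.2 = false → D.left z.1.2 < z.1.1 ∧ z.1.1 ≤ D.right z.1.2)}

instance : Finite D.ZPoint := by unfold ZPoint; infer_instance

def ZPoint.col (z : D.ZPoint) : Fin n := z.1.1.1
def ZPoint.row (z : D.ZPoint) : Fin n := z.1.1.2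
def ZPoint.onRight (z : D.ZPoint) : Bool := z.1.2

/-- The position in the plane, where the puncture in column `c` and row `r` is `(4 c, 4 r)`. -/
def ZPoint.pos (z : D.ZPoint) : ℤ × ℤ :=
  (4 * (z.col.val : ℤ) + (if z.onRight then 1 else -1), 4 * (z.row.val : ℤ))

variable (D) in
/-- Bigelow's generators: one intersection point on each figure-eight and on each horizontal
segment, listed by columns. -/
def Gen : Type :=
  {g : Fin n → D.ZPoint // (∀ c, (g c).col = c) ∧ Function.Bijective fun c => (g c).row}

instance : Finite D.Gen := by unfold Gen; infer_instance
instance : Fintype D.Gen := Fintype.ofFinite _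
instance : DecidableEq D.Gen := Classical.decEq _

/-- The point of `g` on the figure-eight of column `c`. -/
def Gen.pt (g : D.Gen) (c : Fin n) : D.ZPoint := g.1 c

/-- The permutation sending a column to the row of the point of `g` in this column. -/
def Gen.perm (g : D.Gen) : Equiv.Perm (Fin n) := Equiv.ofBijective _ g.2.2

/-- The point of `g` on the horizontal segment of row `r`. -/
def Gen.ptRow (g : D.Gen) (r : Fin n) : D.ZPoint := g.pt (g.perm.symm r)

variable (D) in
/-- The generator formed by the points nearest to the `X`'s. -/
def genX : D.Gen :=
  ⟨fun c => ⟨((c, D.x c), decide (c < D.o.symm (D.x c))), by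
      have h1 : D.o.symm (D.x c) ≠ c := fun h => D.ne c (by
        have := congrArg D.o h
        simpa using this.symm)
      refine ⟨min_le_right _ _, le_max_right _ _, ?_, ?_⟩
      · intro h
        have h : c < D.o.symm (D.x c) := by simpa using h
        simp only [left, right, Equiv.symm_apply_apply]
        exact ⟨min_le_right _ _, lt_max_of_lt_left h⟩
      · intro h
        have h : D.o.symm (D.x c) ≤ c := by simpa using h
        simp only [left, right, Equiv.symm_apply_apply]
        exact ⟨min_lt_of_left_lt (lt_of_le_of_ne h h1), le_max_right _ _⟩⟩,
    fun _ => rfl, D.x.bijective⟩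

/-- Orientation of the figure-eight at an intersection point. A figure-eight winds clockwise around
its top puncture and counterclockwise around its bottom puncture: above the self-intersection it is
oriented upward on its left side, below the self-intersection on its right side. -/
def FigureEights.IsUp (F : D.FigureEights) (z : D.ZPoint) : Prop :=
  (F.split z.col < z.row ∧ z.onRight = false) ∨ (z.row ≤ F.split z.col ∧ z.onRight = true)

open Classical in
/-- The grading `P` before normalization. -/
def FigureEights.Pbar (F : D.FigureEights) (g : D.Gen) : ℤ :=
  ∑ c, if F.IsUp (g.pt c) then 1 else 0

/-- The number of pairs of points of `g`, the second of which is to the right of and above the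
first. -/
def Gen.T (g : D.Gen) : ℤ :=
  ((Finset.univ.filter fun p : Fin n × Fin n =>
    (g.pt p.1).pos.1 < (g.pt p.2).pos.1 ∧ (g.pt p.1).pos.2 < (g.pt p.2).pos.2).card : ℤ)

end GridDiagram

/-- Signed number of crossings of the segment from `a` to `b` with the vertical ray upwards from
`p`: a crossing from right to left counts `+1`, a crossing from left to right counts `-1`. For a
closed polygon that avoids `p`, the sum over its edges is its winding number around `p`. -/
def rayCrossing (p a b : ℤ × ℤ) : ℤ :=
  if a.1 ≤ p.1 ∧ p.1 < b.1 ∧ (b.1 - a.1) * (p.2 - a.2) < (b.2 - a.2) * (p.1 - a.1) then -1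
  else if b.1 ≤ p.1 ∧ p.1 < a.1 ∧ (a.1 - b.1) * (p.2 - b.2) < (a.2 - b.2) * (p.1 - b.1) then 1
  else 0

/-- Signed number of crossings of a polygonal path with the ray. -/
def pathCrossing (p : ℤ × ℤ) : List (ℤ × ℤ) → ℤ
  | a :: b :: l => rayCrossing p a b + pathCrossing p (b :: l)
  | _ => 0

namespace GridDiagram

variable {n : ℕ} {D : GridDiagram n}

/-- The vertices of the figure-eight of column `c`, in the order of its orientation, starting at the
upper left. -/
def FigureEights.polygon (F : D.FigureEights) (c : Fin n) : List (ℤ × ℤ) :=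
  let l : ℤ := 4 * (c.val : ℤ) - 1
  let r : ℤ := 4 * (c.val : ℤ) + 1
  let t : ℤ := 4 * ((D.top c).val : ℤ) + 1
  let b : ℤ := 4 * ((D.bot c).val : ℤ) - 1
  let u : ℤ := 4 * ((F.split c).val : ℤ) + 3
  let d : ℤ := 4 * ((F.split c).val : ℤ) + 1
  [(l, t), (r, t), (r, u), (l, d), (l, b), (r, b), (r, d), (l, u)]

/-- The number of vertices of the figure-eight which precede the point `z`. -/
def FigureEights.index (F : D.FigureEights) (z : D.ZPoint) : ℕ :=
  if F.split z.col < z.row then (if z.onRight then 2 else 8) else (if z.onRight then 6 else 4)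

/-- The path along the figure-eight from its upper left vertex to the point `z`. -/
def FigureEights.pathTo (F : D.FigureEights) (z : D.ZPoint) : List (ℤ × ℤ) :=
  (F.polygon z.col).take (F.index z) ++ [z.pos]

/-- Sum of the winding numbers around `p` of the closed curves that form the loop from `g` along the
horizontal segments to `h` and back to `g` along the figure-eights. -/
def FigureEights.loopWinding (F : D.FigureEights) (g h : D.Gen) (p : ℤ × ℤ) : ℤ :=
  (∑ r, rayCrossing p (g.ptRow r).pos (h.ptRow r).pos) +
  ∑ c, pathCrossing p ((F.pathTo (h.pt c)).reverse ++ F.pathTo (g.pt c))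

/-- The grading `Q`, normalized to vanish on the generator of the `X`'s: the winding numbers of the
loop through `g` and that generator around all the punctures are added. -/
def FigureEights.Q (F : D.FigureEights) (g : D.Gen) : ℤ :=
  ∑ c : Fin n, (F.loopWinding g D.genX (4 * (c.val : ℤ), 4 * ((D.o c).val : ℤ)) +
    F.loopWinding g D.genX (4 * (c.val : ℤ), 4 * ((D.x c).val : ℤ)))

/-- The Jones grading. -/
def FigureEights.J (F : D.FigureEights) (g : D.Gen) : ℤ :=
  2 * (g.T - F.Q g) - 2 * D.genX.T + D.rotD + D.writhe

/-- The homological grading. -/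
def FigureEights.P (F : D.FigureEights) (g : D.Gen) : ℤ :=
  F.Pbar g - F.Pbar D.genX - D.rotD - D.writhe

/-! ## From generators to enhanced Kauffman states -/

/-- The orientation of the edges induced by `g`: a vertical edge is upward iff the point of `g` in
its column is below it, a horizontal edge is leftward iff the point of `g` in its row is to its
left. -/
def Gen.ori (g : D.Gen) : D.Edge → Bool
  | .inl e => decide (e.1.1 < g.perm.symm e.1.2)
  | .inr e => decide (g.perm e.1.1 ≤ e.1.2)

open Classical in
/-- The resolution induced by `g`. At a crossing near a point of `g`, it is the `0`-smoothing iff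
the figure-eight is oriented upward at this point. At the other crossings it is the only smoothing
compatible with the orientation: the `1`-smoothing if the strands are directed up and right or down
and left, the `0`-smoothing otherwise. -/
def FigureEights.res (F : D.FigureEights) (g : D.Gen) : D.Resolution := fun c =>
  if g.perm c.1.1 = c.1.2 then decide (¬ F.IsUp (g.pt c.1.1))
  else decide (g.perm c.1.1 ≤ c.1.2 ↔ c.1.1 < g.perm.symm c.1.2)

theorem corner_iff (D : GridDiagram n) (c r : Fin n) :
    (c = D.left r ∨ c = D.right r) ↔ (r = D.bot c ∨ r = D.top c) := by
  have h1 : (c = D.left r ∨ c = D.right r) ↔ (c = D.o.symm r ∨ c = D.x.symm r) := by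
    unfold left right
    rcases le_total (D.o.symm r) (D.x.symm r) with h | h <;> simp [h, or_comm]
  have h2 : (r = D.bot c ∨ r = D.top c) ↔ (r = D.o c ∨ r = D.x c) := by
    unfold bot top
    rcases le_total (D.o c) (D.x c) with h | h <;> simp [h, or_comm]
  rw [h1, h2, Equiv.eq_symm_apply, Equiv.eq_symm_apply, eq_comm (a := r), eq_comm (a := r)]

theorem Gen.bounds (g : D.Gen) (c : Fin n) :
    D.bot c ≤ g.perm c ∧ g.perm c ≤ D.top c ∧
      D.left (g.perm c) ≤ c ∧ c ≤ D.right (g.perm c) := by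
  have hc : (g.pt c).1.1.1 = c := g.2.1 c
  have hr : (g.pt c).1.1.2 = g.perm c := rfl
  obtain ⟨h1, h2, h3, h4⟩ := (g.pt c).2
  rw [hc, hr] at *
  refine ⟨h1, h2, ?_⟩
  cases hb : (g.pt c).1.2
  · exact ⟨(h4 hb).1.le, (h4 hb).2⟩
  · exact ⟨(h3 hb).1, (h3 hb).2.le⟩

theorem Gen.outward_iff (g : D.Gen) (c r : Fin n) (d : Dir) (e : D.Edge)
    (he : D.IsAt (c, r) d e) :
    match d with
    | .N => (D.bot c ≤ r ∧ r < D.top c) ∧ (d.outward (g.ori e) = true ↔ g.perm c ≤ r)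
    | .S => (D.bot c < r ∧ r ≤ D.top c) ∧ (d.outward (g.ori e) = true ↔ r ≤ g.perm c)
    | .E => (D.left r ≤ c ∧ c < D.right r) ∧ (d.outward (g.ori e) = true ↔ c < g.perm.symm r)
    | .W => (D.left r < c ∧ c ≤ D.right r) ∧ (d.outward (g.ori e) = true ↔ g.perm.symm r < c) := by
  rcases e with ⟨⟨ec, er⟩, h1, h2⟩ | ⟨⟨ec, er⟩, h1, h2⟩ <;> dsimp only at h1 h2 <;> cases d <;>
    simp only [IsAt, Prod.mk.injEq] at he <;> obtain ⟨h3, h4⟩ := he <;>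
    simp only [Gen.ori, Dir.outward, Bool.not_eq_true', decide_eq_false_iff_not, decide_eq_true_eq,
      Fin.lt_def, Fin.le_def] at * <;> subst h3 <;> try subst h4
  all_goals exact ⟨by omega, by omega⟩

theorem FigureEights.coherent (F : D.FigureEights) (g : D.Gen) : Coherent (F.res g) g.ori := by
  rintro ⟨c, r⟩ d d' e e' he he' hl
  have hk : g.perm c = r ↔ g.perm.symm r = c := by
    rw [Equiv.symm_apply_eq, eq_comm]
  have b1 := g.bounds c
  have b2 := g.bounds (g.perm.symm r)
  rw [Equiv.apply_symm_apply] at b2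
  have hcor := D.corner_iff c r
  have hcross : D.IsCrossing (c, r) ↔
    D.left r < c ∧ c < D.right r ∧ D.bot c < r ∧ r < D.top c := Iff.rfl
  have hres : ∀ h : D.IsCrossing (c, r), g.perm c ≠ r →
      (F.res g ⟨(c, r), h⟩ = true ↔ (g.perm c ≤ r ↔ c < g.perm.symm r)) := by
    intro h hne
    simp [FigureEights.res, hne]
  have k1 := g.outward_iff c r d e he
  have k2 := g.outward_iff c r d' e' he'
  have key : ((d.outward (g.ori e) = true) ↔ ¬ (d'.outward (g.ori e') = true)) →
      d.outward (g.ori e) = !d'.outward (g.ori e') := by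
    cases d.outward (g.ori e) <;> cases d'.outward (g.ori e') <;> simp
  apply key
  rcases hl with ⟨h, hl⟩ | ⟨h, hl⟩
  · have hr := hres h
    clear hres
    generalize F.res g ⟨(c, r), h⟩ = b at *
    cases b <;> cases d <;> simp only [Dir.partner] at hl <;> subst hl <;>
      simp only at k1 k2 <;> rw [k1.2, k2.2] <;> clear k1 k2 key <;>
      simp only [Fin.lt_def, Fin.le_def, Fin.ext_iff, ne_eq] at * <;> grind
  · cases d <;> cases d' <;> simp only [ne_eq, not_true_eq_false] at hl <;>
      simp only at k1 k2 <;> rw [k1.2, k2.2] <;>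
      simp only [Fin.lt_def, Fin.le_def, Fin.ext_iff, ne_eq] at * <;> grind

/-- The enhanced Kauffman state of a generator. -/
def FigureEights.toState (F : D.FigureEights) (g : D.Gen) : D.EState :=
  ⟨(F.res g, g.ori), F.coherent g⟩

/-- The canonical differential on the vector space generated by Bigelow's generators. -/
def FigureEights.differential (F : D.FigureEights) : Matrix D.Gen D.Gen ℚ :=
  D.cancelled.submatrix F.toState F.toState

end GridDiagram

/-! ## Bigraded homology -/

/-- The homogeneous part of degree `(a, b)` of the vector space with basis `S`. -/
def homogeneous {S : Type} (deg : S → ℤ × ℤ) (a b : ℤ) : Submodule ℚ (S → ℚ) where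
  carrier := {f | ∀ s, deg s ≠ (a, b) → f s = 0}
  add_mem' hf hg s hs := by simp [hf s hs, hg s hs]
  zero_mem' _ _ := rfl
  smul_mem' k f hf s hs := by simp [hf s hs]

/-- The homogeneous cycles of degree `(a, b)`. -/
def cycles {S : Type} [Fintype S] (deg : S → ℤ × ℤ) (d : Matrix S S ℚ) (a b : ℤ) :
    Submodule ℚ (S → ℚ) :=
  LinearMap.ker d.mulVecLin ⊓ homogeneous deg a b

/-- The boundaries of homogeneous elements of degree `(a - 1, b)`. -/
def boundaries {S : Type} [Fintype S] (deg : S → ℤ × ℤ) (d : Matrix S S ℚ) (a b : ℤ) :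
    Submodule ℚ (S → ℚ) :=
  (homogeneous deg (a - 1) b).map d.mulVecLin

/-- Homology in degree `(a, b)` of the complex with basis `S`, bigrading `deg` and a differential of
degree `(1, 0)`. -/
abbrev Homology {S : Type} [Fintype S] (deg : S → ℤ × ℤ) (d : Matrix S S ℚ) (a b : ℤ) : Type :=
  cycles deg d a b ⧸ (boundaries deg d a b).submoduleOf (cycles deg d a b)

namespace GridDiagram

/-- Khovanov homology with rational coefficients. -/
abbrev Kh {n : ℕ} (D : GridDiagram n) (i j : ℤ) : Type :=
  Homology (fun s : D.EState => (s.i, s.j)) D.khovanov i j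

/-- Homology of the complex of Bigelow's generators, graded by `P` and `J`. -/
abbrev FigureEights.BigelowHomology {n : ℕ} {D : GridDiagram n} (F : D.FigureEights) (p j : ℤ) :
    Type :=
  Homology (fun g : D.Gen => (F.P g, F.J g)) F.differential p j

/-! ## Diffeomorphisms of the plane between rectangular diagrams -/

variable {n m : ℕ}

/-- The horizontal segment of row `r`. -/
def hSegment (D : GridDiagram n) (r : Fin n) : Set (ℝ × ℝ) :=
  segment ℝ (((D.left r).val : ℝ), (r.val : ℝ)) (((D.right r).val : ℝ), (r.val : ℝ))

/-- The vertical segment of column `c`. -/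
def vSegment (D : GridDiagram n) (c : Fin n) : Set (ℝ × ℝ) :=
  segment ℝ ((c.val : ℝ), ((D.bot c).val : ℝ)) ((c.val : ℝ), ((D.top c).val : ℝ))

/-- The positions of the `O`'s. -/
def oPoints (D : GridDiagram n) : Set (ℝ × ℝ) :=
  Set.range fun c : Fin n => ((c.val : ℝ), ((D.o c).val : ℝ))

/-- The positions of the `X`'s. -/
def xPoints (D : GridDiagram n) : Set (ℝ × ℝ) :=
  Set.range fun c : Fin n => ((c.val : ℝ), ((D.x c).val : ℝ))

/-- The orientation-preserving diffeomorphism `f` of the plane sends the oriented rectangular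
diagram `D` to `D'`, horizontal segments to horizontal segments and vertical ones to vertical
ones. -/
structure Carries (f : (ℝ × ℝ) ≃ₘ[ℝ] (ℝ × ℝ)) (D : GridDiagram n) (D' : GridDiagram m) : Prop where
  orientation : ∀ p, 0 < (fderiv ℝ f p).det
  horizontal : ∀ r, ∃ r', f '' D.hSegment r = D'.hSegment r'
  vertical : ∀ c, ∃ c', f '' D.vSegment c = D'.vSegment c'
  o : f '' D.oPoints = D'.oPoints
  x : f '' D.xPoints = D'.xPoints

end GridDiagram

end GridKh

end

open GridKh GridKh.GridDiagram

noncomputable section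
set_option linter.unusedSimpArgs false
set_option linter.unnecessarySeqFocus false

namespace GridKh
namespace GridDiagram

variable {n : ℕ} {D : GridDiagram n}

/-! ## Edges, vertices and the successor of an edge in an oriented state -/

/-! The theorem is a cancellation in a filtered complex, once the two parts d_0 and d_1 of the
Khovanov differential are understood.

The geometric input is `EState.circle_main`: the winding numbers of an oriented circle are 0 or its
sign, and its total turning is this sign times four quarter turns. The latter is a discrete
Umlaufsatz (`sum_cross_of_closed_walk`), proved as by Hopf: the secant directions of the closed walk
through the doubled midpoints of the edges are followed over the triangle of pairs i < j, whose
diagonal gives the turning and whose legs start or end at an extremal point.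

Turning makes `rot` a sum of local terms. Multiplication and comultiplication have the coefficient 1
exactly where the signed number of circles drops by 1, so the degree alone decides which
coefficients vanish. A step that keeps all orientations has the right degree exactly at a forbidden
crossing (`EState.StepAt.touchSgn_of_ori`). A step that changes an orientation strictly lowers `R`
(`EState.StepAt.R_lt`), because the reversed pieces together contribute a positive amount. Hence d_0
consists of flips of forbidden crossings, and d_1 lowers `R`, which makes the series for the
cancelled differential finite.

On a hypercube write d_0 as the sum of its parts a_c at the forbidden crossings; then h_c is minus
the transpose of a_c. These operators satisfy the relations of creation and annihilation operators:
a_c and its transpose have anticommutator 1, and all other pairs anticommute. Therefore each h_c,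
and also the average h, is a homotopy from 0 to minus the identity, and h squares to zero. Together
with `khovanov_mul_khovanov`, proved by viewing labels as monomials in variables of square zero,
this is the input of the perturbation lemma (`Perturbation`). It gives a differential on the states
without forbidden crossings and mutually inverse homotopy equivalences with the Khovanov complex.

These states are exactly the images of generators (`toState_injective`, `exists_toState_eq`).
Without forbidden crossings the orientation of a column can only change from down to up, and that of
a row only from right to left. The sources in the columns coincide with the sinks in the rows and
form a permutation; the side of the figure-eight records the smoothing at such a point.

The gradings are compared by local counts. The turning at each grid point shows that `rot` plus
`Pbar` does not depend on the generator (`rot_toState`), which gives P = i - j. For J, the product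
of the vertical and the horizontal orientation is summed over the grid in two ways
(`grading_identity`): it counts 1-smoothings, and it expands into T and the ray crossings that
compute Q.

For canonicity, the Jacobian of the diffeomorphism is diagonal with positive determinant at the
points of intersection of the segments. So the two segments through such a point are both preserved
or both reversed in direction, and the diagram is changed locally by the identity or a half turn
(`DiagramIso`). All ingredients are transported; only the cube signs use the lexicographic order of
the crossings, and the sign of the permutation of the 1-smoothings corrects them
(`DiagramIso.orderSign`). -/

theorem bot_lt_top (D : GridDiagram n) (c : Fin n) : D.bot c < D.top c :=
  min_lt_max.mpr (D.ne c)

theorem left_lt_right (D : GridDiagram n) (r : Fin n) : D.left r < D.right r := by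
  refine min_lt_max.mpr fun h => D.ne (D.o.symm r) ?_
  rw [Equiv.apply_symm_apply, h, Equiv.apply_symm_apply]

/-- The unit vector in a direction. -/
def _root_.GridKh.Dir.vec : Dir → ℤ × ℤ
  | .N => (0, 1)
  | .S => (0, -1)
  | .E => (1, 0)
  | .W => (-1, 0)

/-- A grid point as a point of the integer lattice. -/
def latticePt (v : Fin n × Fin n) : ℤ × ℤ := (v.1.val, v.2.val)

def HEdge.col (e : D.HEdge) : ℤ := e.1.1.val
def HEdge.row (e : D.HEdge) : ℤ := e.1.2.val
def VEdge.col (e : D.VEdge) : ℤ := e.1.1.val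
def VEdge.row (e : D.VEdge) : ℤ := e.1.2.val

theorem HEdge.ext {e e' : D.HEdge} (h1 : e.col = e'.col) (h2 : e.row = e'.row) : e = e' := by
  unfold col at h1
  unfold row at h2
  exact Subtype.ext (Prod.ext (Fin.ext (by omega)) (Fin.ext (by omega)))

theorem VEdge.ext {e e' : D.VEdge} (h1 : e.col = e'.col) (h2 : e.row = e'.row) : e = e' := by
  unfold col at h1
  unfold row at h2
  exact Subtype.ext (Prod.ext (Fin.ext (by omega)) (Fin.ext (by omega)))

/-- The left or lower end of an edge. -/
def edgeLo : D.Edge → ℤ × ℤ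
  | .inl e => (e.col, e.row)
  | .inr e => (e.col, e.row)

/-- The right or upper end of an edge. -/
def edgeHi : D.Edge → ℤ × ℤ
  | .inl e => (e.col + 1, e.row)
  | .inr e => (e.col, e.row + 1)

/-- Twice the midpoint of an edge. -/
def edgeMid (e : D.Edge) : ℤ × ℤ := edgeLo e + edgeHi e

theorem latticePt_injective : Function.Injective (latticePt : Fin n × Fin n → ℤ × ℤ) := by
  rintro ⟨a, b⟩ ⟨c, d⟩ h
  simp only [latticePt, Prod.mk.injEq, Nat.cast_inj, Fin.val_inj] at h
  exact Prod.ext h.1 h.2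

theorem edgeMid_injective : Function.Injective (edgeMid : D.Edge → ℤ × ℤ) := by
  rintro (⟨⟨a, b⟩, h⟩ | ⟨⟨a, b⟩, h⟩) (⟨⟨c, d⟩, h'⟩ | ⟨⟨c, d⟩, h'⟩) h0 <;>
    simp only [edgeMid, edgeLo, edgeHi, Prod.mk_add_mk, Prod.mk.injEq, HEdge.col, HEdge.row,
      VEdge.col, VEdge.row] at h0
  · have h1 : a = c := Fin.ext (by omega)
    have h2 : b = d := Fin.ext (by omega)
    subst h1 h2; rfl
  · omega
  · omega
  · have h1 : a = c := Fin.ext (by omega)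
    have h2 : b = d := Fin.ext (by omega)
    subst h1 h2; rfl

/-- Doubling makes midpoints integral, so incidence becomes a single linear equation. Uniqueness of
the edge at a vertex in a direction then follows from `edgeMid_injective`. -/
theorem isAt_iff (v : Fin n × Fin n) (d : Dir) (e : D.Edge) :
    D.IsAt v d e ↔ edgeMid e = 2 * latticePt v + d.vec := by
  obtain ⟨x, y⟩ := v
  rcases e with ⟨⟨a, b⟩, h⟩ | ⟨⟨a, b⟩, h⟩ <;> cases d <;>
    simp only [IsAt, edgeMid, edgeLo, edgeHi, HEdge.col, HEdge.row, VEdge.col, VEdge.row, latticePt, Dir.vec, Prod.ext_iff, Fin.ext_iff,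
      Prod.fst_add, Prod.snd_add, Prod.fst_mul, Prod.snd_mul, Prod.fst_ofNat, Prod.snd_ofNat, false_iff] <;>
    omega

theorem IsAt.edge_unique {v : Fin n × Fin n} {d : Dir} {e e' : D.Edge} (h : D.IsAt v d e)
    (h' : D.IsAt v d e') : e = e' :=
  edgeMid_injective (((isAt_iff _ _ _).1 h).trans ((isAt_iff _ _ _).1 h').symm)

/-- Seen from its two ends an edge has opposite directions, and `outward` takes opposite values on
these for the same Boolean. Its value therefore singles out the end. -/
theorem IsAt.end_unique {v v' : Fin n × Fin n} {d d' : Dir} {e : D.Edge} (h : D.IsAt v d e)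
    (h' : D.IsAt v' d' e) {b : Bool} (hb : d.outward b = d'.outward b) : v = v' ∧ d = d' := by
  obtain ⟨x, y⟩ := v
  obtain ⟨x', y'⟩ := v'
  rcases e with ⟨⟨a, c⟩, h0⟩ | ⟨⟨a, c⟩, h0⟩ <;> cases d <;> cases d' <;> cases b <;>
    simp only [IsAt, Dir.outward, Prod.ext_iff, Fin.ext_iff] at * <;> simp at hb ⊢ <;> omega

/-- The diagram has an edge at `v` in direction `d`. -/
def HasEdge (D : GridDiagram n) (v : Fin n × Fin n) : Dir → Prop
  | .N => D.bot v.1 ≤ v.2 ∧ v.2 < D.top v.1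
  | .S => D.bot v.1 < v.2 ∧ v.2 ≤ D.top v.1
  | .E => D.left v.2 ≤ v.1 ∧ v.1 < D.right v.2
  | .W => D.left v.2 < v.1 ∧ v.1 ≤ D.right v.2

theorem hasEdge_iff (v : Fin n × Fin n) (d : Dir) : D.HasEdge v d ↔ ∃ e, D.IsAt v d e := by
  obtain ⟨x, y⟩ := v
  constructor
  · intro h
    cases d <;> simp only [HasEdge] at h
    · exact ⟨.inr ⟨(x, y), h⟩, rfl⟩
    · have hy : 0 < y.val := by have := h.1; simp only [Fin.lt_def] at this; omega
      refine ⟨.inr ⟨(x, ⟨y.val - 1, by omega⟩), ?_⟩, rfl, ?_⟩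
      · simp only [Fin.lt_def, Fin.le_def] at *; omega
      · simp only; omega
    · exact ⟨.inl ⟨(x, y), h⟩, rfl⟩
    · have hy : 0 < x.val := by have := h.1; simp only [Fin.lt_def] at this; omega
      refine ⟨.inl ⟨(⟨x.val - 1, by omega⟩, y), ?_⟩, rfl, ?_⟩
      · simp only [Fin.lt_def, Fin.le_def] at *; omega
      · simp only; omega
  · rintro ⟨⟨⟨a, b⟩, h⟩ | ⟨⟨a, b⟩, h⟩, h'⟩ <;> cases d <;>
      simp only [IsAt, Prod.ext_iff, HasEdge] at * <;> obtain ⟨h1, h2⟩ := h' <;>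
      first | subst h1 h2 | subst h1
    all_goals simp only [Fin.lt_def, Fin.le_def] at *; omega

theorem IsAt.hasEdge {v : Fin n × Fin n} {d : Dir} {e : D.Edge} (h : D.IsAt v d e) :
    D.HasEdge v d := (hasEdge_iff v d).2 ⟨e, h⟩

theorem IsCrossing.hasEdge {v : Fin n × Fin n} (h : D.IsCrossing v) (d : Dir) :
    D.HasEdge v d := by
  obtain ⟨h1, h2, h3, h4⟩ := h
  cases d
  exacts [⟨h3.le, h4⟩, ⟨h3, h4.le⟩, ⟨h1.le, h2⟩, ⟨h1, h2.le⟩]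

/-- By `corner_iff`, a segment that stops at a grid point is continued there by the end of the other
segment. -/
theorem HasEdge.exists_ne {v : Fin n × Fin n} {d : Dir} (h : D.HasEdge v d) :
    ∃ d', d ≠ d' ∧ D.HasEdge v d' := by
  obtain ⟨x, y⟩ := v
  have h1 := D.corner_iff x y
  have h2 := D.bot_lt_top x
  have h3 := D.left_lt_right y
  simp only [Fin.lt_def, Fin.ext_iff] at *
  have key : (d ≠ .N ∧ D.HasEdge (x, y) .N) ∨ (d ≠ .S ∧ D.HasEdge (x, y) .S) ∨
      (d ≠ .E ∧ D.HasEdge (x, y) .E) ∨ (d ≠ .W ∧ D.HasEdge (x, y) .W) := by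
    cases d <;> simp only [HasEdge, Fin.lt_def, Fin.le_def] at * <;> simp <;> omega
  rcases key with h | h | h | h
  exacts [⟨_, h⟩, ⟨_, h⟩, ⟨_, h⟩, ⟨_, h⟩]

/-- A point with three half-edges is interior to one segment and lies on the other; by `corner_iff`
it is not an end of the other either, so it is a crossing. -/
theorem HasEdge.eq_of_not_isCrossing {v : Fin n × Fin n} (hv : ¬ D.IsCrossing v) {d d₁ d₂ : Dir}
    (h : D.HasEdge v d) (h₁ : D.HasEdge v d₁) (h₂ : D.HasEdge v d₂) (n₁ : d ≠ d₁) (n₂ : d ≠ d₂) :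
    d₁ = d₂ := by
  obtain ⟨x, y⟩ := v
  have g1 := D.corner_iff x y
  have g2 := D.bot_lt_top x
  have g3 := D.left_lt_right y
  simp only [Fin.lt_def, Fin.ext_iff, IsCrossing] at *
  cases d <;> cases d₁ <;> cases d₂ <;> first
    | rfl
    | exact absurd rfl n₁
    | exact absurd rfl n₂
    | (exfalso; simp only [HasEdge, Fin.lt_def, Fin.le_def] at h h₁ h₂; omega)

theorem _root_.GridKh.Dir.partner_partner (b : Bool) (d : Dir) :
    Dir.partner b (Dir.partner b d) = d := by cases b <;> cases d <;> rfl

theorem _root_.GridKh.Dir.partner_ne (b : Bool) (d : Dir) : d ≠ Dir.partner b d := by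
  cases b <;> cases d <;> simp [Dir.partner]

theorem Linked.symm {ρ : D.Resolution} {v : Fin n × Fin n} {d d' : Dir} (h : Linked ρ v d d') :
    Linked ρ v d' d := by
  rcases h with ⟨h, rfl⟩ | ⟨h, h'⟩
  · exact .inl ⟨h, (Dir.partner_partner _ _).symm⟩
  · exact .inr ⟨h, h'.symm⟩

theorem Linked.ne {ρ : D.Resolution} {v : Fin n × Fin n} {d d' : Dir} (h : Linked ρ v d d') :
    d ≠ d' := by
  rcases h with ⟨h, rfl⟩ | ⟨h, h'⟩
  · exact Dir.partner_ne _ _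
  · exact h'

theorem exists_linked (ρ : D.Resolution) {v : Fin n × Fin n} {d : Dir} {e : D.Edge}
    (h : D.IsAt v d e) : ∃ d' e', D.IsAt v d' e' ∧ Linked ρ v d d' := by
  by_cases hv : D.IsCrossing v
  · obtain ⟨e', he'⟩ := (hasEdge_iff v _).1 (hv.hasEdge (Dir.partner (ρ ⟨v, hv⟩) d))
    exact ⟨_, e', he', .inl ⟨hv, rfl⟩⟩
  · obtain ⟨d', hd, h'⟩ := h.hasEdge.exists_ne
    obtain ⟨e', he'⟩ := (hasEdge_iff v _).1 h'
    exact ⟨_, e', he', .inr ⟨hv, hd⟩⟩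

theorem Linked.unique {ρ : D.Resolution} {v : Fin n × Fin n} {d d₁ d₂ : Dir}
    (h₁ : Linked ρ v d d₁) (h₂ : Linked ρ v d d₂) (k : D.HasEdge v d) (k₁ : D.HasEdge v d₁)
    (k₂ : D.HasEdge v d₂) : d₁ = d₂ := by
  rcases h₁ with ⟨h₁, rfl⟩ | ⟨h₁, h₁'⟩ <;> rcases h₂ with ⟨h₂, rfl⟩ | ⟨h₂, h₂'⟩
  · rfl
  · exact absurd h₁ h₂
  · exact absurd h₂ h₁
  · exact k.eq_of_not_isCrossing h₁ k₁ k₂ h₁' h₂'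

theorem exists_end (e : D.Edge) (b o : Bool) : ∃ v d, D.IsAt v d e ∧ d.outward b = o := by
  have key : (∃ v, D.IsAt v .N e) ∧ (∃ v, D.IsAt v .S e) ∨
      (∃ v, D.IsAt v .E e) ∧ (∃ v, D.IsAt v .W e) := by
    rcases e with ⟨⟨x, y⟩, h⟩ | ⟨⟨x, y⟩, h⟩
    · refine .inr ⟨⟨_, rfl⟩, ⟨(⟨x.val + 1, ?_⟩, y), rfl, rfl⟩⟩
      have := h.2; simp only [Fin.lt_def] at this; omega
    · refine .inl ⟨⟨_, rfl⟩, ⟨(x, ⟨y.val + 1, ?_⟩), rfl, rfl⟩⟩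
      have := h.2; simp only [Fin.lt_def] at this; omega
  rcases key with ⟨⟨v, hv⟩, ⟨w, hw⟩⟩ | ⟨⟨v, hv⟩, ⟨w, hw⟩⟩ <;>
    cases b <;> cases o <;> first
      | exact ⟨v, _, hv, rfl⟩
      | exact ⟨w, _, hw, rfl⟩

/-! ### Circles as the cycles of a permutation -/

namespace EState

variable (s : D.EState)

theorem exists_next (e : D.Edge) : ∃ e' v d d', D.IsAt v d e ∧ D.IsAt v d' e' ∧
    Linked s.res v d d' ∧ d.outward (s.ori e) = false := by
  obtain ⟨v, d, h, hb⟩ := exists_end e (s.ori e) false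
  obtain ⟨d', e', h', hl⟩ := exists_linked s.res h
  exact ⟨e', v, d, d', h, h', hl, hb⟩

/-- The edge following a given one on its oriented circle. -/
def nextFun (e : D.Edge) : D.Edge := (s.exists_next e).choose

variable {s} in
theorem nextFun_eq {v d d'} {e e' : D.Edge} (h : D.IsAt v d e) (h' : D.IsAt v d' e')
    (hl : Linked s.res v d d') (hb : d.outward (s.ori e) = false) : s.nextFun e = e' := by
  obtain ⟨w, f, f', k, k', kl, kb⟩ := (s.exists_next e).choose_spec
  obtain ⟨rfl, rfl⟩ := h.end_unique k (hb.trans kb.symm)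
  obtain rfl := hl.unique kl h.hasEdge h'.hasEdge k'.hasEdge
  exact k'.edge_unique h'

/-- The successor determines its predecessor: its starting point is its only outward end, and the
linking of half-edges there is symmetric and unique. -/
theorem nextFun_injective : Function.Injective s.nextFun := by
  intro e₁ e₂ h
  obtain ⟨v, d, d', k, k', kl, kb⟩ := (s.exists_next e₁).choose_spec
  obtain ⟨w, f, f', m, m', ml, mb⟩ := (s.exists_next e₂).choose_spec
  change D.IsAt v d' (s.nextFun e₁) at k'
  change D.IsAt w f' (s.nextFun e₂) at m'
  have c1 := s.2 v d d' _ _ k k' kl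
  have c2 := s.2 w f f' _ _ m m' ml
  change d.outward (s.ori e₁) = !d'.outward (s.ori (s.nextFun e₁)) at c1
  change f.outward (s.ori e₂) = !f'.outward (s.ori (s.nextFun e₂)) at c2
  rw [kb] at c1; rw [mb] at c2
  rw [← h] at m' c2
  obtain ⟨rfl, rfl⟩ := k'.end_unique m' (b := s.ori (s.nextFun e₁)) (by
    cases h1 : d'.outward (s.ori (s.nextFun e₁)) <;>
      cases h2 : f'.outward (s.ori (s.nextFun e₁)) <;> simp_all)
  obtain rfl := kl.symm.unique ml.symm k'.hasEdge k.hasEdge m.hasEdge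
  exact k.edge_unique m

/-- The permutation sending each edge to the following one on its oriented circle. -/
def next : Equiv.Perm D.Edge := Equiv.ofBijective _ (Finite.injective_iff_bijective.1 s.nextFun_injective)

theorem next_spec (e : D.Edge) : ∃ v d d', D.IsAt v d e ∧ D.IsAt v d' (s.next e) ∧
    Linked s.res v d d' ∧ d.outward (s.ori e) = false ∧ d'.outward (s.ori (s.next e)) = true := by
  obtain ⟨v, d, d', k, k', kl, kb⟩ := (s.exists_next e).choose_spec
  have c1 := s.2 v d d' _ _ k k' kl
  change d.outward (s.ori e) = !d'.outward (s.ori (s.nextFun e)) at c1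
  refine ⟨v, d, d', k, k', kl, kb, ?_⟩
  rw [kb] at c1
  change d'.outward (s.ori (s.nextFun e)) = true
  simpa using c1.symm

variable {s} in
theorem next_eq {v d d'} {e e' : D.Edge} (h : D.IsAt v d e) (h' : D.IsAt v d' e')
    (hl : Linked s.res v d d') (hb : d.outward (s.ori e) = false) : s.next e = e' :=
  nextFun_eq h h' hl hb

theorem consecutive_iff (e e' : D.Edge) :
    Consecutive s.res e e' ↔ s.next e = e' ∨ s.next e' = e := by
  constructor
  · rintro ⟨v, d, d', h, h', hl⟩
    have c := s.2 v d d' _ _ h h' hl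
    cases hb : d.outward (s.ori e)
    · exact .inl (next_eq h h' hl hb)
    · refine .inr (next_eq h' h hl.symm ?_)
      change d.outward (s.ori e) = !d'.outward (s.ori e') at c
      rw [hb] at c
      simpa using c.symm
  · rintro (rfl | rfl)
    · obtain ⟨v, d, d', k, k', kl, -⟩ := s.next_spec e
      exact ⟨v, d, d', k, k', kl⟩
    · obtain ⟨v, d, d', k, k', kl, -⟩ := s.next_spec e'
      exact ⟨v, d', d, k', k, kl.symm⟩

theorem circleOf_next (e : D.Edge) : circleOf s.res (s.next e) = circleOf s.res e :=
  (Quot.sound ((s.consecutive_iff _ _).2 (.inl rfl))).symm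

/-- Consecutive edges are neighbours under `next`, so the classes they generate are the cycles of
this permutation. This allows circles to be traversed and sums along them to telescope. -/
theorem circleOf_eq_iff (e e' : D.Edge) :
    circleOf s.res e = circleOf s.res e' ↔ s.next.SameCycle e e' := by
  constructor
  · intro h
    have h' := Quot.eqvGen_exact h
    clear h
    induction h' with
    | rel x y h =>
      rcases (s.consecutive_iff _ _).1 h with rfl | rfl
      · exact ⟨1, by simp⟩
      · exact ⟨-1, by simp⟩
    | refl x => exact .refl _ _
    | symm x y _ ih => exact ih.symm
    | trans x y z _ _ ih1 ih2 => exact ih1.trans ih2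
  · rintro ⟨k, rfl⟩
    have hp : ∀ (m : ℕ) e, circleOf s.res ((s.next ^ m) e) = circleOf s.res e := by
      intro m
      induction m with
      | zero => intro e; rfl
      | succ m ih => intro e; rw [pow_succ, Equiv.Perm.mul_apply, ih, circleOf_next]
    cases k with
    | ofNat m => exact (hp m e).symm
    | negSucc m =>
      rw [zpow_negSucc]
      have := hp (m + 1) ((s.next ^ (m + 1))⁻¹ e)
      simpa using this

end EState

end GridDiagram
end GridKh

namespace GridKh
namespace GridDiagram

variable {n : ℕ} {D : GridDiagram n}

/-! ## Conservation of flow and winding numbers -/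

namespace EState

variable (s : D.EState)

/-- The end point of an oriented edge. -/
def head (e : D.Edge) : ℤ × ℤ := if s.ori e then edgeHi e else edgeLo e

/-- The starting point of an oriented edge. -/
def tail (e : D.Edge) : ℤ × ℤ := if s.ori e then edgeLo e else edgeHi e

/-- The direction of an oriented edge. -/
def heading (e : D.Edge) : ℤ × ℤ := s.head e - s.tail e

variable {s}

theorem head_eq {v d} {e : D.Edge} (h : D.IsAt v d e) (hb : d.outward (s.ori e) = false) :
    s.head e = latticePt v ∧ s.heading e = -d.vec := by
  obtain ⟨x, y⟩ := v
  unfold heading head tail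
  rcases e with ⟨⟨a, b⟩, h0⟩ | ⟨⟨a, b⟩, h0⟩ <;> cases d <;>
    simp only [IsAt, Dir.outward, Bool.not_eq_false'] at h hb <;> rw [hb] <;>
    simp only [Prod.ext_iff, Fin.ext_iff] at h <;>
    simp only [latticePt, edgeHi, edgeLo, HEdge.col, HEdge.row, VEdge.col, VEdge.row, Dir.vec, if_true, Bool.false_eq_true, if_false,
      Prod.ext_iff, Prod.fst_sub, Prod.snd_sub, Prod.fst_neg, Prod.snd_neg] <;> omega

theorem tail_eq {v d} {e : D.Edge} (h : D.IsAt v d e) (hb : d.outward (s.ori e) = true) :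
    s.tail e = latticePt v ∧ s.heading e = d.vec := by
  obtain ⟨x, y⟩ := v
  unfold heading head tail
  rcases e with ⟨⟨a, b⟩, h0⟩ | ⟨⟨a, b⟩, h0⟩ <;> cases d <;>
    simp only [IsAt, Dir.outward, Bool.not_eq_true'] at h hb <;> rw [hb] <;>
    simp only [Prod.ext_iff, Fin.ext_iff] at h <;>
    simp only [latticePt, edgeHi, edgeLo, HEdge.col, HEdge.row, VEdge.col, VEdge.row, Dir.vec, if_true, Bool.false_eq_true, if_false,
      Prod.ext_iff, Prod.fst_sub, Prod.snd_sub] <;> omega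

variable (s)

theorem tail_next (e : D.Edge) : s.tail (s.next e) = s.head e := by
  obtain ⟨v, d, d', h, h', -, hb, hb'⟩ := s.next_spec e
  rw [(head_eq h hb).1, (tail_eq h' hb').1]

theorem edgeMid_eq (e : D.Edge) : edgeMid e = s.head e + s.tail e := by
  unfold head tail edgeMid
  split_ifs <;> simp [add_comm]

open Classical in
-- Reindexing by `next` turns tails into heads, because every edge starts where its predecessor
-- ends. Indicators of vertical rays as `φ` give the jumps of winding numbers, and a quadratic `φ`
-- gives the area formula.
theorem sum_flow {A : D.Edge → Prop} (hA : ∀ e, A (s.next e) ↔ A e) (φ : ℤ × ℤ → ℤ) :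
    ∑ e, (if A e then φ (s.head e) - φ (s.tail e) else 0) = 0 := by
  have h : ∑ e, (if A e then φ (s.tail e) else 0) = ∑ e, (if A e then φ (s.head e) else 0) := by
    rw [← Equiv.sum_comp s.next]
    simp only [hA, tail_next]
  refine Eq.trans ?_ (sub_eq_zero.2 h.symm)
  rw [← Finset.sum_sub_distrib]
  refine Finset.sum_congr rfl fun e _ => ?_
  by_cases hx : A e <;> simp only [hx, if_true, if_false, sub_zero]

open Classical in
/-- Signed number of times the edges in `A` cross the vertical ray upwards from the centre of the
cell `(a, b)`. -/
def wind (A : D.Edge → Prop) (a b : ℤ) : ℤ :=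
  ∑ e : D.HEdge, if A (.inl e) ∧ e.col + 1 = a ∧ b ≤ e.row then
    (if s.ori (.inl e) then -1 else 1) else 0

theorem winding_eq (p : Cell n) : s.winding p = s.wind (fun _ => True) p.1.val p.2.val := by
  unfold winding wind
  refine Finset.sum_congr rfl fun e _ => ?_
  simp only [true_and, HEdge.col, HEdge.row]
  norm_cast

variable {s}

open Classical in
theorem wind_sub_h (A : D.Edge → Prop) (a b : ℤ) : s.wind A a b - s.wind A a (b + 1) =
    ∑ e : D.HEdge, if A (.inl e) ∧ e.col + 1 = a ∧ e.row = b then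
      (if s.ori (.inl e) then -1 else 1) else 0 := by
  unfold wind
  rw [← Finset.sum_sub_distrib]
  refine Finset.sum_congr rfl fun e _ => ?_
  by_cases h1 : A (.inl e) <;> by_cases h2 : e.col + 1 = a <;> simp only [h1, h2,
    true_and, false_and, if_false, sub_self]
  generalize (if s.ori (.inl e) = true then (-1 : ℤ) else 1) = k
  split_ifs <;> omega

open Classical in
theorem wind_sub_v {A : D.Edge → Prop} (hA : ∀ e, A (s.next e) ↔ A e) (a b : ℤ) :
    s.wind A a b - s.wind A (a + 1) b =
    ∑ e : D.VEdge, if A (.inr e) ∧ e.col = a ∧ e.row + 1 = b then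
      (if s.ori (.inr e) then 1 else -1) else 0 := by
  -- The test function is the indicator of a ray on the grid line `a`. Horizontal edges ending or
  -- starting on it are those counted by the winding numbers of the adjacent cells; a vertical edge
  -- contributes only if it joins the ray to the point just below it.
  have h := s.sum_flow hA (fun p => if p.1 = a ∧ b ≤ p.2 then 1 else 0)
  rw [Fintype.sum_sum_type] at h
  have h1 : ∑ e : D.HEdge, (if A (.inl e) then
      (if (s.head (.inl e)).1 = a ∧ b ≤ (s.head (.inl e)).2 then (1 : ℤ) else 0) -
      (if (s.tail (.inl e)).1 = a ∧ b ≤ (s.tail (.inl e)).2 then 1 else 0) else 0) =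
      s.wind A (a + 1) b - s.wind A a b := by
    unfold wind
    rw [← Finset.sum_sub_distrib]
    refine Finset.sum_congr rfl fun e _ => ?_
    by_cases hx : A (.inl e) <;> simp only [hx, true_and, false_and, if_false, sub_self, if_true]
    simp only [head, tail, add_left_inj]
    rcases Bool.eq_false_or_eq_true (s.ori (.inl e)) with ho | ho <;> simp [ho, edgeLo, edgeHi] <;>
      split_ifs <;> omega
  have h2 : ∑ e : D.VEdge, (if A (.inr e) then
      (if (s.head (.inr e)).1 = a ∧ b ≤ (s.head (.inr e)).2 then (1 : ℤ) else 0) -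
      (if (s.tail (.inr e)).1 = a ∧ b ≤ (s.tail (.inr e)).2 then 1 else 0) else 0) =
      ∑ e : D.VEdge, if A (.inr e) ∧ e.col = a ∧ e.row + 1 = b then
      (if s.ori (.inr e) then 1 else -1) else 0 := by
    refine Finset.sum_congr rfl fun e _ => ?_
    by_cases hx : A (.inr e) <;> simp only [hx, true_and, false_and, if_false, if_true]
    simp only [head, tail]
    rcases Bool.eq_false_or_eq_true (s.ori (.inr e)) with ho | ho <;> simp [ho, edgeLo, edgeHi] <;> split_ifs <;> omega
  rw [h1, h2] at h
  omega

theorem wind_h (A : D.Edge → Prop) (e : D.HEdge) (he : A (.inl e)) :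
    s.wind A (e.col + 1) e.row =
      s.wind A (e.col + 1) (e.row + 1) + (if s.ori (.inl e) then -1 else 1) := by
  have h := wind_sub_h (s := s) A (e.col + 1) e.row
  rw [Finset.sum_eq_single e, if_pos ⟨he, rfl, rfl⟩] at h
  · omega
  · rintro e' - hne
    rw [if_neg]
    rintro ⟨-, h1, h2⟩
    exact hne (HEdge.ext (by omega) (by omega))
  · simp

theorem wind_h_none (A : D.Edge → Prop) (a b : ℤ)
    (h0 : ∀ e : D.HEdge, A (.inl e) → e.col + 1 = a → e.row = b → False) :
    s.wind A a b = s.wind A a (b + 1) := by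
  have h := wind_sub_h (s := s) A a b
  rw [Finset.sum_eq_zero] at h
  · omega
  · rintro e' -
    rw [if_neg]
    rintro ⟨h1, h2, h3⟩
    exact h0 _ h1 h2 h3

theorem wind_v {A : D.Edge → Prop} (hA : ∀ e, A (s.next e) ↔ A e) (e : D.VEdge)
    (he : A (.inr e)) :
    s.wind A e.col (e.row + 1) =
      s.wind A (e.col + 1) (e.row + 1) + (if s.ori (.inr e) then 1 else -1) := by
  have h := wind_sub_v (s := s) hA e.col (e.row + 1)
  rw [Finset.sum_eq_single e, if_pos ⟨he, rfl, rfl⟩] at h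
  · omega
  · rintro e' - hne
    rw [if_neg]
    rintro ⟨-, h1, h2⟩
    exact hne (VEdge.ext (by omega) (by omega))
  · simp

theorem wind_v_none {A : D.Edge → Prop} (hA : ∀ e, A (s.next e) ↔ A e) (a b : ℤ)
    (h0 : ∀ e : D.VEdge, A (.inr e) → e.col = a → e.row + 1 = b → False) :
    s.wind A a b = s.wind A (a + 1) b := by
  have h := wind_sub_v (s := s) hA a b
  rw [Finset.sum_eq_zero] at h
  · omega
  · rintro e' -
    rw [if_neg]
    rintro ⟨h1, h2, h3⟩
    exact h0 _ h1 h2 h3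

theorem wind_of_le (A : D.Edge → Prop) (a : ℤ) {b : ℤ} (hb : (n : ℤ) ≤ b) : s.wind A a b = 0 := by
  unfold wind
  refine Finset.sum_eq_zero fun e _ => if_neg ?_
  have : e.row < n := by unfold HEdge.row; have := e.1.2.isLt; omega
  rintro ⟨-, -, h⟩
  omega

open Classical in
-- A discrete Green formula, which ties the signed area used to define the sign of a circle to its
-- winding numbers.
theorem sum_wind {A : D.Edge → Prop} (hA : ∀ e, A (s.next e) ↔ A e) :
    ∑ p : Cell n, s.wind A p.1.val p.2.val =
      ∑ e : D.VEdge, if A (.inr e) then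
        (if s.ori (.inr e) then e.col else -e.col) else 0 := by
  -- A horizontal edge at height y changes x(y+1) by plus or minus y+1, the number of cells 0, ...,
  -- y under it whose rays it crosses. A vertical edge changes it by plus or minus its column.
  have h0 := s.sum_flow hA (fun p => p.1 * (p.2 + 1))
  rw [Fintype.sum_sum_type] at h0
  have h2 : ∑ p : Cell n, s.wind A p.1.val p.2.val =
      -(∑ e : D.HEdge, if A (.inl e) then ((s.head (.inl e)).1 * ((s.head (.inl e)).2 + 1) -
        (s.tail (.inl e)).1 * ((s.tail (.inl e)).2 + 1)) else 0) := by
    unfold wind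
    rw [Finset.sum_comm, ← Finset.sum_neg_distrib]
    refine Finset.sum_congr rfl fun e _ => ?_
    by_cases hx : A (.inl e) <;> simp only [hx, true_and, false_and, if_false, if_true,
      Finset.sum_const_zero, neg_zero]
    have h1 : ∀ k : ℤ, ∑ p : Cell n, (if e.col + 1 = (p.1.val : ℤ) ∧
        (p.2.val : ℤ) ≤ e.row then k else 0) = (e.row + 1) * k := by
      intro k
      have hc : (Finset.univ.filter fun p : Cell n => e.col + 1 = (p.1.val : ℤ) ∧
          (p.2.val : ℤ) ≤ e.row) =
          {(⟨e.1.1.val + 1, by omega⟩ : Fin (n + 1))} ×ˢ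
            Finset.Iic (⟨e.1.2.val, by omega⟩ : Fin (n + 1)) := by
        ext ⟨p, q⟩
        rw [Finset.mem_filter]
        have hcol : e.col = e.1.1.val := rfl
        have hrow : e.row = e.1.2.val := rfl
        simp only [Finset.mem_univ, true_and, Finset.mem_product,
          Finset.mem_singleton, Finset.mem_Iic, Fin.ext_iff, Fin.le_def]
        omega
      rw [← Finset.sum_filter, Finset.sum_const, hc]
      simp [HEdge.row]
    rw [h1]
    simp only [head, tail]
    rcases Bool.eq_false_or_eq_true (s.ori (.inl e)) with ho | ho <;> simp [ho, edgeLo, edgeHi] <;> ring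
  rw [h2, neg_eq_iff_add_eq_zero]
  refine Eq.trans ?_ h0
  refine congrArg₂ (· + ·) rfl (Finset.sum_congr rfl fun e _ => ?_)
  by_cases hx : A (.inr e) <;> simp only [hx, if_false, if_true]
  simp only [head, tail]
  rcases Bool.eq_false_or_eq_true (s.ori (.inr e)) with ho | ho <;> simp [ho, edgeLo, edgeHi] <;> ring

/-! ## Winding numbers of circles -/

/-- The winding number of the cell to the left of an edge. -/
def leftWind (s : D.EState) (A : D.Edge → Prop) : D.Edge → ℤ
  | .inl e => s.wind A (e.col + 1) (if s.ori (.inl e) then e.row + 1 else e.row)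
  | .inr e => s.wind A (if s.ori (.inr e) then e.col else e.col + 1) (e.row + 1)

theorem leftWind_head {v d} {e : D.Edge} (A : D.Edge → Prop) (h : D.IsAt v d e)
    (hb : d.outward (s.ori e) = false) : s.leftWind A e =
      match d with
      | .N => s.wind A (v.1.val + 1) (v.2.val + 1)
      | .E => s.wind A (v.1.val + 1) v.2.val
      | .S => s.wind A v.1.val v.2.val
      | .W => s.wind A v.1.val (v.2.val + 1) := by
  obtain ⟨x, y⟩ := v
  rcases e with ⟨⟨a, b⟩, h0⟩ | ⟨⟨a, b⟩, h0⟩ <;> cases d <;>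
    simp only [IsAt, Dir.outward, Bool.not_eq_false'] at h hb <;>
    simp only [leftWind, hb] <;>
    simp only [Prod.ext_iff, Fin.ext_iff] at h <;> simp only [Bool.false_eq_true, if_false, if_true] <;>
    
    simp only [HEdge.col, HEdge.row, VEdge.col, VEdge.row] <;> (congr 1 <;> omega)

theorem leftWind_tail {v d} {e : D.Edge} (A : D.Edge → Prop) (h : D.IsAt v d e)
    (hb : d.outward (s.ori e) = true) : s.leftWind A e =
      match d with
      | .N => s.wind A v.1.val (v.2.val + 1)
      | .E => s.wind A (v.1.val + 1) (v.2.val + 1)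
      | .S => s.wind A (v.1.val + 1) v.2.val
      | .W => s.wind A v.1.val v.2.val := by
  obtain ⟨x, y⟩ := v
  rcases e with ⟨⟨a, b⟩, h0⟩ | ⟨⟨a, b⟩, h0⟩ <;> cases d <;>
    simp only [IsAt, Dir.outward, Bool.not_eq_true'] at h hb <;>
    simp only [leftWind, hb] <;>
    simp only [Prod.ext_iff, Fin.ext_iff] at h <;> simp only [Bool.false_eq_true, if_false, if_true] <;>
    
    simp only [HEdge.col, HEdge.row, VEdge.col, VEdge.row] <;> (congr 1 <;> omega)

theorem wind_vertex {A : D.Edge → Prop} (hA : ∀ e, A (s.next e) ↔ A e) {v : Fin n × Fin n} {d}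
    {e : D.Edge} (h : D.IsAt v d e) (he : A e) : ∃ k, (k = 1 ∨ k = -1) ∧
      match d with
      | .N => s.wind A v.1.val (v.2.val + 1) = s.wind A (v.1.val + 1) (v.2.val + 1) + k
      | .E => s.wind A (v.1.val + 1) v.2.val = s.wind A (v.1.val + 1) (v.2.val + 1) + k
      | .S => s.wind A v.1.val v.2.val = s.wind A (v.1.val + 1) v.2.val + k
      | .W => s.wind A v.1.val v.2.val = s.wind A v.1.val (v.2.val + 1) + k := by
  obtain ⟨x, y⟩ := v
  rcases e with e | e <;> cases d <;> simp only [IsAt, Prod.ext_iff, Fin.ext_iff] at h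
  · have h1 := wind_h (s := s) A e he
    simp only [HEdge.col, HEdge.row, VEdge.col, VEdge.row] at h1
    refine ⟨if s.ori (.inl e) then -1 else 1, by split_ifs <;> simp, ?_⟩
    simp only [← h.1, ← h.2]; exact h1
  · have h1 := wind_h (s := s) A e he
    simp only [HEdge.col, HEdge.row, VEdge.col, VEdge.row] at h1
    refine ⟨if s.ori (.inl e) then -1 else 1, by split_ifs <;> simp, ?_⟩
    simp only [← h.1, ← h.2]; push_cast; exact h1
  · have h1 := wind_v (s := s) hA e he
    simp only [HEdge.col, HEdge.row, VEdge.col, VEdge.row] at h1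
    refine ⟨if s.ori (.inr e) then 1 else -1, by split_ifs <;> simp, ?_⟩
    simp only [← h.1, ← h.2]; exact h1
  · have h1 := wind_v (s := s) hA e he
    simp only [HEdge.col, HEdge.row, VEdge.col, VEdge.row] at h1
    refine ⟨if s.ori (.inr e) then 1 else -1, by split_ifs <;> simp, ?_⟩
    simp only [← h.1, ← h.2]; push_cast; exact h1

theorem wind_vertex_none {A : D.Edge → Prop} (hA : ∀ e, A (s.next e) ↔ A e) {v : Fin n × Fin n} {d}
    (h : ∀ e, D.IsAt v d e → ¬ A e) :
      match d with
      | .N => s.wind A v.1.val (v.2.val + 1) = s.wind A (v.1.val + 1) (v.2.val + 1)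
      | .E => s.wind A (v.1.val + 1) v.2.val = s.wind A (v.1.val + 1) (v.2.val + 1)
      | .S => s.wind A v.1.val v.2.val = s.wind A (v.1.val + 1) v.2.val
      | .W => s.wind A v.1.val v.2.val = s.wind A v.1.val (v.2.val + 1) := by
  obtain ⟨x, y⟩ := v
  cases d
  · refine wind_v_none hA _ _ fun e he h1 h2 => h (.inr e) ?_ he
    simp only [IsAt, Prod.ext_iff, Fin.ext_iff]; simp only [HEdge.col, HEdge.row, VEdge.col, VEdge.row] at h1 h2; omega
  · refine wind_v_none hA _ _ fun e he h1 h2 => h (.inr e) ?_ he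
    simp only [IsAt, Fin.ext_iff]; simp only [HEdge.col, HEdge.row, VEdge.col, VEdge.row] at h1 h2; omega
  · refine wind_h_none A _ _ fun e he h1 h2 => h (.inl e) ?_ he
    simp only [IsAt, Prod.ext_iff, Fin.ext_iff]; simp only [HEdge.col, HEdge.row, VEdge.col, VEdge.row] at h1 h2; omega
  · refine wind_h_none A _ _ fun e he h1 h2 => h (.inl e) ?_ he
    simp only [IsAt, Fin.ext_iff]; simp only [HEdge.col, HEdge.row, VEdge.col, VEdge.row] at h1 h2; omega

/-- At a left turn the two left-hand cells coincide. At a right turn one passes from one to the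
other across the two half-edges of the turn itself, which changes the winding number by an even
amount. Straight on, nothing separates them. -/
theorem leftWind_next {A : D.Edge → Prop} (hA : ∀ e, A (s.next e) ↔ A e) {e : D.Edge} (he : A e) :
    s.leftWind A (s.next e) % 2 = s.leftWind A e % 2 := by
  obtain ⟨v, d, d', h, h', hl, hb, hb'⟩ := s.next_spec e
  rw [leftWind_head A h hb, leftWind_tail A h' hb']
  obtain ⟨k, hk, hd⟩ := wind_vertex hA h he
  obtain ⟨k', hk', hd'⟩ := wind_vertex hA h' ((hA e).2 he)
  have hne := hl.ne
  -- If `d'` is neither partner of `d`, the passage is straight. It then takes place away from the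
  -- crossings, and there is no third half-edge.
  have side : ∀ d'', d ≠ d'' → d' ≠ d'' → d' ≠ Dir.partner true d → d' ≠ Dir.partner false d →
      ∀ e, D.IsAt v d'' e → ¬ A e := by
    intro d'' n1 n2 n3 n4 e'' he''
    rcases hl with ⟨hv, hl⟩ | ⟨hv, -⟩
    · exfalso; cases hr : s.res ⟨v, hv⟩ <;> rw [hr] at hl <;> tauto
    · exact absurd (h.hasEdge.eq_of_not_isCrossing hv h'.hasEdge he''.hasEdge hne n1) n2
  cases d <;> cases d' <;> simp only at hd hd' ⊢ <;> first
    | exact absurd rfl hne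
    | rfl
    | omega
    | skip
  · have := wind_vertex_none hA (side .E (by simp) (by simp) (by simp [Dir.partner]) (by simp [Dir.partner]))
    simp only at this; omega
  · have := wind_vertex_none hA (side .W (by simp) (by simp) (by simp [Dir.partner]) (by simp [Dir.partner]))
    simp only at this; omega
  · have := wind_vertex_none hA (side .S (by simp) (by simp) (by simp [Dir.partner]) (by simp [Dir.partner]))
    simp only at this; omega
  · have := wind_vertex_none hA (side .N (by simp) (by simp) (by simp [Dir.partner]) (by simp [Dir.partner]))
    simp only at this; omega

/-- Propagation forwards suffices, since in a finite cycle every edge is reached by a natural power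
of `next`. -/
theorem circle_induction (s : D.EState) {e₀ : D.Edge} {P : D.Edge → Prop} (h0 : P e₀)
    (h1 : ∀ e, circleOf s.res e = circleOf s.res e₀ → P e → P (s.next e)) {e : D.Edge}
    (he : circleOf s.res e = circleOf s.res e₀) : P e := by
  obtain ⟨k, rfl⟩ := ((s.circleOf_eq_iff _ _).1 he.symm).exists_nat_pow_eq
  clear he
  have : ∀ k : ℕ, circleOf s.res ((s.next ^ k) e₀) = circleOf s.res e₀ ∧ P ((s.next ^ k) e₀) := by
    intro k
    induction k with
    | zero => exact ⟨rfl, h0⟩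
    | succ k ih =>
      rw [pow_succ', Equiv.Perm.mul_apply, circleOf_next]
      exact ⟨ih.1, h1 _ ih.1 ih.2⟩
  exact (this k).2

theorem circle_invariant (s : D.EState) (C : Circle s.res) (e : D.Edge) :
    circleOf s.res (s.next e) = C ↔ circleOf s.res e = C := by rw [circleOf_next]

theorem wind_circle_parity (s : D.EState) (C : Circle s.res) {e₀ e : D.Edge} (h₀ : circleOf s.res e₀ = C)
    (h : circleOf s.res e = C) :
    s.leftWind (fun e => circleOf s.res e = C) e % 2 =
      s.leftWind (fun e => circleOf s.res e = C) e₀ % 2 := by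
  subst h₀
  refine s.circle_induction (P := fun e' => s.leftWind (fun e => circleOf s.res e =
    circleOf s.res e₀) e' % 2 = s.leftWind (fun e => circleOf s.res e = circleOf s.res e₀) e₀ % 2)
    rfl (fun e he ih => ?_) h
  rw [leftWind_next (s.circle_invariant _) he, ih]

/-- Going down a column of cells from outside, each edge of the circle changes the winding number by
one. As the parity on the left of the circle is constant, the direction of each jump is forced by
the parity above it, and the values alternate between 0 and one fixed sign. -/
theorem wind_circle_values (s : D.EState) (C : Circle s.res) : ∃ κ : ℤ, (κ = 1 ∨ κ = -1) ∧
    ∀ a b, s.wind (fun e => circleOf s.res e = C) a b = 0 ∨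
      s.wind (fun e => circleOf s.res e = C) a b = κ := by
  obtain ⟨e₀, h₀⟩ : ∃ e, circleOf s.res e = C := Quot.exists_rep C
  have hp := fun e he => s.wind_circle_parity C (e := e) h₀ he
  set A : D.Edge → Prop := fun e => circleOf s.res e = C
  obtain ⟨κ, hκ, hκ'⟩ : ∃ κ : ℤ, (κ = 1 ∨ κ = -1) ∧ ∀ e, A e →
      s.leftWind A e % 2 = if κ = 1 then 1 else 0 := by
    rcases Int.emod_two_eq_zero_or_one (s.leftWind A e₀) with h | h
    · exact ⟨-1, .inr rfl, fun e he => by rw [hp e he, h]; rfl⟩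
    · exact ⟨1, .inl rfl, fun e he => by rw [hp e he, h]; rfl⟩
  refine ⟨κ, hκ, fun a b => ?_⟩
  rcases le_total (n : ℤ) b with hb | hb
  · exact .inl (wind_of_le A a hb)
  -- The induction descends from the row `n`, above which all winding numbers vanish.
  obtain ⟨k, rfl⟩ : ∃ k : ℕ, b = n - k := ⟨(n - b).toNat, by omega⟩
  clear hb
  induction k with
  | zero => exact .inl (wind_of_le A a (by simp))
  | succ k ih =>
    by_cases hE : ∃ e : D.HEdge, A (.inl e) ∧ e.col + 1 = a ∧
        e.row = n - (k + 1 : ℕ)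
    · obtain ⟨e, he, h1, h2⟩ := hE
      have h3 := wind_h (s := s) A e he
      have h4 := hκ' _ he
      simp only [leftWind] at h4
      rw [h1, h2] at h3 h4
      have h5 : (n : ℤ) - (k + 1 : ℕ) + 1 = n - k := by push_cast; ring
      rw [h5] at h3 h4
      cases ho : s.ori (.inl e) <;> rw [ho] at h3 h4 <;>
        simp only [Bool.false_eq_true, if_true, if_false] at h3 h4 <;> split_ifs at h4 <;> omega
    · rw [wind_h_none A]
      · have h5 : (n : ℤ) - (k + 1 : ℕ) + 1 = n - k := by push_cast; ring
        rw [h5]; exact ih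
      · intro e h1 h2 h3
        exact hE ⟨e, h1, h2, h3⟩

/-- An edge of a circle which is as high and then as far to the right as possible. -/
theorem exists_top_edge (s : D.EState) (C : Circle s.res) : ∃ e₀, circleOf s.res e₀ = C ∧
    ∀ e, circleOf s.res e = C → (edgeMid e).2 < (edgeMid e₀).2 ∨
      (edgeMid e).2 = (edgeMid e₀).2 ∧ (edgeMid e).1 ≤ (edgeMid e₀).1 := by
  classical
  obtain ⟨e₁, h₁⟩ : ∃ e, circleOf s.res e = C := Quot.exists_rep C
  obtain ⟨e₀, h0, hmax⟩ := Finset.exists_max_image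
    (Finset.univ.filter fun e => circleOf s.res e = C)
    (fun e => toLex ((edgeMid e).2, (edgeMid e).1)) ⟨e₁, by simpa using h₁⟩
  refine ⟨e₀, by simpa using h0, fun e he => ?_⟩
  have := hmax e (by simpa using he)
  rw [Prod.Lex.le_iff] at this
  simpa using this

theorem wind_top_edge (s : D.EState) (C : Circle s.res) (e : D.HEdge)
    (h1 : ∀ e', circleOf s.res e' = C → (edgeMid e').2 ≤ (edgeMid (D := D) (.inl e)).2) :
    s.wind (fun e => circleOf s.res e = C) (e.col + 1) (e.row + 1) = 0 := by
  unfold wind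
  refine Finset.sum_eq_zero fun e' _ => if_neg ?_
  rintro ⟨h2, h3, h4⟩
  have := h1 _ h2
  simp only [edgeMid, edgeLo, edgeHi, Prod.snd_add] at this
  omega

end EState
end GridDiagram
end GridKh

namespace GridKh

/-! ## The rotation number of a closed walk that does not cross itself -/

/-- The cross product of two vectors of the plane. -/
def cross (v w : ℤ × ℤ) : ℤ := v.1 * w.2 - v.2 * w.1

/-- Signed crossing of a short segment with the ray slightly above the positive horizontal axis. -/
def rayUp (v w : ℤ × ℤ) : ℤ :=
  (if v.2 ≤ 0 ∧ 0 < w.2 ∧ 0 < v.1 then 1 else 0) - (if w.2 ≤ 0 ∧ 0 < v.2 ∧ 0 < w.1 then 1 else 0)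

/-- The direction of a sum of two unit vectors, in eighths of a full turn. -/
def octant (v : ℤ × ℤ) : ℤ :=
  if 0 < v.2 then (if 0 < v.1 then 0 else if v.1 = 0 then 1 else 2)
  else if v.2 < 0 then (if v.1 < 0 then 4 else if v.1 = 0 then 5 else 6)
  else if v.1 < 0 then 3 else 7

/-- As two points move along the steps `a` and `b`, the secant `v` runs around a square. The count
around the square is zero unless the secant passes through the origin. The parity condition, the
four non-vanishing corners and, for perpendicular straight steps, the non-vanishing centre exclude
this. -/
theorem rayUp_square_near : ∀ a ∈ ([(1,1),(0,2),(-1,1),(-2,0),(-1,-1),(0,-2),(1,-1),(2,0)] : List (ℤ × ℤ)),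
    ∀ b ∈ ([(1,1),(0,2),(-1,1),(-2,0),(-1,-1),(0,-2),(1,-1),(2,0)] : List (ℤ × ℤ)),
    ∀ x ∈ Finset.Icc (-4 : ℤ) 4, ∀ y ∈ Finset.Icc (-4 : ℤ) 4, (x + y) % 2 = 0 →
    (x, y) ≠ 0 → (x, y) - a ≠ 0 → (x, y) + b ≠ 0 → (x, y) - a + b ≠ 0 →
    (a.1 * b.1 + a.2 * b.2 = 0 → a.1 * a.2 = 0 → 2 * (x, y) + b - a ≠ 0) →
    rayUp (x, y) ((x, y) + b) + rayUp ((x, y) + b) ((x, y) - a + b) =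
      rayUp (x, y) ((x, y) - a) + rayUp ((x, y) - a) ((x, y) - a + b) := by
  decide

/-- The directions in which a walk may proceed: all but the opposite one. -/
def Dir.opp : Dir → Dir
  | .N => .S
  | .S => .N
  | .E => .W
  | .W => .E

theorem Dir.vec_add_vec_mem {d d' : Dir} (h : d' ≠ d.opp) : d.vec + d'.vec ∈
    ([(1,1),(0,2),(-1,1),(-2,0),(-1,-1),(0,-2),(1,-1),(2,0)] : List (ℤ × ℤ)) := by
  cases d <;> cases d' <;> first | exact absurd rfl h | decide

theorem rayUp_right {v w : ℤ × ℤ} (hv : 0 < v.1) (hw : 0 < w.1) :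
    rayUp v w = (if 0 < w.2 then 1 else 0) - (if 0 < v.2 then 1 else 0) := by
  unfold rayUp
  split_ifs <;> omega

theorem rayUp_far {v w : ℤ × ℤ}
    (h : v.1 ≤ 0 ∧ w.1 ≤ 0 ∨ 0 < v.2 ∧ 0 < w.2 ∨ v.2 ≤ 0 ∧ w.2 ≤ 0) : rayUp v w = 0 := by
  unfold rayUp
  split_ifs <;> omega

/-- The steps have coordinates of absolute value at most 2. A square starting outside the box of
radius 4 stays in one half-plane, where the counts vanish or telescope, so finitely many cases
remain. -/
theorem rayUp_square {a b v : ℤ × ℤ}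
    (ha : a ∈ ([(1,1),(0,2),(-1,1),(-2,0),(-1,-1),(0,-2),(1,-1),(2,0)] : List (ℤ × ℤ)))
    (hb : b ∈ ([(1,1),(0,2),(-1,1),(-2,0),(-1,-1),(0,-2),(1,-1),(2,0)] : List (ℤ × ℤ)))
    (hv : (v.1 + v.2) % 2 = 0) (h0 : v ≠ 0) (h1 : v - a ≠ 0) (h2 : v + b ≠ 0)
    (h3 : v - a + b ≠ 0)
    (h4 : a.1 * b.1 + a.2 * b.2 = 0 → a.1 * a.2 = 0 → 2 * v + b - a ≠ 0) :
    rayUp v (v + b) + rayUp (v + b) (v - a + b) =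
      rayUp v (v - a) + rayUp (v - a) (v - a + b) := by
  obtain ⟨x, y⟩ := v
  by_cases hxy : (-4 ≤ x ∧ x ≤ 4) ∧ (-4 ≤ y ∧ y ≤ 4)
  · exact rayUp_square_near a ha b hb x (Finset.mem_Icc.2 hxy.1) y (Finset.mem_Icc.2 hxy.2)
      hv h0 h1 h2 h3 h4
  · have bd : ∀ a ∈ ([(1,1),(0,2),(-1,1),(-2,0),(-1,-1),(0,-2),(1,-1),(2,0)] : List (ℤ × ℤ)),
        (-2 ≤ a.1 ∧ a.1 ≤ 2) ∧ (-2 ≤ a.2 ∧ a.2 ≤ 2) := by decide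
    obtain ⟨⟨p1, p2⟩, p3, p4⟩ := bd a ha
    obtain ⟨⟨q1, q2⟩, q3, q4⟩ := bd b hb
    obtain ⟨a1, a2⟩ := a
    obtain ⟨b1, b2⟩ := b
    have hc : 4 < x ∨ x < -4 ∨ 4 < y ∨ y < -4 := by omega
    simp only at p1 p2 p3 p4 q1 q2 q3 q4
    simp only [Prod.mk_add_mk, Prod.mk_sub_mk]
    rcases hc with hc | hc | hc | hc
    · rw [rayUp_right, rayUp_right, rayUp_right, rayUp_right] <;> simp only <;> omega
    all_goals rw [rayUp_far, rayUp_far, rayUp_far, rayUp_far] <;> simp only <;> omega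

/-- The angle swept by the secant along one diagonal step is its crossing number, in full turns of
eight octants, corrected by the change of its octant. It is also the sum of two half quarter turns.
-/
theorem octant_sub (d₀ d₁ d₂ : Dir) (h : d₁ ≠ d₀.opp) (h' : d₂ ≠ d₁.opp) :
    8 * (rayUp (d₀.vec + d₁.vec) (d₀.vec + d₁.vec + (d₁.vec + d₂.vec)) +
      rayUp (d₀.vec + d₁.vec + (d₁.vec + d₂.vec)) (d₁.vec + d₂.vec)) =
    cross d₀.vec d₁.vec + cross d₁.vec d₂.vec -
      (octant (d₁.vec + d₂.vec) - octant (d₀.vec + d₁.vec)) := by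
  cases d₀ <;> cases d₁ <;> first
    | exact absurd rfl h
    | (cases d₂ <;> first | exact absurd rfl h' | decide)

/-- The boundary terms at the extremal point. There the walk leaves downwards and returns from
below, so the middle step is horizontal, and its direction decides the sense of the full turn. -/
theorem rayUp_base (d₀ d₁ d₂ : Dir) (h : d₁ ≠ d₀.opp) (h' : d₂ ≠ d₁.opp)
    (k : (d₁.vec + d₂.vec).2 < 0 ∨ (d₁.vec + d₂.vec).2 = 0 ∧ (d₁.vec + d₂.vec).1 ≤ 0)
    (k' : 0 < (d₀.vec + d₁.vec).2 ∨ (d₀.vec + d₁.vec).2 = 0 ∧ 0 ≤ (d₀.vec + d₁.vec).1) :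
    (d₁.vec.2 = 0 ∧
    rayUp (-(d₀.vec + d₁.vec)) (-(d₀.vec + d₁.vec) - (d₁.vec + d₂.vec)) +
      rayUp (-(d₀.vec + d₁.vec) - (d₁.vec + d₂.vec)) (-(d₁.vec + d₂.vec)) +
      ((if 0 < (d₀.vec + d₁.vec).2 then 1 else 0) - (if 0 < (-(d₁.vec + d₂.vec)).2 then 1 else 0)) +
      (rayUp (d₀.vec + d₁.vec) (d₀.vec + d₁.vec + (d₁.vec + d₂.vec)) +
      rayUp (d₀.vec + d₁.vec + (d₁.vec + d₂.vec)) (d₁.vec + d₂.vec)) = -d₁.vec.1) := by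
  cases d₀ <;> cases d₁ <;> first
    | exact absurd rfl h
    | (cases d₂ <;> first
        | exact absurd rfl h'
        | (exfalso; revert k; decide)
        | (exfalso; revert k'; decide)
        | decide)

theorem rayUp_eq_zero_of_lower {v w : ℤ × ℤ} (hv : v.2 < 0 ∨ v.2 = 0 ∧ v.1 ≤ 0)
    (hw : w.2 < 0 ∨ w.2 = 0 ∧ w.1 ≤ 0) : rayUp v w = 0 := by
  unfold rayUp
  split_ifs <;> omega

theorem rayUp_of_upper {v w : ℤ × ℤ} (hv : 0 < v.2 ∨ v.2 = 0 ∧ 0 ≤ v.1)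
    (hw : 0 < w.2 ∨ w.2 = 0 ∧ 0 ≤ w.1) (hv0 : v ≠ 0) (hw0 : w ≠ 0) :
    rayUp v w = (if 0 < w.2 then 1 else 0) - (if 0 < v.2 then 1 else 0) := by
  obtain ⟨a, b⟩ := v
  obtain ⟨c, d⟩ := w
  simp only [ne_eq, Prod.ext_iff, Prod.fst_zero, Prod.snd_zero, rayUp] at *
  split_ifs <;> omega

/-- A closed walk with steps `h i + h (i + 1)` through distinct points, whose straight steps do not
cross each other, makes one full turn. -/
theorem sum_cross_of_closed_walk (L : ℕ) (hL : 3 ≤ L) (p : ℕ → ℤ × ℤ) (h : ℕ → Dir)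
    (hturn : ∀ i, h (i + 1) ≠ (h i).opp) (hp : ∀ i, p (i + 1) = p i + ((h i).vec + (h (i + 1)).vec))
    (pL : ∀ i, p (i + L) = p i) (hhL : ∀ i, h (i + L) = h i)
    (inj : ∀ i j, i < j → j < i + L → p i ≠ p j) (par : ∀ i, ((p i).1 + (p i).2) % 2 = 1)
    (straight : ∀ i j, h i = h (i + 1) → h j = h (j + 1) →
      (h i).vec.1 * (h j).vec.1 + (h i).vec.2 * (h j).vec.2 = 0 →
      p i + (h i).vec ≠ p j + (h j).vec)
    (top : ∀ i, (p i).2 < (p 0).2 ∨ (p i).2 = (p 0).2 ∧ (p i).1 ≤ (p 0).1) :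
    (h 0).vec.2 = 0 ∧
      ∑ i ∈ Finset.range L, cross (h i).vec (h (i + 1)).vec = -4 * (h 0).vec.1 := by
  -- Crossing numbers of the secant from `p i` to `p j`: `c` when its end point advances, `b` when
  -- its starting point advances.
  set c : ℕ → ℕ → ℤ := fun i j => rayUp (p j - p i) (p (j + 1) - p i) with hc
  set b : ℕ → ℕ → ℤ := fun i j => rayUp (p j - p i) (p j - p (i + 1)) with hb
  have ne : ∀ i j, i < j → j < i + L → p j - p i ≠ 0 := fun i j h1 h2 h3 =>
    inj i j h1 h2 (sub_eq_zero.1 h3).symm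
  -- Closedness on an elementary square of index pairs. The bounds keep all four pairs distinct
  -- modulo the period `L`.
  have sq : ∀ i j, i + 1 < j → j + 1 < i + L → c i j + b i (j + 1) = b i j + c (i + 1) j := by
    intro i j h1 h2
    have e1 : p (j + 1) - p i = p j - p i + ((h j).vec + (h (j + 1)).vec) := by rw [hp]; abel
    have e2 : p j - p (i + 1) = p j - p i - ((h i).vec + (h (i + 1)).vec) := by rw [hp i]; abel
    have e3 : p (j + 1) - p (i + 1) = p j - p i - ((h i).vec + (h (i + 1)).vec) +
      ((h j).vec + (h (j + 1)).vec) := by rw [hp, hp i]; abel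
    simp only [hc, hb]
    rw [e1, e2, e3]
    refine rayUp_square (Dir.vec_add_vec_mem (hturn i)) (Dir.vec_add_vec_mem (hturn j)) ?_
      (ne _ _ (by omega) (by omega)) ?_ ?_ ?_ ?_
    · have := par i; have := par j; simp only [Prod.fst_sub, Prod.snd_sub]; omega
    · rw [← e2]; exact ne _ _ (by omega) (by omega)
    · rw [← e1]; exact ne _ _ (by omega) (by omega)
    · rw [← e3]; exact ne _ _ (by omega) (by omega)
    · intro k1 k2 k3
      have key : ∀ d₀ d₁ d₂ d₃ : Dir, d₁ ≠ d₀.opp → d₃ ≠ d₂.opp →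
          (d₀.vec + d₁.vec).1 * (d₂.vec + d₃.vec).1 + (d₀.vec + d₁.vec).2 * (d₂.vec + d₃.vec).2 = 0 →
          (d₀.vec + d₁.vec).1 * (d₀.vec + d₁.vec).2 = 0 → d₀ = d₁ ∧ d₂ = d₃ ∧
          d₀.vec.1 * d₂.vec.1 + d₀.vec.2 * d₂.vec.2 = 0 := by
        intro d₀ d₁ d₂ d₃
        cases d₀ <;> cases d₁ <;> first
          | exact fun h => absurd rfl h
          | exact fun _ _ _ h => absurd h (by decide)
          | (cases d₂ <;> cases d₃ <;> decide)
      obtain ⟨r1, r2, r3⟩ := key _ _ _ _ (hturn i) (hturn j) k1 k2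
      refine straight i j r1 r2 r3 ?_
      rw [← r1, ← r2] at k3
      simp only [Prod.ext_iff, Prod.fst_add, Prod.snd_add, Prod.fst_sub, Prod.snd_sub,
        Prod.fst_mul, Prod.snd_mul, Prod.fst_ofNat, Prod.snd_ofNat, Prod.fst_zero,
        Prod.snd_zero] at k3 ⊢
      omega
  -- The squares of row `i` from column `i + 2` to column `m` are added up.
  have row : ∀ i m, i + 2 ≤ m → m < i + L →
      ∑ j ∈ Finset.Ico (i + 2) m, c i j + b i m =
        b i (i + 2) + ∑ j ∈ Finset.Ico (i + 2) m, c (i + 1) j := by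
    intro i m hm
    induction m, hm using Nat.le_induction with
    | base => intro _; simp
    | succ m hm ih =>
      intro hm'
      rw [Finset.sum_Ico_succ_top hm, Finset.sum_Ico_succ_top hm]
      have := ih (by omega)
      have := sq i m (by omega) (by omega)
      omega
  have lower : ∀ i, (p i - p 0).2 < 0 ∨ (p i - p 0).2 = 0 ∧ (p i - p 0).1 ≤ 0 := by
    intro i; have := top i; simp only [Prod.fst_sub, Prod.snd_sub]; omega
  have upper : ∀ i, 0 < (p 0 - p i).2 ∨ (p 0 - p i).2 = 0 ∧ 0 ≤ (p 0 - p i).1 := by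
    intro i; have := top i; simp only [Prod.fst_sub, Prod.snd_sub]; omega
  have pL0 : p L = p 0 := by simpa using pL 0
  -- All secants starting at the extremal point `p 0` lie in a half-plane that the ray does not
  -- meet, so one leg of the triangle contributes nothing. On the other leg the secants end at `p L
  -- = p 0` and lie in the opposite half-plane, where the count telescopes.
  have c0 : ∀ j, c 0 j = 0 := fun j => rayUp_eq_zero_of_lower (lower j) (lower (j + 1))
  have leg : ∀ k, 1 ≤ k → k < L → ∑ i ∈ Finset.Ico 1 k, b i L =
      (if 0 < (p 0 - p k).2 then 1 else 0) - (if 0 < (p 0 - p 1).2 then 1 else 0) := by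
    intro k hk
    induction k, hk using Nat.le_induction with
    | base => intro _; simp
    | succ k hk ih =>
      intro hk'
      rw [Finset.sum_Ico_succ_top hk, ih (by omega)]
      have : b k L = _ := rayUp_of_upper (pL0 ▸ upper k) (pL0 ▸ upper (k + 1))
        (ne k L (by omega) (by omega)) (ne (k + 1) L (by omega) (by omega))
      rw [this, pL0]
      ring
  -- Summation over the rows moves the diagonal path to the legs of the triangle.
  have diag : ∀ k, 1 ≤ k → k < L → ∑ i ∈ Finset.Ico 1 k, (c i (i + 1) + b i (i + 2)) =
      ∑ j ∈ Finset.Ico 2 L, c 1 j - ∑ j ∈ Finset.Ico (k + 1) L, c k j +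
        ∑ i ∈ Finset.Ico 1 k, b i L := by
    intro k hk
    induction k, hk using Nat.le_induction with
    | base => intro _; simp
    | succ k hk ih =>
      intro hk'
      rw [Finset.sum_Ico_succ_top hk, Finset.sum_Ico_succ_top hk, ih (by omega),
        Finset.sum_eq_sum_Ico_succ_bot (a := k + 1) (by omega)]
      have := row k L (by omega) (by omega)
      change ∑ j ∈ Finset.Ico (k + 1 + 1) L, c k j + b k L =
        b k (k + 2) + ∑ j ∈ Finset.Ico (k + 1 + 1) L, c (k + 1) j at this
      omega
  obtain ⟨M, rfl⟩ : ∃ M, L = M + 1 := ⟨L - 1, by omega⟩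
  have hdiag := diag M (by omega) (by omega)
  have hleg := leg M (by omega) (by omega)
  have hrow := row 0 M (by omega) (by omega)
  rw [Finset.sum_eq_zero (fun j _ => c0 j)] at hrow
  rw [Finset.Ico_self, Finset.sum_empty] at hdiag
  rw [Finset.sum_Ico_succ_top (by omega : 2 ≤ M)] at hdiag
  simp only [zero_add] at hrow
  have hM : p (M + 1) = p 0 := pL0
  have hhM : h (M + 1) = h 0 := by simpa using hhL 0
  have u1 : p 1 - p 0 = (h 0).vec + (h 1).vec := by rw [hp 0]; abel
  have u2 : p 0 - p M = (h M).vec + (h 0).vec := by rw [← hM, hp M, hhM]; abel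
  have base := rayUp_base (h M) (h 0) (h 1) (hhM ▸ hturn M) (hturn 0) (by rw [← u1]; exact lower 1)
    (by rw [← u2]; exact upper M)
  refine ⟨base.1, ?_⟩
  have tot : ∀ i, 8 * (c i (i + 1) + b i (i + 2)) =
      cross (h i).vec (h (i + 1)).vec + cross (h (i + 1)).vec (h (i + 2)).vec -
      (octant ((h (i + 1)).vec + (h (i + 2)).vec) - octant ((h i).vec + (h (i + 1)).vec)) := by
    intro i
    have := octant_sub (h i) (h (i + 1)) (h (i + 2)) (hturn i) (hturn (i + 1))
    rw [← this]
    simp only [hc, hb]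
    have e1 : p (i + 1) - p i = (h i).vec + (h (i + 1)).vec := by rw [hp]; abel
    have e2 : p (i + 2) - p (i + 1) = (h (i + 1)).vec + (h (i + 2)).vec := by rw [hp (i + 1)]; abel
    have e3 : p (i + 2) - p i = (h i).vec + (h (i + 1)).vec + ((h (i + 1)).vec + (h (i + 2)).vec) := by
      rw [hp (i + 1), hp i]; abel
    rw [e1, e2, e3]
  -- The octants telescope around the closed walk, and each turn occurs in two neighbouring diagonal
  -- steps.
  have totsum : 8 * ∑ i ∈ Finset.range (M + 1), (c i (i + 1) + b i (i + 2)) =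
      2 * ∑ i ∈ Finset.range (M + 1), cross (h i).vec (h (i + 1)).vec := by
    rw [Finset.mul_sum, Finset.sum_congr rfl fun i _ => tot i, Finset.sum_sub_distrib,
      Finset.sum_range_sub (fun i => octant ((h i).vec + (h (i + 1)).vec)), Finset.sum_add_distrib]
    have e1 : h (M + 1 + 1) = h 1 := by rw [add_comm (M + 1) 1]; exact hhL 1
    have e2 := Finset.sum_range_succ' (fun i => cross (h i).vec (h (i + 1)).vec) (M + 1)
    rw [Finset.sum_range_succ, e1, hhM] at e2
    rw [e1, hhM]
    simp only [zero_add] at e2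
    have e3 : ∑ x ∈ Finset.range (M + 1), cross (h (x + 1)).vec (h (x + 2)).vec =
      ∑ x ∈ Finset.range (M + 1), cross (h (x + 1)).vec (h (x + 1 + 1)).vec := rfl
    rw [e3]
    simp only [zero_add]
    omega
  -- The last diagonal step wraps around the period and lies outside the triangle; `rayUp_base`
  -- accounts for it together with the corner terms `b 0 M` and `c 1 M`.
  have last : c M (M + 1) + b M (M + 2) =
      rayUp ((h M).vec + (h 0).vec) ((h M).vec + (h 0).vec + ((h 0).vec + (h 1).vec)) +
      rayUp ((h M).vec + (h 0).vec + ((h 0).vec + (h 1).vec)) ((h 0).vec + (h 1).vec) := by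
    have e1 : p (M + 2) = p 1 := by rw [show M + 2 = 1 + (M + 1) by ring]; exact pL 1
    simp only [hc, hb]
    rw [show M + 1 + 1 = M + 2 by ring, e1, hM, u2, u1,
      show p 1 - p M = (p 0 - p M) + (p 1 - p 0) by abel, u1, u2]
  have hb0 : b 0 M = rayUp (-((h M).vec + (h 0).vec)) (-((h M).vec + (h 0).vec) - ((h 0).vec + (h 1).vec)) := by
    simp only [hb]
    rw [zero_add, show p M - p 1 = -(p 0 - p M) - (p 1 - p 0) by abel,
      show p M - p 0 = -(p 0 - p M) by abel, u1, u2]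
  have hc1 : c 1 M = rayUp (-((h M).vec + (h 0).vec) - ((h 0).vec + (h 1).vec)) (-((h 0).vec + (h 1).vec)) := by
    simp only [hc]
    rw [hM, show p M - p 1 = -(p 0 - p M) - (p 1 - p 0) by abel,
      show p 0 - p 1 = -(p 1 - p 0) by abel, u1, u2]
  rw [u2, show p 0 - p 1 = -(p 1 - p 0) by abel, u1] at hleg
  have hsplit : ∑ i ∈ Finset.range (M + 1), (c i (i + 1) + b i (i + 2)) =
      b 0 2 + ∑ i ∈ Finset.Ico 1 M, (c i (i + 1) + b i (i + 2)) + (c M (M + 1) + b M (M + 2)) := by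
    rw [Finset.sum_range_succ, Finset.range_eq_Ico, Finset.sum_eq_sum_Ico_succ_bot (by omega), c0]
    simp
  have := base.2
  rw [← last, ← hb0, ← hc1, ← hleg] at this
  omega

end GridKh

namespace GridKh
namespace GridDiagram

variable {n : ℕ} {D : GridDiagram n}

/-! ## Winding numbers and rotation numbers of the circles of a state -/

namespace EState

variable (s : D.EState)

/-- The direction of an oriented edge. -/
def dir (e : D.Edge) : Dir :=
  match e, s.ori e with
  | .inl _, true => .E
  | .inl _, false => .W
  | .inr _, true => .N
  | .inr _, false => .S

theorem heading_eq (e : D.Edge) : s.heading e = (s.dir e).vec := by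
  unfold heading head tail dir
  rcases e with e | e <;> rcases Bool.eq_false_or_eq_true (s.ori _) with h | h <;> rw [h] <;>
    simp [edgeHi, edgeLo, Dir.vec]

theorem _root_.GridKh.Dir.vec_injective : Function.Injective Dir.vec := by
  intro d d' h
  cases d <;> cases d' <;> first | rfl | exact absurd h (by decide)

theorem _root_.GridKh.Dir.vec_opp (d : Dir) : d.opp.vec = -d.vec := by cases d <;> rfl

theorem exists_vertex (e : D.Edge) : ∃ v, D.IsAt v (s.dir e).opp e ∧
    D.IsAt v (s.dir (s.next e)) (s.next e) ∧
    Linked s.res v (s.dir e).opp (s.dir (s.next e)) ∧ s.head e = latticePt v := by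
  obtain ⟨v, d, d', h, h', hl, hb, hb'⟩ := s.next_spec e
  have h1 : d = (s.dir e).opp := by
    apply Dir.vec_injective
    rw [Dir.vec_opp, ← heading_eq, (head_eq h hb).2, neg_neg]
  have h2 : d' = s.dir (s.next e) := by
    apply Dir.vec_injective
    rw [← heading_eq, (tail_eq h' hb').2]
  subst h1 h2
  exact ⟨v, h, h', hl, (head_eq h hb).1⟩

theorem dir_next_ne (e : D.Edge) : s.dir (s.next e) ≠ (s.dir e).opp := by
  obtain ⟨v, -, -, h, -⟩ := s.exists_vertex e
  exact h.ne.symm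

theorem edgeMid_eq_head (e : D.Edge) : edgeMid e + (s.dir e).vec = 2 * s.head e := by
  rw [← heading_eq, heading, edgeMid_eq s]
  ring

theorem edgeMid_eq_tail (e : D.Edge) : edgeMid e = 2 * s.tail e + (s.dir e).vec := by
  rw [← heading_eq, heading, edgeMid_eq s]
  ring

theorem edgeMid_next (e : D.Edge) :
    edgeMid (s.next e) = edgeMid e + ((s.dir e).vec + (s.dir (s.next e)).vec) := by
  rw [edgeMid_eq_tail s (s.next e), tail_next, ← edgeMid_eq_head]
  ring

theorem edgeMid_odd (e : D.Edge) : ((edgeMid e).1 + (edgeMid e).2) % 2 = 1 := by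
  rcases e with e | e <;> simp only [edgeMid, edgeLo, edgeHi, Prod.fst_add, Prod.snd_add] <;> omega

/-- A smoothing never goes straight through a crossing, and any other vertex has at most two
half-edges. So two perpendicular straight passages cannot share a vertex, which is what the discrete
Umlaufsatz requires. -/
theorem straight_ne (e e' : D.Edge) (h : s.dir e = s.dir (s.next e))
    (h' : s.dir e' = s.dir (s.next e'))
    (hp : (s.dir e).vec.1 * (s.dir e').vec.1 + (s.dir e).vec.2 * (s.dir e').vec.2 = 0) :
    edgeMid e + (s.dir e).vec ≠ edgeMid e' + (s.dir e').vec := by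
  intro h0
  rw [edgeMid_eq_head, edgeMid_eq_head] at h0
  obtain ⟨v, a1, a2, a3, a4⟩ := s.exists_vertex e
  obtain ⟨v', b1, b2, b3, b4⟩ := s.exists_vertex e'
  have hv : v = v' := by
    apply latticePt_injective
    rw [← a4, ← b4]
    simp only [Prod.ext_iff, Prod.fst_mul, Prod.snd_mul, Prod.fst_ofNat, Prod.snd_ofNat] at h0 ⊢
    omega
  subst hv
  rw [← h] at a2 a3
  rw [← h'] at b2 b3
  rcases a3 with ⟨hv, a3⟩ | ⟨hv, a3⟩
  · cases hr : s.res ⟨v, hv⟩ <;> rw [hr] at a3 <;> cases hd : s.dir e <;> rw [hd] at a3 <;>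
      exact absurd a3 (by decide)
  · have hk := a1.hasEdge.eq_of_not_isCrossing hv a2.hasEdge b2.hasEdge a3
    cases hd : s.dir e <;> cases hd' : s.dir e' <;> simp [hd, hd', Dir.opp, Dir.vec] at hk hp

/-- The turn from an edge to the following one: `1` to the left, `-1` to the right. -/
def turn (e : D.Edge) : ℤ := cross (s.heading e) (s.heading (s.next e))

/-- The edges of the circle are the orbit of `e₀` under `next` over one minimal period; the doubled
midpoints form the closed walk. -/
theorem sum_turn_of_top (C : Circle s.res) (e₀ : D.Edge) (h₀ : circleOf s.res e₀ = C)
    (top : ∀ e, circleOf s.res e = C → (edgeMid e).2 < (edgeMid e₀).2 ∨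
      (edgeMid e).2 = (edgeMid e₀).2 ∧ (edgeMid e).1 ≤ (edgeMid e₀).1) :
    (s.heading e₀).2 = 0 ∧
      ∑ e, (if circleOf s.res e = C then s.turn e else 0) = -4 * (s.heading e₀).1 := by
  have hcirc : ∀ i : ℕ, circleOf s.res (s.next^[i] e₀) = C := by
    intro i
    induction i with
    | zero => exact h₀
    | succ i ih => rw [Function.iterate_succ_apply', circleOf_next, ih]
  have hper : e₀ ∈ Function.periodicPts s.next :=
    Function.Injective.mem_periodicPts s.next.injective e₀
  set L := Function.minimalPeriod s.next e₀ with hLdef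
  have hLpos : 0 < L := Function.minimalPeriod_pos_of_mem_periodicPts hper
  have hLit : s.next^[L] e₀ = e₀ := Function.iterate_minimalPeriod
  have hinj : ∀ i j, i < j → j < i + L → s.next^[i] e₀ ≠ s.next^[j] e₀ := by
    intro i j h1 h2 h3
    obtain ⟨k, rfl⟩ := Nat.exists_eq_add_of_lt h1
    rw [add_assoc, Function.iterate_add_apply] at h3
    have h4 := s.next.injective.iterate i h3
    have h5 : Function.IsPeriodicPt s.next (k + 1) e₀ := h4.symm
    have := Nat.le_of_dvd (by omega) h5.minimalPeriod_dvd
    omega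
  set p : ℕ → ℤ × ℤ := fun i => edgeMid (s.next^[i] e₀) with hpdef
  set h : ℕ → Dir := fun i => s.dir (s.next^[i] e₀) with hhdef
  have hturn : ∀ i, h (i + 1) ≠ (h i).opp := by
    intro i
    simp only [hhdef, Function.iterate_succ_apply']
    exact s.dir_next_ne _
  have hp : ∀ i, p (i + 1) = p i + ((h i).vec + (h (i + 1)).vec) := by
    intro i
    simp only [hpdef, hhdef, Function.iterate_succ_apply']
    exact s.edgeMid_next _
  have hadd : ∀ i, s.next^[i + L] e₀ = s.next^[i] e₀ := by
    intro i
    rw [Function.iterate_add_apply, hLit]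
  -- A closed walk of one or two edges would have opposite successive headings, but `dir_next_ne`
  -- excludes reversals.
  have hL : 3 ≤ L := by
    by_contra hlt
    have hv : (h 0).vec + (h 1).vec = 0 := by
      have h1 := hp 0
      have h2 := hp 1
      have e1 : p L = p 0 := by simp only [hpdef]; rw [hLit]; rfl
      rcases (by omega : L = 1 ∨ L = 2) with hl | hl
      · rw [hl] at e1
        rw [zero_add, e1] at h1
        simpa using h1
      · have e2 : h 2 = h 0 := by simp only [hhdef]; rw [← hl, hLit]; rfl
        rw [hl] at e1
        norm_num at h1 h2
        rw [h1, e1, e2] at h2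
        simp only [Prod.ext_iff, Prod.fst_add, Prod.snd_add, Prod.fst_zero, Prod.snd_zero] at h2 ⊢
        omega
    refine hturn 0 (Dir.vec_injective ?_)
    rw [Dir.vec_opp]
    exact eq_neg_of_add_eq_zero_right hv
  obtain ⟨r1, r2⟩ := sum_cross_of_closed_walk L hL p h hturn hp
    (fun i => by simp only [hpdef, hadd]) (fun i => by simp only [hhdef, hadd])
    (fun i j h1 h2 h3 => hinj i j h1 h2 (edgeMid_injective h3)) (fun i => edgeMid_odd _)
    (fun i j h1 h2 h3 => s.straight_ne _ _
      (by simpa only [hhdef, Function.iterate_succ_apply'] using h1)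
      (by simpa only [hhdef, Function.iterate_succ_apply'] using h2) h3)
    (fun i => top _ (hcirc i))
  refine ⟨by rw [heading_eq]; exact r1, ?_⟩
  have hsum : ∑ e, (if circleOf s.res e = C then s.turn e else 0) =
      ∑ i ∈ Finset.range L, cross (h i).vec (h (i + 1)).vec := by
    rw [← Finset.sum_filter]
    symm
    refine Finset.sum_nbij (fun i => s.next^[i] e₀) (fun i _ => ?_) ?_ ?_ (fun i _ => ?_)
    · simpa using hcirc i
    · intro i hi j hj hij
      simp only [Finset.coe_range, Set.mem_Iio] at hi hj
      rcases lt_trichotomy i j with hlt | hlt | hlt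
      · exact absurd hij (hinj i j hlt (by omega))
      · exact hlt
      · exact absurd hij.symm (hinj j i hlt (by omega))
    · intro e he
      simp only [Finset.coe_filter, Finset.mem_univ, true_and, Set.mem_ofPred_eq] at he
      obtain ⟨k, hk⟩ := ((s.circleOf_eq_iff e₀ e).1 (h₀.trans he.symm)).exists_nat_pow_eq
      refine ⟨k % L, by simpa using Nat.mod_lt _ hLpos, ?_⟩
      simp only
      rw [Function.iterate_mod_minimalPeriod_eq, ← hk, Equiv.Perm.iterate_eq_pow]
    · simp only [turn, heading_eq, hhdef, Function.iterate_succ_apply']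
  rw [hsum, r2, heading_eq]
  rfl

/-- The sign of a circle: `1` if it is counterclockwise, `-1` if it is clockwise. -/
def sgn (C : Circle s.res) : ℤ := by
  classical exact if IsCCW s.res s.ori C then 1 else -1

theorem sgn_eq_or (C : Circle s.res) : s.sgn C = 1 ∨ s.sgn C = -1 := by
  unfold sgn
  split_ifs <;> simp

theorem rot_eq : rot s.res s.ori = ∑ C, s.sgn C := rfl

theorem label_iff (e : D.Edge) : s.label e = true ↔ s.sgn (circleOf s.res e) = 1 := by
  unfold label sgn
  by_cases h : IsCCW s.res s.ori (circleOf s.res e) <;> simp [h]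

theorem sgn_circleOf (e : D.Edge) : s.sgn (circleOf s.res e) = if s.label e then 1 else -1 := by
  have := s.label_iff e
  rcases s.sgn_eq_or (circleOf s.res e) with h | h <;> rw [h] at this ⊢ <;> split_ifs <;> simp_all

theorem signedArea_eq (C : Circle s.res) : signedArea s.res s.ori C =
    ∑ p : Cell n, s.wind (fun e => circleOf s.res e = C) p.1.val p.2.val := by
  rw [sum_wind (s.circle_invariant C)]
  unfold signedArea
  refine Finset.sum_congr rfl fun e _ => ?_
  congr

/-- The highest, then rightmost edge is horizontal, with winding number 0 above it. Its heading
determines the value below it, hence the only non-zero winding number, and also the total turning.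
The area is a sum of winding numbers of this one sign. -/
theorem circle_main (C : Circle s.res) :
    (∀ a b, s.wind (fun e => circleOf s.res e = C) a b = 0 ∨
      s.wind (fun e => circleOf s.res e = C) a b = s.sgn C) ∧
    (∃ p : Cell n, s.wind (fun e => circleOf s.res e = C) p.1.val p.2.val = s.sgn C) ∧
    ∑ e, (if circleOf s.res e = C then s.turn e else 0) = 4 * s.sgn C ∧
    0 < s.sgn C * signedArea s.res s.ori C := by
  obtain ⟨e₀, h₀, top⟩ := s.exists_top_edge C
  obtain ⟨hh, hsum⟩ := s.sum_turn_of_top C e₀ h₀ top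
  obtain ⟨κ, hκ, hval⟩ := s.wind_circle_values C
  rcases e₀ with e₀ | e₀
  swap
  · exfalso
    simp only [heading, head, tail] at hh
    rcases Bool.eq_false_or_eq_true (s.ori (.inr e₀)) with ho | ho <;> rw [ho] at hh <;>
      simp [edgeHi, edgeLo] at hh
  have hup := s.wind_top_edge C e₀ (fun e' he' => by have := top e' he'; omega)
  have hlow := wind_h (s := s) (fun e => circleOf s.res e = C) e₀ h₀
  have hhead : (s.heading (.inl e₀)).1 = if s.ori (.inl e₀) then 1 else -1 := by
    simp only [heading, head, tail]
    rcases Bool.eq_false_or_eq_true (s.ori (.inl e₀)) with ho | ho <;> rw [ho] <;>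
      simp [edgeHi, edgeLo]
  -- The value below the top edge differs by one from the value 0 above it, so it is the non-zero
  -- one.
  have hlow' : s.wind (fun e => circleOf s.res e = C) (e₀.col + 1) e₀.row = κ := by
    rcases hval (e₀.col + 1) e₀.row with h | h
    · rw [h, hup] at hlow; split_ifs at hlow <;> omega
    · exact h
  have hsum' : ∑ e, (if circleOf s.res e = C then s.turn e else 0) = 4 * κ := by
    rw [hsum, hhead, ← hlow', hlow, hup]
    split_ifs <;> rfl
  obtain ⟨p, hp⟩ : ∃ p : Cell n, s.wind (fun e => circleOf s.res e = C) p.1.val p.2.val = κ := by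
    refine ⟨(⟨e₀.1.1.val + 1, by omega⟩, ⟨e₀.1.2.val, by omega⟩), ?_⟩
    rw [← hlow']
    simp only [HEdge.col, HEdge.row]
    push_cast
    rfl
  have harea : 0 < κ * signedArea s.res s.ori C := by
    rw [signedArea_eq, Finset.mul_sum]
    refine Finset.sum_pos' (fun q _ => ?_) ⟨p, Finset.mem_univ _, ?_⟩
    · rcases hval q.1.val q.2.val with h | h <;> rw [h] <;> rcases hκ with h | h <;> rw [h] <;> simp
    · rw [hp]; rcases hκ with h | h <;> rw [h] <;> simp
  have hs : s.sgn C = κ := by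
    unfold sgn IsCCW
    rcases hκ with h | h <;> rw [h] at harea ⊢
    · rw [if_pos (by simpa using harea)]
    · rw [if_neg (by omega)]
  rw [hs]
  exact ⟨hval, ⟨p, hp⟩, hsum', harea⟩

open Classical in
/-- The total turn along some of the circles is four times their number, counted with signs. -/
theorem sum_turn (Q : Circle s.res → Prop) :
    ∑ e, (if Q (circleOf s.res e) then s.turn e else 0) = 4 * ∑ C, if Q C then s.sgn C else 0 := by
  rw [Finset.mul_sum, ← Finset.sum_fiberwise (s := Finset.univ) (g := fun e => circleOf s.res e)]
  refine Finset.sum_congr rfl fun C _ => ?_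
  rw [Finset.sum_filter]
  by_cases h : Q C
  · rw [if_pos h, ← (s.circle_main C).2.2.1]
    refine Finset.sum_congr rfl fun e _ => ?_
    by_cases he : circleOf s.res e = C
    · rw [if_pos he, if_pos he, if_pos (he ▸ h)]
    · rw [if_neg he, if_neg he]
  · rw [if_neg h, mul_zero]
    refine Finset.sum_eq_zero fun e _ => ?_
    by_cases he : circleOf s.res e = C
    · rw [if_pos he, if_neg (he ▸ h)]
    · rw [if_neg he]

theorem four_mul_rot : 4 * rot s.res s.ori = ∑ e, s.turn e := by
  have := s.sum_turn (fun _ => True)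
  simp only [if_true] at this
  rw [this, rot_eq]

end EState
end GridDiagram
end GridKh

namespace GridKh
namespace GridDiagram

variable {n : ℕ} {D : GridDiagram n}

/-! ## States with given labels -/

/-- Figure-eights with lowest possible self-intersections. -/
def lowFigureEights (D : GridDiagram n) : D.FigureEights := ⟨D.bot, fun _ => le_rfl, D.bot_lt_top⟩

/-- The winding numbers of the link around the cells. -/
def linkWind (D : GridDiagram n) (a b : ℤ) : ℤ :=
  (D.lowFigureEights.toState D.genX).wind (fun _ => True) a b

/-- The checkerboard orientation: the cells on the left of the edges are those with an odd winding
number. It is consistent with every resolution. -/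
def checker (D : GridDiagram n) : D.Edge → Bool
  | .inl e => decide (D.linkWind (e.col + 1) (e.row + 1) % 2 = 1)
  | .inr e => decide (D.linkWind e.col (e.row + 1) % 2 = 1)

theorem linkWind_vertex {v : Fin n × Fin n} {d} (h : D.HasEdge v d) :
    match d with
    | .N => D.linkWind v.1.val (v.2.val + 1) % 2 ≠ D.linkWind (v.1.val + 1) (v.2.val + 1) % 2
    | .E => D.linkWind (v.1.val + 1) v.2.val % 2 ≠ D.linkWind (v.1.val + 1) (v.2.val + 1) % 2
    | .S => D.linkWind v.1.val v.2.val % 2 ≠ D.linkWind (v.1.val + 1) v.2.val % 2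
    | .W => D.linkWind v.1.val v.2.val % 2 ≠ D.linkWind v.1.val (v.2.val + 1) % 2 := by
  obtain ⟨e, he⟩ := (hasEdge_iff v d).1 h
  obtain ⟨k, hk, h1⟩ := EState.wind_vertex (s := D.lowFigureEights.toState D.genX)
    (A := fun _ => True) (fun _ => Iff.rfl) he trivial
  cases d <;> simp only [linkWind] at h1 ⊢ <;> omega

theorem linkWind_vertex_none {v : Fin n × Fin n} {d} (h : ¬ D.HasEdge v d) :
    match d with
    | .N => D.linkWind v.1.val (v.2.val + 1) = D.linkWind (v.1.val + 1) (v.2.val + 1)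
    | .E => D.linkWind (v.1.val + 1) v.2.val = D.linkWind (v.1.val + 1) (v.2.val + 1)
    | .S => D.linkWind v.1.val v.2.val = D.linkWind (v.1.val + 1) v.2.val
    | .W => D.linkWind v.1.val v.2.val = D.linkWind v.1.val (v.2.val + 1) := by
  have := EState.wind_vertex_none (s := D.lowFigureEights.toState D.genX)
    (A := fun _ => True) (fun _ => Iff.rfl) fun e he => absurd ((hasEdge_iff v d).2 ⟨e, he⟩) h
  cases d <;> exact this

theorem outward_checker {v d} {e : D.Edge} (h : D.IsAt v d e) : d.outward (D.checker e) = true ↔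
      match d with
      | .N => D.linkWind v.1.val (v.2.val + 1) % 2 = 1
      | .E => D.linkWind (v.1.val + 1) (v.2.val + 1) % 2 = 1
      | .S => D.linkWind (v.1.val + 1) v.2.val % 2 = 1
      | .W => D.linkWind v.1.val v.2.val % 2 = 1 := by
  have hv := linkWind_vertex h.hasEdge
  obtain ⟨x, y⟩ := v
  rcases e with e | e <;> cases d <;> simp only [IsAt, Prod.ext_iff, Fin.ext_iff] at h <;>
    simp only [checker, Dir.outward, Bool.not_eq_true', decide_eq_true_eq,
      decide_eq_false_iff_not] <;> simp only at hv
  · have hc : e.col = x.val := by unfold HEdge.col; omega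
    have hr : e.row = y.val := by unfold HEdge.row; omega
    rw [hc, hr]
  · have hc : e.col + 1 = x.val := by unfold HEdge.col; omega
    have hr : e.row = y.val := by unfold HEdge.row; omega
    rw [hc, hr]
    omega
  · have hc : e.col = x.val := by unfold VEdge.col; omega
    have hr : e.row = y.val := by unfold VEdge.row; omega
    rw [hc, hr]
  · have hc : e.col = x.val := by unfold VEdge.col; omega
    have hr : e.row + 1 = y.val := by unfold VEdge.row; omega
    rw [hc, hr]
    omega

/-- Every half-edge separates cells of opposite parity. At a turn, the cell between the two
half-edges is to the left of one and to the right of the other, seen from the vertex. In a straight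
passage the missing side half-edges make the cells on each side agree. -/
theorem coherent_checker (ρ : D.Resolution) : Coherent ρ D.checker := by
  intro v d d' e e' h h' hl
  have key : (d.outward (D.checker e) = true ↔ ¬ d'.outward (D.checker e') = true) →
      d.outward (D.checker e) = !d'.outward (D.checker e') := by
    cases d.outward (D.checker e) <;> cases d'.outward (D.checker e') <;> simp
  apply key
  rw [outward_checker h, outward_checker h']
  have a := linkWind_vertex h.hasEdge
  have a' := linkWind_vertex h'.hasEdge
  have hne := hl.ne
  have side : ∀ d'', d ≠ d'' → d' ≠ d'' → d' ≠ Dir.partner true d → d' ≠ Dir.partner false d →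
      ¬ D.HasEdge v d'' := by
    intro d'' n1 n2 n3 n4 he''
    rcases hl with ⟨hv, hl⟩ | ⟨hv, -⟩
    · exfalso; cases hr : ρ ⟨v, hv⟩ <;> rw [hr] at hl <;> tauto
    · exact absurd (h.hasEdge.eq_of_not_isCrossing hv h'.hasEdge he'' hne n1) n2
  cases d <;> cases d' <;> simp only at a a' ⊢ <;> first
    | exact absurd rfl hne
    | omega
    | skip
  · have := linkWind_vertex_none (side .E (by simp) (by simp) (by simp [Dir.partner]) (by simp [Dir.partner]))
    simp only at this; omega
  · have := linkWind_vertex_none (side .E (by simp) (by simp) (by simp [Dir.partner]) (by simp [Dir.partner]))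
    simp only at this; omega
  · have := linkWind_vertex_none (side .S (by simp) (by simp) (by simp [Dir.partner]) (by simp [Dir.partner]))
    simp only at this; omega
  · have := linkWind_vertex_none (side .S (by simp) (by simp) (by simp [Dir.partner]) (by simp [Dir.partner]))
    simp only at this; omega

namespace EState

/-- The state with the checkerboard orientation. -/
def checkerState (ρ : D.Resolution) : D.EState := ⟨(ρ, D.checker), coherent_checker ρ⟩

@[ext]
theorem ext {s t : D.EState} (h : s.res = t.res) (h' : ∀ e, s.ori e = t.ori e) : s = t :=
  Subtype.ext (Prod.ext h (funext h'))

theorem outward_inj {d : Dir} {b b' : Bool} : d.outward b = d.outward b' ↔ b = b' := by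
  cases d <;> cases b <;> cases b' <;> simp [Dir.outward]

/-- Both orientations are reversed or kept together at each passage from an edge to the next, so
their comparison is constant along a circle. -/
theorem ori_eq_checker_iff (s : D.EState) {e e' : D.Edge}
    (h : circleOf s.res e = circleOf s.res e') :
    s.ori e = D.checker e ↔ s.ori e' = D.checker e' := by
  refine (s.circle_induction (P := fun e'' => (s.ori e'' = D.checker e'' ↔ s.ori e = D.checker e))
    Iff.rfl (fun f hf ih => ?_) h.symm).symm
  rw [← ih]
  obtain ⟨v, d, d', k, k', kl, kb, kb'⟩ := s.next_spec f
  have := coherent_checker s.res v d d' _ _ k k' kl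
  rw [← outward_inj (d := d'), kb', ← outward_inj (d := d) (b := s.ori f), kb, this]
  cases d'.outward (D.checker (s.next f)) <;> simp

/-- The checkerboard orientation serves as an intermediary. It is coherent with both resolutions, so
`s` and `t` need not have the same one. -/
theorem ori_eq_iff (s t : D.EState) {e e' : D.Edge} (hs : circleOf s.res e = circleOf s.res e')
    (ht : circleOf t.res e = circleOf t.res e') :
    s.ori e = t.ori e ↔ s.ori e' = t.ori e' := by
  have h1 := s.ori_eq_checker_iff hs
  have h2 := t.ori_eq_checker_iff ht
  revert h1 h2
  cases s.ori e <;> cases s.ori e' <;> cases t.ori e <;> cases t.ori e' <;>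
    cases D.checker e <;> cases D.checker e' <;> simp

/-- The circles through `e` have the same edges in `s` and in `t`. -/
def SameCircle (s t : D.EState) (e : D.Edge) : Prop :=
  ∀ e', circleOf s.res e' = circleOf s.res e ↔ circleOf t.res e' = circleOf t.res e

/-- Reversing the orientation negates the signed area, which is non-zero by `circle_main`. -/
theorem SameCircle.label_iff {s t : D.EState} {e : D.Edge} (h : SameCircle s t e) :
    s.label e = t.label e ↔ s.ori e = t.ori e := by
  have hs := (s.circle_main (circleOf s.res e)).2.2.2
  have ht := (t.circle_main (circleOf t.res e)).2.2.2
  have hso := s.sgn_circleOf e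
  have hto := t.sgn_circleOf e
  have hori : ∀ e', circleOf s.res e' = circleOf s.res e → (s.ori e = t.ori e ↔ s.ori e' = t.ori e') :=
    fun e' he' => s.ori_eq_iff t he'.symm ((h e').1 he').symm
  have harea : signedArea s.res s.ori (circleOf s.res e) =
      (if s.ori e = t.ori e then 1 else -1) * signedArea t.res t.ori (circleOf t.res e) := by
    unfold signedArea
    rw [Finset.mul_sum]
    refine Finset.sum_congr rfl fun f _ => ?_
    by_cases hf : circleOf s.res (.inr f) = circleOf s.res e
    · rw [if_pos hf, if_pos ((h _).1 hf)]
      have := hori _ hf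
      revert this
      cases s.ori e <;> cases t.ori e <;> cases s.ori (.inr f) <;> cases t.ori (.inr f) <;> simp
    · rw [if_neg hf, if_neg (fun h' => hf ((h _).2 h')), mul_zero]
  rw [hso, harea] at hs
  rw [hto] at ht
  generalize signedArea t.res t.ori (circleOf t.res e) = A at *
  generalize s.label e = x at *
  generalize t.label e = y at *
  by_cases ho : s.ori e = t.ori e
  · rw [if_pos ho] at hs
    simp only [ho, iff_true]
    cases x <;> cases y <;> simp at hs ht ⊢ <;> omega
  · rw [if_neg ho] at hs
    simp only [ho, iff_false]
    cases x <;> cases y <;> simp at hs ht ⊢ <;> omega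

theorem label_congr (s : D.EState) {e e' : D.Edge} (h : circleOf s.res e = circleOf s.res e') :
    s.label e = s.label e' := by
  unfold label
  rw [h]

theorem sameCircle_of_res {s t : D.EState} (h : s.res = t.res) (e : D.Edge) : SameCircle s t e := by
  intro e'
  rw [h]

theorem ext_label {s t : D.EState} (h : s.res = t.res) (h' : ∀ e, s.label e = t.label e) : s = t :=
  ext h fun e => (sameCircle_of_res h e).label_iff.1 (h' e)

/-- The checkerboard state provides some orientation of every circle; those with the wrong label are
reversed. -/
theorem exists_labels (ρ : D.Resolution) (f : D.Edge → Bool)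
    (hf : ∀ e e', circleOf ρ e = circleOf ρ e' → f e = f e') :
    ∃ s : D.EState, s.res = ρ ∧ ∀ e, s.label e = f e := by
  set t : D.EState := checkerState ρ
  have hco : Coherent ρ (fun e => if t.label e = f e then D.checker e else !D.checker e) := by
    intro v d d' e e' h h' hl
    have h1 := coherent_checker ρ v d d' e e' h h' hl
    have h2 : circleOf ρ e = circleOf ρ e' := Quot.sound ⟨v, d, d', h, h', hl⟩
    simp only
    rw [t.label_congr h2, hf e e' h2]
    split_ifs
    · exact h1
    · have hn : ∀ (d : Dir) b, d.outward (!b) = !d.outward b := by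
        intro d b; cases d <;> cases b <;> rfl
      rw [hn, hn, h1]
  refine ⟨⟨(ρ, fun e => if t.label e = f e then D.checker e else !D.checker e), hco⟩, rfl, ?_⟩
  · intro e
    have h1 := (sameCircle_of_res (s := ⟨(ρ, fun e => if t.label e = f e then D.checker e else
      !D.checker e), hco⟩) (t := t) rfl e).label_iff
    change _ ↔ (if t.label e = f e then D.checker e else !D.checker e) = D.checker e at h1
    by_cases ht : t.label e = f e
    · rw [if_pos ht] at h1
      rw [h1.2 rfl, ht]
    · rw [if_neg ht] at h1
      have h2 := mt h1.1 (by cases D.checker e <;> simp)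
      revert h2 ht
      generalize label _ e = x
      cases x <;> cases t.label e <;> cases f e <;> simp

end EState
end GridDiagram
end GridKh

namespace GridKh
namespace GridDiagram

variable {n : ℕ} {D : GridDiagram n}

/-! ## Changing the smoothing of a crossing -/

namespace Crossing

variable (c : D.Crossing)

/-- The edge leaving a crossing in a given direction. -/
def edge (d : Dir) : D.Edge := ((hasEdge_iff c.1 d).1 (IsCrossing.hasEdge c.2 d)).choose

theorem isAt_edge (d : Dir) : D.IsAt c.1 d (c.edge d) :=
  ((hasEdge_iff c.1 d).1 (IsCrossing.hasEdge c.2 d)).choose_spec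

theorem north_eq : c.north = c.edge .N := by
  refine IsAt.edge_unique (v := c.1) (d := .N) ?_ (c.isAt_edge .N)
  unfold north
  exact rfl

theorem south_eq : c.south = c.edge .S := by
  refine IsAt.edge_unique (v := c.1) (d := .S) ?_ (c.isAt_edge .S)
  have h1 := c.2.2.2.1
  simp only [Fin.lt_def] at h1
  refine ⟨rfl, ?_⟩
  change c.1.2.val - 1 + 1 = c.1.2.val
  omega

theorem edge_injective : Function.Injective c.edge := by
  intro d d' h
  have h1 := (isAt_iff _ _ _).1 (c.isAt_edge d)
  have h2 := (isAt_iff _ _ _).1 (c.isAt_edge d')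
  rw [h, h2] at h1
  exact Dir.vec_injective (add_left_cancel h1).symm

theorem linked_partner (ρ : D.Resolution) (d : Dir) : Linked ρ c.1 d (Dir.partner (ρ c) d) :=
  .inl ⟨c.2, rfl⟩

theorem circleOf_partner (ρ : D.Resolution) (d : Dir) :
    circleOf ρ (c.edge (Dir.partner (ρ c) d)) = circleOf ρ (c.edge d) :=
  (Quot.sound ⟨c.1, d, _, c.isAt_edge _, c.isAt_edge _, c.linked_partner ρ d⟩).symm

/-- The circle of an edge passes by the crossing. -/
def Touches (ρ : D.Resolution) (e : D.Edge) : Prop :=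
  circleOf ρ e = circleOf ρ (c.edge .N) ∨ circleOf ρ e = circleOf ρ (c.edge .S)

theorem touches_edge (ρ : D.Resolution) (d : Dir) : c.Touches ρ (c.edge d) := by
  have h1 := c.circleOf_partner ρ .N
  have h2 := c.circleOf_partner ρ .S
  unfold Touches
  cases hr : ρ c <;> rw [hr] at h1 h2 <;> cases d <;> simp only [Dir.partner] at h1 h2 <;> tauto

variable {c}

theorem Touches.congr {ρ : D.Resolution} {e e' : D.Edge} (h : circleOf ρ e = circleOf ρ e') :
    c.Touches ρ e ↔ c.Touches ρ e' := by
  unfold Touches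
  rw [h]

theorem linked_iff_of_ne {ρ ρ' : D.Resolution} (hρ : ∀ c', c' ≠ c → ρ c' = ρ' c')
    {v : Fin n × Fin n} (hv : v ≠ c.1) (d d' : Dir) : Linked ρ v d d' ↔ Linked ρ' v d d' := by
  unfold Linked
  have : ∀ h : D.IsCrossing v, ρ ⟨v, h⟩ = ρ' ⟨v, h⟩ := fun h => hρ _ fun h' => hv (by rw [← h'])
  simp only [this]

/-- A chain of consecutive edges for `ρ` stays a chain for `ρ'` except where it passes through `c`.
There all four half-edges lie on circles touching `c`. -/
theorem circleOf_join {ρ ρ' : D.Resolution} (hρ : ∀ c', c' ≠ c → ρ c' = ρ' c')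
    {e e' : D.Edge} (h : circleOf ρ e = circleOf ρ e') :
    circleOf ρ' e = circleOf ρ' e' ∨ c.Touches ρ' e ∧ c.Touches ρ' e' := by
  have h' := Quot.eqvGen_exact h
  clear h
  induction h' with
  | rel x y h =>
    obtain ⟨v, d, d', k, k', kl⟩ := h
    by_cases hv : v = c.1
    · subst hv
      refine .inr ⟨?_, ?_⟩
      · rw [k.edge_unique (c.isAt_edge d)]; exact c.touches_edge _ _
      · rw [k'.edge_unique (c.isAt_edge d')]; exact c.touches_edge _ _
    · exact .inl (Quot.sound ⟨v, d, d', k, k', (linked_iff_of_ne hρ hv d d').1 kl⟩)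
  | refl x => exact .inl rfl
  | symm x y _ ih =>
    rcases ih with ih | ih
    · exact .inl ih.symm
    · exact .inr ⟨ih.2, ih.1⟩
  | trans x y z _ _ ih1 ih2 =>
    rcases ih1 with ih1 | ih1 <;> rcases ih2 with ih2 | ih2
    · exact .inl (ih1.trans ih2)
    · exact .inr ⟨(Touches.congr ih1).2 ih2.1, ih2.2⟩
    · exact .inr ⟨ih1.1, (Touches.congr ih2).1 ih1.2⟩
    · exact .inr ⟨ih1.1, ih2.2⟩

theorem touches_of_ne {ρ ρ' : D.Resolution} (hρ : ∀ c', c' ≠ c → ρ c' = ρ' c')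
    {e : D.Edge} (h : c.Touches ρ e) : c.Touches ρ' e := by
  rcases h with h | h <;> rcases circleOf_join hρ h with h' | h'
  · exact .inl h'
  · exact h'.1
  · exact .inr h'
  · exact h'.1

theorem touches_iff {ρ ρ' : D.Resolution} (hρ : ∀ c', c' ≠ c → ρ c' = ρ' c')
    {e : D.Edge} : c.Touches ρ e ↔ c.Touches ρ' e :=
  ⟨touches_of_ne hρ, touches_of_ne fun c' hc => (hρ c' hc).symm⟩

theorem circleOf_iff_of_not_touches {ρ ρ' : D.Resolution} (hρ : ∀ c', c' ≠ c → ρ c' = ρ' c')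
    {e e' : D.Edge} (h : ¬ c.Touches ρ e) :
    circleOf ρ e' = circleOf ρ e ↔ circleOf ρ' e' = circleOf ρ' e := by
  constructor
  · intro h1
    rcases circleOf_join hρ h1 with h2 | h2
    · exact h2
    · exact absurd ((touches_iff hρ).2 h2.2) h
  · intro h1
    rcases circleOf_join (fun c' hc => (hρ c' hc).symm) h1 with h2 | h2
    · exact h2
    · exact absurd h2.2 h

end Crossing

/-! ### Turning of the arcs at a crossing for its two smoothings -/

namespace EState

theorem next_edge (s : D.EState) (c : D.Crossing) {d : Dir}
    (h : d.outward (s.ori (c.edge d)) = false) :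
    s.next (c.edge d) = c.edge (Dir.partner (s.res c) d) :=
  next_eq (c.isAt_edge d) (c.isAt_edge _) (c.linked_partner _ d) h

theorem outward_partner (s : D.EState) (c : D.Crossing) (d : Dir) :
    (Dir.partner (s.res c) d).outward (s.ori (c.edge (Dir.partner (s.res c) d))) =
      !d.outward (s.ori (c.edge d)) := by
  have h1 : d.outward (s.ori (c.edge d)) =
      !(Dir.partner (s.res c) d).outward (s.ori (c.edge (Dir.partner (s.res c) d))) :=
    s.2 c.1 d _ _ _ (c.isAt_edge d) (c.isAt_edge _) (c.linked_partner s.res d)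
  rw [h1, Bool.not_not]

theorem turn_edge (s : D.EState) (c : D.Crossing) {d : Dir}
    (h : d.outward (s.ori (c.edge d)) = false) :
    s.turn (c.edge d) = cross (-d.vec) (Dir.partner (s.res c) d).vec := by
  have h1 := s.outward_partner c d
  rw [h, Bool.not_false] at h1
  unfold turn
  rw [next_edge s c h, (head_eq (c.isAt_edge d) h).2,
    (tail_eq (c.isAt_edge (Dir.partner (s.res c) d)) h1).2]

theorem forbidden_iff_edge (s : D.EState) (c : D.Crossing) :
    s.Forbidden c ↔ ∀ d : Dir, (d.outward (s.ori (c.edge d)) = true ↔ d = .E ∨ d = .W) := by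
  constructor
  · exact fun h d => h d _ (c.isAt_edge d)
  · intro h d e he
    rw [he.edge_unique (c.isAt_edge d)]
    exact h d

theorem next_eq_of_ne {s t : D.EState} {c : D.Crossing} (hres : ∀ c', c' ≠ c → s.res c' = t.res c')
    {e : D.Edge} (hori : s.ori e = t.ori e)
    (he : ∀ d, e = c.edge d → d.outward (s.ori e) = true) : s.next e = t.next e := by
  obtain ⟨v, d, d', h, h', hl, hb, -⟩ := s.next_spec e
  refine (next_eq (s := t) h h' ?_ (hori ▸ hb)).symm
  refine (Crossing.linked_iff_of_ne hres ?_ d d').1 hl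
  rintro rfl
  rw [he d (h.edge_unique (c.isAt_edge d))] at hb
  exact absurd hb (by simp)

/-- The orientation at a crossing which is consistent with both smoothings. -/
theorem outward_of_both {s t : D.EState} {c : D.Crossing} (hori : s.ori = t.ori)
    (hs : s.res c = false) (ht : t.res c = true) :
    Dir.S.outward (s.ori (c.edge .S)) = Dir.N.outward (s.ori (c.edge .N)) ∧
    Dir.E.outward (s.ori (c.edge .E)) = !Dir.N.outward (s.ori (c.edge .N)) ∧
    Dir.W.outward (s.ori (c.edge .W)) = !Dir.N.outward (s.ori (c.edge .N)) := by
  have h1 := s.outward_partner c .N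
  have h2 := t.outward_partner c .N
  have h3 := t.outward_partner c .E
  rw [hs] at h1
  rw [ht, ← hori] at h2 h3
  simp only [Dir.partner] at h1 h2 h3
  refine ⟨?_, h1, h2⟩
  rw [h3, h1, Bool.not_not]

/-- Coherence with both smoothings leaves two orientations at the crossing: in along the vertical
strand and out along the horizontal one, or the reverse. -/
theorem forbidden_iff_of_both {s t : D.EState} {c : D.Crossing} (hori : s.ori = t.ori)
    (hs : s.res c = false) (ht : t.res c = true) :
    s.Forbidden c ↔ Dir.N.outward (s.ori (c.edge .N)) = false := by
  obtain ⟨h1, h2, h3⟩ := outward_of_both hori hs ht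
  rw [forbidden_iff_edge]
  constructor
  · intro h
    have := h .N
    simpa using this
  · intro h d
    cases d <;> simp [h1, h2, h3, h]

open Classical in
-- Only the two arcs at `c` change. At a forbidden crossing both turn left in the `0`-smoothing and
-- right in the `1`-smoothing, a difference of four; for the opposite orientation the turns are
-- exchanged.
theorem sum_turn_sub {s t : D.EState} {c : D.Crossing} (hori : s.ori = t.ori)
    (hres : ∀ c', c' ≠ c → s.res c' = t.res c') (hs : s.res c = false) (ht : t.res c = true)
    (P : D.Edge → Prop) (hP : ∀ d, P (c.edge d)) :
    ∑ e, (if P e then s.turn e else 0) - ∑ e, (if P e then t.turn e else 0) =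
      if s.Forbidden c then 4 else -4 := by
  obtain ⟨h1, h2, h3⟩ := outward_of_both hori hs ht
  have hhead : ∀ e, s.heading e = t.heading e := by
    intro e; unfold heading head tail; rw [hori]
  have key : ∀ d₁ d₂ : Dir, d₁ ≠ d₂ → d₁.outward (s.ori (c.edge d₁)) = false →
      d₂.outward (s.ori (c.edge d₂)) = false →
      (∀ d, d ≠ d₁ → d ≠ d₂ → d.outward (s.ori (c.edge d)) = true) →
      ∑ e, (if P e then s.turn e else 0) - ∑ e, (if P e then t.turn e else 0) =
      (cross (-d₁.vec) (Dir.partner false d₁).vec - cross (-d₁.vec) (Dir.partner true d₁).vec) +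
      (cross (-d₂.vec) (Dir.partner false d₂).vec - cross (-d₂.vec) (Dir.partner true d₂).vec) := by
    intro d₁ d₂ hne k1 k2 k
    rw [← Finset.sum_sub_distrib, ← Finset.sum_subset (Finset.subset_univ {c.edge d₁, c.edge d₂}),
      Finset.sum_pair (fun h => hne (c.edge_injective h))]
    · rw [if_pos (hP _), if_pos (hP _), if_pos (hP _), if_pos (hP _), turn_edge s c k1,
        turn_edge s c k2, turn_edge t c (hori ▸ k1), turn_edge t c (hori ▸ k2), hs, ht]
    · intro e _ he
      simp only [Finset.mem_insert, Finset.mem_singleton, not_or] at he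
      have hn : s.next e = t.next e := next_eq_of_ne hres (by rw [hori]) fun d hd => by
        rw [hd]
        exact k d (fun h => he.1 (h ▸ hd)) (fun h => he.2 (h ▸ hd))
      unfold turn
      rw [hn, hhead, hhead, sub_self]
  by_cases hf : s.Forbidden c
  · rw [if_pos hf]
    rw [forbidden_iff_of_both hori hs ht] at hf
    rw [key .N .S (by decide) hf (h1.trans hf) (fun d n1 n2 => by
      cases d
      · exact absurd rfl n1
      · exact absurd rfl n2
      · rw [h2, hf]; rfl
      · rw [h3, hf]; rfl)]
    decide
  · rw [if_neg hf]
    rw [forbidden_iff_of_both hori hs ht, Bool.not_eq_false] at hf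
    rw [key .E .W (by decide) (by rw [h2, hf]; rfl) (by rw [h3, hf]; rfl) (fun d n1 n2 => by
      cases d
      · exact hf
      · rw [h1, hf]
      · exact absurd rfl n1
      · exact absurd rfl n2)]
    decide

open Classical in
/-- The signed number of circles passing by a crossing. -/
def touchSgn (s : D.EState) (c : D.Crossing) : ℤ :=
  if circleOf s.res (c.edge .N) = circleOf s.res (c.edge .S) then s.sgn (circleOf s.res (c.edge .N))
  else s.sgn (circleOf s.res (c.edge .N)) + s.sgn (circleOf s.res (c.edge .S))

open Classical in
theorem sum_turn_touches (s : D.EState) (c : D.Crossing) :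
    ∑ e, (if c.Touches s.res e then s.turn e else 0) = 4 * s.touchSgn c := by
  have := s.sum_turn (fun C => C = circleOf s.res (c.edge .N) ∨ C = circleOf s.res (c.edge .S))
  unfold Crossing.Touches
  rw [this]
  congr 1
  refine (Finset.sum_subset (Finset.subset_univ
    {circleOf s.res (c.edge .N), circleOf s.res (c.edge .S)})
    (fun x _ hx => if_neg (by simpa using hx))).symm.trans ?_
  refine (Finset.sum_congr rfl (fun x hx => if_pos (by simpa using hx))).trans ?_
  unfold touchSgn
  split_ifs with h
  · rw [← h]; simp
  · rw [Finset.sum_pair h]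

end EState

/-- Changing a smoothing either merges two circles or splits a circle. -/
theorem circleOf_xor {ρ ρ' : D.Resolution} {c : D.Crossing} (hρ : ∀ c', c' ≠ c → ρ c' = ρ' c')
    (hs : ρ c = false) (ht : ρ' c = true) :
    circleOf ρ (c.edge .N) = circleOf ρ (c.edge .S) ↔
      ¬ circleOf ρ' (c.edge .N) = circleOf ρ' (c.edge .S) := by
  classical
  -- The checkerboard orientation is coherent with both resolutions. The turning through `c` changes
  -- by plus or minus 4, so the signed number of circles through `c` changes by an odd number, which
  -- is impossible if their number stays the same.
  have h := EState.sum_turn_sub (s := EState.checkerState ρ) (t := EState.checkerState ρ') rfl hρ hs ht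
    (c.Touches ρ) (c.touches_edge ρ)
  have h1 := (EState.checkerState ρ).sum_turn_touches c
  have h2 := (EState.checkerState ρ').sum_turn_touches c
  change ∑ e, (if c.Touches ρ e then _ else 0) = _ at h1
  change ∑ e, (if c.Touches ρ' e then _ else 0) = _ at h2
  simp only [← Crossing.touches_iff hρ] at h2
  rw [h1, h2] at h
  have s1 := (EState.checkerState ρ).sgn_eq_or
  have s2 := (EState.checkerState ρ').sgn_eq_or
  have a1 := s1 (circleOf ρ (c.edge .N))
  have a2 := s1 (circleOf ρ (c.edge .S))
  have b1 := s2 (circleOf ρ' (c.edge .N))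
  have b2 := s2 (circleOf ρ' (c.edge .S))
  unfold EState.touchSgn at h
  change (4 : ℤ) * (if circleOf ρ (c.edge .N) = circleOf ρ (c.edge .S) then _ else _) -
    4 * (if circleOf ρ' (c.edge .N) = circleOf ρ' (c.edge .S) then _ else _) = _ at h
  by_cases k1 : circleOf ρ (c.edge .N) = circleOf ρ (c.edge .S) <;>
    by_cases k2 : circleOf ρ' (c.edge .N) = circleOf ρ' (c.edge .S) <;>
    simp only [k1, k2, if_true, if_false, not_true, not_false_iff, iff_self] at h ⊢
  · exfalso
    change 4 * (EState.checkerState ρ).sgn (circleOf ρ (c.edge .N)) -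
      4 * (EState.checkerState ρ').sgn (circleOf ρ' (c.edge .N)) = _ at h
    split_ifs at h <;> omega
  · exfalso
    change 4 * ((EState.checkerState ρ).sgn (circleOf ρ (c.edge .N)) +
        (EState.checkerState ρ).sgn (circleOf ρ (c.edge .S))) -
      4 * ((EState.checkerState ρ').sgn (circleOf ρ' (c.edge .N)) +
        (EState.checkerState ρ').sgn (circleOf ρ' (c.edge .S))) = _ at h
    split_ifs at h <;> omega

end GridDiagram
end GridKh

namespace GridKh
namespace GridDiagram

variable {n : ℕ} {D : GridDiagram n}

/-! ## The Khovanov differential and the grading `R` -/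

namespace EState

/-- The state `t` is obtained from `s` by changing the smoothing of `c` from `0` to `1` and possibly
the orientations of the circles passing by `c`. -/
structure StepAt (s t : D.EState) (c : D.Crossing) : Prop where
  res_eq : s.res c = false
  res : t.res = Function.update s.res c true
  ori : ∀ e, ¬ c.Touches s.res e → t.ori e = s.ori e

namespace StepAt

variable {s t : D.EState} {c : D.Crossing}

theorem res_eq' (h : StepAt s t c) : t.res c = true := by rw [h.res, Function.update_self]

theorem res_of_ne (h : StepAt s t c) (c' : D.Crossing) (hc : c' ≠ c) : s.res c' = t.res c' := by
  rw [h.res, Function.update_of_ne hc]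

theorem res_of_ne' (h : StepAt s t c) (c' : D.Crossing) (hc : c' ≠ c) : t.res c' = s.res c' :=
  (h.res_of_ne c' hc).symm

theorem xor (h : StepAt s t c) : circleOf s.res (c.edge .N) = circleOf s.res (c.edge .S) ↔
    ¬ circleOf t.res (c.edge .N) = circleOf t.res (c.edge .S) :=
  circleOf_xor h.res_of_ne h.res_eq h.res_eq'

theorem unique (h : StepAt s t c) {c' : D.Crossing} (h' : StepAt s t c') : c = c' := by
  by_contra hne
  have := h.res_of_ne c' (fun h => hne h.symm)
  rw [h'.res_eq, h'.res_eq'] at this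
  exact absurd this (by simp)

theorem ibar (h : StepAt s t c) : t.ibar = s.ibar + 1 := by
  unfold EState.ibar
  rw [Fintype.sum_eq_add_sum_compl c, Fintype.sum_eq_add_sum_compl c, h.res_eq, h.res_eq',
    Finset.sum_congr rfl fun c' hc => by
      rw [h.res_of_ne' c' (by simpa using hc)]]
  simp [add_comm]

/-- An edge not touching `c` keeps its orientation and its successor, hence its turn. The remaining
turning is that of the circles through `c`. -/
theorem rot (h : StepAt s t c) :
    rot t.res t.ori - rot s.res s.ori = t.touchSgn c - s.touchSgn c := by
  classical
  have key : ∀ u : D.EState, 4 * GridDiagram.rot u.res u.ori =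
      4 * u.touchSgn c + ∑ e, (if c.Touches u.res e then 0 else u.turn e) := by
    intro u
    rw [four_mul_rot, ← sum_turn_touches, ← Finset.sum_add_distrib]
    exact Finset.sum_congr rfl fun e _ => by split_ifs <;> simp
  have hs := key s
  have ht := key t
  have : ∑ e, (if c.Touches s.res e then 0 else s.turn e) =
      ∑ e, (if c.Touches t.res e then 0 else t.turn e) := by
    refine Finset.sum_congr rfl fun e _ => ?_
    rw [← Crossing.touches_iff h.res_of_ne]
    split_ifs with he
    · rfl
    · have hn : s.next e = t.next e := next_eq_of_ne h.res_of_ne (h.ori e he).symm fun d hd =>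
        absurd (hd ▸ c.touches_edge s.res d) he
      have he' : ¬ c.Touches s.res (s.next e) := by
        rwa [Crossing.Touches.congr (s.circleOf_next e)]
      unfold turn
      rw [← hn]
      simp only [heading, head, tail, h.ori e he, h.ori _ he']
  omega

theorem touchSgn_of_edgeCoeff (h : StepAt s t c) (hc : edgeCoeff s t c ≠ 0) :
    t.touchSgn c = s.touchSgn c - 1 := by
  unfold edgeCoeff at hc
  rw [c.north_eq, c.south_eq] at hc
  have hx := h.xor
  unfold touchSgn
  simp only [sgn_circleOf]
  by_cases h1 : circleOf s.res (c.edge .N) = circleOf s.res (c.edge .S)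
  · rw [if_pos h1] at hc ⊢
    rw [if_neg (hx.1 h1)]
    revert hc
    cases s.label (c.edge .N) <;> cases t.label (c.edge .N) <;> cases t.label (c.edge .S) <;>
      simp [comulCoeff]
  · rw [if_neg h1] at hc ⊢
    rw [if_pos (not_not.1 (mt hx.2 h1))]
    revert hc
    cases s.label (c.edge .N) <;> cases s.label (c.edge .S) <;> cases t.label (c.edge .N) <;>
      simp [mulCoeff]

/-- Every entry of the multiplication and comultiplication tables of the right degree equals 1. The
degree thus determines the coefficient completely. -/
theorem edgeCoeff_of_touchSgn (h : StepAt s t c) (hc : t.touchSgn c = s.touchSgn c - 1) :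
    edgeCoeff s t c = 1 := by
  unfold edgeCoeff
  rw [c.north_eq, c.south_eq]
  have hx := h.xor
  unfold touchSgn at hc
  simp only [sgn_circleOf] at hc
  by_cases h1 : circleOf s.res (c.edge .N) = circleOf s.res (c.edge .S)
  · rw [if_pos h1] at hc ⊢
    rw [if_neg (hx.1 h1)] at hc
    revert hc
    cases s.label (c.edge .N) <;> cases t.label (c.edge .N) <;> cases t.label (c.edge .S) <;>
      simp [comulCoeff]
  · rw [if_neg h1] at hc ⊢
    rw [if_pos (not_not.1 (mt hx.2 h1))] at hc
    revert hc
    cases s.label (c.edge .N) <;> cases s.label (c.edge .S) <;> cases t.label (c.edge .N) <;>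
      simp [mulCoeff]

/-- By `sum_turn_sub` the signed number of circles drops by one at a forbidden crossing and rises by
one at the opposite orientation. -/
theorem touchSgn_of_ori (h : StepAt s t c) (ho : t.ori = s.ori) :
    s.Forbidden c ↔ t.touchSgn c = s.touchSgn c - 1 := by
  classical
  have := sum_turn_sub ho.symm h.res_of_ne h.res_eq h.res_eq' (c.Touches s.res) (c.touches_edge _)
  rw [sum_turn_touches] at this
  simp only [Crossing.touches_iff h.res_of_ne] at this
  rw [sum_turn_touches] at this
  split_ifs at this with hf
  · simp only [hf, true_iff]; omega
  · simp only [hf, false_iff]; omega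

end StepAt

end EState

open Classical in
theorem khovanov_apply (s t : D.EState) : D.khovanov t s =
    ∑ c : D.Crossing, if s.StepAt t c then cubeSign s.res c * edgeCoeff s t c else 0 := by
  unfold khovanov
  refine Finset.sum_congr rfl fun c _ => ?_
  congr 1
  rw [c.north_eq, c.south_eq]
  refine propext ⟨fun ⟨h1, h2, h3⟩ => ⟨h1, h2, fun e he => ?_⟩, fun h => ⟨h.1, h.2, fun e h1 h2 => ?_⟩⟩
  · unfold Crossing.Touches at he
    exact h3 e (fun h => he (.inl h)) (fun h => he (.inr h))
  · exact h.3 e (by rintro (h | h); exacts [h1 h, h2 h])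

theorem khovanov_of_step {s t : D.EState} {c : D.Crossing} (h : s.StepAt t c) :
    D.khovanov t s = cubeSign s.res c * edgeCoeff s t c := by
  rw [khovanov_apply, Finset.sum_eq_single c, if_pos h]
  · exact fun c' _ hc => if_neg fun h' => hc (h'.unique h)
  · simp

theorem exists_step {s t : D.EState} (h : D.khovanov t s ≠ 0) :
    ∃ c, s.StepAt t c ∧ edgeCoeff s t c ≠ 0 := by
  rw [khovanov_apply] at h
  obtain ⟨c, -, hc⟩ := Finset.exists_ne_zero_of_sum_ne_zero h
  split_ifs at hc with h'
  · exact ⟨c, h', right_ne_zero_of_mul hc⟩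
  · exact absurd rfl hc

theorem cubeSign_eq_or (ρ : D.Resolution) (c : D.Crossing) :
    cubeSign ρ c = 1 ∨ cubeSign ρ c = -1 := by
  unfold cubeSign
  refine Finset.prod_induction _ (fun x : ℚ => x = 1 ∨ x = -1) ?_ (.inl rfl) ?_
  · rintro a b (rfl | rfl) (rfl | rfl) <;> simp
  · intro c' _
    split_ifs <;> simp

theorem cubeSign_mul_self (ρ : D.Resolution) (c : D.Crossing) :
    cubeSign ρ c * cubeSign ρ c = 1 := by
  rcases cubeSign_eq_or ρ c with h | h <;> rw [h] <;> norm_num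

theorem cubeSign_ne_zero (ρ : D.Resolution) (c : D.Crossing) : cubeSign ρ c ≠ 0 := by
  rcases cubeSign_eq_or ρ c with h | h <;> rw [h] <;> norm_num

theorem khovanov_degree {s t : D.EState} (h : D.khovanov t s ≠ 0) : t.i = s.i + 1 ∧ t.j = s.j := by
  obtain ⟨c, hc, he⟩ := exists_step h
  have h1 := hc.ibar
  have h2 := hc.rot
  rw [hc.touchSgn_of_edgeCoeff he] at h2
  unfold EState.i EState.j
  constructor <;> omega

/-! ### Contributions of circles to the grading `R` -/

namespace EState

/-- The sum of the values of a function at one cell in each region. -/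
def regionSum (D : GridDiagram n) (f : ℤ → ℤ → ℤ) : ℤ :=
  ∑ q : D.Region, f (Quot.out q).1.val (Quot.out q).2.val

theorem R_eq (s : D.EState) : s.R = regionSum D (s.wind fun _ => True) :=
  Finset.sum_congr rfl fun _ _ => s.winding_eq _

/-- Winding numbers are locally constant off the diagram, so the representative chosen in a region
is immaterial. -/
theorem wind_region {s : D.EState} {A : D.Edge → Prop} (hA : ∀ e, A (s.next e) ↔ A e)
    (p : Cell n) : s.wind A (Quot.out (Quot.mk D.CellAdj p)).1.val
      (Quot.out (Quot.mk D.CellAdj p)).2.val = s.wind A p.1.val p.2.val := by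
  have key : ∀ p q, D.CellAdj p q → s.wind A p.1.val p.2.val = s.wind A q.1.val q.2.val := by
    rintro p q (⟨h1, h2, h3⟩ | ⟨h1, h2, h3⟩)
    · rw [h1, h2]
      push_cast
      refine wind_v_none hA _ _ fun e _ k1 k2 => h3 ⟨e, ?_, ?_⟩
      · unfold VEdge.col at k1; omega
      · unfold VEdge.row at k2; omega
    · rw [h1, h2]
      push_cast
      refine wind_h_none A _ _ fun e _ k1 k2 => h3 ⟨e, ?_, ?_⟩
      · unfold HEdge.col at k1; omega
      · unfold HEdge.row at k2; omega
  have hq := Quot.eqvGen_exact (Quot.out_eq (Quot.mk D.CellAdj p))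
  generalize Quot.out (Quot.mk D.CellAdj p) = q at hq ⊢
  induction hq with
  | rel x y h => exact key _ _ h
  | refl => rfl
  | symm _ _ _ ih => exact ih.symm
  | trans _ _ _ _ _ ih1 ih2 => exact ih1.trans ih2

/-- The contribution to `R` of the circle through an edge. -/
def circleR (s : D.EState) (e : D.Edge) : ℤ :=
  regionSum D (s.wind fun e' => circleOf s.res e' = circleOf s.res e)

/-- All winding numbers of the circle are 0 or its sign, and the non-zero value is attained in some
region. -/
theorem circleR_pos (s : D.EState) (e : D.Edge) : 0 < s.sgn (circleOf s.res e) * s.circleR e := by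
  obtain ⟨h1, ⟨p, hp⟩, -, -⟩ := s.circle_main (circleOf s.res e)
  have h2 := s.sgn_eq_or (circleOf s.res e)
  unfold circleR regionSum
  rw [Finset.mul_sum]
  refine Finset.sum_pos' (fun q _ => ?_) ⟨Quot.mk _ p, Finset.mem_univ _, ?_⟩
  · rcases h1 (Quot.out q).1.val (Quot.out q).2.val with h | h <;> rw [h] <;>
      rcases h2 with h | h <;> rw [h] <;> simp
  · rw [wind_region (s.circle_invariant _), hp]
    rcases h2 with h | h <;> rw [h] <;> simp

theorem wind_add (s : D.EState) (A B : D.Edge → Prop) (a b : ℤ) :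
    s.wind A a b = s.wind (fun e => A e ∧ B e) a b + s.wind (fun e => A e ∧ ¬ B e) a b := by
  classical
  unfold wind
  rw [← Finset.sum_add_distrib]
  refine Finset.sum_congr rfl fun e _ => ?_
  by_cases h1 : A (.inl e) <;> by_cases h2 : B (.inl e) <;> simp [h1, h2]

theorem wind_of_ori (s t : D.EState) (A : D.Edge → Prop) (p : Prop) [Decidable p]
    (h : ∀ e, A e → (t.ori e = s.ori e ↔ p)) (a b : ℤ) :
    t.wind A a b = (if p then 1 else -1) * s.wind A a b := by
  unfold wind
  rw [Finset.mul_sum]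
  refine Finset.sum_congr rfl fun e _ => ?_
  by_cases h1 : A (.inl e)
  · have := h _ h1
    by_cases hp : p <;> simp only [hp, iff_true, iff_false] at this <;>
      cases hs : s.ori (.inl e) <;> cases ht : t.ori (.inl e) <;> simp_all
  · simp [h1]

theorem regionSum_add (f g : ℤ → ℤ → ℤ) :
    regionSum D (fun a b => f a b + g a b) = regionSum D f + regionSum D g :=
  Finset.sum_add_distrib

theorem regionSum_mul (k : ℤ) (f : ℤ → ℤ → ℤ) :
    regionSum D (fun a b => k * f a b) = k * regionSum D f :=
  (Finset.mul_sum _ _ _).symm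

open Classical in
/-- The contribution to `R` of the circles passing by a crossing. -/
def touchR (s : D.EState) (c : D.Crossing) : ℤ :=
  if circleOf s.res (c.edge .N) = circleOf s.res (c.edge .S) then s.circleR (c.edge .N)
  else s.circleR (c.edge .N) + s.circleR (c.edge .S)

theorem regionSum_touches (s : D.EState) (c : D.Crossing) :
    regionSum D (s.wind (c.Touches s.res)) = s.touchR c := by
  unfold touchR
  split_ifs with h
  · unfold circleR Crossing.Touches
    rw [← h]
    simp only [or_self]
  · unfold circleR
    rw [← regionSum_add]
    congr 1
    funext a b
    rw [wind_add s (c.Touches s.res) (fun e => circleOf s.res e = circleOf s.res (c.edge .N))]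
    unfold Crossing.Touches
    congr 2 <;> funext e <;> refine propext ⟨fun h' => ?_, fun h' => ?_⟩
    · exact h'.2
    · exact ⟨.inl h', h'⟩
    · exact h'.1.resolve_left h'.2
    · exact ⟨.inr h', fun h'' => h (h''.symm.trans h')⟩

theorem StepAt.R {s t : D.EState} {c : D.Crossing} (h : StepAt s t c) :
    t.R - s.R = t.touchR c - s.touchR c := by
  have key : ∀ u : D.EState, u.R = u.touchR c + regionSum D (u.wind fun e => ¬ c.Touches u.res e) := by
    intro u
    rw [R_eq, ← regionSum_touches, ← regionSum_add]
    congr 1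
    funext a b
    rw [wind_add u _ (c.Touches u.res)]
    simp
  have : regionSum D (t.wind fun e => ¬ c.Touches t.res e) =
      regionSum D (s.wind fun e => ¬ c.Touches s.res e) := by
    congr 1
    funext a b
    simp only [← Crossing.touches_iff h.res_of_ne]
    rw [wind_of_ori s t _ True (fun e he => by simp [h.ori e he])]
    simp
  rw [key s, key t, this]
  ring

open Classical in
-- On the edges of each of the two circles, the orientation in the merged circle agrees everywhere
-- or nowhere with the old one. So the contributions are combined with signs. Neither state is
-- required to be the earlier one, and the formula covers splits as well.
theorem circleR_merge {s t : D.EState} {c : D.Crossing} (hres : ∀ c', c' ≠ c → s.res c' = t.res c')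
    (hs : ¬ circleOf s.res (c.edge .N) = circleOf s.res (c.edge .S))
    (ht : circleOf t.res (c.edge .N) = circleOf t.res (c.edge .S)) :
    t.circleR (c.edge .N) =
      (if t.ori (c.edge .N) = s.ori (c.edge .N) then 1 else -1) * s.circleR (c.edge .N) +
      (if t.ori (c.edge .S) = s.ori (c.edge .S) then 1 else -1) * s.circleR (c.edge .S) := by
  have hN : ∀ e, c.Touches s.res e → circleOf t.res e = circleOf t.res (c.edge .N) := by
    intro e he
    rcases (Crossing.touches_iff hres).1 he with h | h
    · exact h
    · rw [h, ht]
  have h1 : ∀ d, d = Dir.N ∨ d = Dir.S → ∀ e, circleOf s.res e = circleOf s.res (c.edge d) →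
      (t.ori e = s.ori e ↔ t.ori (c.edge d) = s.ori (c.edge d)) := by
    intro d hd e he
    refine t.ori_eq_iff s ?_ he
    rw [hN _ (c.touches_edge _ d), hN e]
    rcases hd with rfl | rfl
    · exact .inl he
    · exact .inr he
  have h2 : t.circleR (c.edge .N) = regionSum D (t.wind (c.Touches s.res)) := by
    unfold circleR
    congr 2
    funext e
    refine propext ⟨fun h => (Crossing.touches_iff hres).2 (.inl h), hN e⟩
  rw [h2]
  unfold circleR
  rw [← regionSum_mul, ← regionSum_mul, ← regionSum_add]
  congr 1
  funext a b
  rw [← wind_of_ori s t _ _ (h1 .N (.inl rfl)), ← wind_of_ori s t _ _ (h1 .S (.inr rfl)),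
    wind_add t (c.Touches s.res) (fun e => circleOf s.res e = circleOf s.res (c.edge .N))]
  unfold Crossing.Touches
  congr 2 <;> funext e <;> refine propext ⟨fun h' => ?_, fun h' => ?_⟩
  · exact h'.2
  · exact ⟨.inl h', h'⟩
  · exact h'.1.resolve_left h'.2
  · exact ⟨.inr h', fun h'' => hs (h''.symm.trans h')⟩

theorem ori_eq_of_merge {s t : D.EState} {c : D.Crossing} (hres : ∀ c', c' ≠ c → s.res c' = t.res c')
    (ht : circleOf t.res (c.edge .N) = circleOf t.res (c.edge .S))
    (hN : t.ori (c.edge .N) = s.ori (c.edge .N)) (hS : t.ori (c.edge .S) = s.ori (c.edge .S))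
    {e : D.Edge} (he : c.Touches s.res e) : t.ori e = s.ori e := by
  have hN' : circleOf t.res e = circleOf t.res (c.edge .N) := by
    rcases (Crossing.touches_iff hres).1 he with h | h
    · exact h
    · rw [h, ht]
  rcases he with he | he
  · exact (t.ori_eq_iff s hN' he).2 hN
  · exact (t.ori_eq_iff s (hN'.trans ht) he).2 hS

/-- Reversing pieces changes `R` by minus twice their joint contribution in `s`. The sign rule
`circleR_pos`, applied to the labels allowed by multiplication or comultiplication, excludes the
cases in which this joint contribution would not be positive. -/
theorem StepAt.R_lt {s t : D.EState} {c : D.Crossing} (h : StepAt s t c)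
    (hc : edgeCoeff s t c ≠ 0) (ho : t.ori ≠ s.ori) : t.R < s.R := by
  have hR := h.R
  have hx := h.xor
  have sN := s.circleR_pos (c.edge .N)
  have sS := s.circleR_pos (c.edge .S)
  have tN := t.circleR_pos (c.edge .N)
  have tS := t.circleR_pos (c.edge .S)
  rw [sgn_circleOf] at sN sS tN tS
  have hori : ¬ (t.ori (c.edge .N) = s.ori (c.edge .N) ∧ t.ori (c.edge .S) = s.ori (c.edge .S)) := by
    rintro ⟨h1, h2⟩
    refine ho (funext fun e => ?_)
    by_cases he : c.Touches s.res e
    · by_cases hs : circleOf s.res (c.edge .N) = circleOf s.res (c.edge .S)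
      · exact (ori_eq_of_merge h.res_of_ne' hs h1.symm h2.symm
          ((Crossing.touches_iff h.res_of_ne).1 he)).symm
      · exact ori_eq_of_merge h.res_of_ne (not_not.1 (mt hx.2 hs)) h1 h2 he
    · exact h.ori e he
  unfold edgeCoeff at hc
  rw [c.north_eq, c.south_eq] at hc
  unfold touchR at hR
  by_cases hs : circleOf s.res (c.edge .N) = circleOf s.res (c.edge .S)
  · have hm := circleR_merge h.res_of_ne' (hx.1 hs) hs
    rw [if_pos hs] at hR hc
    rw [if_neg (hx.1 hs)] at hR
    simp only [eq_comm (a := s.ori _)] at hm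
    by_cases p : t.ori (c.edge .N) = s.ori (c.edge .N) <;>
      by_cases q : t.ori (c.edge .S) = s.ori (c.edge .S) <;>
      simp only [p, q, true_and, not_true, not_false_iff, if_true, if_false] at hori hm <;>
      revert hc sN tN tS <;>
      cases s.label (c.edge .N) <;> cases t.label (c.edge .N) <;> cases t.label (c.edge .S) <;>
      simp [comulCoeff] <;> intros <;> omega
  · have hm := circleR_merge h.res_of_ne hs (not_not.1 (mt hx.2 hs))
    rw [if_neg hs] at hR hc
    rw [if_pos (not_not.1 (mt hx.2 hs))] at hR
    by_cases p : t.ori (c.edge .N) = s.ori (c.edge .N) <;>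
      by_cases q : t.ori (c.edge .S) = s.ori (c.edge .S) <;>
      simp only [p, q, true_and, not_true, not_false_iff, if_true, if_false] at hori hm <;>
      revert hc sN sS tN <;>
      cases s.label (c.edge .N) <;> cases s.label (c.edge .S) <;> cases t.label (c.edge .N) <;>
      simp [mulCoeff] <;> intros <;> omega

theorem R_congr {s t : D.EState} (h : t.ori = s.ori) : t.R = s.R := by
  unfold R winding
  rw [h]

/-- The state `t` is obtained from `s` by changing the smoothing of the forbidden crossing `c` from
`0` to `1`, without changing the orientations of the edges. -/
structure FlipAt (s t : D.EState) (c : D.Crossing) : Prop where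
  res_eq : s.res c = false
  res : t.res = Function.update s.res c true
  ori : t.ori = s.ori
  forbidden : s.Forbidden c

theorem FlipAt.stepAt {s t : D.EState} {c : D.Crossing} (h : FlipAt s t c) : StepAt s t c :=
  ⟨h.res_eq, h.res, fun _ _ => by rw [h.ori]⟩

theorem forbidden_congr {s t : D.EState} (h : t.ori = s.ori) (c : D.Crossing) :
    t.Forbidden c ↔ s.Forbidden c := by
  unfold Forbidden
  rw [h]

end EState

theorem khovanovR_of_flip {s t : D.EState} {c : D.Crossing} (h : s.FlipAt t c) :
    D.khovanovR t s = cubeSign s.res c := by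
  unfold khovanovR
  rw [if_pos (EState.R_congr h.ori), khovanov_of_step h.stepAt,
    h.stepAt.edgeCoeff_of_touchSgn ((h.stepAt.touchSgn_of_ori h.ori).1 h.forbidden), mul_one]

/-- If `R` is preserved, no orientation changes by `R_lt`; the degree of the differential then makes
the crossing forbidden. -/
theorem exists_flip {s t : D.EState} (h : D.khovanovR t s ≠ 0) : ∃ c, s.FlipAt t c := by
  unfold khovanovR at h
  split_ifs at h with hR
  · obtain ⟨c, hc, he⟩ := exists_step h
    have ho : t.ori = s.ori := by
      by_contra ho
      exact absurd hR (hc.R_lt he ho).ne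
    exact ⟨c, hc.res_eq, hc.res, ho, (hc.touchSgn_of_ori ho).2 (hc.touchSgn_of_edgeCoeff he)⟩
  · exact absurd rfl h

theorem khovanovRest_lt {s t : D.EState} (h : D.khovanovRest t s ≠ 0) : t.R < s.R := by
  unfold khovanovRest at h
  rw [Matrix.sub_apply] at h
  have hR : t.R ≠ s.R := fun hR => h (by unfold khovanovR; rw [if_pos hR, sub_self])
  unfold khovanovR at h
  rw [if_neg hR, sub_zero] at h
  obtain ⟨c, hc, he⟩ := exists_step h
  exact hc.R_lt he fun ho => hR (EState.R_congr ho)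

end GridDiagram
end GridKh

namespace GridKh
namespace GridDiagram

variable {n : ℕ} {D : GridDiagram n}

/-! ## The square of the Khovanov differential -/

open Classical in
/-- The number of factors of a monomial in the edges which lie on the circle of a given edge. -/
def circleCount (ρ : D.Resolution) (m : Multiset D.Edge) (e : D.Edge) : ℕ :=
  m.countP fun e' => circleOf ρ e' = circleOf ρ e

theorem circleCount_congr {ρ : D.Resolution} (m : Multiset D.Edge) {e e' : D.Edge}
    (h : circleOf ρ e = circleOf ρ e') : circleCount ρ m e = circleCount ρ m e' := by
  unfold circleCount
  rw [h]

open Classical in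
theorem circleCount_add (ρ : D.Resolution) (f m : Multiset D.Edge) (e : D.Edge) :
    circleCount ρ (f + m) e = circleCount ρ f e + circleCount ρ m e :=
  Multiset.countP_add _ _ _

open Classical in
theorem circleCount_singleton (ρ : D.Resolution) (a e : D.Edge) :
    circleCount ρ {a} e = if circleOf ρ a = circleOf ρ e then 1 else 0 := by
  unfold circleCount
  rw [← Multiset.cons_zero, Multiset.countP_cons]
  simp

theorem countP_or {α : Type*} (p q r : α → Prop) [DecidablePred p] [DecidablePred q]
    [DecidablePred r] (m : Multiset α) (h : ∀ a, p a ↔ q a ∨ r a) (h' : ∀ a, q a → ¬ r a) :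
    m.countP p = m.countP q + m.countP r := by
  induction m using Multiset.induction_on with
  | empty => simp
  | cons a m ih =>
    rw [Multiset.countP_cons, Multiset.countP_cons, Multiset.countP_cons, ih]
    have h1 := h a
    have h2 := h' a
    by_cases hq : q a <;> by_cases hr : r a <;> simp_all <;> omega

section

variable {ρ ρ' : D.Resolution} {c : D.Crossing} (hρ : ∀ c', c' ≠ c → ρ c' = ρ' c')

include hρ

theorem circleCount_of_not_touches (m : Multiset D.Edge) {e : D.Edge} (h : ¬ c.Touches ρ e) :
    circleCount ρ m e = circleCount ρ' m e := by
  unfold circleCount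
  simp only [Crossing.circleOf_iff_of_not_touches hρ h]

theorem circleCount_merge (m : Multiset D.Edge)
    (h : circleOf ρ (c.edge .N) ≠ circleOf ρ (c.edge .S))
    (h' : circleOf ρ' (c.edge .N) = circleOf ρ' (c.edge .S)) :
    circleCount ρ' m (c.edge .N) = circleCount ρ m (c.edge .N) + circleCount ρ m (c.edge .S) := by
  classical
  refine countP_or _ _ _ m (fun e => ?_) (fun e h1 h2 => h (h1.symm.trans h2))
  have := Crossing.touches_iff hρ (e := e)
  unfold Crossing.Touches at this
  rw [this, ← h', or_self]

end

/-- The monomial represents the enhanced state: it has one factor on each circle labelled `x`, and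
no factor on the others. -/
def EState.Represents (t : D.EState) (m : Multiset D.Edge) : Prop :=
  ∀ e, circleCount t.res m e = if t.label e then 0 else 1

open Classical in
/-- The coefficient of an enhanced state in a monomial. -/
def EState.coeff (t : D.EState) (m : Multiset D.Edge) : ℚ := if t.Represents m then 1 else 0

theorem EState.coeff_congr (t : D.EState) (m : Multiset D.Edge) {a b : D.Edge}
    (h : circleOf t.res a = circleOf t.res b) : t.coeff ({a} + m) = t.coeff ({b} + m) := by
  unfold coeff Represents
  simp only [circleCount_add, circleCount_singleton, h]

/-- One edge is chosen on each circle labelled `x`. Labels become square-free monomials in variables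
of square zero, one for each circle. -/
theorem EState.exists_represents (s : D.EState) : ∃ m, s.Represents m := by
  classical
  let out : Circle s.res → D.Edge := Quot.out
  let F : Finset (Circle s.res) := Finset.univ.filter fun C => s.label (out C) = false
  refine ⟨F.val.map out, fun e => ?_⟩
  unfold circleCount
  rw [Multiset.countP_map]
  have h1 : ∀ C : Circle s.res, circleOf s.res (out C) = C := fun C => Quot.out_eq C
  have h2 : s.label (out (circleOf s.res e)) = s.label e := s.label_congr (h1 _)
  simp only [h1]
  change (F.filter fun C => C = circleOf s.res e).card = _
  rw [Finset.filter_eq']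
  simp only [F, Finset.mem_filter, Finset.mem_univ, true_and, h2]
  split_ifs <;> simp_all

theorem EState.Represents.eq {s t : D.EState} {m : Multiset D.Edge} (hs : s.Represents m)
    (ht : t.Represents m) (h : s.res = t.res) : s = t := by
  refine EState.ext_label h fun e => ?_
  have h1 := hs e
  have h2 := ht e
  rw [h, h2] at h1
  cases hx : s.label e <;> cases hy : t.label e <;> simp_all

theorem exists_represents_of_le (ρ : D.Resolution) (m : Multiset D.Edge)
    (h : ∀ e, circleCount ρ m e ≤ 1) : ∃ s : D.EState, s.res = ρ ∧ s.Represents m := by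
  obtain ⟨s, rfl, hs⟩ := EState.exists_labels ρ (fun e => decide (circleCount ρ m e = 0))
    fun e e' he => by rw [circleCount_congr m he]
  refine ⟨s, rfl, fun e => ?_⟩
  rw [hs]
  have := h e
  by_cases h0 : circleCount s.res m e = 0
  · simp [h0]
  · simp [h0]; omega

theorem EState.represents_iff (t : D.EState) (m : Multiset D.Edge) (c : D.Crossing) :
    t.Represents m ↔ (∀ e, ¬ c.Touches t.res e → circleCount t.res m e = if t.label e then 0 else 1) ∧
      circleCount t.res m (c.edge .N) = (if t.label (c.edge .N) then 0 else 1) ∧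
      circleCount t.res m (c.edge .S) = (if t.label (c.edge .S) then 0 else 1) := by
  refine ⟨fun h => ⟨fun e _ => h e, h _, h _⟩, fun ⟨h1, h2, h3⟩ e => ?_⟩
  by_cases he : c.Touches t.res e
  · rcases he with he | he
    · rw [circleCount_congr m he, t.label_congr he, h2]
    · rw [circleCount_congr m he, t.label_congr he, h3]
  · exact h1 e he

open Classical in
/-- The product with the factor of the edge of the cube of resolutions at `c`: `1` for a merge, the
sum of the two circles for a split. -/
def facSum (ρ : D.Resolution) (c : D.Crossing) (f : Multiset D.Edge → ℚ) : ℚ :=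
  if circleOf ρ (c.edge .N) = circleOf ρ (c.edge .S) then f {c.edge .N} + f {c.edge .S} else f 0

open Classical in
/-- The Khovanov differential at one crossing, without its sign. -/
def stepCoeff (c : D.Crossing) (t s : D.EState) : ℚ :=
  if s.StepAt t c then edgeCoeff s t c else 0

/-- In terms of monomials a merge identifies two variables, and a split multiplies by the sum of the
two new variables, whichever of them the old factors are assigned to. A factor on a circle away from
`c` is unchanged, which is the condition on orientations in `StepAt`. -/
theorem stepCoeff_eq {c : D.Crossing} {s t : D.EState} (hs : s.res c = false)
    (ht : t.res = Function.update s.res c true) {m : Multiset D.Edge} (hm : s.Represents m) :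
    stepCoeff c t s = facSum s.res c fun f => t.coeff (f + m) := by
  classical
  have hρ : ∀ c', c' ≠ c → s.res c' = t.res c' := fun c' hc => by
    rw [ht, Function.update_of_ne hc]
  have hρ' : ∀ c', c' ≠ c → t.res c' = s.res c' := fun c' hc => (hρ c' hc).symm
  have ht' : t.res c = true := by rw [ht, Function.update_self]
  have hx := circleOf_xor hρ hs ht'
  have hT : ∀ e, c.Touches t.res e ↔ c.Touches s.res e := fun e => (Crossing.touches_iff hρ).symm
  have hfar : s.StepAt t c ↔
      ∀ e, ¬ c.Touches t.res e → circleCount t.res m e = if t.label e then 0 else 1 := by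
    have key : ∀ e, ¬ c.Touches s.res e →
        ((circleCount t.res m e = if t.label e then 0 else 1) ↔ t.ori e = s.ori e) := by
      intro e he
      rw [← circleCount_of_not_touches hρ m he, hm e, eq_comm (a := t.ori e),
        ← EState.SameCircle.label_iff fun e' => Crossing.circleOf_iff_of_not_touches hρ he]
      cases s.label e <;> cases t.label e <;> simp
    simp only [hT]
    exact ⟨fun h e he => (key e he).2 (h.ori e he), fun h => ⟨hs, ht, fun e he => (key e he).1 (h e he)⟩⟩
  have hN := hm (c.edge .N)
  have hS := hm (c.edge .S)
  have hadd : ∀ f : Multiset D.Edge, (∀ a ∈ f, c.Touches t.res a) → ∀ e, ¬ c.Touches t.res e →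
      circleCount t.res (f + m) e = circleCount t.res m e := by
    intro f hf e he
    rw [circleCount_add]
    have : circleCount t.res f e = 0 := by
      unfold circleCount
      rw [Multiset.countP_eq_zero]
      exact fun a ha h => he ((Crossing.Touches.congr h).1 (hf a ha))
    omega
  unfold stepCoeff facSum EState.coeff
  beta_reduce
  by_cases h1 : circleOf s.res (c.edge .N) = circleOf s.res (c.edge .S)
  · have h2 := hx.1 h1
    have hc := circleCount_merge hρ' m h2 h1
    rw [if_pos h1, t.represents_iff _ c, t.represents_iff _ c]
    have e1 : (∀ e, ¬ c.Touches t.res e → circleCount t.res ({c.edge .N} + m) e =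
        if t.label e then 0 else 1) ↔ s.StepAt t c := by
      rw [hfar]
      refine forall₂_congr fun e he => ?_
      rw [hadd _ (by simpa using c.touches_edge _ _) e he]
    have e2 : (∀ e, ¬ c.Touches t.res e → circleCount t.res ({c.edge .S} + m) e =
        if t.label e then 0 else 1) ↔ s.StepAt t c := by
      rw [hfar]
      refine forall₂_congr fun e he => ?_
      rw [hadd _ (by simpa using c.touches_edge _ _) e he]
    rw [e1, e2]
    simp only [circleCount_add, circleCount_singleton, if_neg h2, if_neg (Ne.symm h2), if_true]
    unfold edgeCoeff
    rw [c.north_eq, c.south_eq, if_pos h1]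
    by_cases hst : s.StepAt t c
    · simp only [hst, if_true, true_and]
      rw [hN] at hc
      generalize circleCount t.res m (c.edge .N) = a at *
      generalize circleCount t.res m (c.edge .S) = b at *
      cases hl : s.label (c.edge .N) <;> rw [hl] at hc
      · have : (a = 1 ∧ b = 0) ∨ (a = 0 ∧ b = 1) := by simp at hc; omega
        rcases this with ⟨rfl, rfl⟩ | ⟨rfl, rfl⟩ <;> cases t.label (c.edge .N) <;>
          cases t.label (c.edge .S) <;> simp [comulCoeff]
      · have : a = 0 ∧ b = 0 := by simp at hc; omega
        rcases this with ⟨rfl, rfl⟩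
        cases t.label (c.edge .N) <;> cases t.label (c.edge .S) <;> simp [comulCoeff]
    · simp [hst]
  · have h2 : circleOf t.res (c.edge .N) = circleOf t.res (c.edge .S) := by
      by_contra h; exact h1 (hx.2 h)
    have hc := circleCount_merge hρ m h1 h2
    rw [if_neg h1, t.represents_iff _ c, zero_add, ← hfar]
    unfold edgeCoeff
    rw [c.north_eq, c.south_eq, if_neg h1]
    rw [← circleCount_congr m h2, ← t.label_congr h2, and_self, hc, hN, hS]
    by_cases hst : s.StepAt t c
    · simp only [hst, if_true, true_and]
      cases s.label (c.edge .N) <;> cases s.label (c.edge .S) <;> cases t.label (c.edge .N) <;>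
        simp [mulCoeff]
    · simp [hst]

theorem res_of_update {ρ ρ' : D.Resolution} {c : D.Crossing} (h : ρ c = false)
    (h' : ρ' = Function.update ρ c true) : ρ = Function.update ρ' c false := by
  rw [h', Function.update_idem, ← h, Function.update_eq_self]

/-- This extends `stepCoeff_eq` from square-free monomials to all monomials, as needed for composing
two steps: the product with the first factor need not be square-free. -/
theorem sum_stepCoeff_mul_coeff (c : D.Crossing) (u : D.EState) (hu : u.res c = true)
    (m : Multiset D.Edge) : ∑ t, stepCoeff c u t * t.coeff m =
      facSum (Function.update u.res c false) c fun f => u.coeff (f + m) := by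
  classical
  set ρ := Function.update u.res c false with hρd
  have hρc : ρ c = false := by rw [hρd, Function.update_self]
  have huρ : u.res = Function.update ρ c true := by
    rw [hρd, Function.update_idem, ← hu, Function.update_eq_self]
  have hρ : ∀ c', c' ≠ c → ρ c' = u.res c' := fun c' hc => by
    rw [huρ, Function.update_of_ne hc]
  by_cases hm : ∀ e, circleCount ρ m e ≤ 1
  · obtain ⟨s, hs, hsm⟩ := exists_represents_of_le ρ m hm
    rw [Finset.sum_eq_single s, stepCoeff_eq (by rw [hs, hρc]) (by rw [hs, huρ]) hsm, hs]
    · unfold EState.coeff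
      rw [if_pos hsm, mul_one]
    · intro t _ hts
      unfold stepCoeff EState.coeff
      split_ifs with h1 h2
      · exact absurd (h2.eq hsm (by rw [hs, res_of_update h1.1 h1.2])) hts
      all_goals simp
    · simp
  -- Some circle carries two factors, so the monomial is zero before the step. After a merge or away
  -- from `c` a repeated factor remains. After a split the two factors may lie on different circles,
  -- but then the extra factor repeats one of them.
  · push Not at hm
    obtain ⟨e, he⟩ := hm
    rw [Finset.sum_eq_zero]
    swap
    · intro t _
      unfold stepCoeff EState.coeff
      split_ifs with h1 h2
      · have := h2 e
        rw [res_of_update h1.1 h1.2, ← hρd] at this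
        rw [this] at he
        split_ifs at he <;> omega
      all_goals simp
    have hzero : ∀ f : Multiset D.Edge, (∃ e, 1 < circleCount u.res (f + m) e) →
        u.coeff (f + m) = 0 := by
      rintro f ⟨e, he⟩
      unfold EState.coeff
      rw [if_neg]
      intro h
      rw [h e] at he
      split_ifs at he <;> omega
    have hx := circleOf_xor hρ hρc hu
    unfold facSum
    beta_reduce
    by_cases hT : c.Touches ρ e
    · by_cases h1 : circleOf ρ (c.edge .N) = circleOf ρ (c.edge .S)
      · have hc := circleCount_merge (fun c' h => (hρ c' h).symm) m (hx.1 h1) h1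
        have he' : circleOf ρ e = circleOf ρ (c.edge .N) := by
          rcases hT with h | h
          · exact h
          · rw [h, h1]
        rw [circleCount_congr m he'] at he
        rw [if_pos h1]
        have hne := hx.1 h1
        by_cases hu0 : circleCount u.res m (c.edge .N) = 0
        · rw [hzero _ ⟨c.edge .S, ?_⟩, hzero _ ⟨c.edge .S, ?_⟩, add_zero] <;>
            rw [circleCount_add] <;> omega
        · by_cases hu1 : circleCount u.res m (c.edge .N) = 1
          · rw [hzero _ ⟨c.edge .N, ?_⟩, hzero _ ⟨c.edge .S, ?_⟩, add_zero] <;>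
              rw [circleCount_add, circleCount_singleton, if_pos rfl] <;> omega
          · rw [hzero _ ⟨c.edge .N, ?_⟩, hzero _ ⟨c.edge .N, ?_⟩, add_zero] <;>
              rw [circleCount_add] <;> omega
      · have h2 : circleOf u.res (c.edge .N) = circleOf u.res (c.edge .S) := by
          by_contra h; exact h1 (hx.2 h)
        have hc := circleCount_merge hρ m h1 h2
        rw [if_neg h1, hzero _ ⟨c.edge .N, ?_⟩]
        rw [zero_add, hc]
        rcases hT with h | h <;> rw [circleCount_congr m h] at he <;> omega
    · rw [circleCount_of_not_touches hρ m hT] at he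
      have : ∀ f : Multiset D.Edge, u.coeff (f + m) = 0 := fun f => hzero f ⟨e, by
        rw [circleCount_add]; omega⟩
      simp only [this]
      split_ifs <;> simp

/-! ### Changing two smoothings in either order -/

theorem exists_ones (ρ : D.Resolution) : ∃ s : D.EState, s.res = ρ ∧ ∀ e, s.label e = true :=
  EState.exists_labels ρ (fun _ => true) fun _ _ _ => rfl

open Classical in
/-- The number of circles changes by one. -/
theorem card_circle_update {ρ : D.Resolution} {c : D.Crossing} (h : ρ c = false) :
    (Fintype.card (Circle (Function.update ρ c true)) : ℤ) = Fintype.card (Circle ρ) +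
      if circleOf ρ (c.edge .N) = circleOf ρ (c.edge .S) then 1 else -1 := by
  obtain ⟨s, hs, hs1⟩ := exists_ones ρ
  obtain ⟨t, ht, ht1⟩ := exists_ones (Function.update ρ c true)
  subst hs
  have hρ : ∀ c', c' ≠ c → s.res c' = t.res c' := fun c' hc => by
    rw [ht, Function.update_of_ne hc]
  have hst : s.StepAt t c := ⟨h, ht, fun e he => Eq.symm ((EState.SameCircle.label_iff
    fun e' => Crossing.circleOf_iff_of_not_touches hρ he).1 (by rw [hs1, ht1]))⟩
  have h1 := hst.rot
  have h2 := hst.xor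
  have hcard : ∀ u : D.EState, (∀ e, u.label e = true) →
      rot u.res u.ori = Fintype.card (Circle u.res) := by
    intro u hu
    rw [u.rot_eq, Finset.sum_congr rfl (fun C _ => ?_), Finset.sum_const, Finset.card_univ,
      nsmul_eq_mul, mul_one]
    induction C using Quot.ind with
    | mk e => exact (u.sgn_circleOf e).trans (by rw [hu]; rfl)
  rw [hcard s hs1, hcard t ht1] at h1
  rw [← ht]
  unfold EState.touchSgn at h1
  simp only [EState.sgn_circleOf, hs1, ht1, if_true] at h1
  by_cases h3 : circleOf s.res (c.edge .N) = circleOf s.res (c.edge .S)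
  · rw [if_pos h3, if_neg (h2.1 h3)] at h1
    rw [if_pos h3]
    omega
  · rw [if_neg h3, if_pos (not_not.1 (mt h2.2 h3))] at h1
    rw [if_neg h3]
    omega

/-- Both sides multiply by factors attached to the same final circles, so it remains to compare
these factors according to which changes split and which merge. -/
theorem facSum_comm {c c' : D.Crossing} (hne : c ≠ c') {ρ : D.Resolution} (hc : ρ c = false)
    (hc' : ρ c' = false) (u : D.EState)
    (hu : u.res = Function.update (Function.update ρ c true) c' true) (m : Multiset D.Edge) :
    (facSum ρ c fun f => facSum (Function.update ρ c true) c' fun f' => u.coeff (f' + (f + m))) =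
      facSum ρ c' fun f => facSum (Function.update ρ c' true) c fun f' => u.coeff (f' + (f + m)) := by
  classical
  have hu' : u.res = Function.update (Function.update ρ c' true) c true := by
    rw [hu, Function.update_comm hne]
  set ρ1 := Function.update ρ c true with h1
  set ρ2 := Function.update ρ c' true with h2
  have hc1 : ρ1 c = true := Function.update_self ..
  have hc2 : ρ2 c' = true := Function.update_self ..
  have hc1' : ρ1 c' = false := by rw [h1, Function.update_of_ne hne.symm, hc']
  have hc2' : ρ2 c = false := by rw [h2, Function.update_of_ne hne, hc]
  have k1 := card_circle_update (ρ := ρ) (c := c) hc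
  have k2 := card_circle_update (ρ := ρ1) (c := c') hc1'
  have k3 := card_circle_update (ρ := ρ) (c := c') hc'
  have k4 := card_circle_update (ρ := ρ2) (c := c) hc2'
  have r1 : ∀ d, d ≠ c → ρ d = ρ1 d := fun d hd => by rw [h1, Function.update_of_ne hd]
  have r2 : ∀ d, d ≠ c' → ρ d = ρ2 d := fun d hd => by rw [h2, Function.update_of_ne hd]
  have r3 : ∀ d, d ≠ c' → ρ1 d = u.res d := fun d hd => by rw [hu, Function.update_of_ne hd]
  have r4 : ∀ d, d ≠ c → ρ2 d = u.res d := fun d hd => by rw [hu', Function.update_of_ne hd]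
  have x1 := circleOf_xor r1 hc hc1
  have x2 := circleOf_xor r2 hc' hc2
  have x3 := circleOf_xor r3 hc1' (by rw [hu, Function.update_self])
  have x4 := circleOf_xor r4 hc2' (by rw [hu', Function.update_self])
  -- The number of circles at the end does not depend on the order, so both orders have the same
  -- number of splits.
  have hkey : ((if circleOf ρ (c.edge .N) = circleOf ρ (c.edge .S) then 1 else -1) +
      (if circleOf ρ1 (c'.edge .N) = circleOf ρ1 (c'.edge .S) then 1 else -1) : ℤ) =
      (if circleOf ρ (c'.edge .N) = circleOf ρ (c'.edge .S) then 1 else -1) +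
      (if circleOf ρ2 (c.edge .N) = circleOf ρ2 (c.edge .S) then 1 else -1) := by
    rw [← h1] at k1
    rw [← h2] at k3
    rw [← hu] at k2
    rw [← hu'] at k4
    omega
  clear k1 k2 k3 k4
  unfold facSum
  beta_reduce
  by_cases a : circleOf ρ (c.edge .N) = circleOf ρ (c.edge .S) <;>
  by_cases a' : circleOf ρ2 (c.edge .N) = circleOf ρ2 (c.edge .S) <;>
  by_cases b : circleOf ρ (c'.edge .N) = circleOf ρ (c'.edge .S) <;>
  by_cases b' : circleOf ρ1 (c'.edge .N) = circleOf ρ1 (c'.edge .S) <;>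
  simp only [a, a', b, b', if_true, if_false] at hkey ⊢ <;> try (exfalso; omega)
  · simp only [← add_assoc, add_comm, add_left_comm]
  · simp only [zero_add]
  -- Either order splits and then merges. All the half-edges at both crossings end up on one circle,
  -- and each side is twice the product with its variable.
  · have u1 : circleOf u.res (c.edge .N) = circleOf u.res (c.edge .S) := by
      by_contra h; exact a' (x4.2 h)
    have u2 : circleOf u.res (c'.edge .N) = circleOf u.res (c'.edge .S) := by
      by_contra h; exact b' (x3.2 h)
    have hT : c'.Touches u.res (c.edge .N) := by
      rcases Crossing.circleOf_join (fun d hd => (r3 d hd).symm) u1 with h | h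
      · exact absurd h (x1.1 a)
      · exact (Crossing.touches_iff r3).1 h.1
    have u3 : circleOf u.res (c.edge .N) = circleOf u.res (c'.edge .N) := by
      rcases hT with h | h
      · exact h
      · rw [h, u2]
    simp only [zero_add]
    rw [u.coeff_congr m u1.symm, u.coeff_congr m u2.symm, u.coeff_congr m u3]
  -- Either order merges and then splits: both crossings join the same two circles. The two final
  -- circles touch both crossings, so the two sums of variables agree.
  · have v1 : circleOf ρ2 (c'.edge .N) = circleOf ρ2 (c'.edge .S) := by
      by_contra h; exact b (x2.2 h)
    have w1 := x3.1 b'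
    have w2 := x4.1 a'
    have hT := Crossing.circleOf_join (fun d hd => (r2 d hd).symm) a'
    have hT := hT.resolve_left a
    have t1 := (Crossing.touches_iff r2).1 hT.1
    have v2 : circleOf ρ2 (c.edge .N) = circleOf ρ2 (c'.edge .N) := by
      rcases t1 with h | h
      · exact h
      · rw [h, v1]
    have t2 : c.Touches ρ2 (c'.edge .N) := .inl v2.symm
    have t3 : c.Touches ρ2 (c'.edge .S) := .inl (by rw [← v1, v2])
    have t2 := (Crossing.touches_iff r4).1 t2
    have t3 := (Crossing.touches_iff r4).1 t3
    simp only [zero_add]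
    rcases t2 with t2 | t2 <;> rcases t3 with t3 | t3
    · exact absurd (t2.trans t3.symm) w1
    · rw [u.coeff_congr m t2, u.coeff_congr m t3]
    · rw [u.coeff_congr m t2, u.coeff_congr m t3, add_comm]
    · exact absurd (t2.trans t3.symm) w1
  · simp only [zero_add]

open Classical in
theorem cubeSign_update {c c' : D.Crossing} {ρ : D.Resolution} (hc : ρ c = false) :
    cubeSign (Function.update ρ c true) c' =
      (if toLex c.1 < toLex c'.1 then -1 else 1) * cubeSign ρ c' := by
  unfold cubeSign
  rw [Fintype.prod_eq_mul_prod_compl c, Fintype.prod_eq_mul_prod_compl c, Function.update_self, hc,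
    Finset.prod_congr rfl fun d hd => by
      rw [Function.update_of_ne (by simpa using hd)]]
  simp

/-- A new `1`-smoothing affects only the signs of later crossings, and exactly one of the two
crossings is the later one. -/
theorem cubeSign_anticomm {c c' : D.Crossing} (hne : c ≠ c') {ρ : D.Resolution} (hc : ρ c = false)
    (hc' : ρ c' = false) : cubeSign (Function.update ρ c true) c' * cubeSign ρ c =
      -(cubeSign (Function.update ρ c' true) c * cubeSign ρ c') := by
  rw [cubeSign_update hc, cubeSign_update hc']
  have : toLex c.1 ≠ toLex c'.1 := fun h => hne (Subtype.ext (toLex_inj.1 h))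
  rcases lt_or_gt_of_ne this with h | h
  · rw [if_pos h, if_neg h.not_gt]; ring
  · rw [if_neg h.not_gt, if_pos h]; ring

/-- The Khovanov differential at one crossing. -/
def stepMatrix (c : D.Crossing) : Matrix D.EState D.EState ℚ := fun t s =>
  cubeSign s.res c * stepCoeff c t s

theorem khovanov_eq_sum : D.khovanov = ∑ c, stepMatrix c := by
  ext t s
  rw [khovanov_apply, Matrix.sum_apply]
  refine Finset.sum_congr rfl fun c _ => ?_
  unfold stepMatrix stepCoeff
  split_ifs <;> simp

theorem stepMatrix_mul_eq_zero {c c' : D.Crossing} {u s : D.EState}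
    (h : ¬ (s.res c = false ∧ s.res c' = false ∧ c ≠ c' ∧
      u.res = Function.update (Function.update s.res c true) c' true)) :
    (stepMatrix c' * stepMatrix c : Matrix D.EState D.EState ℚ) u s = 0 := by
  rw [Matrix.mul_apply]
  refine Finset.sum_eq_zero fun t _ => ?_
  unfold stepMatrix stepCoeff
  split_ifs with h1 h2
  · refine absurd ⟨h2.1, ?_, ?_, ?_⟩ h
    · by_cases hcc : c' = c
      · rw [hcc, h2.1]
      · rw [h2.res_of_ne c' hcc, h1.1]
    · rintro rfl
      have := h2.res_eq'
      rw [h1.1] at this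
      exact absurd this (by simp)
    · rw [h1.2, h2.2]
  all_goals simp

theorem stepMatrix_mul {c c' : D.Crossing} {u s : D.EState} (hc : s.res c = false)
    (hu : u.res = Function.update (Function.update s.res c true) c' true)
    (hc' : s.res c' = false) (hne : c ≠ c')
    {m : Multiset D.Edge} (hm : s.Represents m) :
    (stepMatrix c' * stepMatrix c : Matrix D.EState D.EState ℚ) u s =
      cubeSign (Function.update s.res c true) c' * cubeSign s.res c *
      facSum s.res c fun f => facSum (Function.update s.res c true) c' fun f' =>
        u.coeff (f' + (f + m)) := by
  have huc : u.res c' = true := by rw [hu, Function.update_self]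
  have hρ : Function.update u.res c' false = Function.update s.res c true := by
    rw [hu, Function.update_idem]
    have : Function.update s.res c true c' = false := by rw [Function.update_of_ne hne.symm, hc']
    rw [← this, Function.update_eq_self]
  have key := fun m' => sum_stepCoeff_mul_coeff c' u huc m'
  rw [hρ] at key
  simp only [← key]
  rw [Matrix.mul_apply]
  have : ∀ t, stepMatrix c' u t * stepMatrix c t s = cubeSign (Function.update s.res c true) c' *
      cubeSign s.res c * (stepCoeff c' u t * facSum s.res c fun f => t.coeff (f + m)) := by
    intro t
    unfold stepMatrix
    by_cases h : t.StepAt u c'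
    · have ht := res_of_update h.1 h.2
      rw [hρ] at ht
      rw [stepCoeff_eq hc ht hm, ht]
      ring
    · have : stepCoeff c' u t = 0 := if_neg h
      rw [this]
      ring
  rw [Finset.sum_congr rfl fun t _ => this t, ← Finset.mul_sum]
  unfold facSum
  split_ifs
  · rw [← Finset.sum_add_distrib]
    simp only [mul_add]
  · rfl

theorem stepMatrix_anticomm (c c' : D.Crossing) :
    (stepMatrix c' * stepMatrix c + stepMatrix c * stepMatrix c' :
      Matrix D.EState D.EState ℚ) = 0 := by
  ext u s
  rw [Matrix.add_apply, Matrix.zero_apply]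
  by_cases h : s.res c = false ∧ s.res c' = false ∧ c ≠ c' ∧
      u.res = Function.update (Function.update s.res c true) c' true
  · obtain ⟨h1, h2, h3, h4⟩ := h
    obtain ⟨m, hm⟩ := s.exists_represents
    rw [stepMatrix_mul h1 h4 h2 h3 hm,
      stepMatrix_mul h2 (by rw [h4, Function.update_comm h3]) h1 h3.symm hm,
      facSum_comm h3 h1 h2 u h4, cubeSign_anticomm h3 h1 h2]
    ring
  · rw [stepMatrix_mul_eq_zero h, stepMatrix_mul_eq_zero, add_zero]
    rintro ⟨h1, h2, h3, h4⟩
    exact h ⟨h2, h1, h3.symm, by rw [h4, Function.update_comm h3]⟩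

theorem khovanov_mul_khovanov : D.khovanov * D.khovanov = 0 := by
  have h : D.khovanov * D.khovanov = -(D.khovanov * D.khovanov) := by
    rw [eq_neg_iff_add_eq_zero]
    conv_lhs => rw [khovanov_eq_sum]
    rw [Finset.sum_mul_sum]
    conv_lhs =>
      arg 2
      rw [Finset.sum_comm]
    simp only [← Finset.sum_add_distrib, stepMatrix_anticomm, Finset.sum_const_zero]
  ext u s
  have := congrFun (congrFun h u) s
  rw [Matrix.neg_apply] at this
  rw [Matrix.zero_apply]
  linarith

end GridDiagram
end GridKh

namespace GridKh
namespace GridDiagram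

variable {n : ℕ} {D : GridDiagram n}

/-! ## The hypercubes -/

namespace EState

/-- At a forbidden crossing either smoothing joins a vertical half-edge coming in to a horizontal
one going out. -/
theorem coherent_update (s : D.EState) {c : D.Crossing} (h : s.Forbidden c) (b : Bool) :
    Coherent (Function.update s.res c b) s.ori := by
  intro v d d' e e' he he' hl
  by_cases hv : v = c.1
  · subst hv
    have h1 := h d e he
    have h2 := h d' e' he'
    rcases hl with ⟨hc, hl⟩ | ⟨hc, -⟩
    · have hb : Function.update s.res c b ⟨c.1, hc⟩ = b := Function.update_self ..
      rw [hb] at hl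
      cases hx : d.outward (s.ori e) <;> cases hy : d'.outward (s.ori e') <;>
        cases b <;> cases d <;> simp_all [Dir.partner]
    · exact absurd c.2 hc
  · refine s.2 v d d' e e' he he' ((Crossing.linked_iff_of_ne (fun c' hc => ?_) hv d d').1 hl)
    exact Function.update_of_ne hc _ _

/-- The enhanced state with a given resolution and given orientations. -/
def mk (ρ : D.Resolution) (ε : D.Edge → Bool) (h : Coherent ρ ε) : D.EState := ⟨(ρ, ε), h⟩

theorem mk_res (ρ : D.Resolution) (ε : D.Edge → Bool) (h : Coherent ρ ε) : (mk ρ ε h).res = ρ := rfl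

theorem mk_ori (ρ : D.Resolution) (ε : D.Edge → Bool) (h : Coherent ρ ε) : (mk ρ ε h).ori = ε := rfl

open Classical in
/-- The smoothing of a forbidden crossing is changed. -/
def flip (c : D.Crossing) (s : D.EState) : D.EState :=
  if h : s.Forbidden c then mk _ _ (s.coherent_update h (!s.res c))
  else s

theorem flip_of_not {c : D.Crossing} {s : D.EState} (h : ¬ s.Forbidden c) : s.flip c = s := dif_neg h

theorem flip_ori (c : D.Crossing) (s : D.EState) : (s.flip c).ori = s.ori := by
  unfold flip
  split_ifs <;> rfl

theorem flip_res {c : D.Crossing} {s : D.EState} (h : s.Forbidden c) :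
    (s.flip c).res = Function.update s.res c (!s.res c) := by
  unfold flip
  rw [dif_pos h]
  rfl

theorem flip_forbidden (c c' : D.Crossing) (s : D.EState) :
    (s.flip c).Forbidden c' ↔ s.Forbidden c' := forbidden_congr (flip_ori c s) c'

theorem flip_res_of_ne {c c' : D.Crossing} (h : c' ≠ c) (s : D.EState) :
    (s.flip c).res c' = s.res c' := by
  by_cases hf : s.Forbidden c
  · rw [flip_res hf, Function.update_of_ne h]
  · rw [flip_of_not hf]

theorem flip_flip (c : D.Crossing) (s : D.EState) : (s.flip c).flip c = s := by
  by_cases hf : s.Forbidden c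
  · refine EState.ext ?_ fun e => by rw [flip_ori, flip_ori]
    rw [flip_res ((flip_forbidden _ _ _).2 hf), flip_res hf]
    simp
  · rw [flip_of_not hf, flip_of_not hf]

theorem flip_comm (c c' : D.Crossing) (s : D.EState) : (s.flip c).flip c' = (s.flip c').flip c := by
  by_cases h : c = c'
  · rw [h]
  by_cases hf : s.Forbidden c <;> by_cases hf' : s.Forbidden c'
  · refine EState.ext ?_ fun e => by rw [flip_ori, flip_ori, flip_ori, flip_ori]
    rw [flip_res ((flip_forbidden _ _ _).2 hf), flip_res ((flip_forbidden _ _ _).2 hf'), flip_res hf,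
      flip_res hf', Function.update_of_ne h, Function.update_of_ne (Ne.symm h),
      Function.update_comm (Ne.symm h)]
  · rw [flip_of_not hf', flip_of_not ((flip_forbidden _ _ _).not.2 hf')]
  · rw [flip_of_not hf, flip_of_not ((flip_forbidden _ _ _).not.2 hf)]
  · rw [flip_of_not hf, flip_of_not hf', flip_of_not hf]

theorem flipAt_iff {s t : D.EState} {c : D.Crossing} :
    s.FlipAt t c ↔ s.Forbidden c ∧ s.res c = false ∧ t = s.flip c := by
  constructor
  · intro h
    refine ⟨h.forbidden, h.res_eq, EState.ext ?_ fun e => by rw [flip_ori, h.ori]⟩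
    rw [flip_res h.forbidden, h.res, h.res_eq]
    rfl
  · rintro ⟨h1, h2, rfl⟩
    exact ⟨h2, by rw [flip_res h1, h2]; rfl, flip_ori _ _, h1⟩

theorem cubeDim_flip (c : D.Crossing) (s : D.EState) : (s.flip c).cubeDim = s.cubeDim := by
  classical
  unfold cubeDim
  congr 1
  ext c'
  simp only [Finset.mem_filter, flip_forbidden]

theorem cubeDim_eq_zero_iff (s : D.EState) : s.cubeDim = 0 ↔ s.InH := by
  classical
  unfold cubeDim InH
  rw [Finset.card_eq_zero, Finset.filter_eq_empty_iff]
  simp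

end EState

open Classical in
theorem cubeSign_flip {c c' : D.Crossing} {s : D.EState} (h : s.Forbidden c) :
    cubeSign (s.flip c).res c' = (if toLex c.1 < toLex c'.1 then -1 else 1) * cubeSign s.res c' := by
  rw [EState.flip_res h]
  cases hs : s.res c
  · exact cubeSign_update hs
  · have : s.res = Function.update (Function.update s.res c false) c true := by
      rw [Function.update_idem, ← hs, Function.update_eq_self]
    conv_rhs => rw [this, cubeSign_update (Function.update_self ..)]
    rw [← mul_assoc, Bool.not_true]
    split_ifs <;> simp

open Classical in
/-- The part of `d₀` at the crossing `c` (for `b = false`), and its transpose (for `b = true`). -/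
def flipMatrix (b : Bool) (c : D.Crossing) : Matrix D.EState D.EState ℚ := fun t s =>
  if s.Forbidden c ∧ s.res c = b ∧ t = s.flip c then cubeSign s.res c else 0

open Classical in
theorem mul_flipMatrix (A : Matrix D.EState D.EState ℚ) (b : Bool) (c : D.Crossing) (u s) :
    (A * flipMatrix b c) u s =
      if s.Forbidden c ∧ s.res c = b then A u (s.flip c) * cubeSign s.res c else 0 := by
  rw [Matrix.mul_apply, Finset.sum_eq_single (s.flip c)]
  · unfold flipMatrix
    split_ifs with h1 h2 h2
    · rfl
    · exact absurd ⟨h1.1, h1.2.1⟩ h2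
    · exact absurd ⟨h2.1, h2.2, rfl⟩ h1
    · simp
  · intro t _ ht
    unfold flipMatrix
    rw [if_neg fun h => ht h.2.2, mul_zero]
  · simp

open Classical in
theorem flipMatrix_mul_of_ne {c c' : D.Crossing} (h : c ≠ c') (b b' : Bool) (u s : D.EState) :
    (flipMatrix b' c' * flipMatrix b c) u s = if s.Forbidden c ∧ s.res c = b ∧ s.Forbidden c' ∧
      s.res c' = b' ∧ u = (s.flip c).flip c' then
      (if toLex c.1 < toLex c'.1 then -1 else 1) * cubeSign s.res c' * cubeSign s.res c else 0 := by
  rw [mul_flipMatrix]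
  unfold flipMatrix
  rw [EState.flip_forbidden, EState.flip_res_of_ne h.symm]
  by_cases hf : s.Forbidden c
  · rw [cubeSign_flip hf]
    simp only [hf, true_and]
    split_ifs <;> simp_all
  · simp [hf]

/-- Flips at different crossings commute. The cube sign of the later crossing changes when the
earlier one is flipped, in either direction, and not conversely. -/
theorem flipMatrix_anticomm {c c' : D.Crossing} (h : c ≠ c') (b b' : Bool) :
    (flipMatrix b' c' * flipMatrix b c + flipMatrix b c * flipMatrix b' c' :
      Matrix D.EState D.EState ℚ) = 0 := by
  classical
  ext u s
  rw [Matrix.add_apply, flipMatrix_mul_of_ne h, flipMatrix_mul_of_ne h.symm, EState.flip_comm c c',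
    Matrix.zero_apply]
  by_cases hx : s.Forbidden c ∧ s.res c = b ∧ s.Forbidden c' ∧ s.res c' = b' ∧
      u = (s.flip c').flip c
  · rw [if_pos hx, if_pos (⟨hx.2.2.1, hx.2.2.2.1, hx.1, hx.2.1, hx.2.2.2.2⟩ : _ ∧ _ ∧ _ ∧ _ ∧ _)]
    have : toLex c.1 ≠ toLex c'.1 := fun h' => h (Subtype.ext (toLex_inj.1 h'))
    rcases lt_or_gt_of_ne this with h | h
    · rw [if_pos h, if_neg h.not_gt]; ring
    · rw [if_neg h.not_gt, if_pos h]; ring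
  · rw [if_neg hx, if_neg fun h' => hx ⟨h'.2.2.1, h'.2.2.2.1, h'.1, h'.2.1, h'.2.2.2.2⟩, add_zero]

theorem flipMatrix_sq (b : Bool) (c : D.Crossing) :
    (flipMatrix b c * flipMatrix b c : Matrix D.EState D.EState ℚ) = 0 := by
  classical
  ext u s
  rw [mul_flipMatrix, Matrix.zero_apply]
  unfold flipMatrix
  split_ifs with h1 h2
  · have := h2.2.1
    rw [EState.flip_res h1.1, Function.update_self, h1.2] at this
    cases b <;> simp at this
  all_goals simp

open Classical in
theorem flipMatrix_mul_not (b : Bool) (c : D.Crossing) (u s : D.EState) :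
    (flipMatrix b c * flipMatrix (!b) c) u s =
      if s.Forbidden c ∧ s.res c = !b ∧ u = s then 1 else 0 := by
  rw [mul_flipMatrix]
  unfold flipMatrix
  rw [EState.flip_forbidden, EState.flip_flip]
  by_cases hf : s.Forbidden c
  · rw [cubeSign_flip hf, EState.flip_res hf, Function.update_self, if_neg (lt_irrefl _)]
    have := cubeSign_mul_self s.res c
    cases hs : s.res c <;> cases b <;> simp_all
  · simp [hf]

open Classical in
-- On states with `c` forbidden, exactly one of the two products is non-zero, depending on the
-- smoothing, and it undoes the flip. Flipping `c` does not affect its own cube sign, so the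
-- coefficient is a square.
theorem flipMatrix_add (c : D.Crossing) (u s : D.EState) :
    (flipMatrix true c * flipMatrix false c + flipMatrix false c * flipMatrix true c) u s =
      if s.Forbidden c ∧ u = s then 1 else 0 := by
  have h1 := flipMatrix_mul_not true c u s
  have h2 := flipMatrix_mul_not false c u s
  simp only [Bool.not_true, Bool.not_false] at h1 h2
  rw [Matrix.add_apply, h1, h2]
  cases s.res c <;> simp

theorem khovanovR_eq_sum : D.khovanovR = ∑ c, flipMatrix false c := by
  classical
  ext t s
  rw [Matrix.sum_apply]
  by_cases h : ∃ c, s.FlipAt t c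
  · obtain ⟨c, hc⟩ := h
    rw [khovanovR_of_flip hc, Finset.sum_eq_single c]
    · unfold flipMatrix
      rw [if_pos (EState.flipAt_iff.1 hc)]
    · intro c' _ hne
      unfold flipMatrix
      rw [if_neg fun h => hne ((EState.flipAt_iff.2 h).stepAt.unique hc.stepAt)]
    · simp
  · rw [not_not.1 fun h' => h (exists_flip h'), Finset.sum_eq_zero]
    intro c _
    unfold flipMatrix
    rw [if_neg fun h' => h ⟨c, EState.flipAt_iff.2 h'⟩]

/-- The entries of d_0 on a hypercube are signs, and a sign is its own inverse; thus the inverse is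
the transpose. -/
theorem splitHomotopy_eq (c : D.Crossing) :
    (splitHomotopy c : Matrix D.EState D.EState ℚ) = -flipMatrix true c := by
  classical
  ext t s
  rw [Matrix.neg_apply]
  unfold splitHomotopy flipMatrix
  by_cases h : s.Forbidden c ∧ s.res c = true ∧ t = s.flip c
  · obtain ⟨h1, h2, rfl⟩ := h
    have hfl : (s.flip c).FlipAt s c := by
      rw [EState.flipAt_iff, EState.flip_flip, EState.flip_forbidden, EState.flip_res h1,
        Function.update_self, h2]
      exact ⟨h1, rfl, rfl⟩
    rw [if_pos ⟨h1, h2, by rw [EState.flip_res h1, h2]; rfl, EState.flip_ori _ _⟩, if_pos ⟨h1, h2, rfl⟩,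
      khovanovR_of_flip hfl, cubeSign_flip h1, if_neg (lt_irrefl _), one_mul]
    rcases cubeSign_eq_or s.res c with h | h <;> rw [h] <;> norm_num
  · rw [if_neg h, if_neg, neg_zero]
    rintro ⟨h1, h2, h3, h4⟩
    refine h ⟨h1, h2, EState.ext ?_ fun e => by rw [EState.flip_ori, h4]⟩
    rw [EState.flip_res h1, h3, h2]
    rfl

theorem sum_mul_self_eq_zero {ι S : Type*} [Fintype S] [Fintype ι] (M : ι → Matrix S S ℚ)
    (h : ∀ a b, M a * M b + M b * M a = 0) : (∑ a, M a) * ∑ a, M a = 0 := by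
  have h' : (∑ a, M a) * ∑ a, M a + (∑ a, M a) * ∑ a, M a = 0 := by
    rw [Finset.sum_mul_sum]
    conv_lhs =>
      arg 2
      rw [Finset.sum_comm]
    simp only [← Finset.sum_add_distrib, h, Finset.sum_const_zero]
  ext u s
  have := congrFun (congrFun h' u) s
  rw [Matrix.add_apply, Matrix.zero_apply] at this
  rw [Matrix.zero_apply]
  linarith

theorem flipMatrix_anticomm_self (b : Bool) (c c' : D.Crossing) :
    (flipMatrix b c * flipMatrix b c' + flipMatrix b c' * flipMatrix b c :
      Matrix D.EState D.EState ℚ) = 0 := by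
  by_cases h : c = c'
  · rw [h, flipMatrix_sq, add_zero]
  · exact flipMatrix_anticomm (Ne.symm h) _ _

theorem khovanovR_mul_khovanovR : D.khovanovR * D.khovanovR = 0 := by
  rw [khovanovR_eq_sum]
  exact sum_mul_self_eq_zero _ (flipMatrix_anticomm_self false)

theorem not_inH_of_khovanovR {s t : D.EState} (h : D.khovanovR t s ≠ 0) : ¬ s.InH ∧ ¬ t.InH := by
  obtain ⟨c, hc⟩ := exists_flip h
  exact ⟨fun h => h c hc.forbidden, fun h => h c ((EState.forbidden_congr hc.ori c).2 hc.forbidden)⟩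

open Classical in
-- The parts of d_0 at other crossings anticommute with the homotopy of `c`; only the part at `c`
-- survives.
theorem splitHomotopy_anticomm (c : D.Crossing) (s t : D.EState) :
    (splitHomotopy c * D.khovanovR + D.khovanovR * splitHomotopy c) t s =
      if s.Forbidden c ∧ t = s then -1 else 0 := by
  have : splitHomotopy c * D.khovanovR + D.khovanovR * splitHomotopy c =
      -(flipMatrix true c * flipMatrix false c + flipMatrix false c * flipMatrix true c) := by
    rw [splitHomotopy_eq, khovanovR_eq_sum, neg_mul, mul_neg, ← neg_add, Finset.mul_sum,
      Finset.sum_mul, ← Finset.sum_add_distrib, Finset.sum_eq_single c]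
    · intro c' _ h
      exact flipMatrix_anticomm h _ _
    · simp
  rw [this, Matrix.neg_apply, flipMatrix_add]
  split_ifs <;> simp

/-- The diagonal matrix of the inverses of the dimensions of the hypercubes. -/
def dimInv (D : GridDiagram n) : Matrix D.EState D.EState ℚ :=
  Matrix.diagonal fun s => 1 / (s.cubeDim : ℚ)

theorem averageHomotopy_eq : D.averageHomotopy = (∑ c, splitHomotopy c) * D.dimInv := by
  classical
  ext t s
  unfold averageHomotopy dimInv
  rw [Matrix.mul_diagonal, Matrix.sum_apply, mul_comm, Finset.sum_filter]
  congr 1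
  refine Finset.sum_congr rfl fun c _ => ?_
  split_ifs with h
  · rfl
  · unfold splitHomotopy
    rw [if_neg fun h' => h h'.1]

/-- The weight of the average is constant on every hypercube, so it can be moved past all operators
that preserve hypercubes. -/
theorem dimInv_comm {M : Matrix D.EState D.EState ℚ} (h : ∀ s t, M t s ≠ 0 → t.cubeDim = s.cubeDim) :
    D.dimInv * M = M * D.dimInv := by
  classical
  ext t s
  unfold dimInv
  rw [Matrix.mul_diagonal, Matrix.diagonal_mul]
  by_cases h' : M t s = 0
  · rw [h']; ring
  · rw [h s t h']; ring

theorem khovanovR_dim {s t : D.EState} (h : D.khovanovR t s ≠ 0) : t.cubeDim = s.cubeDim := by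
  obtain ⟨c, hc⟩ := exists_flip h
  rw [(EState.flipAt_iff.1 hc).2.2, EState.cubeDim_flip]

theorem exists_flip_of_sum {s t : D.EState}
    (h : (∑ c, splitHomotopy c : Matrix D.EState D.EState ℚ) t s ≠ 0) :
    ∃ c, s.Forbidden c ∧ s.res c = true ∧ t = s.flip c := by
  classical
  rw [Matrix.sum_apply] at h
  obtain ⟨c, -, hc⟩ := Finset.exists_ne_zero_of_sum_ne_zero h
  rw [splitHomotopy_eq, Matrix.neg_apply] at hc
  unfold flipMatrix at hc
  split_ifs at hc with h'
  · exact ⟨c, h'⟩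
  · simp at hc

theorem exists_flip_of_averageHomotopy {s t : D.EState} (h : D.averageHomotopy t s ≠ 0) :
    ∃ c, s.Forbidden c ∧ s.res c = true ∧ t = s.flip c := by
  classical
  rw [averageHomotopy_eq, dimInv, Matrix.mul_diagonal] at h
  exact exists_flip_of_sum (left_ne_zero_of_mul h)

theorem sum_splitHomotopy_dim {s t : D.EState}
    (h : (∑ c, splitHomotopy c : Matrix D.EState D.EState ℚ) t s ≠ 0) : t.cubeDim = s.cubeDim := by
  obtain ⟨c, h1, h2, rfl⟩ := exists_flip_of_sum h
  exact EState.cubeDim_flip _ _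

/-- The transposed flips square to zero and anticommute, hence so does their sum square to zero.
This side condition is used in composing the inclusion and the projection of the perturbation lemma.
-/
theorem averageHomotopy_sq : D.averageHomotopy * D.averageHomotopy = 0 := by
  have h0 : (∑ c, splitHomotopy c : Matrix D.EState D.EState ℚ) * ∑ c, splitHomotopy c = 0 := by
    refine sum_mul_self_eq_zero _ fun c c' => ?_
    rw [splitHomotopy_eq, splitHomotopy_eq, neg_mul_neg, neg_mul_neg, flipMatrix_anticomm_self]
  rw [averageHomotopy_eq, Matrix.mul_assoc, ← Matrix.mul_assoc D.dimInv,
    dimInv_comm (M := ∑ c, splitHomotopy c) fun s t => sum_splitHomotopy_dim, Matrix.mul_assoc, ← Matrix.mul_assoc, h0,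
    Matrix.zero_mul]

open Classical in
-- Each forbidden crossing of `s` contributes -1 on the diagonal, and division by their number gives
-- -1. For no forbidden crossing the empty sum gives 0, whatever value division by zero has.
theorem averageHomotopy_anticomm (s t : D.EState) :
    (D.averageHomotopy * D.khovanovR + D.khovanovR * D.averageHomotopy) t s =
      if ¬ s.InH ∧ t = s then -1 else 0 := by
  rw [averageHomotopy_eq, Matrix.mul_assoc, dimInv_comm (M := D.khovanovR) fun s t => khovanovR_dim, ← Matrix.mul_assoc,
    ← Matrix.mul_assoc, ← Matrix.add_mul, dimInv, Matrix.mul_diagonal, Finset.sum_mul, Finset.mul_sum,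
    ← Finset.sum_add_distrib, Matrix.sum_apply]
  simp only [splitHomotopy_anticomm]
  by_cases hts : t = s
  · subst hts
    simp only [and_true]
    rw [← Finset.sum_filter, Finset.sum_const, nsmul_eq_mul]
    change (t.cubeDim : ℚ) * _ * _ = _
    by_cases h : t.InH
    · rw [(t.cubeDim_eq_zero_iff).2 h]
      simp [h]
    · have : (t.cubeDim : ℚ) ≠ 0 := by
        rw [← t.cubeDim_eq_zero_iff] at h
        exact_mod_cast h
      rw [if_pos h]
      field_simp
  · simp [hts]

open Classical in
/-- The projection to the states without forbidden crossings. -/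
def projH (D : GridDiagram n) : Matrix D.EState D.EState ℚ :=
  Matrix.diagonal fun s => if s.InH then 1 else 0

theorem mul_projH_eq_zero {M : Matrix D.EState D.EState ℚ} (h : ∀ s t, M t s ≠ 0 → ¬ s.InH) :
    M * D.projH = 0 := by
  classical
  ext t s
  rw [projH, Matrix.mul_diagonal, Matrix.zero_apply]
  by_cases h' : M t s = 0
  · rw [h', zero_mul]
  · rw [if_neg (h s t h'), mul_zero]

theorem projH_mul_eq_zero {M : Matrix D.EState D.EState ℚ} (h : ∀ s t, M t s ≠ 0 → ¬ t.InH) :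
    D.projH * M = 0 := by
  classical
  ext t s
  rw [projH, Matrix.diagonal_mul, Matrix.zero_apply]
  by_cases h' : M t s = 0
  · rw [h', mul_zero]
  · rw [if_neg (h s t h'), zero_mul]

theorem averageHomotopy_not_inH {s t : D.EState} (h : D.averageHomotopy t s ≠ 0) :
    ¬ s.InH ∧ ¬ t.InH := by
  obtain ⟨c, h1, h2, rfl⟩ := exists_flip_of_averageHomotopy h
  exact ⟨fun h => h c h1, fun h => h c ((EState.flip_forbidden _ _ _).2 h1)⟩

theorem homotopy_identity :
    D.averageHomotopy * D.khovanovR + D.khovanovR * D.averageHomotopy = D.projH - 1 := by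
  classical
  ext t s
  rw [averageHomotopy_anticomm, Matrix.sub_apply, projH, Matrix.diagonal_apply, Matrix.one_apply]
  by_cases hts : t = s
  · subst hts
    by_cases h : t.InH <;> simp [h]
  · simp [hts]

end GridDiagram
end GridKh

namespace GridKh

/-! ## Homological perturbation -/

/-- The data of the perturbation lemma: the differential `d0 + d1`, the homotopy `h` of `d0` to the
projection `p`, and the perturbed operator `a`. -/
structure Perturbation {R : Type*} [Ring R] (d0 d1 h p a : R) : Prop where
  d0_sq : d0 * d0 = 0
  d_sq : (d0 + d1) * (d0 + d1) = 0
  homotopy : h * d0 + d0 * h = p - 1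
  h_sq : h * h = 0
  h_p : h * p = 0
  p_h : p * h = 0
  d0_p : d0 * p = 0
  p_d0 : p * d0 = 0
  left : a = d1 + d1 * h * a
  right : a = d1 + a * h * d1

namespace Perturbation

variable {R : Type*} [Ring R] {d0 d1 h p a : R} (H : Perturbation d0 d1 h p a)

include H

theorem mul_left : d1 * (1 + h * a) = a := by
  conv_rhs => rw [H.left]
  noncomm_ring

theorem mul_right : (1 + a * h) * d1 = a := by
  conv_rhs => rw [H.right]
  noncomm_ring

/-- Since d and d_0 square to zero, so does the combination d_1 d_1 + d_0 d_1 + d_1 d_0. Multiplying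
it by `1 + a * h` and `1 + h * a` on the two sides turns each outer `d1` into `a`. -/
theorem sum_eq_zero : a * a + (1 + a * h) * d0 * a + a * d0 * (1 + h * a) = 0 := by
  have e : (1 + a * h) * ((d0 + d1) * (d0 + d1) - d0 * d0) * (1 + h * a) = 0 := by
    rw [H.d_sq, H.d0_sq]
    noncomm_ring
  have e' : (1 + a * h) * ((d0 + d1) * (d0 + d1) - d0 * d0) * (1 + h * a) =
      ((1 + a * h) * d1) * (d1 * (1 + h * a)) + (1 + a * h) * d0 * (d1 * (1 + h * a)) +
      ((1 + a * h) * d1) * d0 * (1 + h * a) := by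
    noncomm_ring
  rw [e', H.mul_left, H.mul_right] at e
  exact e

/-- The homotopy relation expresses `p` as `1 + h * d0 + d0 * h`, which turns the identity into
`sum_eq_zero`. All chain map properties follow by multiplying with `p`. -/
theorem master : a * p * a + d0 * a + a * d0 = 0 := by
  have hp : p = 1 + h * d0 + d0 * h := by
    have := H.homotopy
    rw [add_assoc, this]
    abel
  have := H.sum_eq_zero
  rw [hp, ← this]
  noncomm_ring

theorem differential_sq : p * (a * p * a) * p = 0 := by
  have e : p * (a * p * a + d0 * a + a * d0) * p = 0 := by rw [H.master]; simp
  have e1 : p * (a * p * a + d0 * a + a * d0) * p =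
      p * (a * p * a) * p + (p * d0) * a * p + p * a * (d0 * p) := by noncomm_ring
  rw [e1, H.d0_p, H.p_d0] at e
  simpa using e

/-- The perturbed inclusion is a chain map from the cancelled complex. After `d0 * h` is rewritten
by the homotopy relation, the remaining error is removed by `master`. -/
theorem inclusion : (d0 + d1) * ((1 + h * a) * p) = (1 + h * a) * p * a * p := by
  have e0 : a * p * a * p = -(d0 * a * p) := by
    have := congrArg (· * p) H.master
    simp only [zero_mul, add_mul] at this
    rw [mul_assoc a d0 p, H.d0_p, mul_zero, add_zero] at this
    exact eq_neg_of_add_eq_zero_left this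
  have e1 : d0 * h = p - 1 - h * d0 := by rw [← H.homotopy]; abel
  calc (d0 + d1) * ((1 + h * a) * p)
      = d0 * p + (d0 * h) * a * p + d1 * (1 + h * a) * p := by noncomm_ring
    _ = p * a * p + h * (-(d0 * a * p)) := by rw [H.d0_p, e1, H.mul_left]; noncomm_ring
    _ = p * a * p + h * (a * p * a * p) := by rw [e0]
    _ = _ := by noncomm_ring

theorem projection : p * (1 + a * h) * (d0 + d1) = p * a * (p * (1 + a * h)) := by
  have e0 : p * a * p * a = -(p * a * d0) := by
    have := congrArg (p * ·) H.master
    simp only [mul_zero, mul_add] at this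
    rw [← mul_assoc p d0 a, H.p_d0, zero_mul, add_zero] at this
    have := eq_neg_of_add_eq_zero_left this
    rw [← mul_assoc, ← mul_assoc, ← mul_assoc] at this
    exact this
  have e1 : h * d0 = p - 1 - d0 * h := by rw [← H.homotopy]; abel
  calc p * (1 + a * h) * (d0 + d1)
      = p * d0 + p * a * (h * d0) + p * ((1 + a * h) * d1) := by noncomm_ring
    _ = p * a * p + (-(p * a * d0)) * h := by rw [H.p_d0, e1, H.mul_right]; noncomm_ring
    _ = p * a * p + (p * a * p * a) * h := by rw [e0]
    _ = _ := by noncomm_ring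

/-- All correction terms contain `h * p`, `p * h` or `h * h`, so this composition is the identity on
the image of `p` without a homotopy. -/
theorem projection_inclusion : p * (1 + a * h) * ((1 + h * a) * p) = p * p := by
  have : p * (1 + a * h) * ((1 + h * a) * p) =
      p * p + p * a * (h * p) + (p * h) * a * p + p * a * (h * h) * a * p := by noncomm_ring
  rw [this, H.h_p, H.p_h, H.h_sq]
  simp

/-- The homotopy is `h` corrected by the same geometric series. The difference of the two sides is
`h` times `sum_eq_zero` times `h`. -/
theorem inclusion_projection : (1 + h * a) * p * (1 + a * h) =
    1 + (d0 + d1) * (h * (1 + a * h)) + (h * (1 + a * h)) * (d0 + d1) := by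
  have hp : p = 1 + h * d0 + d0 * h := by
    have := H.homotopy
    rw [add_assoc, this]
    abel
  have e1 : d1 * (h * (1 + a * h)) = a * h := by
    calc d1 * (h * (1 + a * h)) = d1 * (1 + h * a) * h := by noncomm_ring
      _ = a * h := by rw [H.mul_left]
  have e2 : (h * (1 + a * h)) * d1 = h * a := by
    rw [mul_assoc, H.mul_right]
  have e3 : h * (a * a + (1 + a * h) * d0 * a + a * d0 * (1 + h * a)) * h = 0 := by
    rw [H.sum_eq_zero]; simp
  rw [add_mul d0, e1, mul_add _ d0, e2, hp, ← sub_eq_zero, ← e3]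
  noncomm_ring

end Perturbation

/-! ## Homology of homotopy equivalent complexes -/

theorem nonempty_quotient_equiv {V W : Type*} [AddCommGroup V] [Module ℚ V] [AddCommGroup W]
    [Module ℚ W] {Z B : Submodule ℚ V} {Z' B' : Submodule ℚ W} (f : V →ₗ[ℚ] W) (g : W →ₗ[ℚ] V)
    (hfZ : ∀ z ∈ Z, f z ∈ Z') (hfB : ∀ b ∈ B, f b ∈ B') (hgZ : ∀ z ∈ Z', g z ∈ Z)
    (hgB : ∀ b ∈ B', g b ∈ B) (hgf : ∀ z ∈ Z, g (f z) - z ∈ B) (hfg : ∀ z ∈ Z', f (g z) - z ∈ B') :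
    Nonempty ((Z ⧸ B.submoduleOf Z) ≃ₗ[ℚ] (Z' ⧸ B'.submoduleOf Z')) := by
  refine ⟨LinearEquiv.ofLinearMap
    (Submodule.mapQ _ _ (f.restrict hfZ) ?_) (Submodule.mapQ _ _ (g.restrict hgZ) ?_) ?_ ?_⟩
  · exact fun z hz => hfB _ hz
  · exact fun z hz => hgB _ hz
  · refine Submodule.linearMap_qext _ (LinearMap.ext fun z => ?_)
    exact (Submodule.Quotient.eq _).2 (hfg _ z.2)
  · refine Submodule.linearMap_qext _ (LinearMap.ext fun z => ?_)
    exact (Submodule.Quotient.eq _).2 (hgf _ z.2)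

theorem mulVec_homogeneous {S T : Type} [Fintype S] {degS : S → ℤ × ℤ} {degT : T → ℤ × ℤ}
    {M : Matrix T S ℚ} {a b a' b' : ℤ} (hM : ∀ t s, M t s ≠ 0 → degS s = (a, b) → degT t = (a', b'))
    {f : S → ℚ} (hf : f ∈ homogeneous degS a b) : M.mulVec f ∈ homogeneous degT a' b' := by
  intro t ht
  refine Finset.sum_eq_zero fun s _ => ?_
  by_cases h : M t s = 0
  · exact mul_eq_zero_of_left h _
  · rw [hf s fun hs => ht (hM t s h hs), mul_zero]

/-- Homotopy equivalent complexes have isomorphic homology. -/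
theorem nonempty_homology_equiv {S T : Type} [Fintype S] [Fintype T] [DecidableEq S] [DecidableEq T]
    {degS : S → ℤ × ℤ} {degT : T → ℤ × ℤ} {dS : Matrix S S ℚ} {dT : Matrix T T ℚ}
    {f : Matrix T S ℚ} {g : Matrix S T ℚ} {h : Matrix S S ℚ} {a b a' b' : ℤ}
    (hf : f * dS = dT * f) (hg : g * dT = dS * g) (hfg : f * g = 1)
    (hgf : g * f = 1 + dS * h + h * dS)
    (df : ∀ t s, f t s ≠ 0 → ∀ k, degS s = (a + k, b) ↔ degT t = (a' + k, b'))
    (dg : ∀ s t, g s t ≠ 0 → ∀ k, degS s = (a + k, b) ↔ degT t = (a' + k, b'))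
    (dh : ∀ s t, h s t ≠ 0 → degS t = (a, b) → degS s = (a - 1, b)) :
    Nonempty (Homology degS dS a b ≃ₗ[ℚ] Homology degT dT a' b') := by
  -- The shift 0 concerns cycles in the given degree, and the shift -1 the elements whose boundaries
  -- lie there.
  have df0 : ∀ t s, f t s ≠ 0 → degS s = (a, b) → degT t = (a', b') := fun t s hn => by
    have := (df t s hn 0).1
    simpa using this
  have dg0 : ∀ s t, g s t ≠ 0 → degT t = (a', b') → degS s = (a, b) := fun s t hn => by
    have := (dg s t hn 0).2
    simpa using this
  have df1 : ∀ t s, f t s ≠ 0 → degS s = (a - 1, b) → degT t = (a' - 1, b') := fun t s hn => by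
    have := (df t s hn (-1)).1
    simpa [← sub_eq_add_neg] using this
  have dg1 : ∀ s t, g s t ≠ 0 → degT t = (a' - 1, b') → degS s = (a - 1, b) := fun s t hn => by
    have := (dg s t hn (-1)).2
    simpa [← sub_eq_add_neg] using this
  refine nonempty_quotient_equiv f.mulVecLin g.mulVecLin ?_ ?_ ?_ ?_ ?_ ?_
  · rintro z ⟨hz, hz'⟩
    refine ⟨?_, mulVec_homogeneous df0 hz'⟩
    rw [SetLike.mem_coe, LinearMap.mem_ker, Matrix.mulVecLin_apply] at *
    rw [Matrix.mulVecLin_apply, Matrix.mulVec_mulVec, ← hf, ← Matrix.mulVec_mulVec, hz,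
      Matrix.mulVec_zero]
  · rintro _ ⟨w, hw, rfl⟩
    refine ⟨f.mulVec w, mulVec_homogeneous df1 hw, ?_⟩
    simp only [Matrix.mulVecLin_apply, Matrix.mulVec_mulVec, hf]
  · rintro z ⟨hz, hz'⟩
    refine ⟨?_, mulVec_homogeneous dg0 hz'⟩
    rw [SetLike.mem_coe, LinearMap.mem_ker, Matrix.mulVecLin_apply] at *
    rw [Matrix.mulVecLin_apply, Matrix.mulVec_mulVec, ← hg, ← Matrix.mulVec_mulVec, hz,
      Matrix.mulVec_zero]
  · rintro _ ⟨w, hw, rfl⟩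
    refine ⟨g.mulVec w, mulVec_homogeneous dg1 hw, ?_⟩
    simp only [Matrix.mulVecLin_apply, Matrix.mulVec_mulVec, hg]
  · rintro z ⟨hz, hz'⟩
    refine ⟨h.mulVec z, mulVec_homogeneous dh hz', ?_⟩
    rw [SetLike.mem_coe, LinearMap.mem_ker, Matrix.mulVecLin_apply] at hz
    simp only [Matrix.mulVecLin_apply, Matrix.mulVec_mulVec, hgf, Matrix.add_mulVec,
      Matrix.one_mulVec]
    rw [← Matrix.mulVec_mulVec z h, hz, Matrix.mulVec_zero]
    abel
  · intro z _
    simp only [Matrix.mulVecLin_apply, Matrix.mulVec_mulVec, hfg, Matrix.one_mulVec, sub_self]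
    exact Submodule.zero_mem _

namespace GridDiagram

variable {n : ℕ} {D : GridDiagram n}

/-- A non-zero entry of the power comes from a strictly descending chain, and each step removes at
least one element from the set lying below. -/
theorem pow_apply_eq_zero {S : Type} [Fintype S] [DecidableEq S] (r : S → ℤ) {M : Matrix S S ℚ}
    (hM : ∀ t s, M t s ≠ 0 → r t < r s) (k : ℕ) (t s : S) (h : (M ^ k) t s ≠ 0) :
    k ≤ (Finset.univ.filter fun u => r u < r s).card := by
  induction k generalizing s with
  | zero => exact Nat.zero_le _
  | succ k ih =>
    rw [pow_succ, Matrix.mul_apply] at h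
    obtain ⟨u, -, hu⟩ := Finset.exists_ne_zero_of_sum_ne_zero h
    have h1 := ih u (left_ne_zero_of_mul hu)
    have h2 := hM u s (right_ne_zero_of_mul hu)
    refine Nat.succ_le_of_lt (h1.trans_lt (Finset.card_lt_card ?_))
    refine (Finset.ssubset_iff_of_subset fun v hv => ?_).2 ⟨u, by simpa using h2, by simp⟩
    simp only [Finset.mem_filter, Finset.mem_univ, true_and] at hv ⊢
    exact hv.trans h2

theorem pow_card_eq_zero {S : Type} [Fintype S] [DecidableEq S] (r : S → ℤ) {M : Matrix S S ℚ}
    (hM : ∀ t s, M t s ≠ 0 → r t < r s) : M ^ Fintype.card S = 0 := by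
  ext t s
  by_contra h
  have h1 := pow_apply_eq_zero r hM _ t s h
  refine absurd h1 (not_le.2 ?_)
  rw [← Finset.card_univ]
  exact Finset.card_lt_card ((Finset.ssubset_iff_of_subset (Finset.filter_subset _ _)).2
    ⟨s, Finset.mem_univ _, by simp⟩)

theorem averageHomotopy_mul_khovanovRest_lt {s t : D.EState}
    (h : (D.averageHomotopy * D.khovanovRest) t s ≠ 0) : t.R < s.R := by
  rw [Matrix.mul_apply] at h
  obtain ⟨u, -, hu⟩ := Finset.exists_ne_zero_of_sum_ne_zero h
  have h1 := khovanovRest_lt (right_ne_zero_of_mul hu)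
  obtain ⟨c, -, -, rfl⟩ := exists_flip_of_averageHomotopy (left_ne_zero_of_mul hu)
  rw [EState.R_congr (EState.flip_ori c u)]
  exact h1

/-- The finite sum is the whole geometric series, because `R` strictly decreases under h d_1 and
makes this matrix nilpotent. -/
theorem cancelled_eq_left : D.cancelled =
    D.khovanovRest + D.khovanovRest * D.averageHomotopy * D.cancelled := by
  set M := D.averageHomotopy * D.khovanovRest with hM
  have h0 : M ^ Fintype.card D.EState = 0 :=
    pow_card_eq_zero EState.R fun t s => averageHomotopy_mul_khovanovRest_lt
  have h1 : D.cancelled = D.khovanovRest * ∑ k ∈ Finset.range (Fintype.card D.EState), M ^ k := by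
    unfold cancelled
    rw [Finset.mul_sum]
  have h2 : (1 - M) * ∑ k ∈ Finset.range (Fintype.card D.EState), M ^ k = 1 := by
    rw [mul_neg_geom_sum, h0, sub_zero]
  set Y := ∑ k ∈ Finset.range (Fintype.card D.EState), M ^ k
  have h3 : Y = 1 + M * Y := by
    rw [sub_mul, one_mul] at h2
    rw [← h2]
    abel
  rw [h1]
  conv_lhs => rw [h3, mul_add, mul_one, hM]
  simp only [mul_assoc]

theorem cancelled_eq_right : D.cancelled =
    D.khovanovRest + D.cancelled * D.averageHomotopy * D.khovanovRest := by
  set M := D.averageHomotopy * D.khovanovRest with hM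
  have h0 : M ^ Fintype.card D.EState = 0 :=
    pow_card_eq_zero EState.R fun t s => averageHomotopy_mul_khovanovRest_lt
  have h1 : D.cancelled = D.khovanovRest * ∑ k ∈ Finset.range (Fintype.card D.EState), M ^ k := by
    unfold cancelled
    rw [Finset.mul_sum]
  have h2 : (∑ k ∈ Finset.range (Fintype.card D.EState), M ^ k) * (1 - M) = 1 := by
    rw [geom_sum_mul_neg, h0, sub_zero]
  set Y := ∑ k ∈ Finset.range (Fintype.card D.EState), M ^ k
  have h3 : Y = 1 + Y * M := by
    rw [mul_sub, mul_one] at h2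
    rw [← h2]
    abel
  rw [h1]
  conv_lhs => rw [h3, mul_add, mul_one, hM]
  simp only [mul_assoc]

theorem perturbation : Perturbation D.khovanovR D.khovanovRest D.averageHomotopy D.projH
    D.cancelled where
  d0_sq := khovanovR_mul_khovanovR
  d_sq := by
    unfold khovanovRest
    rw [add_sub_cancel, khovanov_mul_khovanov]
  homotopy := homotopy_identity
  h_sq := averageHomotopy_sq
  h_p := mul_projH_eq_zero fun s t h => (averageHomotopy_not_inH h).1
  p_h := projH_mul_eq_zero fun s t h => (averageHomotopy_not_inH h).2
  d0_p := mul_projH_eq_zero fun s t h => (not_inH_of_khovanovR h).1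
  p_d0 := projH_mul_eq_zero fun s t h => (not_inH_of_khovanovR h).2
  left := cancelled_eq_left
  right := cancelled_eq_right

/-! ### Degrees -/

/-- The matrix has degree `(k, 0)` for the bigrading `(i, j)`. -/
def HasDegree (M : Matrix D.EState D.EState ℚ) (k : ℤ) : Prop :=
  ∀ t s, M t s ≠ 0 → t.i = s.i + k ∧ t.j = s.j

theorem HasDegree.mul {M N : Matrix D.EState D.EState ℚ} {k l : ℤ} (hM : HasDegree M k)
    (hN : HasDegree N l) : HasDegree (M * N) (k + l) := by
  intro t s h
  rw [Matrix.mul_apply] at h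
  obtain ⟨u, -, hu⟩ := Finset.exists_ne_zero_of_sum_ne_zero h
  have h1 := hM t u (left_ne_zero_of_mul hu)
  have h2 := hN u s (right_ne_zero_of_mul hu)
  exact ⟨by omega, h1.2.trans h2.2⟩

theorem hasDegree_one : HasDegree (1 : Matrix D.EState D.EState ℚ) 0 := by
  intro t s h
  rw [Matrix.one_apply] at h
  split_ifs at h with hts
  · simp [hts]
  · exact absurd rfl h

theorem HasDegree.pow {M : Matrix D.EState D.EState ℚ} (hM : HasDegree M 0) (k : ℕ) :
    HasDegree (M ^ k) 0 := by
  induction k with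
  | zero => rw [pow_zero]; exact hasDegree_one
  | succ k ih => rw [pow_succ]; exact ih.mul hM

theorem HasDegree.add {M N : Matrix D.EState D.EState ℚ} {k : ℤ} (hM : HasDegree M k)
    (hN : HasDegree N k) : HasDegree (M + N) k := by
  intro t s h
  rw [Matrix.add_apply] at h
  by_cases h' : M t s = 0
  · rw [h', zero_add] at h
    exact hN t s h
  · exact hM t s h'

theorem hasDegree_khovanovRest : HasDegree D.khovanovRest 1 := by
  intro t s h
  refine khovanov_degree fun h0 => h ?_
  unfold khovanovRest
  rw [Matrix.sub_apply]
  unfold khovanovR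
  rw [h0]
  simp

/-- Every entry of h reverses a flip of d_0, and a flip has degree (1, 0). -/
theorem hasDegree_averageHomotopy : HasDegree D.averageHomotopy (-1) := by
  intro t s h
  obtain ⟨c, h1, h2, rfl⟩ := exists_flip_of_averageHomotopy h
  have hfl : (s.flip c).FlipAt s c := by
    rw [EState.flipAt_iff, EState.flip_flip, EState.flip_forbidden, EState.flip_res h1,
      Function.update_self, h2]
    exact ⟨h1, rfl, rfl⟩
  have hne : D.khovanov s (s.flip c) ≠ 0 := by
    have := khovanovR_of_flip hfl
    unfold khovanovR at this
    split_ifs at this with hR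
    · rw [this]
      exact cubeSign_ne_zero _ _
    · exact absurd this.symm (cubeSign_ne_zero _ _)
  have := khovanov_degree hne
  exact ⟨by omega, this.2.symm⟩

theorem hasDegree_cancelled : HasDegree D.cancelled 1 := by
  intro t s h
  unfold cancelled at h
  rw [Matrix.sum_apply] at h
  obtain ⟨k, -, hk⟩ := Finset.exists_ne_zero_of_sum_ne_zero h
  refine (hasDegree_khovanovRest.mul (HasDegree.pow ?_ k)) t s hk
  exact hasDegree_averageHomotopy.mul hasDegree_khovanovRest

end GridDiagram
end GridKh

namespace GridKh
namespace GridDiagram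

variable {n : ℕ} {D : GridDiagram n}

/-! ## Generators are the states without forbidden crossings -/

/-- An upward closed condition on an interval begins at some point; the end `b` is the value when it
never holds. -/
theorem exists_threshold (P : ℕ → Prop) (a b : ℕ) (hab : a ≤ b)
    (h : ∀ r, a ≤ r → r + 1 < b → P r → P (r + 1)) :
    ∃ σ, a ≤ σ ∧ σ ≤ b ∧ ∀ r, a ≤ r → r < b → (P r ↔ σ ≤ r) := by
  induction b, hab using Nat.le_induction with
  | base => exact ⟨a, le_rfl, le_rfl, fun r h1 h2 => absurd h1 (not_le.2 h2)⟩
  | succ b hab ih =>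
    obtain ⟨σ, h1, h2, h3⟩ := ih fun r h1 h2 => h r h1 (by omega)
    by_cases hσ : σ < b
    · refine ⟨σ, h1, by omega, fun r k1 k2 => ?_⟩
      by_cases hr : r < b
      · exact h3 r k1 hr
      · have e : r = (b - 1) + 1 := by omega
        refine iff_of_true ?_ (by omega)
        rw [e]
        exact h _ (by omega) (by omega) ((h3 _ (by omega) (by omega)).2 (by omega))
    · by_cases hb : P b
      · refine ⟨σ, h1, by omega, fun r k1 k2 => ?_⟩
        by_cases hr : r < b
        · exact h3 r k1 hr
        · have e : r = b := by omega
          exact iff_of_true (e ▸ hb) (by omega)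
      · refine ⟨b + 1, by omega, le_rfl, fun r k1 k2 => ?_⟩
        by_cases hr : r < b
        · rw [h3 r k1 hr]; omega
        · have e : r = b := by omega
          exact iff_of_false (e ▸ hb) (by omega)

namespace EState

variable (s : D.EState)

/-- The half-edge at `v` in direction `d` exists and is oriented away from `v`. -/
def Out (v : Fin n × Fin n) (d : Dir) : Prop := ∃ e, D.IsAt v d e ∧ d.outward (s.ori e) = true

variable {s}

theorem out_iff {v : Fin n × Fin n} {d : Dir} {e : D.Edge} (h : D.IsAt v d e) :
    s.Out v d ↔ d.outward (s.ori e) = true :=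
  ⟨fun ⟨_, h1, h2⟩ => h1.edge_unique h ▸ h2, fun h' => ⟨e, h, h'⟩⟩

theorem out_linked {v : Fin n × Fin n} {d d' : Dir} (h : D.HasEdge v d) (h' : D.HasEdge v d')
    (hl : Linked s.res v d d') : s.Out v d ↔ ¬ s.Out v d' := by
  obtain ⟨e, he⟩ := (hasEdge_iff v d).1 h
  obtain ⟨e', he'⟩ := (hasEdge_iff v d').1 h'
  rw [out_iff he, out_iff he']
  have h1 : d.outward (s.ori e) = !d'.outward (s.ori e') := s.2 v d d' e e' he he' hl
  rw [h1]
  cases d'.outward (s.ori e') <;> simp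

theorem out_N_iff {c r r' : Fin n} (h : D.HasEdge (c, r) .N) (hr : r'.val = r.val + 1) :
    s.Out (c, r) .N ↔ ¬ s.Out (c, r') .S := by
  obtain ⟨e, he⟩ := (hasEdge_iff _ _).1 h
  have he' : D.IsAt (c, r') .S e := by
    rw [isAt_iff] at he ⊢
    rw [he]
    unfold latticePt
    rw [hr]
    ext <;> simp [Dir.vec]
    ring
  rw [out_iff he, out_iff he']
  simp [Dir.outward]

theorem out_E_iff {c c' r : Fin n} (h : D.HasEdge (c, r) .E) (hc : c'.val = c.val + 1) :
    s.Out (c, r) .E ↔ ¬ s.Out (c', r) .W := by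
  obtain ⟨e, he⟩ := (hasEdge_iff _ _).1 h
  have he' : D.IsAt (c', r) .W e := by
    rw [isAt_iff] at he ⊢
    rw [he]
    unfold latticePt
    rw [hc]
    ext <;> simp [Dir.vec]
    ring
  rw [out_iff he, out_iff he']
  simp [Dir.outward]

theorem forbidden_of_out {c : D.Crossing} (h : ∀ d, s.Out c.1 d ↔ d = .E ∨ d = .W) :
    s.Forbidden c := fun d e he => by rw [← out_iff he, h]

theorem out_partner {c : D.Crossing} (d : Dir) :
    s.Out c.1 d ↔ ¬ s.Out c.1 (Dir.partner (s.res c) d) :=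
  out_linked (IsCrossing.hasEdge c.2 _) (IsCrossing.hasEdge c.2 _) (c.linked_partner _ d)

/-- At a crossing which is not forbidden, two opposite strands do not go from the vertical ones to
the horizontal ones. -/
theorem not_out_N_S {c : D.Crossing} (h : ¬ s.Forbidden c) : s.Out c.1 .N ∨ s.Out c.1 .S := by
  by_contra! h'
  refine h (forbidden_of_out fun d => ?_)
  have hE := out_partner (s := s) (c := c) .E
  have hW := out_partner (s := s) (c := c) .W
  cases hr : s.res c <;> rw [hr] at hE hW <;> cases d <;> simp_all [Dir.partner]

/-- Going up a column, an upward edge cannot be followed by a downward one: both would point to the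
point between them, which would be a forbidden crossing or an incoherent straight passage. So the
orientation has a single source, possibly an end of the segment. -/
theorem exists_sigma (hs : s.InH) (c : Fin n) : ∃ σ : Fin n, D.bot c ≤ σ ∧ σ ≤ D.top c ∧
    (∀ r, D.HasEdge (c, r) .N → (s.Out (c, r) .N ↔ σ ≤ r)) ∧
    ∀ r, D.HasEdge (c, r) .S → (s.Out (c, r) .S ↔ r ≤ σ) := by
  obtain ⟨σ, h1, h2, h3⟩ := exists_threshold (fun r => ∃ h : r < n, s.Out (c, ⟨r, h⟩) .N) (D.bot c).val
    (D.top c).val (D.bot_lt_top c).le (by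
      rintro r hr1 hr2 ⟨hr3, hr4⟩
      have hn : r + 1 < n := by omega
      refine ⟨hn, ?_⟩
      have hN : D.HasEdge (c, ⟨r, hr3⟩) .N := by
        simp only [HasEdge, Fin.le_def, Fin.lt_def]; omega
      have hS' : ¬ s.Out (c, ⟨r + 1, hn⟩) .S := (out_N_iff hN rfl).1 hr4
      have eN : D.HasEdge (c, ⟨r + 1, hn⟩) .N := by
        simp only [HasEdge, Fin.le_def, Fin.lt_def]; omega
      have eS : D.HasEdge (c, ⟨r + 1, hn⟩) .S := by
        simp only [HasEdge, Fin.le_def, Fin.lt_def]; omega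
      by_cases hv : D.IsCrossing (c, ⟨r + 1, hn⟩)
      · exact (not_out_N_S (hs ⟨_, hv⟩)).resolve_right hS'
      · exact (out_linked eN eS (.inr ⟨hv, by simp⟩)).2 hS')
  have hn : σ < n := by omega
  have h3' : ∀ r, D.HasEdge (c, r) .N → (s.Out (c, r) .N ↔ (⟨σ, hn⟩ : Fin n) ≤ r) := by
    rintro r ⟨k1, k2⟩
    have := h3 r.val k1 k2
    rw [Fin.le_def, ← this]
    exact ⟨fun h => ⟨r.2, h⟩, fun ⟨_, h⟩ => h⟩
  refine ⟨⟨σ, hn⟩, h1, h2, h3', ?_⟩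
  rintro r ⟨k1, k2⟩
  simp only [Fin.lt_def, Fin.le_def] at k1 k2
  have hr : r.val - 1 < n := by omega
  have hN : D.HasEdge (c, ⟨r.val - 1, hr⟩) .N := by
        simp only [HasEdge, Fin.le_def, Fin.lt_def]; omega
  have := (out_N_iff (s := s) hN (r' := r) (by simp only; omega)).symm.trans (h3' _ hN)
  rw [← not_iff_not, this, Fin.le_def, Fin.le_def]
  simp only
  omega

/-- In a row, a leftward edge followed by a rightward one would leave a point on both horizontal
sides. At a crossing the vertical edges would then come in and the crossing would be forbidden. So
the row has a single sink. -/
theorem exists_tau (hs : s.InH) (r : Fin n) : ∃ τ : Fin n, D.left r ≤ τ ∧ τ ≤ D.right r ∧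
    (∀ c, D.HasEdge (c, r) .E → (s.Out (c, r) .E ↔ c < τ)) ∧
    ∀ c, D.HasEdge (c, r) .W → (s.Out (c, r) .W ↔ τ < c) := by
  obtain ⟨τ, h1, h2, h3⟩ := exists_threshold (fun c => ∃ h : c < n, ¬ s.Out (⟨c, h⟩, r) .E)
    (D.left r).val (D.right r).val (D.left_lt_right r).le (by
      rintro c hr1 hr2 ⟨hr3, hr4⟩
      have hn : c + 1 < n := by omega
      refine ⟨hn, fun hE => ?_⟩
      have hN : D.HasEdge (⟨c, hr3⟩, r) .E := by
        simp only [HasEdge, Fin.le_def, Fin.lt_def]; omega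
      have hW : s.Out (⟨c + 1, hn⟩, r) .W := not_not.1 (mt (out_E_iff hN rfl).2 hr4)
      have eN : D.HasEdge (⟨c + 1, hn⟩, r) .E := by
        simp only [HasEdge, Fin.le_def, Fin.lt_def]; omega
      have eS : D.HasEdge (⟨c + 1, hn⟩, r) .W := by
        simp only [HasEdge, Fin.le_def, Fin.lt_def]; omega
      by_cases hv : D.IsCrossing (⟨c + 1, hn⟩, r)
      · have h1 := out_partner (s := s) (c := ⟨_, hv⟩) .N
        have h2 := out_partner (s := s) (c := ⟨_, hv⟩) .S
        have h3 := not_out_N_S (hs ⟨_, hv⟩)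
        cases hr : s.res ⟨_, hv⟩ <;> rw [hr] at h1 h2 <;> simp_all [Dir.partner]
      · exact (out_linked eN eS (.inr ⟨hv, by simp⟩)).1 hE hW)
  have hn : τ < n := by omega
  have h3' : ∀ c, D.HasEdge (c, r) .E → (s.Out (c, r) .E ↔ c < (⟨τ, hn⟩ : Fin n)) := by
    rintro c ⟨k1, k2⟩
    have := h3 c.val k1 k2
    rw [← not_iff_not, not_lt, Fin.le_def, ← this]
    exact ⟨fun h => ⟨c.2, h⟩, fun ⟨_, h⟩ => h⟩
  refine ⟨⟨τ, hn⟩, h1, h2, h3', ?_⟩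
  rintro c ⟨k1, k2⟩
  simp only [Fin.lt_def, Fin.le_def] at k1 k2
  have hr : c.val - 1 < n := by omega
  have hN : D.HasEdge (⟨c.val - 1, hr⟩, r) .E := by
        simp only [HasEdge, Fin.le_def, Fin.lt_def]; omega
  have := (out_E_iff (s := s) hN (c' := c) (by simp only; omega)).symm.trans (h3' _ hN)
  rw [← not_iff_not, this, Fin.lt_def, Fin.lt_def]
  simp only
  omega

/-- At the source of a column all vertical half-edges go out, so coherence makes all horizontal ones
come in. The point is therefore the sink of its row. -/
theorem tau_sigma {c r τ : Fin n} (hb : D.bot c ≤ r) (ht : r ≤ D.top c)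
    (hN : ∀ r', D.HasEdge (c, r') .N → (s.Out (c, r') .N ↔ r ≤ r'))
    (hS : ∀ r', D.HasEdge (c, r') .S → (s.Out (c, r') .S ↔ r' ≤ r))
    (hl : D.left r ≤ τ) (hr : τ ≤ D.right r)
    (hE : ∀ c', D.HasEdge (c', r) .E → (s.Out (c', r) .E ↔ c' < τ))
    (hW : ∀ c', D.HasEdge (c', r) .W → (s.Out (c', r) .W ↔ τ < c')) : τ = c := by
  have hout : ∀ d, (d = .N ∨ d = .S) → D.HasEdge (c, r) d → s.Out (c, r) d := by
    rintro d (rfl | rfl) h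
    · exact (hN r h).2 le_rfl
    · exact (hS r h).2 le_rfl
  have hex : D.HasEdge (c, r) .N ∨ D.HasEdge (c, r) .S := by
    rcases lt_or_eq_of_le ht with h | h
    · exact .inl ⟨hb, h⟩
    · exact .inr ⟨h ▸ D.bot_lt_top c, ht⟩
  have hin : ∀ d, (d = .E ∨ d = .W) → D.HasEdge (c, r) d → ¬ s.Out (c, r) d := by
    intro d hd h
    by_cases hv : D.IsCrossing (c, r)
    · refine (out_partner (s := s) (c := ⟨_, hv⟩) d).not.2 (not_not.2 (hout _ ?_ (hv.hasEdge _)))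
      rcases hd with rfl | rfl <;> cases s.res ⟨_, hv⟩ <;> simp [Dir.partner]
    · rcases hex with h' | h'
      · refine (out_linked h h' (.inr ⟨hv, ?_⟩)).not.2 (not_not.2 (hout _ (.inl rfl) h'))
        rcases hd with rfl | rfl <;> simp
      · refine (out_linked h h' (.inr ⟨hv, ?_⟩)).not.2 (not_not.2 (hout _ (.inr rfl) h'))
        rcases hd with rfl | rfl <;> simp
  have hEW : D.HasEdge (c, r) .E ∨ D.HasEdge (c, r) .W := by
    by_cases hv : D.IsCrossing (c, r)
    · exact .inl (hv.hasEdge _)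
    · by_contra! hno
      have hboth : D.HasEdge (c, r) .N ∧ D.HasEdge (c, r) .S := by
        rcases hex with h | h <;> obtain ⟨d', hd, h'⟩ := h.exists_ne <;> cases d' <;> simp_all
      exact (out_linked hboth.1 hboth.2 (.inr ⟨hv, by simp⟩)).1 (hout _ (.inl rfl) hboth.1)
        (hout _ (.inr rfl) hboth.2)
  have kE : D.HasEdge (c, r) .E → τ ≤ c := fun h => not_lt.1 ((hE c h).not.1 (hin _ (.inl rfl) h))
  have kW : D.HasEdge (c, r) .W → c ≤ τ := fun h => not_lt.1 ((hW c h).not.1 (hin _ (.inr rfl) h))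
  unfold HasEdge at hEW kE kW
  simp only at hEW kE kW
  have := D.left_lt_right r
  simp only [Fin.lt_def, Fin.le_def, Fin.ext_iff] at *
  omega

end EState

theorem Gen.out_iff (F : D.FigureEights) (g : D.Gen) {c r : Fin n} {d : Dir}
    (h : D.HasEdge (c, r) d) : (F.toState g).Out (c, r) d ↔
      match d with
      | .N => g.perm c ≤ r
      | .S => r ≤ g.perm c
      | .E => c < g.perm.symm r
      | .W => g.perm.symm r < c := by
  obtain ⟨e, he⟩ := (hasEdge_iff _ _).1 h
  rw [EState.out_iff he]
  have := g.outward_iff c r d e he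
  cases d <;> exact this.2

/-- At any row of a column, the point of `g` lies weakly below or weakly above, so one of the two
vertical half-edges goes out. -/
theorem toState_inH (F : D.FigureEights) (g : D.Gen) : (F.toState g).InH := by
  intro c hc
  have h1 := Gen.out_iff F g (IsCrossing.hasEdge c.2 .N)
  have h2 := Gen.out_iff F g (IsCrossing.hasEdge c.2 .S)
  have hN : ¬ (F.toState g).Out c.1 .N := by
    rw [EState.out_iff (c.isAt_edge _), hc _ _ (c.isAt_edge _)]
    simp
  have hS : ¬ (F.toState g).Out c.1 .S := by
    rw [EState.out_iff (c.isAt_edge _), hc _ _ (c.isAt_edge _)]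
    simp
  exact (le_total (g.perm c.1.1) c.1.2).elim (fun h => hN (h1.2 h)) (fun h => hS (h2.2 h))

theorem Gen.perm_eq_of_ori {g g' : D.Gen} (h : g.ori = g'.ori) : g.perm = g'.perm := by
  ext c
  by_contra hne
  have key : ∀ g g' : D.Gen, g.ori = g'.ori → ¬ g.perm c < g'.perm c := by
    intro g g' h hlt
    have h1 := g.bounds c
    have h2 := g'.bounds c
    have e := congrFun h (.inr ⟨(c, g.perm c), h1.1, hlt.trans_le h2.2.1⟩)
    simp only [Gen.ori, le_refl, decide_true] at e
    exact absurd (of_decide_eq_true e.symm) (not_le.2 hlt)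
  rcases lt_trichotomy (g.perm c) (g'.perm c) with h' | h' | h'
  · exact key _ _ h h'
  · exact hne (congrArg _ h')
  · exact key _ _ h.symm h'

theorem Gen.ext {g g' : D.Gen} (h : g.perm = g'.perm)
    (h' : ∀ c, (g.pt c).onRight = (g'.pt c).onRight) : g = g' := by
  refine Subtype.ext (funext fun c => Subtype.ext (Prod.ext (Prod.ext ?_ ?_) ?_))
  · exact (g.2.1 c).trans (g'.2.1 c).symm
  · exact congrArg (· c) h
  · exact h' c

theorem Gen.pt_col (g : D.Gen) (c : Fin n) : (g.pt c).col = c := g.2.1 c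

theorem Gen.pt_row (g : D.Gen) (c : Fin n) : (g.pt c).row = g.perm c := rfl

theorem Gen.pt_right {g : D.Gen} {c : Fin n} (h : (g.pt c).onRight = true) :
    D.left (g.perm c) ≤ c ∧ c < D.right (g.perm c) := by
  have := (g.pt c).2.2.2.1 h
  rw [show (g.pt c).1.1.1 = c from g.2.1 c] at this
  exact this

theorem Gen.pt_left {g : D.Gen} {c : Fin n} (h : (g.pt c).onRight = false) :
    D.left (g.perm c) < c ∧ c ≤ D.right (g.perm c) := by
  have := (g.pt c).2.2.2.2 h
  rw [show (g.pt c).1.1.1 = c from g.2.1 c] at this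
  exact this

theorem FigureEights.isUp_pt (F : D.FigureEights) (g : D.Gen) (c : Fin n) : F.IsUp (g.pt c) ↔
    ((g.pt c).onRight = true ↔ g.perm c ≤ F.split c) := by
  unfold FigureEights.IsUp
  rw [g.pt_col, g.pt_row]
  rcases le_or_gt (g.perm c) (F.split c) with h | h <;> cases (g.pt c).onRight <;>
    simp [h, not_lt.2, not_le.2]

theorem isCrossing_of_bounds {c r : Fin n} (h1 : D.left r < c) (h2 : c < D.right r)
    (h3 : D.bot c ≤ r) (h4 : r ≤ D.top c) : D.IsCrossing (c, r) := by
  have := D.corner_iff c r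
  refine ⟨h1, h2, lt_of_le_of_ne h3 fun h => ?_, lt_of_le_of_ne h4 fun h => ?_⟩
  · exact (this.2 (.inl h.symm)).elim h1.ne' h2.ne
  · exact (this.2 (.inr h)).elim h1.ne' h2.ne

/-- The orientation determines the sources, hence the permutation. At a crossing the smoothing then
determines the side of the figure-eight; at a corner only one side meets the horizontal segment. -/
theorem toState_injective (F : D.FigureEights) : Function.Injective F.toState := by
  intro g g' h
  have hori : g.ori = g'.ori := congrArg EState.ori h
  have hres : F.res g = F.res g' := congrArg EState.res h
  have hp := Gen.perm_eq_of_ori hori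
  refine Gen.ext hp fun c => ?_
  by_cases hv : D.IsCrossing (c, g.perm c)
  · have e := congrFun hres ⟨_, hv⟩
    unfold FigureEights.res at e
    rw [if_pos rfl, if_pos (congrArg (· c) hp).symm] at e
    have e' := decide_eq_decide.1 e
    rw [F.isUp_pt, F.isUp_pt, ← hp, not_iff_not] at e'
    by_cases hl : g.perm c ≤ F.split c <;> simp only [hl, iff_true, iff_false] at e' <;>
      cases hx : (g.pt c).onRight <;> cases hy : (g'.pt c).onRight <;> simp_all
  · have b1 := g.bounds c
    by_contra hne
    refine hv ?_
    cases hx : (g.pt c).onRight <;> cases hy : (g'.pt c).onRight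
    · exact absurd (hx.trans hy.symm) hne
    · have := Gen.pt_left hx
      have h2 := Gen.pt_right hy
      rw [← hp] at h2
      exact isCrossing_of_bounds this.1 h2.2 b1.1 b1.2.1
    · have := Gen.pt_right hx
      have h2 := Gen.pt_left hy
      rw [← hp] at h2
      exact isCrossing_of_bounds h2.1 this.2 b1.1 b1.2.1
    · exact absurd (hx.trans hy.symm) hne

open Classical in
/-- The side of the figure-eight on which a generator with a given resolution lies. -/
def sideOf (F : D.FigureEights) (ρ : D.Resolution) (c r : Fin n) : Bool :=
  if h : D.IsCrossing (c, r) then (if r ≤ F.split c then !ρ ⟨_, h⟩ else ρ ⟨_, h⟩)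
  else decide (c < D.right r)

theorem exists_toState_eq (F : D.FigureEights) {s : D.EState} (hs : s.InH) :
    ∃ g, F.toState g = s := by
  choose σ hσb hσt hσN hσS using EState.exists_sigma hs
  choose τ hτl hτr hτE hτW using EState.exists_tau hs
  have hτσ : ∀ c, τ (σ c) = c := fun c => EState.tau_sigma (hσb c) (hσt c) (hσN c) (hσS c) (hτl _)
    (hτr _) (hτE _) (hτW _)
  have hlr : ∀ c, D.left (σ c) ≤ c ∧ c ≤ D.right (σ c) := fun c => by
    have h1 := hτl (σ c)
    have h2 := hτr (σ c)
    rw [hτσ] at h1 h2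
    exact ⟨h1, h2⟩
  have hinj : Function.Injective σ := fun a b h => by rw [← hτσ a, h, hτσ]
  let g : D.Gen := ⟨fun c => ⟨((c, σ c), sideOf F s.res c (σ c)), hσb c, hσt c, by
      intro h
      refine ⟨(hlr c).1, ?_⟩
      by_cases hv : D.IsCrossing (c, σ c)
      · exact hv.2.1
      · simp only [sideOf, dif_neg hv, decide_eq_true_eq] at h
        exact h, by
      intro h
      refine ⟨?_, (hlr c).2⟩
      by_cases hv : D.IsCrossing (c, σ c)
      · exact hv.1
      · simp only [sideOf, dif_neg hv, decide_eq_false_iff_not, not_lt] at h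
        exact (D.left_lt_right _).trans_le h⟩,
    fun c => rfl, Finite.injective_iff_bijective.1 hinj⟩
  have hgσ : ∀ c, g.perm c = σ c := fun c => rfl
  have hgτ : ∀ r, g.perm.symm r = τ r := fun r => by
    rw [Equiv.symm_apply_eq, hgσ]
    obtain ⟨c, rfl⟩ := (Finite.injective_iff_bijective.1 hinj).2 r
    rw [hτσ]
  have hori : (F.toState g).ori = s.ori := by
    funext e
    rw [Bool.eq_iff_iff]
    rcases e with e | e
    · have he : D.IsAt e.1 .E (.inl e) := rfl
      have h1 := EState.out_iff (s := s) he
      have h2 := EState.out_iff (s := F.toState g) he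
      refine h2.symm.trans (Iff.trans ?_ h1)
      rw [hτE e.1.2 e.1.1 he.hasEdge, ← hgτ]
      exact Gen.out_iff F g he.hasEdge
    · have he : D.IsAt e.1 .N (.inr e) := rfl
      have h1 := EState.out_iff (s := s) he
      have h2 := EState.out_iff (s := F.toState g) he
      refine h2.symm.trans (Iff.trans ?_ h1)
      rw [hσN e.1.1 e.1.2 he.hasEdge, ← hgσ]
      exact Gen.out_iff F g he.hasEdge
  refine ⟨g, EState.ext (funext fun c => ?_) fun e => congrFun hori e⟩
  obtain ⟨⟨c, r⟩, hv⟩ := c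
  by_cases hr : σ c = r
  · subst hr
    change F.res g _ = _
    unfold FigureEights.res
    simp only
    rw [if_pos (hgσ c), F.isUp_pt, hgσ]
    have : (g.pt c).onRight = sideOf F s.res c (σ c) := rfl
    rw [this, sideOf, dif_pos hv]
    split_ifs with h <;> cases s.res ⟨(c, σ c), hv⟩ <;> simp [h]
  -- If both smoothings were coherent, the vertical half-edges would go out together or come in
  -- together. The thresholds allow this only at the source of the column.
  · have key : ∀ t t' : D.EState, t.ori = t'.ori → t.ori = s.ori → t.res ⟨(c, r), hv⟩ = false →
        t'.res ⟨(c, r), hv⟩ = true → False := by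
      intro t t' h1 h2 h3 h4
      have h5 := (EState.outward_of_both h1 h3 h4).1
      have hN := (hσN c r (hv.hasEdge _))
      have hS := (hσS c r (hv.hasEdge _))
      rw [EState.out_iff (Crossing.isAt_edge ⟨(c, r), hv⟩ _), ← h2] at hN hS
      rw [h5] at hS
      exact hr (le_antisymm (by by_contra h; exact h (hN.1 (hS.2 (le_of_not_ge h))))
        (by by_contra h; exact h (hS.1 (hN.2 (le_of_not_ge h)))))
    cases h1 : (F.toState g).res ⟨(c, r), hv⟩ <;> cases h2 : s.res ⟨(c, r), hv⟩
    · rfl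
    · exact (key _ _ hori hori h1 h2).elim
    · exact (key _ _ hori.symm rfl h2 h1).elim
    · rfl

end GridDiagram
end GridKh

namespace GridKh
namespace GridDiagram

variable {n : ℕ} {D : GridDiagram n}

/-! ## Homology of the cancelled complex -/

section Cancel

variable (F : D.FigureEights)

theorem submatrix_mul_id {A B C : Type} (M : Matrix A D.EState ℚ) (N : Matrix D.EState B ℚ)
    (f : C → A) {E : Type} (g : E → B) :
    M.submatrix f id * N.submatrix id g = (M * N).submatrix f g :=
  (Matrix.submatrix_mul M N f id g Function.bijective_id).symm

/-- The inclusion of the states of the generators. -/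
def genIncl : Matrix D.EState D.Gen ℚ := (1 : Matrix D.EState D.EState ℚ).submatrix id F.toState

/-- The projection to the states of the generators. -/
def genProj : Matrix D.Gen D.EState ℚ := (1 : Matrix D.EState D.EState ℚ).submatrix F.toState id

theorem mul_genIncl (M : Matrix D.EState D.EState ℚ) :
    M * genIncl F = M.submatrix id F.toState := by
  unfold genIncl
  have := submatrix_mul_id M 1 id F.toState
  rwa [Matrix.submatrix_id_id, mul_one] at this

theorem genProj_mul (M : Matrix D.EState D.EState ℚ) :
    genProj F * M = M.submatrix F.toState id := by
  unfold genProj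
  have := submatrix_mul_id 1 M F.toState id
  rwa [Matrix.submatrix_id_id, one_mul] at this

theorem genProj_mul_genIncl : genProj F * genIncl F = 1 := by
  unfold genProj genIncl
  rw [submatrix_mul_id, mul_one]
  ext g g'
  rw [Matrix.submatrix_apply, Matrix.one_apply, Matrix.one_apply]
  simp only [(toState_injective F).eq_iff]

/-- This restates that `toState` is a bijection onto the states without forbidden crossings. -/
theorem genIncl_mul_genProj : genIncl F * genProj F = D.projH := by
  classical
  ext s t
  rw [Matrix.mul_apply, projH, Matrix.diagonal_apply]
  unfold genIncl genProj
  simp only [Matrix.submatrix_apply, Matrix.one_apply, id_eq]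
  by_cases hs : s.InH
  · obtain ⟨g, rfl⟩ := exists_toState_eq F hs
    rw [Finset.sum_eq_single g]
    · simp [hs]
    · intro g' _ hg
      rw [if_neg fun h => hg (toState_injective F h).symm, zero_mul]
    · simp
  · rw [Finset.sum_eq_zero, if_neg hs, ite_self]
    intro g _
    rw [if_neg, zero_mul]
    rintro rfl
    exact hs (toState_inH F g)

theorem differential_eq : F.differential = genProj F * D.cancelled * genIncl F := by
  rw [genProj_mul]
  unfold genIncl
  rw [submatrix_mul_id, mul_one]
  rfl

theorem genProj_mul_projH : genProj F * D.projH = genProj F := by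
  rw [← genIncl_mul_genProj F, ← Matrix.mul_assoc, genProj_mul_genIncl, Matrix.one_mul]

theorem projH_mul_genIncl : D.projH * genIncl F = genIncl F := by
  rw [← genIncl_mul_genProj F, Matrix.mul_assoc, genProj_mul_genIncl, Matrix.mul_one]

theorem differential_mul_differential : F.differential * F.differential = 0 := by
  have h := (perturbation (D := D)).differential_sq
  have e : F.differential * F.differential =
      genProj F * (D.projH * (D.cancelled * D.projH * D.cancelled) * D.projH) * genIncl F := by
    calc F.differential * F.differential
        = genProj F * D.cancelled * (genIncl F * genProj F) * D.cancelled * genIncl F := by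
          rw [differential_eq]
          simp only [Matrix.mul_assoc]
      _ = (genProj F * D.projH) * D.cancelled * D.projH * D.cancelled * (D.projH * genIncl F) := by
          rw [genIncl_mul_genProj, genProj_mul_projH, projH_mul_genIncl]
      _ = _ := by simp only [Matrix.mul_assoc]
  rw [e, h]
  simp

/-- The chain homotopy equivalence from the generators to the Khovanov complex. -/
def bigIncl : Matrix D.EState D.Gen ℚ := (1 + D.averageHomotopy * D.cancelled) * genIncl F

/-- The chain homotopy equivalence from the Khovanov complex to the generators. -/
def bigProj : Matrix D.Gen D.EState ℚ := genProj F * (1 + D.cancelled * D.averageHomotopy)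

theorem khovanovR_add_khovanovRest : D.khovanovR + D.khovanovRest = D.khovanov := by
  unfold khovanovRest
  rw [add_sub_cancel]

theorem bigProj_comm : bigProj F * D.khovanov = F.differential * bigProj F := by
  have h := (perturbation (D := D)).projection
  rw [khovanovR_add_khovanovRest] at h
  calc bigProj F * D.khovanov
      = genProj F * (D.projH * (1 + D.cancelled * D.averageHomotopy) * D.khovanov) := by
        rw [← Matrix.mul_assoc (genProj F), ← Matrix.mul_assoc (genProj F), genProj_mul_projH]
        rfl
    _ = (genProj F * D.projH) * D.cancelled * (D.projH * (1 + D.cancelled * D.averageHomotopy)) := by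
        rw [h]
        simp only [Matrix.mul_assoc]
    _ = F.differential * bigProj F := by
        rw [genProj_mul_projH, differential_eq, bigProj, ← genIncl_mul_genProj F]
        simp only [Matrix.mul_assoc]

theorem bigIncl_comm : bigIncl F * F.differential = D.khovanov * bigIncl F := by
  have h := (perturbation (D := D)).inclusion
  rw [khovanovR_add_khovanovRest] at h
  symm
  calc D.khovanov * bigIncl F
      = D.khovanov * ((1 + D.averageHomotopy * D.cancelled) * D.projH) * genIncl F := by
        rw [bigIncl]
        conv_lhs => rw [← projH_mul_genIncl F]
        simp only [Matrix.mul_assoc]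
    _ = (1 + D.averageHomotopy * D.cancelled) * D.projH * D.cancelled * (D.projH * genIncl F) := by
        rw [h]
        simp only [Matrix.mul_assoc]
    _ = bigIncl F * F.differential := by
        rw [projH_mul_genIncl, differential_eq, bigIncl, ← genIncl_mul_genProj F]
        simp only [Matrix.mul_assoc]

theorem bigProj_mul_bigIncl : bigProj F * bigIncl F = 1 := by
  have h := (perturbation (D := D)).projection_inclusion
  calc bigProj F * bigIncl F
      = genProj F * (D.projH * (1 + D.cancelled * D.averageHomotopy) *
          ((1 + D.averageHomotopy * D.cancelled) * D.projH)) * genIncl F := by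
        rw [bigProj, bigIncl]
        conv_lhs => rw [← projH_mul_genIncl F, ← genProj_mul_projH F]
        simp only [Matrix.mul_assoc]
    _ = (genProj F * D.projH) * (D.projH * genIncl F) := by
        rw [h]
        simp only [Matrix.mul_assoc]
    _ = 1 := by rw [genProj_mul_projH, projH_mul_genIncl, genProj_mul_genIncl]

theorem bigIncl_mul_bigProj : bigIncl F * bigProj F = 1 +
    D.khovanov * (D.averageHomotopy * (1 + D.cancelled * D.averageHomotopy)) +
    (D.averageHomotopy * (1 + D.cancelled * D.averageHomotopy)) * D.khovanov := by
  have h := (perturbation (D := D)).inclusion_projection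
  rw [khovanovR_add_khovanovRest] at h
  rw [← h, ← genIncl_mul_genProj F, bigIncl, bigProj]
  simp only [Matrix.mul_assoc]

theorem hasDegree_one_add : HasDegree (1 + D.cancelled * D.averageHomotopy) 0 :=
  hasDegree_one.add (hasDegree_cancelled.mul hasDegree_averageHomotopy)

theorem bigIncl_degree {s : D.EState} {g : D.Gen} (h : bigIncl F s g ≠ 0) :
    s.i = (F.toState g).i ∧ s.j = (F.toState g).j := by
  rw [bigIncl, mul_genIncl] at h
  have : HasDegree (1 + D.averageHomotopy * D.cancelled) 0 :=
    hasDegree_one.add (hasDegree_averageHomotopy.mul hasDegree_cancelled)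
  simpa using this _ _ h

theorem bigProj_degree {s : D.EState} {g : D.Gen} (h : bigProj F g s ≠ 0) :
    s.i = (F.toState g).i ∧ s.j = (F.toState g).j := by
  rw [bigProj, genProj_mul] at h
  have := hasDegree_one_add _ _ h
  simp only [add_zero, id_eq] at this
  exact ⟨this.1.symm, this.2.symm⟩

/-- The transfer maps preserve the bidegree of states. The grading P = i - j rises by one exactly
when i does, since j is preserved. -/
theorem nonempty_bigelowHomology_equiv (hP : ∀ g, F.P g = (F.toState g).i - (F.toState g).j)
    (hJ : ∀ g, F.J g = (F.toState g).j) (i j : ℤ) :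
    Nonempty (F.BigelowHomology (i - j) j ≃ₗ[ℚ] D.Kh i j) := by
  have hdeg : ∀ (s : D.EState) (g : D.Gen), s.i = (F.toState g).i ∧ s.j = (F.toState g).j →
      ∀ k, (s.i, s.j) = (i + k, j) ↔ (F.P g, F.J g) = (i - j + k, j) := by
    intro s g h k
    rw [hP, hJ, ← h.1, ← h.2, Prod.mk.injEq, Prod.mk.injEq]
    omega
  obtain ⟨e⟩ := nonempty_homology_equiv (degS := fun s : D.EState => (s.i, s.j))
    (degT := fun g : D.Gen => (F.P g, F.J g)) (a := i) (b := j) (a' := i - j) (b' := j)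
    (bigProj_comm F) (bigIncl_comm F) (bigProj_mul_bigIncl F) (bigIncl_mul_bigProj F)
    (fun g s h => hdeg s g (bigProj_degree F h)) (fun s g h => hdeg s g (bigIncl_degree F h))
    (fun s t h => by
      have := (hasDegree_averageHomotopy.mul hasDegree_one_add) _ _ h
      rw [Prod.mk.injEq, Prod.mk.injEq]
      omega)
  exact ⟨e.symm⟩

theorem differential_degree (hP : ∀ g, F.P g = (F.toState g).i - (F.toState g).j)
    (hJ : ∀ g, F.J g = (F.toState g).j) (g g' : D.Gen) (h : F.differential g' g ≠ 0) :
    F.J g' = F.J g ∧ F.P g' = F.P g + 1 := by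
  have := hasDegree_cancelled _ _ h
  rw [hP, hP, hJ, hJ]
  omega

end Cancel

end GridDiagram
end GridKh

namespace GridKh
namespace GridDiagram

variable {n : ℕ} {D : GridDiagram n}

/-! ## The rotation number of the state of a generator -/

namespace EState

open Classical in
/-- The turning at `v` of the circle which arrives at `v` from direction `d`. -/
def inTurn (s : D.EState) (v : Fin n × Fin n) (d : Dir) : ℤ :=
  ∑ e, if D.IsAt v d e ∧ d.outward (s.ori e) = false then s.turn e else 0

/-- The total turning at a vertex. -/
def vertexTurn (s : D.EState) (v : Fin n × Fin n) : ℤ :=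
  s.inTurn v .N + s.inTurn v .S + s.inTurn v .E + s.inTurn v .W

theorem inTurn_of_not {s : D.EState} {v : Fin n × Fin n} {d : Dir}
    (h : D.HasEdge v d → s.Out v d) : s.inTurn v d = 0 := by
  refine Finset.sum_eq_zero fun e _ => if_neg ?_
  rintro ⟨h1, h2⟩
  have := (out_iff h1).1 (h h1.hasEdge)
  rw [h2] at this
  exact absurd this (by simp)

theorem inTurn_of_linked {s : D.EState} {v : Fin n × Fin n} {d d' : Dir} (h : D.HasEdge v d)
    (h' : D.HasEdge v d') (hl : Linked s.res v d d') (ho : ¬ s.Out v d) :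
    s.inTurn v d = cross (-d.vec) d'.vec := by
  obtain ⟨e, he⟩ := (hasEdge_iff v d).1 h
  obtain ⟨e', he'⟩ := (hasEdge_iff v d').1 h'
  have ho' : d.outward (s.ori e) = false := by
    rw [out_iff he] at ho
    simpa using ho
  have ho'' : d'.outward (s.ori e') = true := by
    have h1 : d.outward (s.ori e) = !d'.outward (s.ori e') := s.2 v d d' e e' he he' hl
    rw [ho'] at h1
    simpa using h1.symm
  unfold inTurn
  rw [Finset.sum_eq_single e, if_pos ⟨he, ho'⟩]
  · unfold turn
    rw [next_eq he he' hl ho', (head_eq he ho').2, (tail_eq he' ho'').2]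
  · exact fun e'' _ hne => if_neg fun h'' => hne (h''.1.edge_unique he)
  · simp

/-- Each oriented edge has exactly one end where it arrives, and its turn is assigned to this
vertex. -/
theorem sum_vertexTurn (s : D.EState) : ∑ e, s.turn e = ∑ v, s.vertexTurn v := by
  classical
  have key : ∀ e, s.turn e = ∑ v : Fin n × Fin n,
      ((if D.IsAt v .N e ∧ Dir.N.outward (s.ori e) = false then s.turn e else 0) +
      (if D.IsAt v .S e ∧ Dir.S.outward (s.ori e) = false then s.turn e else 0) +
      (if D.IsAt v .E e ∧ Dir.E.outward (s.ori e) = false then s.turn e else 0) +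
      (if D.IsAt v .W e ∧ Dir.W.outward (s.ori e) = false then s.turn e else 0)) := by
    intro e
    obtain ⟨v, d, h, hb⟩ := exists_end e (s.ori e) false
    have huniq : ∀ v' d', D.IsAt v' d' e ∧ d'.outward (s.ori e) = false ↔ v' = v ∧ d' = d := by
      refine fun v' d' => ⟨fun h' => ?_, ?_⟩
      · exact h'.1.end_unique h (h'.2.trans hb.symm)
      · rintro ⟨rfl, rfl⟩
        exact ⟨h, hb⟩
    simp only [huniq]
    rw [Finset.sum_eq_single v]
    · cases d <;> simp
    · intro v' _ hv'
      simp [hv']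
    · simp
  rw [Finset.sum_congr rfl fun e _ => key e, Finset.sum_comm]
  unfold vertexTurn inTurn
  simp only [Finset.sum_add_distrib]

end EState

theorem Gen.perm_eq_iff (g : D.Gen) (c r : Fin n) : g.perm c = r ↔ g.perm.symm r = c := by
  rw [Equiv.symm_apply_eq, eq_comm]

open Classical in
-- At a crossing with a point of `g` both arcs arrive horizontally; they turn right for the
-- `0`-smoothing and left for the `1`-smoothing. At the other crossings one arc turns left and the
-- other right. At a corner the product of differences is the turn when the path arrives vertically,
-- and a point of `g` there reverses it.
theorem vertexTurn_toState (F : D.FigureEights) (g : D.Gen) (c r : Fin n) :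
    (F.toState g).vertexTurn (c, r) +
      4 * (if g.perm c = r then (if F.IsUp (g.pt c) then 1 else 0) else 0) =
    2 * (if g.perm c = r then 1 else 0) +
      ((if D.HasEdge (c, r) .N then 1 else 0) - if D.HasEdge (c, r) .S then 1 else 0) *
      ((if D.HasEdge (c, r) .E then 1 else 0) - if D.HasEdge (c, r) .W then 1 else 0) := by
  have hk := g.perm_eq_iff c r
  have b1 := g.bounds c
  have b2 := g.bounds (g.perm.symm r)
  rw [Equiv.apply_symm_apply] at b2
  have hcor := D.corner_iff c r
  have oN := fun h => Gen.out_iff F g (c := c) (r := r) (d := .N) h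
  have oS := fun h => Gen.out_iff F g (c := c) (r := r) (d := .S) h
  have oE := fun h => Gen.out_iff F g (c := c) (r := r) (d := .E) h
  have oW := fun h => Gen.out_iff F g (c := c) (r := r) (d := .W) h
  simp only at oN oS oE oW
  unfold EState.vertexTurn
  by_cases hv : D.IsCrossing (c, r)
  · have eN := hv.hasEdge .N
    have eS := hv.hasEdge .S
    have eE := hv.hasEdge .E
    have eW := hv.hasEdge .W
    replace oN := oN eN
    replace oS := oS eS
    replace oE := oE eE
    replace oW := oW eW
    simp only [eN, eS, eE, eW, if_true, sub_self, mul_zero, add_zero]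
    have hlink : ∀ d, ¬ (F.toState g).Out (c, r) d → (F.toState g).inTurn (c, r) d =
        cross (-d.vec) (Dir.partner ((F.toState g).res ⟨_, hv⟩) d).vec := fun d hd =>
      EState.inTurn_of_linked (hv.hasEdge _) (hv.hasEdge _) (Crossing.linked_partner ⟨_, hv⟩ _ d) hd
    have hz : ∀ d, (F.toState g).Out (c, r) d → (F.toState g).inTurn (c, r) d = 0 := fun d hd =>
      EState.inTurn_of_not fun _ => hd
    by_cases hr : g.perm c = r
    · have hres : (F.toState g).res ⟨_, hv⟩ = decide (¬ F.IsUp (g.pt c)) := by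
        change F.res g _ = _
        unfold FigureEights.res
        rw [if_pos hr]
      rw [hz .N (oN.2 hr.le), hz .S (oS.2 hr.ge), hlink .E (by rw [oE, hk.1 hr]; simp),
        hlink .W (by rw [oW, hk.1 hr]; simp), hres, if_pos hr, if_pos hr]
      by_cases hu : F.IsUp (g.pt c) <;> simp [hu, Dir.partner, cross, Dir.vec]
    · have hr' : g.perm.symm r ≠ c := fun h => hr (hk.2 h)
      have hres : (F.toState g).res ⟨_, hv⟩ = decide (g.perm c ≤ r ↔ c < g.perm.symm r) := by
        change F.res g _ = _
        unfold FigureEights.res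
        rw [if_neg hr]
      rw [if_neg hr, if_neg hr]
      by_cases h1 : g.perm c ≤ r <;> by_cases h2 : c < g.perm.symm r
      · rw [hz .N (oN.2 h1), hlink .S (by rw [oS]; exact fun h => hr (le_antisymm h1 h)),
          hz .E (oE.2 h2), hlink .W (by rw [oW]; exact h2.not_gt), hres]
        simp [h1, h2, Dir.partner, cross, Dir.vec]
      · rw [hz .N (oN.2 h1), hlink .S (by rw [oS]; exact fun h => hr (le_antisymm h1 h)),
          hlink .E (by rwa [oE]), hz .W (by rw [oW]; exact lt_of_le_of_ne (not_lt.1 h2) hr'), hres]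
        simp [h1, h2, Dir.partner, cross, Dir.vec]
      · rw [hlink .N (by rwa [oN]), hz .S (by rw [oS]; exact (not_le.1 h1).le),
          hz .E (oE.2 h2), hlink .W (by rw [oW]; exact h2.not_gt), hres]
        simp [h1, h2, Dir.partner, cross, Dir.vec]
      · rw [hlink .N (by rwa [oN]), hz .S (by rw [oS]; exact (not_le.1 h1).le),
          hlink .E (by rwa [oE]), hz .W (by rw [oW]; exact lt_of_le_of_ne (not_lt.1 h2) hr'), hres]
        simp [h1, h2, Dir.partner, cross, Dir.vec]
  · have hno : ∀ d, ¬ D.HasEdge (c, r) d → (F.toState g).inTurn (c, r) d = 0 := fun d hd =>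
      EState.inTurn_of_not fun h => absurd h hd
    have hout : ∀ d, (F.toState g).Out (c, r) d → (F.toState g).inTurn (c, r) d = 0 := fun d hd =>
      EState.inTurn_of_not fun _ => hd
    have hlink : ∀ d d', D.HasEdge (c, r) d → D.HasEdge (c, r) d' → d ≠ d' →
        ¬ (F.toState g).Out (c, r) d → (F.toState g).inTurn (c, r) d = cross (-d.vec) d'.vec :=
      fun d d' h h' hd ho => EState.inTurn_of_linked h h' (.inr ⟨hv, hd⟩) ho
    have hup : g.perm c = r → (F.IsUp (g.pt c) ↔
        (D.HasEdge (c, r) .N ∧ D.HasEdge (c, r) .E) ∨ (D.HasEdge (c, r) .S ∧ D.HasEdge (c, r) .W)) := by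
      intro hr
      have k1 := F.bot_le c
      have k2 := F.lt_top c
      rw [F.isUp_pt]
      have p1 : (g.pt c).onRight = true → _ := Gen.pt_right
      have p2 : (g.pt c).onRight = false → _ := Gen.pt_left
      unfold IsCrossing at hv
      unfold HasEdge
      rw [hr] at p1 p2 b1 ⊢
      simp only at hv ⊢
      cases hb : (g.pt c).onRight <;> rw [hb] at p1 p2 <;>
        simp only [Fin.lt_def, Fin.le_def, Fin.ext_iff, true_iff, false_iff, Bool.false_eq_true,
          true_imp_iff, false_imp_iff] at * <;> omega
    have lb := D.left_lt_right r
    have bt := D.bot_lt_top c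
    -- Off the crossings either at most one segment passes through, in a straight line, or the
    -- vertex is a corner with one vertical and one horizontal half-edge.
    have hpat : (¬ D.HasEdge (c, r) .E ∧ ¬ D.HasEdge (c, r) .W ∧
          (D.HasEdge (c, r) .N ↔ D.HasEdge (c, r) .S) ∧ g.perm c ≠ r) ∨
        (¬ D.HasEdge (c, r) .N ∧ ¬ D.HasEdge (c, r) .S ∧
          (D.HasEdge (c, r) .E ↔ D.HasEdge (c, r) .W) ∧ g.perm c ≠ r) ∨
        ((D.HasEdge (c, r) .N ↔ ¬ D.HasEdge (c, r) .S) ∧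
          (D.HasEdge (c, r) .E ↔ ¬ D.HasEdge (c, r) .W)) := by
      have b3 : g.perm c = r → D.left r ≤ c ∧ c ≤ D.right r := fun h => h ▸ b1.2.2
      unfold IsCrossing at hv
      unfold HasEdge
      simp only [Fin.lt_def, Fin.le_def, Fin.ext_iff, ne_eq] at *
      omega
    rcases hpat with ⟨eE, eW, eNS, hr⟩ | ⟨eN, eS, eEW, hr⟩ | ⟨eNS, eEW⟩
    · have t1 : (F.toState g).inTurn (c, r) .N = 0 := by
        by_cases eN : D.HasEdge (c, r) .N
        · by_cases ho : (F.toState g).Out (c, r) .N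
          · exact hout _ ho
          · rw [hlink .N .S eN (eNS.1 eN) (by simp) ho]
            simp [cross, Dir.vec]
        · exact hno _ eN
      have t2 : (F.toState g).inTurn (c, r) .S = 0 := by
        by_cases eS : D.HasEdge (c, r) .S
        · by_cases ho : (F.toState g).Out (c, r) .S
          · exact hout _ ho
          · rw [hlink .S .N eS (eNS.2 eS) (by simp) ho]
            simp [cross, Dir.vec]
        · exact hno _ eS
      rw [t1, t2, hno _ eE, hno _ eW]
      simp [eE, eW, hr]
    · have t1 : (F.toState g).inTurn (c, r) .E = 0 := by
        by_cases eE : D.HasEdge (c, r) .E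
        · by_cases ho : (F.toState g).Out (c, r) .E
          · exact hout _ ho
          · rw [hlink .E .W eE (eEW.1 eE) (by simp) ho]
            simp [cross, Dir.vec]
        · exact hno _ eE
      have t2 : (F.toState g).inTurn (c, r) .W = 0 := by
        by_cases eW : D.HasEdge (c, r) .W
        · by_cases ho : (F.toState g).Out (c, r) .W
          · exact hout _ ho
          · rw [hlink .W .E eW (eEW.2 eW) (by simp) ho]
            simp [cross, Dir.vec]
        · exact hno _ eW
      rw [t1, t2, hno _ eN, hno _ eS]
      simp [eN, eS, hr]
    · have corner : ∀ dv dh : Dir, D.HasEdge (c, r) dv → D.HasEdge (c, r) dh → dv ≠ dh →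
          ((F.toState g).Out (c, r) dv ↔ g.perm c = r) →
          (F.toState g).inTurn (c, r) dv + (F.toState g).inTurn (c, r) dh =
            if g.perm c = r then cross (-dh.vec) dv.vec else cross (-dv.vec) dh.vec := by
        intro dv dh h1 h2 hd ho
        have ho' : (F.toState g).Out (c, r) dh ↔ ¬ (F.toState g).Out (c, r) dv :=
          EState.out_linked h2 h1 (.inr ⟨hv, hd.symm⟩)
        by_cases hr : g.perm c = r
        · rw [hout _ (ho.2 hr), hlink dh dv h2 h1 hd.symm (by rw [ho', ho]; simpa using hr), if_pos hr,
            zero_add]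
        · rw [hout dh (by rw [ho', ho]; exact hr), hlink dv dh h1 h2 hd (by rwa [ho]), if_neg hr,
            add_zero]
      have oN' : D.HasEdge (c, r) .N → ¬ D.HasEdge (c, r) .S →
          ((F.toState g).Out (c, r) .N ↔ g.perm c = r) := by
        intro h1 h2
        rw [oN h1]
        unfold HasEdge at h1 h2
        simp only [Fin.lt_def, Fin.le_def, Fin.ext_iff, ne_eq] at h1 h2 b1 ⊢
        omega
      have oS' : D.HasEdge (c, r) .S → ¬ D.HasEdge (c, r) .N →
          ((F.toState g).Out (c, r) .S ↔ g.perm c = r) := by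
        intro h1 h2
        rw [oS h1]
        unfold HasEdge at h1 h2
        simp only [Fin.lt_def, Fin.le_def, Fin.ext_iff, ne_eq] at h1 h2 b1 ⊢
        omega
      by_cases eN : D.HasEdge (c, r) .N
      · have eS := eNS.1 eN
        by_cases eE : D.HasEdge (c, r) .E
        · have eW := eEW.1 eE
          have := corner .N .E eN eE (by simp) (oN' eN eS)
          simp only [eN, eS, eE, eW, and_self, or_false, iff_true] at hup
          rw [hno _ eS, hno _ eW, add_zero, add_zero, this]
          by_cases hr : g.perm c = r <;> simp [hr, hup, eN, eS, eE, eW, cross, Dir.vec]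
        · have eW := not_not.1 (mt eEW.2 eE)
          have := corner .N .W eN eW (by simp) (oN' eN eS)
          simp only [eN, eS, eE, eW, and_false, false_and, or_self, iff_false] at hup
          rw [hno _ eS, hno _ eE, add_zero, add_zero, this]
          by_cases hr : g.perm c = r <;> simp [hr, hup, eN, eS, eE, eW, cross, Dir.vec]
      · have eS := not_not.1 (mt eNS.2 eN)
        by_cases eE : D.HasEdge (c, r) .E
        · have eW := eEW.1 eE
          have := corner .S .E eS eE (by simp) (oS' eS eN)
          simp only [eN, eS, eE, eW, and_false, false_and, or_self, iff_false] at hup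
          rw [hno _ eN, hno _ eW, zero_add, add_zero, this]
          by_cases hr : g.perm c = r <;> simp [hr, hup, eN, eS, eE, eW, cross, Dir.vec]
        · have eW := not_not.1 (mt eEW.2 eE)
          have := corner .S .W eS eW (by simp) (oS' eS eN)
          simp only [eN, eS, eE, eW, and_self, or_true, iff_true] at hup
          rw [hno _ eN, hno _ eE, zero_add, add_zero, this]
          by_cases hr : g.perm c = r <;> simp [hr, hup, eN, eS, eE, eW, cross, Dir.vec]

open Classical in
/-- The rotation number of the state of a generator is determined by the number of points where the
figure-eights are oriented upward. -/
theorem rot_toState (F : D.FigureEights) (g : D.Gen) :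
    4 * (rot (F.toState g).res (F.toState g).ori + F.Pbar g) = 2 * n + ∑ v : Fin n × Fin n,
      ((if D.HasEdge v .N then 1 else 0) - if D.HasEdge v .S then 1 else 0) *
      ((if D.HasEdge v .E then 1 else 0) - if D.HasEdge v .W then 1 else 0) := by
  have h1 : F.Pbar g = ∑ v : Fin n × Fin n,
      if g.perm v.1 = v.2 then (if F.IsUp (g.pt v.1) then 1 else 0) else 0 := by
    rw [Fintype.sum_prod_type]
    unfold FigureEights.Pbar
    refine Finset.sum_congr rfl fun c _ => ?_
    simp only [Finset.sum_ite_eq, Finset.mem_univ, if_true]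
  have h2 : (n : ℤ) = ∑ v : Fin n × Fin n, if g.perm v.1 = v.2 then 1 else 0 := by
    rw [Fintype.sum_prod_type]
    simp
  rw [mul_add, EState.four_mul_rot, EState.sum_vertexTurn, h1]
  conv_rhs => rw [h2]
  rw [Finset.mul_sum, Finset.mul_sum, ← Finset.sum_add_distrib, ← Finset.sum_add_distrib]
  exact Finset.sum_congr rfl fun v _ => vertexTurn_toState F g v.1 v.2

theorem toState_genX_ori (F : D.FigureEights) : (F.toState D.genX).ori = D.linkOri := by
  have hp : D.genX.perm = D.x := Equiv.ext fun c => rfl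
  funext e
  change Gen.ori _ e = _
  rcases e with ⟨⟨c, r⟩, h1, h2⟩ | ⟨⟨c, r⟩, h1, h2⟩ <;>
    simp only [Gen.ori, linkOri, hp, decide_eq_decide]
  · simp only [left, right, min_le_iff, lt_max_iff] at h1 h2
    constructor
    · intro h
      rcases h1 with h1 | h1
      · exact h1.trans_lt h
      · exact absurd h1 (not_le.2 h)
    · intro h
      rcases h2 with h2 | h2
      · exact h2.trans h
      · exact h2
  · simp only [bot, top, min_le_iff, lt_max_iff] at h1 h2
    constructor
    · intro h
      rcases h2 with h2 | h2
      · exact h.trans_lt h2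
      · exact absurd h (not_le.2 h2)
    · intro h
      rcases h1 with h1 | h1
      · exact h.le.trans h1
      · exact h1

/-- The `X`'s lie at corners, so every crossing has the orientation-compatible smoothing; this is
the Seifert smoothing. -/
theorem toState_genX_res (F : D.FigureEights) : (F.toState D.genX).res = D.seifertRes := by
  have hp : D.genX.perm = D.x := Equiv.ext fun c => rfl
  funext ⟨⟨c, r⟩, hv⟩
  change F.res _ _ = _
  unfold FigureEights.res seifertRes IsPositive
  obtain ⟨h1, h2, h3, h4⟩ := hv
  simp only [left, right, bot, top, min_lt_iff, lt_max_iff] at h1 h2 h3 h4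
  simp only [hp, not_not]
  rw [if_neg, decide_eq_decide]
  · refine iff_congr ⟨fun h => ?_, fun h => ?_⟩ ⟨fun h => ?_, fun h => ?_⟩
    · exact h4.elim (fun h4 => h.trans_lt h4) (fun h4 => absurd h (not_le.2 h4))
    · exact h3.elim (fun h3 => (h.trans h3).le) (fun h3 => h3.le)
    · exact h1.elim (fun h1 => h1.trans h) (fun h1 => absurd h1 h.not_gt)
    · exact h2.elim (fun h2 => h2.trans h) id
  · rintro rfl
    have hne : ∀ c, D.o c ≠ D.x c := D.ne
    have := hne c
    rcases h3 with h3 | h3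
    · rcases h4 with h4 | h4
      · exact absurd h3 h4.not_gt
      · exact lt_irrefl _ h4
    · exact lt_irrefl _ h3

theorem rotD_eq (F : D.FigureEights) :
    D.rotD = rot (F.toState D.genX).res (F.toState D.genX).ori := by
  unfold rotD
  have h1 := toState_genX_res F
  have h2 := toState_genX_ori F
  rw [h2]
  congr 1
  exact h1.symm

theorem P_eq (F : D.FigureEights) (g : D.Gen) : F.P g = (F.toState g).i - (F.toState g).j := by
  have h1 := rot_toState F g
  have h2 := rot_toState F D.genX
  have h3 := rotD_eq F
  unfold FigureEights.P EState.i EState.j writhe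
  omega

end GridDiagram
end GridKh

namespace GridKh

/-! ## Winding numbers of the loops of figure-eights -/

theorem rayCrossing_self (p a : ℤ × ℤ) : rayCrossing p a a = 0 := by
  unfold rayCrossing
  rw [if_neg (by omega), if_neg (by omega)]

theorem rayCrossing_swap (p a b : ℤ × ℤ) : rayCrossing p b a = -rayCrossing p a b := by
  unfold rayCrossing
  by_cases h1 : a.1 ≤ p.1 ∧ p.1 < b.1 ∧ (b.1 - a.1) * (p.2 - a.2) < (b.2 - a.2) * (p.1 - a.1)
  · rw [if_pos h1, if_neg (by omega), if_pos h1]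
    rfl
  · by_cases h2 : b.1 ≤ p.1 ∧ p.1 < a.1 ∧ (a.1 - b.1) * (p.2 - b.2) < (a.2 - b.2) * (p.1 - b.1)
    · rw [if_pos h2, if_neg h1, if_pos h2]
    · rw [if_neg h2, if_neg h1, if_neg h1, if_neg h2]
      rfl

theorem pathCrossing_append (p a : ℤ × ℤ) (l l' : List (ℤ × ℤ)) :
    pathCrossing p (l ++ a :: l') = pathCrossing p (l ++ [a]) + pathCrossing p (a :: l') := by
  induction l with
  | nil => simp [pathCrossing]
  | cons b l ih =>
    cases l with
    | nil => simp [pathCrossing]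
    | cons b' l =>
      simp only [List.cons_append, pathCrossing] at ih ⊢
      rw [ih]
      ring

theorem pathCrossing_reverse (p : ℤ × ℤ) (l : List (ℤ × ℤ)) :
    pathCrossing p l.reverse = -pathCrossing p l := by
  induction l with
  | nil => simp [pathCrossing]
  | cons a l ih =>
    cases l with
    | nil => simp [pathCrossing]
    | cons b l =>
      rw [List.reverse_cons, List.reverse_cons, List.append_assoc, List.singleton_append,
        pathCrossing_append, ← List.reverse_cons, ih]
      simp only [pathCrossing]
      rw [rayCrossing_swap]
      ring

/-- Two paths with a common starting point form a loop; the degenerate segment at this point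
contributes nothing. -/
theorem pathCrossing_reverse_append (p a : ℤ × ℤ) (l l' : List (ℤ × ℤ)) :
    pathCrossing p ((a :: l).reverse ++ a :: l') =
      pathCrossing p (a :: l') - pathCrossing p (a :: l) := by
  rw [pathCrossing_append, List.reverse_cons, List.append_assoc, List.singleton_append,
    pathCrossing_append, ← List.reverse_cons, pathCrossing_reverse]
  simp only [pathCrossing, rayCrossing_self]
  ring

theorem rayCrossing_horizontal (px py xa xb y : ℤ) : rayCrossing (px, py) (xa, y) (xb, y) =
    (if py < y ∧ xb ≤ px then 1 else 0) - (if py < y ∧ xa ≤ px then 1 else 0) := by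
  unfold rayCrossing
  simp only [sub_self, zero_mul]
  by_cases h1 : xa ≤ px ∧ px < xb
  · have e : (xb - xa) * (py - y) < 0 ↔ py < y := by
      constructor <;> intro h <;> nlinarith
    by_cases hy : py < y
    · rw [if_pos ⟨h1.1, h1.2, e.2 hy⟩, if_neg (by omega), if_pos ⟨hy, h1.1⟩]
      rfl
    · rw [if_neg fun h => hy (e.1 h.2.2), if_neg (by omega), if_neg fun h => hy h.1,
        if_neg fun h => hy h.1]
      rfl
  · rw [if_neg fun h => h1 ⟨h.1, h.2.1⟩]
    by_cases h2 : xb ≤ px ∧ px < xa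
    · have e : (xa - xb) * (py - y) < 0 ↔ py < y := by
        constructor <;> intro h <;> nlinarith
      by_cases hy : py < y
      · rw [if_pos ⟨h2.1, h2.2, e.2 hy⟩, if_pos ⟨hy, h2.1⟩, if_neg (by omega)]
        rfl
      · rw [if_neg fun h => hy (e.1 h.2.2), if_neg fun h => hy h.1, if_neg fun h => hy h.1]
        rfl
    · rw [if_neg fun h => h2 ⟨h.1, h.2.1⟩]
      split_ifs <;> omega

theorem rayCrossing_vertical (p : ℤ × ℤ) (x y y' : ℤ) : rayCrossing p (x, y) (x, y') = 0 := by
  unfold rayCrossing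
  rw [if_neg fun h => absurd (h.1.trans_lt h.2.1) (lt_irrefl _),
    if_neg fun h => absurd (h.1.trans_lt h.2.1) (lt_irrefl _)]

/-- The puncture lies halfway between the two abscissae, so the segment passes above it exactly when
its mean height is larger. This covers the slanted edges of a figure-eight. -/
theorem rayCrossing_right (c c' q y y' : ℤ) :
    rayCrossing (4 * c', q) (4 * c - 1, y) (4 * c + 1, y') =
      if c' = c ∧ 2 * q < y + y' then -1 else 0 := by
  unfold rayCrossing
  have e : (4 * c + 1) - (4 * c - 1) = 2 := by ring
  simp only [e]
  by_cases hc : c' = c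
  · subst hc
    have e' : 4 * c' - (4 * c' - 1) = 1 := by ring
    have e2 : 4 * c' - (4 * c' + 1) = -1 := by ring
    have e3 : (4 * c' - 1) - (4 * c' + 1) = -2 := by ring
    simp only [e', e2, e3, true_and]
    split_ifs <;> omega
  · rw [if_neg (by omega), if_neg (by omega), if_neg (by omega)]

theorem rayCrossing_left (c c' q y y' : ℤ) :
    rayCrossing (4 * c', q) (4 * c + 1, y) (4 * c - 1, y') =
      if c' = c ∧ 2 * q < y + y' then 1 else 0 := by
  rw [rayCrossing_swap, rayCrossing_right, add_comm]
  split_ifs <;> rfl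

namespace GridDiagram

variable {n : ℕ} {D : GridDiagram n}

/-- The sum over all the `X`'s and `O`'s. -/
def punctureSum (D : GridDiagram n) (f : Fin n → Fin n → ℤ) : ℤ := ∑ c, (f c (D.o c) + f c (D.x c))

theorem punctureSum_col (f : Fin n → Fin n → ℤ) :
    D.punctureSum f = ∑ c, (f c (D.bot c) + f c (D.top c)) := by
  refine Finset.sum_congr rfl fun c _ => ?_
  unfold bot top
  rcases le_total (D.o c) (D.x c) with h | h
  · rw [min_eq_left h, max_eq_right h]
  · rw [min_eq_right h, max_eq_left h, add_comm]

theorem punctureSum_row (f : Fin n → Fin n → ℤ) :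
    D.punctureSum f = ∑ r, (f (D.left r) r + f (D.right r) r) := by
  have h1 : D.punctureSum f = ∑ r, (f (D.o.symm r) r + f (D.x.symm r) r) := by
    unfold punctureSum
    rw [Finset.sum_add_distrib, Finset.sum_add_distrib,
      ← Equiv.sum_comp D.o (fun r => f (D.o.symm r) r), ← Equiv.sum_comp D.x (fun r => f (D.x.symm r) r)]
    simp
  rw [h1]
  refine Finset.sum_congr rfl fun r _ => ?_
  unfold left right
  rcases le_total (D.o.symm r) (D.x.symm r) with h | h
  · rw [min_eq_left h, max_eq_right h]
  · rw [min_eq_right h, max_eq_left h, add_comm]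

theorem punctureSum_add (f g : Fin n → Fin n → ℤ) :
    D.punctureSum (fun c r => f c r + g c r) = D.punctureSum f + D.punctureSum g := by
  unfold punctureSum
  rw [← Finset.sum_add_distrib]
  exact Finset.sum_congr rfl fun c _ => by ring

theorem punctureSum_sub (f g : Fin n → Fin n → ℤ) :
    D.punctureSum (fun c r => f c r - g c r) = D.punctureSum f - D.punctureSum g := by
  unfold punctureSum
  rw [← Finset.sum_sub_distrib]
  exact Finset.sum_congr rfl fun c _ => by ring

theorem punctureSum_sum {ι : Type*} (S : Finset ι) (f : ι → Fin n → Fin n → ℤ) :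
    D.punctureSum (fun c r => ∑ i ∈ S, f i c r) = ∑ i ∈ S, D.punctureSum (f i) := by
  unfold punctureSum
  rw [Finset.sum_comm]
  simp only [Finset.sum_add_distrib]

/-- The sum of the numbers of crossings of the path along a figure-eight with the rays from the
`X`'s and `O`'s. -/
def pathWeight (F : D.FigureEights) (z : D.ZPoint) : ℤ :=
  if F.split z.col < z.row then (if z.onRight then -2 else 0) else -1

/-- The top edge passes over both punctures of the column from left to right. The slanted edges pass
back over the lower one only, and the bottom edge over none. -/
theorem punctureSum_pathCrossing (F : D.FigureEights) (z : D.ZPoint) :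
    D.punctureSum (fun c r => pathCrossing (4 * (c.val : ℤ), 4 * (r.val : ℤ)) (F.pathTo z)) =
      pathWeight F z := by
  have h1 := F.bot_le z.col
  have h2 := F.lt_top z.col
  have hb := D.bot_lt_top z.col
  rw [Fin.le_def] at h1
  rw [Fin.lt_def] at h2 hb
  have key : ∀ c r : Fin n, r = D.bot c ∨ r = D.top c →
      pathCrossing (4 * (c.val : ℤ), 4 * (r.val : ℤ)) (F.pathTo z) =
        if c = z.col then (if F.split z.col < z.row then
          (if z.onRight then -1 else if r = D.bot c then 1 else -1)
          else if r = D.bot c then 0 else -1) else 0 := by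
    intro c r hr
    by_cases hc : c = z.col
    · subst hc
      rw [if_pos rfl]
      rcases hr with rfl | rfl
      · unfold FigureEights.pathTo FigureEights.index FigureEights.polygon ZPoint.pos
        by_cases k1 : F.split z.col < z.row <;> cases k2 : z.onRight <;>
          simp only [k1, k2, if_true, if_false, List.take, List.cons_append, List.nil_append,
            pathCrossing, rayCrossing_vertical, rayCrossing_right, rayCrossing_left, true_and,
            Bool.false_eq_true, ← sub_eq_add_neg]
        all_goals
          split_ifs <;> omega
      · have hne : D.top z.col ≠ D.bot z.col := fun h => by
          rw [h] at hb
          exact lt_irrefl _ hb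
        unfold FigureEights.pathTo FigureEights.index FigureEights.polygon ZPoint.pos
        by_cases k1 : F.split z.col < z.row <;> cases k2 : z.onRight <;>
          simp only [k1, k2, if_true, if_false, List.take, List.cons_append, List.nil_append,
            pathCrossing, rayCrossing_vertical, rayCrossing_right, rayCrossing_left, true_and, hne,
            Bool.false_eq_true, ← sub_eq_add_neg]
        all_goals
          split_ifs <;> omega
    · have hc' : (c.val : ℤ) ≠ z.col.val := fun h => hc (Fin.ext (by exact_mod_cast h))
      rw [if_neg hc]
      unfold FigureEights.pathTo FigureEights.index FigureEights.polygon ZPoint.pos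
      by_cases k1 : F.split z.col < z.row <;> cases k2 : z.onRight <;>
        simp only [k1, k2, if_true, if_false, List.take, List.cons_append, List.nil_append,
          pathCrossing, rayCrossing_vertical, rayCrossing_right, rayCrossing_left, hc', false_and,
          Bool.false_eq_true, add_zero, ← sub_eq_add_neg]
  rw [punctureSum_col, Finset.sum_eq_single z.col]
  · have hne : D.top z.col ≠ D.bot z.col := fun h => by
      rw [h] at hb
      exact lt_irrefl _ hb
    rw [key _ _ (.inl rfl), key _ _ (.inr rfl)]
    unfold pathWeight
    simp only [if_true, hne, if_false]
    split_ifs <;> rfl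
  · intro c _ hc
    rw [key _ _ (.inl rfl), key _ _ (.inr rfl), if_neg hc, if_neg hc]
    rfl
  · simp

/-- The number of `X`'s and `O`'s below and to the right of a point of a generator. -/
def lowerRight (z : D.ZPoint) : ℤ :=
  D.punctureSum fun c r => if r < z.row ∧ z.pos.1 ≤ 4 * (c.val : ℤ) then 1 else 0

theorem pathTo_eq_cons (F : D.FigureEights) (z : D.ZPoint) :
    ∃ l, F.pathTo z = (4 * (z.col.val : ℤ) - 1, 4 * ((D.top z.col).val : ℤ) + 1) :: l := by
  unfold FigureEights.pathTo FigureEights.index FigureEights.polygon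
  split_ifs <;> exact ⟨_, rfl⟩

/-- The grading `Q` of a generator up to a constant. -/
def relQ (F : D.FigureEights) (g : D.Gen) : ℤ := ∑ c, (pathWeight F (g.pt c) - lowerRight (g.pt c))

/-- All paths on a figure-eight start at the same vertex, and a horizontal piece of the loop
contributes a difference of counts of punctures below it. Thus the loop contribution separates into
terms of `g` and of `genX`. -/
theorem Q_eq (F : D.FigureEights) (g : D.Gen) : F.Q g = relQ F g - relQ F D.genX := by
  have h0 : F.Q g = D.punctureSum fun c r => F.loopWinding g D.genX (4 * (c.val : ℤ), 4 * (r.val : ℤ)) :=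
    rfl
  have hrow : ∀ (g : D.Gen) (N : D.ZPoint → ℤ), ∑ r, N (g.ptRow r) = ∑ c, N (g.pt c) := by
    intro g N
    exact Equiv.sum_comp g.perm.symm fun c => N (g.pt c)
  have hpath : ∀ c, D.punctureSum (fun c' r' => pathCrossing (4 * (c'.val : ℤ), 4 * (r'.val : ℤ))
      ((F.pathTo (D.genX.pt c)).reverse ++ F.pathTo (g.pt c))) =
      pathWeight F (g.pt c) - pathWeight F (D.genX.pt c) := by
    intro c
    rw [← punctureSum_pathCrossing, ← punctureSum_pathCrossing, ← punctureSum_sub]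
    congr 1
    funext c' r'
    obtain ⟨l, hl⟩ := pathTo_eq_cons F (D.genX.pt c)
    obtain ⟨l', hl'⟩ := pathTo_eq_cons F (g.pt c)
    rw [Gen.pt_col] at hl hl'
    rw [hl, hl', pathCrossing_reverse_append]
  have hhor : ∀ r, D.punctureSum (fun c' r' => rayCrossing (4 * (c'.val : ℤ), 4 * (r'.val : ℤ))
      (g.ptRow r).pos (D.genX.ptRow r).pos) = lowerRight (D.genX.ptRow r) - lowerRight (g.ptRow r) := by
    intro r
    unfold lowerRight
    rw [← punctureSum_sub]
    congr 1
    funext c' r'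
    have e : ∀ g : D.Gen, (g.ptRow r).row = r := fun g => g.perm.apply_symm_apply r
    have e' : ∀ g : D.Gen, (g.ptRow r).pos = ((g.ptRow r).pos.1, 4 * (r.val : ℤ)) := fun g => by
      have := congrArg (fun r : Fin n => 4 * (r.val : ℤ)) (e g)
      exact Prod.ext rfl this
    rw [e' g, e' D.genX, rayCrossing_horizontal, e g, e D.genX]
    congr 2 <;> exact propext (and_congr (by rw [Fin.lt_def]; omega) Iff.rfl)
  rw [h0]
  unfold FigureEights.loopWinding
  rw [punctureSum_add, punctureSum_sum, punctureSum_sum, Finset.sum_congr rfl fun c _ => hpath c,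
    Finset.sum_congr rfl fun r _ => hhor r, Finset.sum_sub_distrib, hrow, hrow,
    Finset.sum_sub_distrib]
  unfold relQ
  rw [Finset.sum_sub_distrib, Finset.sum_sub_distrib]
  ring

end GridDiagram
end GridKh

namespace GridKh
namespace GridDiagram

variable {n : ℕ} {D : GridDiagram n}

/-! ## The grading `J` -/

/-- The sign of `b - a`. -/
def sg (a b : Fin n) : ℤ := if a < b then 1 else if b < a then -1 else 0

theorem sg_swap (a b : Fin n) : sg b a = -sg a b := by
  unfold sg
  rcases lt_trichotomy a b with h | h | h
  · simp [h, h.not_gt]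
  · simp [h]
  · simp [h, h.not_gt]

theorem sg_of_lt {a b : Fin n} (h : a < b) : sg a b = 1 := if_pos h

theorem sg_of_gt {a b : Fin n} (h : b < a) : sg a b = -1 := by
  rw [sg_swap, sg_of_lt h]

theorem sg_self (a : Fin n) : sg a a = 0 := by
  unfold sg
  simp

theorem punctureSum_ite_col (c : Fin n) (h : Fin n → ℤ) :
    D.punctureSum (fun c' r' => if c' = c then h r' else 0) = h (D.bot c) + h (D.top c) := by
  rw [punctureSum_col, Finset.sum_eq_single c]
  · simp
  · intro c' _ hc
    simp [hc]
  · simp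

theorem punctureSum_ite_row (r : Fin n) (h : Fin n → ℤ) :
    D.punctureSum (fun c' r' => if r' = r then h c' else 0) = h (D.left r) + h (D.right r) := by
  rw [punctureSum_row, Finset.sum_eq_single r]
  · simp
  · intro c' _ hc
    simp [hc]
  · simp

theorem punctureSum_const_mul (k : ℤ) (f : Fin n → Fin n → ℤ) :
    D.punctureSum (fun c r => k * f c r) = k * D.punctureSum f := by
  unfold punctureSum
  rw [Finset.mul_sum]
  exact Finset.sum_congr rfl fun c _ => by ring

/-- The contribution to `lowerRight` of the `X`'s and `O`'s in the row and the column of a point. -/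
def localLower (g : D.Gen) (c : Fin n) : ℤ :=
  ((if D.bot c = g.perm c then 1 else 0) + if D.top c = g.perm c then 1 else 0) -
    (sg c (D.left (g.perm c)) + sg c (D.right (g.perm c))) +
    (sg (g.perm c) (D.bot c) + sg (g.perm c) (D.top c)) +
    4 * (if (g.pt c).onRight = false ∧ D.bot c < g.perm c then 1 else 0) - 4

/-- Away from the row and the column of the point, four times the indicator of the quadrant is the
product of `1 + sg c c'` and `1 - sg (g.perm c) r'`. The punctures in that row and column give the
local correction. -/
theorem four_mul_lowerRight (g : D.Gen) (c : Fin n) : 4 * lowerRight (g.pt c) =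
    -D.punctureSum (fun c' r' => sg c c' * sg (g.perm c) r') +
      D.punctureSum (fun c' _ => sg c c') - D.punctureSum (fun _ r' => sg (g.perm c) r') +
      D.punctureSum (fun _ _ => 1) + localLower g c := by
  set σ := g.perm c
  have hp : ∀ c' r' : Fin n, 4 * (if r' < (g.pt c).row ∧ (g.pt c).pos.1 ≤ 4 * (c'.val : ℤ) then 1 else 0) =
      ((((-(sg c c' * sg σ r') + sg c c') - sg σ r' + 1) +
        (if c' = c then (-1 + (if r' = σ then 1 else 0) + sg σ r' +
          4 * (if (g.pt c).onRight = false ∧ r' < σ then 1 else 0)) else 0)) +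
        (if r' = σ then (-1 - sg c c') else 0) : ℤ) := by
    intro c' r'
    have e1 : (g.pt c).row = σ := rfl
    have e2 : (g.pt c).pos.1 = 4 * (c.val : ℤ) + (if (g.pt c).onRight then 1 else -1) := by
      unfold ZPoint.pos
      rw [g.pt_col]
    rw [e1, e2]
    unfold sg
    simp only [Fin.lt_def, Fin.ext_iff]
    cases (g.pt c).onRight <;> simp only [if_true, if_false, Bool.false_eq_true, true_and, false_and, eq_self_iff_true,
      reduceCtorEq] <;>
      rcases lt_trichotomy c.val c'.val with h1 | h1 | h1 <;>
      rcases lt_trichotomy σ.val r'.val with h2 | h2 | h2 <;>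
      split_ifs <;> omega
  unfold lowerRight
  rw [← punctureSum_const_mul]
  simp only [hp]
  rw [punctureSum_add, punctureSum_add, punctureSum_add, punctureSum_sub, punctureSum_add,
    punctureSum_ite_col, punctureSum_ite_row]
  have hneg : D.punctureSum (fun c' r' => -(sg c c' * sg σ r')) =
      -D.punctureSum (fun c' r' => sg c c' * sg σ r') := by
    have := punctureSum_const_mul (D := D) (-1) (fun c' r' => sg c c' * sg σ r')
    simpa using this
  rw [hneg]
  have ht : ¬ D.top c < σ := not_lt.2 (g.bounds c).2.1
  unfold localLower
  change _ = _ + (((if D.bot c = σ then 1 else 0) + if D.top c = σ then 1 else 0) -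
    (sg c (D.left σ) + sg c (D.right σ)) + (sg σ (D.bot c) + sg σ (D.top c)) +
    4 * (if (g.pt c).onRight = false ∧ D.bot c < σ then 1 else 0) - 4)
  simp only [ht, and_false, if_false]
  ring

/-- Twice the orientation of the vertical strand of the state of a generator, as a function on the
grid points. -/
def vertSign (g : D.Gen) (c r : Fin n) : ℤ := 2 * sg (g.perm c) r - (sg (D.bot c) r + sg (D.top c) r)

/-- Twice the orientation of the horizontal strand. -/
def horSign (g : D.Gen) (c r : Fin n) : ℤ :=
  2 * sg c (g.perm.symm r) - (sg c (D.left r) + sg c (D.right r))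

open Classical in
-- A factor vanishes outside its segment and is twice the orientation inside. At a crossing without
-- a point of `g` the product is 4 for the `1`-smoothing and -4 for the `0`-smoothing; at a point of
-- `g` both factors vanish and the smoothing is corrected by hand. At a corner both factors change
-- sign together.
theorem vertSign_mul_horSign (F : D.FigureEights) (g : D.Gen) (c r : Fin n) :
    vertSign g c r * horSign g c r =
      (if h : D.IsCrossing (c, r) then 8 * (if F.res g ⟨_, h⟩ then 1 else 0) - 4 else 0) -
      (if g.perm c = r then
        (if D.IsCrossing (c, g.perm c) then 4 - 8 * (if F.IsUp (g.pt c) then 1 else 0) else 0) else 0) +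
      (if c = D.left r ∨ c = D.right r then
        (sg (D.bot c) r + sg (D.top c) r) * (sg c (D.left r) + sg c (D.right r)) else 0) := by
  have hk := g.perm_eq_iff c r
  have b1 := g.bounds c
  have b2 := g.bounds (g.perm.symm r)
  rw [Equiv.apply_symm_apply] at b2
  have hcor := D.corner_iff c r
  have lr := D.left_lt_right r
  have bt := D.bot_lt_top c
  unfold vertSign horSign
  by_cases hv : D.IsCrossing (c, r)
  · obtain ⟨v1, v2, v3, v4⟩ := id hv
    rw [dif_pos hv, sg_of_lt v3, sg_of_gt v4, sg_of_gt v1, sg_of_lt v2,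
      if_neg (show ¬ (c = D.left r ∨ c = D.right r) from by
        rintro (h | h)
        exacts [v1.ne' h, v2.ne h])]
    unfold FigureEights.res
    simp only
    by_cases hr : g.perm c = r
    · have hτ := hk.1 hr
      have hv' : D.IsCrossing (c, g.perm c) := by rw [hr]; exact hv
      rw [if_pos hr, if_pos hr, if_pos hv', hr, hτ, sg_self, sg_self]
      by_cases hu : F.IsUp (g.pt c) <;> simp [hu]
    · have hτ : ¬ g.perm.symm r = c := fun h => hr (hk.2 h)
      rw [if_neg hr, if_neg hr]
      rcases lt_or_gt_of_ne hr with h1 | h1 <;> rcases lt_or_gt_of_ne hτ with h2 | h2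
      · rw [sg_of_lt h1, sg_of_gt h2]
        simp [h1.le, h2.not_gt]
      · rw [sg_of_lt h1, sg_of_lt h2]
        simp [h1.le, h2]
      · rw [sg_of_gt h1, sg_of_gt h2]
        simp [h1.not_ge, h2.not_gt]
      · rw [sg_of_gt h1, sg_of_lt h2]
        simp [h1.not_ge, h2]
  · have hzero : (if g.perm c = r then (if D.IsCrossing (c, g.perm c) then
        (4 - 8 * (if F.IsUp (g.pt c) then 1 else 0) : ℤ) else 0) else 0) = 0 := by
      by_cases h1 : g.perm c = r
      · rw [if_pos h1, h1, if_neg hv]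
      · rw [if_neg h1]
    rw [dif_neg hv, hzero]
    by_cases hc : c = D.left r ∨ c = D.right r
    · rw [if_pos hc]
      have hc' := hcor.1 hc
      have key : sg (g.perm c) r = (if g.perm c = r then 0 else sg (D.bot c) r + sg (D.top c) r) ∧
          sg c (g.perm.symm r) = (if g.perm c = r then 0 else sg c (D.left r) + sg c (D.right r)) := by
        constructor
        · split_ifs with hr
          · rw [hr, sg_self]
          · rcases hc' with h | h
            · have h1 : D.bot c < g.perm c := lt_of_le_of_ne b1.1 fun h' => hr (h' ▸ h.symm)
              rw [h, sg_self, sg_of_gt h1, sg_of_gt bt]; rfl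
            · have h1 : g.perm c < D.top c := lt_of_le_of_ne b1.2.1 fun h' => hr (h' ▸ h.symm)
              rw [h, sg_self, sg_of_lt h1, sg_of_lt bt]; rfl
        · split_ifs with hr
          · rw [hk.1 hr, sg_self]
          · have hτ : ¬ g.perm.symm r = c := fun h => hr (hk.2 h)
            rcases hc with h | h
            · have h1 : D.left r < g.perm.symm r := lt_of_le_of_ne b2.2.2.1 fun h' => hτ (h' ▸ h.symm)
              rw [h, sg_self, sg_of_lt h1, sg_of_lt lr]; rfl
            · have h1 : g.perm.symm r < D.right r := lt_of_le_of_ne b2.2.2.2 fun h' => hτ (h' ▸ h.symm)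
              rw [h, sg_self, sg_of_gt h1, sg_of_gt lr]; rfl
      rw [key.1, key.2]
      split_ifs <;> ring
    · rw [if_neg hc]
      have hc' := hcor.not.1 hc
      unfold IsCrossing at hv
      simp only at hv
      push Not at hc hc'
      by_cases hbt : D.bot c < r ∧ r < D.top c
      · have hlr : c < D.left r ∨ D.right r < c := by
          by_contra! h
          exact hv ⟨lt_of_le_of_ne h.1 hc.1.symm, lt_of_le_of_ne h.2 hc.2, hbt⟩
        rcases hlr with h | h
        · rw [sg_of_lt h, sg_of_lt (h.trans lr), sg_of_lt (h.trans_le b2.2.2.1)]; ring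
        · rw [sg_of_gt h, sg_of_gt (lr.trans h), sg_of_gt (b2.2.2.2.trans_lt h)]; ring
      · have hbt' : r < D.bot c ∨ D.top c < r := by
          by_contra! h
          exact hbt ⟨lt_of_le_of_ne h.1 hc'.1.symm, lt_of_le_of_ne h.2 hc'.2⟩
        rcases hbt' with h | h
        · rw [sg_of_gt h, sg_of_gt (h.trans bt), sg_of_gt (h.trans_le b1.1)]; ring
        · rw [sg_of_lt h, sg_of_lt (bt.trans h), sg_of_lt (b1.2.1.trans_lt h)]; ring

open Classical in
-- The separate contributions of the side of the figure-eight, of the position relative to the split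
-- and of the smoothing at the point always add up to the same number. This makes the grading
-- comparison independent of `g`.
theorem local_weight (F : D.FigureEights) (g : D.Gen) (c : Fin n) :
    -16 * pathWeight F (g.pt c) + 4 * localLower g c + 8 * (if F.IsUp (g.pt c) then 1 else 0) -
      (if D.IsCrossing (c, g.perm c) then 4 - 8 * (if F.IsUp (g.pt c) then 1 else 0) else 0) = 12 := by
  have b1 := g.bounds c
  have lr := D.left_lt_right (g.perm c)
  have bt := D.bot_lt_top c
  have hcor := D.corner_iff c (g.perm c)
  have s1 := F.bot_le c
  have s2 := F.lt_top c
  have p1 : (g.pt c).onRight = true → _ := Gen.pt_right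
  have p2 : (g.pt c).onRight = false → _ := Gen.pt_left
  have hup := F.isUp_pt g c
  unfold pathWeight localLower
  rw [g.pt_col, g.pt_row, hup]
  generalize g.perm c = σ at *
  clear hup
  generalize (g.pt c).onRight = b at *
  by_cases hv : D.IsCrossing (c, σ)
  · obtain ⟨v1, v2, v3, v4⟩ := id hv
    rw [if_pos hv, if_neg v3.ne, if_neg v4.ne', sg_of_gt v1, sg_of_lt v2, sg_of_gt v3, sg_of_lt v4]
    by_cases hs : F.split c < σ
    · cases b <;> simp [hs, hs.not_ge, v3]
    · cases b <;> simp [hs, not_lt.1 hs, v3]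
  · rw [if_neg hv]
    have hc : c = D.left σ ∨ c = D.right σ := by
      by_contra! h
      exact hv (isCrossing_of_bounds (lt_of_le_of_ne b1.2.2.1 h.1.symm) (lt_of_le_of_ne b1.2.2.2 h.2)
        b1.1 b1.2.1)
    rcases hc with hc | hc <;> rcases hcor.1 (by tauto) with hr | hr
    · have hs : ¬ F.split c < σ := by rw [hr]; exact s1.not_gt
      have hb : b = true := by
        cases b
        · exact absurd (p2 rfl).1 (by rw [← hc]; exact lt_irrefl _)
        · rfl
      have e1 : D.left σ = c := hc.symm
      have e2 : D.bot c = σ := hr.symm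
      rw [e1] at lr
      rw [e2] at bt
      rw [e1, e2, sg_self, sg_self, sg_of_lt lr, sg_of_lt bt, if_neg bt.ne', hb]
      simp [hs, not_lt.1 hs]
    · have hs : F.split c < σ := by rw [hr]; exact s2
      have hb : b = true := by
        cases b
        · exact absurd (p2 rfl).1 (by rw [← hc]; exact lt_irrefl _)
        · rfl
      have e1 : D.left σ = c := hc.symm
      have e2 : D.top c = σ := hr.symm
      rw [e1] at lr
      rw [e2] at bt
      rw [e1, e2, sg_self, sg_self, sg_of_lt lr, sg_of_gt bt, if_neg bt.ne, hb]
      simp [hs, hs.not_ge]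
    · have hs : ¬ F.split c < σ := by rw [hr]; exact s1.not_gt
      have hb : b = false := by
        cases b
        · rfl
        · exact absurd (p1 rfl).2 (by rw [← hc]; exact lt_irrefl _)
      have e1 : D.right σ = c := hc.symm
      have e2 : D.bot c = σ := hr.symm
      rw [e1] at lr
      rw [e2] at bt
      rw [e1, e2, sg_self, sg_self, sg_of_gt lr, sg_of_lt bt, if_neg bt.ne', hb]
      simp [hs, not_lt.1 hs]
    · have hs : F.split c < σ := by rw [hr]; exact s2
      have hb : b = false := by
        cases b
        · rfl
        · exact absurd (p1 rfl).2 (by rw [← hc]; exact lt_irrefl _)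
      have e1 : D.right σ = c := hc.symm
      have e2 : D.top c = σ := hr.symm
      rw [e1] at lr
      rw [e2] at bt
      rw [e1, e2, sg_self, sg_self, sg_of_gt lr, sg_of_gt bt, if_neg bt.ne, hb]
      simp [hs, hs.not_ge, bt]

/-- The sum counts concordant minus discordant ordered pairs, whose total number is n(n-1). Each
pair counted by `T` occurs in both orders; the offset to the left or right of a column does not
affect the order of different columns. -/
theorem T_eq (g : D.Gen) : 4 * g.T =
    (∑ c, ∑ c', sg (g.perm c) (g.perm c') * sg c c') + (n * n - n) := by
  have h1 : g.T = ∑ c, ∑ c', if c < c' ∧ g.perm c < g.perm c' then 1 else 0 := by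
    unfold Gen.T
    rw [Finset.card_filter, Nat.cast_sum, Fintype.sum_prod_type]
    refine Finset.sum_congr rfl fun c _ => Finset.sum_congr rfl fun c' _ => ?_
    rw [Nat.cast_ite, Nat.cast_one, Nat.cast_zero]
    congr 1
    unfold ZPoint.pos
    simp only
    rw [g.pt_col, g.pt_col, g.pt_row, g.pt_row]
    refine propext ⟨fun ⟨k1, k2⟩ => ?_, fun ⟨k1, k2⟩ => ?_⟩
    · have hr : g.perm c < g.perm c' := by rw [Fin.lt_def]; omega
      refine ⟨lt_of_le_of_ne (by rw [Fin.le_def]; split_ifs at k1 <;> omega) ?_, hr⟩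
      rintro rfl
      exact lt_irrefl _ hr
    · rw [Fin.lt_def] at k1 k2
      refine ⟨by split_ifs <;> omega, by omega⟩
  have h2 : g.T = ∑ c, ∑ c', if c' < c ∧ g.perm c' < g.perm c then 1 else 0 := by
    rw [h1, Finset.sum_comm]
  have h3 : ((n : ℤ) * n - n) = ∑ c : Fin n, ∑ c' : Fin n, (1 - if c' = c then 1 else 0) := by
    simp [Finset.sum_sub_distrib]
  have h4 : 4 * g.T = 2 * g.T + 2 * g.T := by ring
  rw [h4]
  conv_lhs =>
    arg 1
    rw [h1]
  rw [h2, h3, Finset.mul_sum, Finset.mul_sum, ← Finset.sum_add_distrib, ← Finset.sum_add_distrib]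
  refine Finset.sum_congr rfl fun c _ => ?_
  rw [Finset.mul_sum, Finset.mul_sum, ← Finset.sum_add_distrib, ← Finset.sum_add_distrib]
  refine Finset.sum_congr rfl fun c' _ => ?_
  rcases lt_trichotomy c c' with h | h | h
  · have hne : g.perm c ≠ g.perm c' := fun h' => h.ne (g.perm.injective h')
    rcases lt_or_gt_of_ne hne with k | k
    · rw [sg_of_lt h, sg_of_lt k]; simp [h, k, h.not_gt, h.ne']
    · rw [sg_of_lt h, sg_of_gt k]; simp [h, k, h.not_gt, k.not_gt, h.ne']
  · subst h
    simp [sg_self]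
  · have hne : g.perm c ≠ g.perm c' := fun h' => h.ne' (g.perm.injective h')
    rcases lt_or_gt_of_ne hne with k | k
    · rw [sg_of_gt h, sg_of_lt k]; simp [h, k, h.not_gt, k.not_gt, h.ne]
    · rw [sg_of_gt h, sg_of_gt k]; simp [h, k, h.not_gt, h.ne]

/-- The pure term of the expanded product gives `T`. Each mixed term is the same sum over punctures,
once sorted by rows and once by columns; it is the main part of `lowerRight`. -/
theorem sum_vertSign_mul_horSign (g : D.Gen) : ∑ c, ∑ r, vertSign g c r * horSign g c r =
    4 * (4 * g.T - (n * n - n)) -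
      4 * (∑ c, D.punctureSum fun c' r' => sg c c' * sg (g.perm c) r') +
      ∑ c, ∑ r, (sg (D.bot c) r + sg (D.top c) r) * (sg c (D.left r) + sg c (D.right r)) := by
  have h1 : ∑ c, ∑ r, sg (g.perm c) r * sg c (g.perm.symm r) = 4 * g.T - (n * n - n) := by
    rw [T_eq, add_sub_cancel_right]
    refine Finset.sum_congr rfl fun c _ => ?_
    rw [← Equiv.sum_comp g.perm fun r => sg (g.perm c) r * sg c (g.perm.symm r)]
    simp
  have h2 : ∑ c, ∑ r, sg (g.perm c) r * (sg c (D.left r) + sg c (D.right r)) =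
      ∑ c, D.punctureSum fun c' r' => sg c c' * sg (g.perm c) r' := by
    refine Finset.sum_congr rfl fun c _ => ?_
    rw [punctureSum_row]
    exact Finset.sum_congr rfl fun r _ => by ring
  have h3 : ∑ c, ∑ r, (sg (D.bot c) r + sg (D.top c) r) * sg c (g.perm.symm r) =
      ∑ c, D.punctureSum fun c' r' => sg c c' * sg (g.perm c) r' := by
    rw [Finset.sum_comm, ← Equiv.sum_comp g.perm]
    refine Finset.sum_congr rfl fun c _ => ?_
    rw [punctureSum_col]
    refine Finset.sum_congr rfl fun c' _ => ?_
    rw [Equiv.symm_apply_apply, sg_swap (g.perm c), sg_swap (g.perm c), sg_swap c c']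
    ring
  have h4 : ∀ c r, vertSign g c r * horSign g c r = 4 * (sg (g.perm c) r * sg c (g.perm.symm r)) -
      2 * (sg (g.perm c) r * (sg c (D.left r) + sg c (D.right r))) -
      2 * ((sg (D.bot c) r + sg (D.top c) r) * sg c (g.perm.symm r)) +
      (sg (D.bot c) r + sg (D.top c) r) * (sg c (D.left r) + sg c (D.right r)) := by
    intro c r
    unfold vertSign horSign
    ring
  simp only [h4, Finset.sum_add_distrib, Finset.sum_sub_distrib, ← Finset.mul_sum]
  rw [h1, h2, h3]
  ring

open Classical in
theorem sum_crossing (f : D.Crossing → ℤ) :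
    ∑ c, f c = ∑ v : Fin n × Fin n, if h : D.IsCrossing v then f ⟨v, h⟩ else 0 := by
  refine Finset.sum_of_injOn Subtype.val Subtype.val_injective.injOn (fun _ _ => by simp) ?_ ?_
  · intro v _ hv
    exact dif_neg fun h => hv ⟨⟨v, h⟩, by simp only [Finset.coe_univ]; trivial, rfl⟩
  · intro c _
    have h : D.IsCrossing c.1 := c.2
    change _ = if h : D.IsCrossing c.1 then f ⟨c.1, h⟩ else 0
    rw [dif_pos h]
    rfl

open Classical in
/-- The relation between the gradings of generators and the number of `1`-smoothings. -/
theorem grading_identity (F : D.FigureEights) (g : D.Gen) :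
    16 * g.T - 16 * relQ F g + 8 * F.Pbar g - 8 * (F.toState g).ibar =
      12 * n + 4 * (n * n - n) +
      4 * (∑ c, D.punctureSum fun c' _ => sg c c') - 4 * (∑ r, D.punctureSum fun _ r' => sg r r') +
      4 * (∑ _ : Fin n, D.punctureSum fun _ _ => 1) -
      (∑ c, ∑ r, (sg (D.bot c) r + sg (D.top c) r) * (sg c (D.left r) + sg c (D.right r))) -
      (∑ c, ∑ r, if D.IsCrossing (c, r) then 4 else 0) +
      ∑ c, ∑ r, if c = D.left r ∨ c = D.right r then
        (sg (D.bot c) r + sg (D.top c) r) * (sg c (D.left r) + sg c (D.right r)) else 0 := by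
  -- The grid sum is evaluated locally by `vertSign_mul_horSign` and globally by expansion. The
  -- quadratic puncture terms cancel against those of `relQ`.
  have h1 := sum_vertSign_mul_horSign g
  simp only [vertSign_mul_horSign F, Finset.sum_add_distrib, Finset.sum_sub_distrib,
    Finset.sum_ite_eq, Finset.mem_univ, if_true] at h1
  have h2 : ∑ c, ∑ r, (if h : D.IsCrossing (c, r) then
      (8 * (if F.res g ⟨_, h⟩ then 1 else 0) - 4 : ℤ) else 0) = 8 * (F.toState g).ibar -
      ∑ c, ∑ r, if D.IsCrossing (c, r) then 4 else 0 := by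
    unfold EState.ibar
    rw [sum_crossing, Fintype.sum_prod_type, Finset.mul_sum, ← Finset.sum_sub_distrib]
    refine Finset.sum_congr rfl fun c _ => ?_
    rw [Finset.mul_sum, ← Finset.sum_sub_distrib]
    refine Finset.sum_congr rfl fun r _ => ?_
    by_cases h : D.IsCrossing (c, r)
    · rw [dif_pos h, dif_pos h, if_pos h]
      rfl
    · rw [dif_neg h, dif_neg h, if_neg h]
      rfl
  have h3 : ∑ c, (-16 * pathWeight F (g.pt c) + 4 * localLower g c +
      8 * (if F.IsUp (g.pt c) then 1 else 0) -
      (if D.IsCrossing (c, g.perm c) then 4 - 8 * (if F.IsUp (g.pt c) then 1 else 0) else 0)) =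
      12 * n := by
    rw [Finset.sum_congr rfl fun c _ => local_weight F g c]
    simp [mul_comm]
  have h4 : 4 * ∑ c, lowerRight (g.pt c) =
      -(∑ c, D.punctureSum fun c' r' => sg c c' * sg (g.perm c) r') +
      (∑ c, D.punctureSum fun c' _ => sg c c') - (∑ r, D.punctureSum fun _ r' => sg r r') +
      (∑ _ : Fin n, D.punctureSum fun _ _ => 1) + ∑ c, localLower g c := by
    rw [Finset.mul_sum, Finset.sum_congr rfl fun c _ => four_mul_lowerRight g c,
      ← Equiv.sum_comp g.perm fun r => D.punctureSum fun _ r' => sg r r']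
    simp only [Finset.sum_add_distrib, Finset.sum_sub_distrib, Finset.sum_neg_distrib]
  simp only [Finset.sum_add_distrib, Finset.sum_sub_distrib, ← Finset.mul_sum] at h3
  have h5 : F.Pbar g = ∑ c, if F.IsUp (g.pt c) then 1 else 0 := rfl
  rw [h2] at h1
  unfold relQ
  rw [Finset.sum_sub_distrib]
  rw [← h5] at h3
  linarith

theorem J_eq (F : D.FigureEights) (g : D.Gen) : F.J g = (F.toState g).j := by
  have h1 := rot_toState F g
  have h2 := rot_toState F D.genX
  have h3 := rotD_eq F
  have h4 := grading_identity F g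
  have h5 := grading_identity F D.genX
  have h6 := Q_eq F g
  have h7 : (F.toState D.genX).ibar = D.nNeg := by
    unfold EState.ibar nNeg
    rw [toState_genX_res]
    refine Finset.sum_congr rfl fun c _ => ?_
    unfold seifertRes
    by_cases h : D.IsPositive c <;> simp [h]
  unfold FigureEights.J EState.j writhe
  omega

end GridDiagram
end GridKh

namespace GridKh
namespace GridDiagram

variable {n : ℕ} {D : GridDiagram n}

/-! ## Combinatorial isomorphisms of diagrams -/

/-- The identity (`true`) or the rotation by a half turn (`false`). -/
def _root_.GridKh.Dir.rotate : Bool → Dir → Dir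
  | true, d => d
  | false, .N => .S
  | false, .S => .N
  | false, .E => .W
  | false, .W => .E

theorem _root_.GridKh.Dir.rotate_rotate (u : Bool) (d : Dir) : (d.rotate u).rotate u = d := by
  cases u <;> cases d <;> rfl

theorem _root_.GridKh.Dir.rotate_injective (u : Bool) : Function.Injective (Dir.rotate u) :=
  Function.LeftInverse.injective (Dir.rotate_rotate u)

theorem _root_.GridKh.Dir.partner_rotate (u b : Bool) (d : Dir) :
    Dir.partner b (d.rotate u) = (Dir.partner b d).rotate u := by
  cases u <;> cases b <;> cases d <;> rfl

theorem _root_.GridKh.Dir.outward_rotate (u b : Bool) (d : Dir) :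
    (d.rotate u).outward (b == u) = d.outward b := by
  cases u <;> cases b <;> cases d <;> rfl

/-- The grid point `v` lies on the segments of its row and of its column. -/
def Touch (D : GridDiagram n) (v : Fin n × Fin n) : Prop :=
  (D.left v.2 ≤ v.1 ∧ v.1 ≤ D.right v.2) ∧ D.bot v.1 ≤ v.2 ∧ v.2 ≤ D.top v.1

theorem touch_corner {c r : Fin n} (h : c = D.left r ∨ c = D.right r) : D.Touch (c, r) := by
  have h' := (D.corner_iff c r).1 h
  have h1 := D.bot_lt_top c
  have h2 := D.left_lt_right r
  refine ⟨?_, ?_⟩ <;> simp only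
  · rcases h with rfl | rfl
    exacts [⟨le_rfl, h2.le⟩, ⟨h2.le, le_rfl⟩]
  · rcases h' with rfl | rfl
    exacts [⟨le_rfl, h1.le⟩, ⟨h1.le, le_rfl⟩]

theorem touch_o (c : Fin n) : D.Touch (c, D.o c) :=
  touch_corner ((D.corner_iff _ _).2 (by
    unfold bot top
    rcases le_total (D.o c) (D.x c) with h | h <;> simp [h]))

theorem touch_x (c : Fin n) : D.Touch (c, D.x c) :=
  touch_corner ((D.corner_iff _ _).2 (by
    unfold bot top
    rcases le_total (D.o c) (D.x c) with h | h <;> simp [h]))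

theorem IsCrossing.touch {v : Fin n × Fin n} (h : D.IsCrossing v) : D.Touch v :=
  ⟨⟨h.1.le, h.2.1.le⟩, h.2.2.1.le, h.2.2.2.le⟩

theorem isCrossing_iff_hasEdge {v : Fin n × Fin n} : D.IsCrossing v ↔ ∀ d, D.HasEdge v d :=
  ⟨fun h d => h.hasEdge d, fun h => ⟨(h .W).1, (h .E).2, (h .S).1, (h .N).2⟩⟩

/-- Half-edges are expressed by the order of points of intersection on a segment, which is what a
`DiagramIso` transports. -/
theorem Touch.hasEdge_iff {v : Fin n × Fin n} (h : D.Touch v) (d : Dir) : D.HasEdge v d ↔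
    match d with
    | .N => ∃ r, D.Touch (v.1, r) ∧ v.2 < r
    | .S => ∃ r, D.Touch (v.1, r) ∧ r < v.2
    | .E => ∃ c, D.Touch (c, v.2) ∧ v.1 < c
    | .W => ∃ c, D.Touch (c, v.2) ∧ c < v.1 := by
  obtain ⟨⟨h1, h2⟩, h3, h4⟩ := h
  cases d <;> simp only [HasEdge]
  · exact ⟨fun h => ⟨_, touch_corner ((D.corner_iff _ _).2 (.inr rfl)), h.2⟩,
      fun ⟨r, k, k'⟩ => ⟨h3, k'.trans_le k.2.2⟩⟩
  · exact ⟨fun h => ⟨_, touch_corner ((D.corner_iff _ _).2 (.inl rfl)), h.1⟩,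
      fun ⟨r, k, k'⟩ => ⟨k.2.1.trans_lt k', h4⟩⟩
  · exact ⟨fun h => ⟨_, touch_corner (.inr rfl), h.2⟩, fun ⟨c, k, k'⟩ => ⟨h1, k'.trans_le k.1.2⟩⟩
  · exact ⟨fun h => ⟨_, touch_corner (.inl rfl), h.1⟩, fun ⟨c, k, k'⟩ => ⟨k.1.1.trans_lt k', h2⟩⟩

/-- A bijection between the rows and the columns of two diagrams, which respects their `O`'s and
`X`'s and the position of the points of intersection of the segments on each segment, up to rotations
by half turns. -/
structure DiagramIso {n m : ℕ} (D : GridDiagram n) (D' : GridDiagram m) where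
  col : Fin n ≃ Fin m
  row : Fin n ≃ Fin m
  colUp : Fin n → Bool
  rowUp : Fin n → Bool
  o : ∀ c, D'.o (col c) = row (D.o c)
  x : ∀ c, D'.x (col c) = row (D.x c)
  touch : ∀ c r, D'.Touch (col c, row r) ↔ D.Touch (c, r)
  row_lt : ∀ {r c c'}, D.Touch (c, r) → D.Touch (c', r) →
    (c < c' ↔ if rowUp r then col c < col c' else col c' < col c)
  col_lt : ∀ {c r r'}, D.Touch (c, r) → D.Touch (c, r') →
    (r < r' ↔ if colUp c then row r < row r' else row r' < row r)
  up : ∀ {c r}, D.Touch (c, r) → rowUp r = colUp c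

namespace DiagramIso

variable {m : ℕ} {D' : GridDiagram m} (I : DiagramIso D D')

def symm : DiagramIso D' D where
  col := I.col.symm
  row := I.row.symm
  colUp c := I.colUp (I.col.symm c)
  rowUp r := I.rowUp (I.row.symm r)
  o c := by
    have := I.o (I.col.symm c)
    rw [Equiv.apply_symm_apply] at this
    rw [this, Equiv.symm_apply_apply]
  x c := by
    have := I.x (I.col.symm c)
    rw [Equiv.apply_symm_apply] at this
    rw [this, Equiv.symm_apply_apply]
  touch c r := by
    rw [← I.touch, Equiv.apply_symm_apply, Equiv.apply_symm_apply]
  row_lt {r c c'} h h' := by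
    have k := (I.touch (I.col.symm c) (I.row.symm r)).1 (by simpa using h)
    have k' := (I.touch (I.col.symm c') (I.row.symm r)).1 (by simpa using h')
    have e1 := I.row_lt k k'
    have e2 := I.row_lt k' k
    simp only [Equiv.apply_symm_apply] at e1 e2
    cases hu : I.rowUp (I.row.symm r) <;> simp only [hu, Bool.false_eq_true, if_true, if_false] at *
    · exact e2.symm
    · exact e1.symm
  col_lt {c r r'} h h' := by
    have k := (I.touch (I.col.symm c) (I.row.symm r)).1 (by simpa using h)
    have k' := (I.touch (I.col.symm c) (I.row.symm r')).1 (by simpa using h')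
    have e1 := I.col_lt k k'
    have e2 := I.col_lt k' k
    simp only [Equiv.apply_symm_apply] at e1 e2
    cases hu : I.colUp (I.col.symm c) <;> simp only [hu, Bool.false_eq_true, if_true, if_false] at *
    · exact e2.symm
    · exact e1.symm
  up {c r} h := I.up ((I.touch _ _).1 (by simpa using h))

theorem symm_symm : I.symm.symm = I := by
  cases I
  simp [symm]

/-- The bijection on grid points. -/
def vert : Fin n × Fin n ≃ Fin m × Fin m := Equiv.prodCongr I.col I.row

theorem vert_mk (c r : Fin n) : I.vert (c, r) = (I.col c, I.row r) := rfl

theorem touch_vert (v : Fin n × Fin n) : D'.Touch (I.vert v) ↔ D.Touch v := I.touch _ _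

theorem hasEdge_vert_of {v : Fin n × Fin n} (hv : D.Touch v) {d : Dir} (h : D.HasEdge v d) :
    D'.HasEdge (I.vert v) (d.rotate (I.rowUp v.2)) := by
  obtain ⟨c, r⟩ := v
  have hv' := (I.touch_vert _).2 hv
  have hu := I.up hv
  rw [hv'.hasEdge_iff]
  rw [hv.hasEdge_iff] at h
  simp only [vert_mk]
  cases d <;> simp only at h <;> obtain ⟨a, h1, h2⟩ := h <;>
    cases hr : I.rowUp r <;> rw [hr] at hu <;> simp only [Dir.rotate] <;>
    refine ⟨_, (I.touch _ _).2 h1, ?_⟩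
  all_goals first
    | simpa [hr] using (I.row_lt hv h1).1 h2
    | simpa [hr] using (I.row_lt h1 hv).1 h2
    | simpa [← hu] using (I.col_lt hv h1).1 h2
    | simpa [← hu] using (I.col_lt h1 hv).1 h2

theorem symm_vert_vert (v : Fin n × Fin n) : I.symm.vert (I.vert v) = v := by
  change (I.col.symm (I.col v.1), I.row.symm (I.row v.2)) = v
  simp

theorem hasEdge_vert {v : Fin n × Fin n} (hv : D.Touch v) (d : Dir) :
    D'.HasEdge (I.vert v) (d.rotate (I.rowUp v.2)) ↔ D.HasEdge v d := by
  refine ⟨fun h => ?_, I.hasEdge_vert_of hv⟩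
  have h' := I.symm.hasEdge_vert_of ((I.touch_vert v).2 hv) h
  rw [symm_vert_vert] at h'
  have e : I.symm.rowUp (I.vert v).2 = I.rowUp v.2 := by
    change I.rowUp (I.row.symm (I.row v.2)) = _
    rw [Equiv.symm_apply_apply]
  rwa [e, Dir.rotate_rotate] at h'

theorem isCrossing_vert (v : Fin n × Fin n) : D'.IsCrossing (I.vert v) ↔ D.IsCrossing v := by
  constructor
  · intro h
    have hv := (I.touch_vert v).1 h.touch
    exact isCrossing_iff_hasEdge.2 fun d => (I.hasEdge_vert hv d).1 (h.hasEdge _)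
  · intro h
    refine isCrossing_iff_hasEdge.2 fun d => ?_
    have := (I.hasEdge_vert h.touch (d.rotate (I.rowUp v.2))).2 (h.hasEdge _)
    rwa [Dir.rotate_rotate] at this

/-- The bijection on crossings. -/
def crossing : D.Crossing ≃ D'.Crossing :=
  I.vert.subtypeEquiv fun v => (I.isCrossing_vert v).symm

theorem symm_crossing : I.symm.crossing = I.crossing.symm := by
  ext c : 1
  rfl

end DiagramIso

/-! ### Arcs -/

/-- The two unit edges lie on the same piece of a segment between points of intersection. -/
def SameArc : D.Edge → D.Edge → Prop
  | .inl e, .inl e' => e.1.2 = e'.1.2 ∧ ∀ c, D.Touch (c, e.1.2) → (c ≤ e.1.1 ↔ c ≤ e'.1.1)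
  | .inr e, .inr e' => e.1.1 = e'.1.1 ∧ ∀ r, D.Touch (e.1.1, r) → (r ≤ e.1.2 ↔ r ≤ e'.1.2)
  | _, _ => False

theorem SameArc.symm {e e' : D.Edge} (h : SameArc e e') : SameArc e' e := by
  rcases e with e | e <;> rcases e' with e' | e' <;> simp only [SameArc] at h ⊢
  · exact ⟨h.1.symm, fun c hc => (h.2 c (h.1 ▸ hc)).symm⟩
  · exact ⟨h.1.symm, fun c hc => (h.2 c (h.1 ▸ hc)).symm⟩

theorem ori_eq_of_straight (s : D.EState) {v : Fin n × Fin n} (hv : ¬ D.IsCrossing v)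
    {d d' : Dir} (hd : (d = .E ∧ d' = .W) ∨ (d = .N ∧ d' = .S)) {e e' : D.Edge}
    (h : D.IsAt v d e) (h' : D.IsAt v d' e') : s.ori e' = s.ori e := by
  have hl : Linked s.res v d d' := .inr ⟨hv, by rcases hd with ⟨rfl, rfl⟩ | ⟨rfl, rfl⟩ <;> simp⟩
  have h1 : d.outward (s.ori e) = !d'.outward (s.ori e') := s.2 v d d' e e' h h' hl
  rcases hd with ⟨rfl, rfl⟩ | ⟨rfl, rfl⟩ <;> simpa [Dir.outward] using h1.symm

theorem HEdge.ori_eq_of_sameArc (s : D.EState) (k : ℕ) : ∀ a b : D.HEdge, a.1.2 = b.1.2 →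
    b.1.1.val = a.1.1.val + k → (∀ c, D.Touch (c, a.1.2) → c ≤ b.1.1 → c ≤ a.1.1) →
    s.ori (.inl a) = s.ori (.inl b) := by
  induction k with
  | zero =>
    rintro ⟨⟨a, r⟩, ha⟩ ⟨⟨b, r'⟩, hb⟩ h1 h2 h3
    simp only at h1 h2
    obtain rfl : a = b := Fin.ext (by omega)
    subst h1
    rfl
  | succ k ih =>
    rintro ⟨⟨a, r⟩, ha⟩ ⟨⟨b, r'⟩, hb⟩ h1 h2 h3
    simp only at h1 h2 h3 ha hb
    subst h1
    have hb' : D.left r ≤ (⟨b.val - 1, by omega⟩ : Fin n) ∧ (⟨b.val - 1, by omega⟩ : Fin n) < D.right r := by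
      simp only [Fin.lt_def, Fin.le_def] at *
      omega
    rw [ih ⟨(a, r), ha⟩ ⟨(⟨b.val - 1, by omega⟩, r), hb'⟩ rfl (by simp only; omega) fun c hc h => h3 c hc (by
      simp only [Fin.le_def] at *
      omega)]
    have hnt : ¬ D.IsCrossing (b, r) := fun h => by
      have := h3 b h.touch le_rfl
      rw [Fin.le_def] at this
      omega
    refine ori_eq_of_straight s hnt (.inl ⟨rfl, rfl⟩) (e := .inl ⟨(b, r), hb⟩) rfl ⟨rfl, ?_⟩
    simp only
    omega

theorem VEdge.ori_eq_of_sameArc (s : D.EState) (k : ℕ) : ∀ a b : D.VEdge, a.1.1 = b.1.1 →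
    b.1.2.val = a.1.2.val + k → (∀ r, D.Touch (a.1.1, r) → r ≤ b.1.2 → r ≤ a.1.2) →
    s.ori (.inr a) = s.ori (.inr b) := by
  induction k with
  | zero =>
    rintro ⟨⟨c, a⟩, ha⟩ ⟨⟨c', b⟩, hb⟩ h1 h2 h3
    simp only at h1 h2
    obtain rfl : a = b := Fin.ext (by omega)
    subst h1
    rfl
  | succ k ih =>
    rintro ⟨⟨c, a⟩, ha⟩ ⟨⟨c', b⟩, hb⟩ h1 h2 h3
    simp only at h1 h2 h3 ha hb
    subst h1
    have hb' : D.bot c ≤ (⟨b.val - 1, by omega⟩ : Fin n) ∧ (⟨b.val - 1, by omega⟩ : Fin n) < D.top c := by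
      simp only [Fin.lt_def, Fin.le_def] at *
      omega
    rw [ih ⟨(c, a), ha⟩ ⟨(c, ⟨b.val - 1, by omega⟩), hb'⟩ rfl (by simp only; omega) fun c hc h => h3 c hc (by
      simp only [Fin.le_def] at *
      omega)]
    have hnt : ¬ D.IsCrossing (c, b) := fun h => by
      have := h3 b h.touch le_rfl
      rw [Fin.le_def] at this
      omega
    refine ori_eq_of_straight s hnt (.inr ⟨rfl, rfl⟩) (e := .inr ⟨(c, b), hb⟩) rfl ⟨rfl, ?_⟩
    simp only
    omega

/-- Between two points of intersection the diagram goes straight, and coherence passes the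
orientation from each unit edge to the next. -/
theorem SameArc.ori_eq {e e' : D.Edge} (h : SameArc e e') (s : D.EState) : s.ori e = s.ori e' := by
  rcases e with e | e <;> rcases e' with e' | e' <;> simp only [SameArc] at h
  · rcases le_total e.1.1.val e'.1.1.val with hle | hle
    · exact HEdge.ori_eq_of_sameArc s _ e e' h.1 (Nat.add_sub_of_le hle).symm fun c hc => (h.2 c hc).2
    · exact (HEdge.ori_eq_of_sameArc s _ e' e h.1.symm (Nat.add_sub_of_le hle).symm
        fun c hc => (h.2 c (h.1 ▸ hc)).1).symm
  · rcases le_total e.1.2.val e'.1.2.val with hle | hle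
    · exact VEdge.ori_eq_of_sameArc s _ e e' h.1 (Nat.add_sub_of_le hle).symm fun c hc => (h.2 c hc).2
    · exact (VEdge.ori_eq_of_sameArc s _ e' e h.1.symm (Nat.add_sub_of_le hle).symm
        fun c hc => (h.2 c (h.1 ▸ hc)).1).symm

/-- Every arc begins at a point of intersection. -/
theorem exists_touch (e : D.Edge) :
    ∃ v d e', D.Touch v ∧ D.IsAt v d e' ∧ SameArc e e' := by
  classical
  rcases e with ⟨⟨a, r⟩, h1, h2⟩ | ⟨⟨c, a⟩, h1, h2⟩ <;> simp only at h1 h2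
  · obtain ⟨c, hc, hmax⟩ := (Finset.univ.filter fun c => D.Touch (c, r) ∧ c ≤ a).exists_max_image id
      ⟨D.left r, by simpa using ⟨touch_corner (.inl rfl), h1⟩⟩
    simp only [Finset.mem_filter, Finset.mem_univ, true_and, id] at hc hmax
    refine ⟨(c, r), .E, .inl ⟨(c, r), hc.1.1.1, hc.2.trans_lt h2⟩, hc.1, rfl, rfl, fun c' hc' => ?_⟩
    exact ⟨fun h => hmax c' ⟨hc', h⟩, fun h => h.trans hc.2⟩
  · obtain ⟨r, hr, hmax⟩ := (Finset.univ.filter fun r => D.Touch (c, r) ∧ r ≤ a).exists_max_image id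
      ⟨D.bot c, by simpa using ⟨touch_corner ((D.corner_iff _ _).2 (.inl rfl)), h1⟩⟩
    simp only [Finset.mem_filter, Finset.mem_univ, true_and, id] at hr hmax
    refine ⟨(c, r), .N, .inr ⟨(c, r), hr.1.2.1, hr.2.trans_lt h2⟩, hr.1, rfl, rfl, fun r' hr' => ?_⟩
    exact ⟨fun h => hmax r' ⟨hr', h⟩, fun h => h.trans hr.2⟩

/-- At a grid point which is not a point of intersection, the diagram goes straight. -/
theorem sameArc_of_not_touch {v : Fin n × Fin n} (hv : ¬ D.Touch v) {d d' : Dir} (hd : d ≠ d')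
    {e e' : D.Edge} (h : D.IsAt v d e) (h' : D.IsAt v d' e') :
    SameArc e e' ∧ d' = d.rotate false := by
  obtain ⟨c, r⟩ := v
  have k := h.hasEdge
  have k' := h'.hasEdge
  have key : ((d = .E ∧ d' = .W) ∨ (d = .W ∧ d' = .E)) ∨ (d = .N ∧ d' = .S) ∨ (d = .S ∧ d' = .N) := by
    unfold Touch at hv
    cases d <;> cases d' <;> simp only [HasEdge, ne_eq, not_true_eq_false] at * <;> simp <;>
      simp only [Fin.lt_def, Fin.le_def] at * <;> omega
  have main : ∀ {e e' : D.Edge}, (D.IsAt (c, r) .E e → D.IsAt (c, r) .W e' → SameArc e e') ∧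
      (D.IsAt (c, r) .N e → D.IsAt (c, r) .S e' → SameArc e e') := by
    intro e e'
    rcases e with ⟨⟨a, b⟩, _⟩ | ⟨⟨a, b⟩, _⟩ <;> rcases e' with ⟨⟨a', b'⟩, _⟩ | ⟨⟨a', b'⟩, _⟩ <;>
      simp only [IsAt, SameArc, Prod.mk.injEq, false_imp_iff, imp_true_iff, imp_false, true_and,
        and_true, not_false_eq_true, implies_true, false_and, and_false]
    · rintro ⟨rfl, rfl⟩ ⟨rfl, h2⟩
      refine ⟨rfl, fun x hx => ?_⟩
      have hne : x ≠ a := fun h => hv (h ▸ hx)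
      simp only [Fin.le_def, ne_eq, Fin.ext_iff] at *
      omega
    · rintro ⟨rfl, rfl⟩ ⟨rfl, h2⟩
      refine ⟨rfl, fun x hx => ?_⟩
      have hne : x ≠ b := fun h => hv (h ▸ hx)
      simp only [Fin.le_def, ne_eq, Fin.ext_iff] at *
      omega
  rcases key with (⟨rfl, rfl⟩ | ⟨rfl, rfl⟩) | (⟨rfl, rfl⟩ | ⟨rfl, rfl⟩)
  exacts [⟨main.1 h h', rfl⟩, ⟨(main.1 h' h).symm, rfl⟩, ⟨main.2 h h', rfl⟩,
    ⟨(main.2 h' h).symm, rfl⟩]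

namespace DiagramIso

variable {m : ℕ} {D' : GridDiagram m} (I : DiagramIso D D')

/-- The edges lie on corresponding arcs. -/
def Corr : D.Edge → D'.Edge → Prop
  | .inl e, .inl e' => e'.1.2 = I.row e.1.2 ∧
      ∀ c, D.Touch (c, e.1.2) → (c ≤ e.1.1 ↔ (I.col c ≤ e'.1.1 ↔ I.rowUp e.1.2 = true))
  | .inr e, .inr e' => e'.1.1 = I.col e.1.1 ∧
      ∀ r, D.Touch (e.1.1, r) → (r ≤ e.1.2 ↔ (I.row r ≤ e'.1.2 ↔ I.colUp e.1.1 = true))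
  | _, _ => False

/-- Whether the isomorphism respects the direction of an edge. -/
def edgeUp : D.Edge → Bool
  | .inl e => I.rowUp e.1.2
  | .inr e => I.colUp e.1.1

variable {I}

theorem Corr.symm {e : D.Edge} {e' : D'.Edge} (h : I.Corr e e') : I.symm.Corr e' e := by
  rcases e with e | e <;> rcases e' with e' | e' <;> simp only [Corr] at h ⊢
  · obtain ⟨h1, h2⟩ := h
    have h3 : I.symm.row e'.1.2 = e.1.2 := by rw [h1]; exact I.row.symm_apply_apply _
    have h4 : I.symm.rowUp e'.1.2 = I.rowUp e.1.2 := congrArg I.rowUp h3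
    refine ⟨h3.symm, fun c hc => ?_⟩
    have := h2 (I.col.symm c) (by rw [← I.touch, Equiv.apply_symm_apply, ← h1]; exact hc)
    rw [Equiv.apply_symm_apply] at this
    change _ ↔ (I.col.symm c ≤ _ ↔ _)
    rw [h4, this]
    tauto
  · obtain ⟨h1, h2⟩ := h
    have h3 : I.symm.col e'.1.1 = e.1.1 := by rw [h1]; exact I.col.symm_apply_apply _
    have h4 : I.symm.colUp e'.1.1 = I.colUp e.1.1 := congrArg I.colUp h3
    refine ⟨h3.symm, fun c hc => ?_⟩
    have := h2 (I.row.symm c) (by rw [← I.touch, Equiv.apply_symm_apply, ← h1]; exact hc)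
    rw [Equiv.apply_symm_apply] at this
    change _ ↔ (I.row.symm c ≤ _ ↔ _)
    rw [h4, this]
    tauto

theorem Corr.edgeUp {e : D.Edge} {e' : D'.Edge} (h : I.Corr e e') :
    I.symm.edgeUp e' = I.edgeUp e := by
  rcases e with e | e <;> rcases e' with e' | e' <;> simp only [Corr] at h
  · change I.rowUp (I.row.symm e'.1.2) = I.rowUp e.1.2
    rw [h.1, Equiv.symm_apply_apply]
  · change I.colUp (I.col.symm e'.1.1) = I.colUp e.1.1
    rw [h.1, Equiv.symm_apply_apply]

theorem Corr.trans_sameArc {e : D.Edge} {e' e'' : D'.Edge} (h : I.Corr e e')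
    (h' : SameArc e' e'') : I.Corr e e'' := by
  rcases e with e | e <;> rcases e' with e' | e' <;> rcases e'' with e'' | e'' <;>
    simp only [Corr, SameArc] at h h' ⊢
  · refine ⟨h'.1.symm.trans h.1, fun c hc => ?_⟩
    rw [h.2 c hc, h'.2 _ (by rw [h.1, I.touch]; exact hc)]
  · refine ⟨h'.1.symm.trans h.1, fun c hc => ?_⟩
    rw [h.2 c hc, h'.2 _ (by rw [h.1, I.touch]; exact hc)]

theorem Corr.sameArc {e₁ e₂ : D.Edge} {e' : D'.Edge} (h₁ : I.Corr e₁ e') (h₂ : I.Corr e₂ e') :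
    SameArc e₁ e₂ := by
  rcases e₁ with e₁ | e₁ <;> rcases e₂ with e₂ | e₂ <;> rcases e' with e' | e' <;>
    simp only [Corr, SameArc] at h₁ h₂ ⊢
  · have he : e₁.1.2 = e₂.1.2 := I.row.injective (h₁.1.symm.trans h₂.1)
    refine ⟨he, fun c hc => ?_⟩
    rw [h₁.2 c hc, h₂.2 c (he ▸ hc), he]
  · have he : e₁.1.1 = e₂.1.1 := I.col.injective (h₁.1.symm.trans h₂.1)
    refine ⟨he, fun c hc => ?_⟩
    rw [h₁.2 c hc, h₂.2 c (he ▸ hc), he]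

theorem edgeUp_of_isAt {v : Fin n × Fin n} (hv : D.Touch v) {d : Dir} {e : D.Edge}
    (h : D.IsAt v d e) : I.edgeUp e = I.rowUp v.2 := by
  have hu := I.up hv
  rcases e with ⟨⟨a, b⟩, _⟩ | ⟨⟨a, b⟩, _⟩ <;> cases d <;> simp only [IsAt] at h
  · change I.rowUp b = _
    rw [← h]
  · change I.rowUp b = _
    rw [h.1]
  · change I.colUp a = _
    rw [hu, ← h]
  · change I.colUp a = _
    rw [hu, h.1]

/-- A half-edge at a point of intersection begins an arc. Monotonicity on the segment carries over
the position of every other point of intersection relative to it. -/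
theorem corr_of_isAt {v : Fin n × Fin n} (hv : D.Touch v) {d : Dir} {e : D.Edge} {e' : D'.Edge}
    (h : D.IsAt v d e) (h' : D'.IsAt (I.vert v) (d.rotate (I.rowUp v.2)) e') : I.Corr e e' := by
  obtain ⟨c, r⟩ := v
  have hu := I.up hv
  rw [vert_mk] at h'
  simp only at h'
  have hlt := fun {c'} (h : D.Touch (c', r)) => I.row_lt hv h
  have hgt := fun {c'} (h : D.Touch (c', r)) => I.row_lt h hv
  have vlt := fun {r'} (h : D.Touch (c, r')) => I.col_lt hv h
  have vgt := fun {r'} (h : D.Touch (c, r')) => I.col_lt h hv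
  rcases e with ⟨⟨a, b⟩, _⟩ | ⟨⟨a, b⟩, _⟩ <;> rcases e' with ⟨⟨a', b'⟩, _⟩ | ⟨⟨a', b'⟩, _⟩ <;>
    cases d <;> simp only [IsAt] at h <;> cases hr : I.rowUp r <;> rw [hr] at hu h' <;>
    simp only [IsAt, Dir.rotate] at h' <;> try simp only [Prod.mk.injEq] at h h'
  all_goals
    obtain ⟨h1, h2⟩ := h
    obtain ⟨h3, h4⟩ := h'
    simp only [Corr]
    first | subst h1 h2 | subst h1
    first | subst h3 h4 | subst h3
    refine ⟨rfl, fun x hx => ?_⟩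
    first
      | have k1 := hlt hx
        have k2 := hgt hx
      | have k1 := vlt hx
        have k2 := vgt hx
    simp only [hr, ← hu, if_true, Bool.false_eq_true, if_false, iff_false, iff_true, not_le] at k1 k2 ⊢
    simp only [Fin.lt_def, Fin.le_def] at *
    omega

theorem exists_corr (I : DiagramIso D D') (e : D.Edge) : ∃ e', I.Corr e e' := by
  obtain ⟨v, d, e₁, hv, h, ha⟩ := exists_touch e
  obtain ⟨e', he'⟩ := (GridDiagram.hasEdge_iff _ _).1 (I.hasEdge_vert_of hv h.hasEdge)
  refine ⟨e', ?_⟩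
  have h1 : I.Corr e₁ e' := corr_of_isAt hv h he'
  exact I.symm_symm ▸ (h1.symm.trans_sameArc ha.symm).symm

theorem exists_corr' (I : DiagramIso D D') (e' : D'.Edge) : ∃ e, I.Corr e e' := by
  obtain ⟨e, he⟩ := I.symm.exists_corr e'
  exact ⟨e, I.symm_symm ▸ he.symm⟩

end DiagramIso
end GridDiagram
end GridKh

namespace GridKh
namespace GridDiagram

variable {n : ℕ} {D : GridDiagram n}

/-! ### Transport of enhanced states -/

/-- Reversing exactly the other circles separates the circle of `e` from them. Circles are thus
described by orientations of states alone, and a bijection of states transports them. -/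
theorem circleOf_eq_iff {ρ : D.Resolution} {e e' : D.Edge} : circleOf ρ e = circleOf ρ e' ↔
    ∀ s t : D.EState, s.res = ρ → t.res = ρ → (s.ori e = t.ori e ↔ s.ori e' = t.ori e') := by
  classical
  constructor
  · rintro h s t rfl ht
    exact EState.ori_eq_iff s t h (ht ▸ h)
  · intro h
    obtain ⟨s, hs, hs'⟩ := EState.exists_labels ρ (fun _ => true) fun _ _ _ => rfl
    obtain ⟨t, ht, ht'⟩ := EState.exists_labels ρ (fun f => decide (circleOf ρ f = circleOf ρ e))
      fun f f' hf => by rw [hf]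
    have k := h s t hs ht
    have hst : s.res = t.res := hs.trans ht.symm
    rw [← (EState.sameCircle_of_res hst e).label_iff, ← (EState.sameCircle_of_res hst e').label_iff,
      hs', hs', ht', ht'] at k
    simpa [eq_comm] using k

namespace DiagramIso

variable {m : ℕ} {D' : GridDiagram m} (I : DiagramIso D D')

/-- The orientation of the edges of `D'` which corresponds to the orientation of a state. -/
def mapOri (s : D.EState) (e' : D'.Edge) : Bool :=
  s.ori (I.exists_corr' e').choose == I.edgeUp (I.exists_corr' e').choose

variable {I} in
theorem Corr.mapOri_eq {e : D.Edge} {e' : D'.Edge} (h : I.Corr e e') (s : D.EState) :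
    I.mapOri s e' = (s.ori e == I.edgeUp e) := by
  have h' := (I.exists_corr' e').choose_spec
  unfold mapOri
  rw [(h'.sameArc h).ori_eq s, ← h.edgeUp, ← h'.edgeUp]

theorem mapOri_isAt (s : D.EState) {v : Fin n × Fin n} (hv : D.Touch v) {d : Dir} {e : D.Edge}
    {e' : D'.Edge} (h : D.IsAt v d e) (h' : D'.IsAt (I.vert v) (d.rotate (I.rowUp v.2)) e') :
    (d.rotate (I.rowUp v.2)).outward (I.mapOri s e') = d.outward (s.ori e) := by
  rw [(corr_of_isAt hv h h').mapOri_eq, edgeUp_of_isAt hv h, Dir.outward_rotate]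

/-- A half turn commutes with both smoothings of a crossing, by `Dir.partner_rotate`. -/
theorem linked_vert {ρ : D.Resolution} {v : Fin n × Fin n} {u : Bool} {d d' : Dir} :
    Linked (fun c' => ρ (I.crossing.symm c')) (I.vert v) (d.rotate u) (d'.rotate u) ↔
      Linked ρ v d d' := by
  have key : ∀ (hv : D.IsCrossing v) (h : D'.IsCrossing (I.vert v)),
      (fun c' => ρ (I.crossing.symm c')) ⟨I.vert v, h⟩ = ρ ⟨v, hv⟩ := fun hv _ =>
    congrArg ρ (I.crossing.symm_apply_apply ⟨v, hv⟩)
  unfold Linked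
  refine or_congr ⟨?_, ?_⟩
    (and_congr (I.isCrossing_vert v).not (Dir.rotate_injective u).ne_iff)
  · rintro ⟨h, k⟩
    have hv := (I.isCrossing_vert v).1 h
    have k' := k.trans (congrArg (Dir.partner · (d.rotate u)) (key hv h))
    rw [Dir.partner_rotate] at k'
    exact ⟨hv, Dir.rotate_injective u k'⟩
  · rintro ⟨hv, rfl⟩
    have h := (I.isCrossing_vert v).2 hv
    refine ⟨h, ?_⟩
    rw [← Dir.partner_rotate]
    exact (congrArg (Dir.partner · (d.rotate u)) (key hv h)).symm

theorem coherent_mapOri (s : D.EState) :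
    Coherent (fun c' => s.res (I.crossing.symm c')) (I.mapOri s) := by
  intro v' d₁' d₂' e₁' e₂' h₁' h₂' hl
  by_cases hv' : D'.Touch v'
  · obtain ⟨v, rfl⟩ := I.vert.surjective v'
    have hv := (I.touch_vert v).1 hv'
    set u := I.rowUp v.2 with hu
    obtain ⟨d₁, rfl⟩ : ∃ d₁ : Dir, d₁' = d₁.rotate u := ⟨_, (Dir.rotate_rotate u d₁').symm⟩
    obtain ⟨d₂, rfl⟩ : ∃ d₂ : Dir, d₂' = d₂.rotate u := ⟨_, (Dir.rotate_rotate u d₂').symm⟩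
    obtain ⟨e₁, h₁⟩ := (GridDiagram.hasEdge_iff _ _).1 ((I.hasEdge_vert hv d₁).1 h₁'.hasEdge)
    obtain ⟨e₂, h₂⟩ := (GridDiagram.hasEdge_iff _ _).1 ((I.hasEdge_vert hv d₂).1 h₂'.hasEdge)
    rw [I.mapOri_isAt s hv h₁ h₁', I.mapOri_isAt s hv h₂ h₂']
    exact s.2 v d₁ d₂ e₁ e₂ h₁ h₂ (I.linked_vert.1 hl)
  -- Off the points of intersection the two half-edges lie on one arc in opposite directions, and
  -- the transported orientation is constant on it.
  · obtain ⟨ha, rfl⟩ := sameArc_of_not_touch hv' hl.ne h₁' h₂'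
    obtain ⟨e, he⟩ := I.exists_corr' e₁'
    rw [he.mapOri_eq, (he.trans_sameArc ha).mapOri_eq]
    cases d₁' <;> simp [Dir.rotate, Dir.outward]

/-- The state of `D'` which corresponds to a state of `D`. -/
def mapState (s : D.EState) : D'.EState :=
  EState.mk (fun c' => s.res (I.crossing.symm c')) (I.mapOri s) (I.coherent_mapOri s)

theorem mapState_res (s : D.EState) (c : D.Crossing) :
    (I.mapState s).res (I.crossing c) = s.res c := by
  unfold mapState
  rw [EState.mk_res, Equiv.symm_apply_apply]

variable {I} in
theorem Corr.mapState_ori {e : D.Edge} {e' : D'.Edge} (h : I.Corr e e') (s : D.EState) :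
    (I.mapState s).ori e' = (s.ori e == I.edgeUp e) := by
  unfold mapState
  rw [EState.mk_ori, h.mapOri_eq]

theorem symm_mapState_mapState (s : D.EState) : I.symm.mapState (I.mapState s) = s := by
  refine EState.ext (funext fun c => ?_) fun e => ?_
  · have h := I.symm.mapState_res (I.mapState s) (I.crossing c)
    rw [I.mapState_res, I.symm_crossing, Equiv.symm_apply_apply] at h
    exact h
  · obtain ⟨e', he⟩ := I.exists_corr e
    rw [he.symm.mapState_ori, he.mapState_ori, he.edgeUp]
    cases s.ori e <;> cases I.edgeUp e <;> rfl

/-- The bijection on enhanced states. -/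
def state : D.EState ≃ D'.EState where
  toFun := I.mapState
  invFun := I.symm.mapState
  left_inv := I.symm_mapState_mapState
  right_inv s := by
    have := I.symm.symm_mapState_mapState s
    rwa [I.symm_symm] at this

theorem state_res (s : D.EState) (c : D.Crossing) : (I.state s).res (I.crossing c) = s.res c :=
  I.mapState_res s c

variable {I} in
theorem Corr.state_ori {e : D.Edge} {e' : D'.Edge} (h : I.Corr e e') (s : D.EState) :
    (I.state s).ori e' = (s.ori e == I.edgeUp e) :=
  h.mapState_ori s

variable {I} in
theorem Corr.state_ori_eq {e : D.Edge} {e' : D'.Edge} (h : I.Corr e e') (s t : D.EState) :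
    (I.state s).ori e' = (I.state t).ori e' ↔ s.ori e = t.ori e := by
  rw [h.state_ori, h.state_ori]
  cases s.ori e <;> cases t.ori e <;> cases I.edgeUp e <;> simp

theorem state_ori_eq (s t : D.EState) : (I.state s).ori = (I.state t).ori ↔ s.ori = t.ori := by
  constructor
  · intro h
    funext e
    obtain ⟨e', he⟩ := I.exists_corr e
    exact (he.state_ori_eq s t).1 (congrFun h e')
  · intro h
    funext e'
    obtain ⟨e, he⟩ := I.exists_corr' e'
    exact (he.state_ori_eq s t).2 (congrFun h e)

theorem state_res_eq (s t : D.EState) : (I.state s).res = (I.state t).res ↔ s.res = t.res := by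
  constructor
  · intro h
    funext c
    rw [← I.state_res, h, I.state_res]
  · intro h
    funext c'
    obtain ⟨c, rfl⟩ := I.crossing.surjective c'
    rw [I.state_res, h, I.state_res]

theorem state_res_update (s t : D.EState) (c : D.Crossing) (b : Bool) :
    (I.state t).res = Function.update (I.state s).res (I.crossing c) b ↔
      t.res = Function.update s.res c b := by
  have key : ∀ c', Function.update (I.state s).res (I.crossing c) b (I.crossing c') =
      Function.update s.res c b c' := by
    intro c'
    by_cases h : c' = c
    · subst h
      rw [Function.update_self, Function.update_self]
    · rw [Function.update_of_ne h, Function.update_of_ne fun h' => h (I.crossing.injective h'),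
        I.state_res]
  constructor
  · intro h
    funext c'
    rw [← I.state_res, h, key]
  · intro h
    funext c'
    obtain ⟨c', rfl⟩ := I.crossing.surjective c'
    rw [I.state_res, h, key]

variable {I} in
theorem Corr.circleOf_iff {e₁ e₂ : D.Edge} {e₁' e₂' : D'.Edge} (h₁ : I.Corr e₁ e₁')
    (h₂ : I.Corr e₂ e₂') (s : D.EState) :
    circleOf (I.state s).res e₁' = circleOf (I.state s).res e₂' ↔
      circleOf s.res e₁ = circleOf s.res e₂ := by
  rw [circleOf_eq_iff, circleOf_eq_iff]
  constructor
  · intro h t u ht hu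
    have := h (I.state t) (I.state u) ((I.state_res_eq _ _).2 ht) ((I.state_res_eq _ _).2 hu)
    rwa [h₁.state_ori_eq, h₂.state_ori_eq] at this
  · intro h t' u' ht hu
    obtain ⟨t, rfl⟩ := I.state.surjective t'
    obtain ⟨u, rfl⟩ := I.state.surjective u'
    rw [h₁.state_ori_eq, h₂.state_ori_eq]
    exact h t u ((I.state_res_eq _ _).1 ht) ((I.state_res_eq _ _).1 hu)

theorem corr_edge (c : D.Crossing) (d : Dir) :
    I.Corr (c.edge d) ((I.crossing c).edge (d.rotate (I.rowUp c.1.2))) :=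
  corr_of_isAt (IsCrossing.touch c.2) (c.isAt_edge d) ((I.crossing c).isAt_edge _)

theorem touches_iff {e : D.Edge} {e' : D'.Edge} (h : I.Corr e e') (s : D.EState)
    (c : D.Crossing) : (I.crossing c).Touches (I.state s).res e' ↔ c.Touches s.res e := by
  have hN := I.corr_edge c .N
  have hS := I.corr_edge c .S
  unfold Crossing.Touches
  cases hu : I.rowUp c.1.2 <;> rw [hu] at hN hS <;> simp only [Dir.rotate] at hN hS
  · rw [h.circleOf_iff hN, h.circleOf_iff hS, or_comm]
  · rw [h.circleOf_iff hN, h.circleOf_iff hS]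

theorem stepAt_iff (s t : D.EState) (c : D.Crossing) :
    (I.state s).StepAt (I.state t) (I.crossing c) ↔ s.StepAt t c := by
  constructor
  · rintro ⟨h1, h2, h3⟩
    refine ⟨by rwa [I.state_res] at h1, (I.state_res_update _ _ _ _).1 h2, fun e he => ?_⟩
    obtain ⟨e', hc⟩ := I.exists_corr e
    exact (hc.state_ori_eq t s).1 (h3 e' ((I.touches_iff hc s c).not.2 he))
  · rintro ⟨h1, h2, h3⟩
    refine ⟨by rwa [I.state_res], (I.state_res_update _ _ _ _).2 h2, fun e' he => ?_⟩
    obtain ⟨e, hc⟩ := I.exists_corr' e'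
    exact (hc.state_ori_eq t s).2 (h3 e ((I.touches_iff hc s c).not.1 he))

theorem forbidden_state (s : D.EState) (c : D.Crossing) :
    (I.state s).Forbidden (I.crossing c) ↔ s.Forbidden c := by
  rw [EState.forbidden_iff_edge, EState.forbidden_iff_edge]
  have key : ∀ d : Dir, (d.rotate (I.rowUp c.1.2)).outward
      ((I.state s).ori ((I.crossing c).edge (d.rotate (I.rowUp c.1.2)))) =
      d.outward (s.ori (c.edge d)) := fun d => by
    rw [(I.corr_edge c d).state_ori, edgeUp_of_isAt (IsCrossing.touch c.2) (c.isAt_edge d),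
      Dir.outward_rotate]
  have hew : ∀ d : Dir, (d.rotate (I.rowUp c.1.2) = .E ∨ d.rotate (I.rowUp c.1.2) = .W) ↔
      d = .E ∨ d = .W := fun d => by
    cases I.rowUp c.1.2 <;> cases d <;> simp [Dir.rotate]
  constructor
  · intro h d
    rw [← key, h, hew]
  · intro h d
    obtain ⟨d, rfl⟩ : ∃ d₁ : Dir, d = d₁.rotate (I.rowUp c.1.2) := ⟨_, (Dir.rotate_rotate _ d).symm⟩
    rw [key, h, hew]

theorem inH_state (s : D.EState) : (I.state s).InH ↔ s.InH := by
  unfold EState.InH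
  rw [← I.crossing.forall_congr_right]
  simp only [I.forbidden_state]

theorem flipAt_iff (s t : D.EState) (c : D.Crossing) :
    (I.state s).FlipAt (I.state t) (I.crossing c) ↔ s.FlipAt t c := by
  constructor
  · rintro ⟨h1, h2, h3, h4⟩
    exact ⟨by rwa [I.state_res] at h1, (I.state_res_update _ _ _ _).1 h2, (I.state_ori_eq _ _).1 h3,
      (I.forbidden_state _ _).1 h4⟩
  · rintro ⟨h1, h2, h3, h4⟩
    exact ⟨by rwa [I.state_res], (I.state_res_update _ _ _ _).2 h2, (I.state_ori_eq _ _).2 h3,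
      (I.forbidden_state _ _).2 h4⟩

/-! ### Gradings -/

theorem ibar_state (s : D.EState) : (I.state s).ibar = s.ibar := by
  unfold EState.ibar
  rw [← I.crossing.sum_comp]
  simp only [I.state_res]

/-- A half turn reverses both strands, so their relative direction is unchanged. -/
theorem isPositive_iff (c : D.Crossing) : D'.IsPositive (I.crossing c) ↔ D.IsPositive c := by
  obtain ⟨⟨a, r⟩, hv⟩ := c
  have ho : D'.o.symm (I.row r) = I.col (D.o.symm r) := by
    rw [Equiv.symm_apply_eq, I.o, Equiv.apply_symm_apply]
  have hx : D'.x.symm (I.row r) = I.col (D.x.symm r) := by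
    rw [Equiv.symm_apply_eq, I.x, Equiv.apply_symm_apply]
  have t1 := touch_o (D := D) (D.o.symm r)
  have t2 := touch_x (D := D) (D.x.symm r)
  rw [Equiv.apply_symm_apply] at t1 t2
  have h1 := I.col_lt (touch_x a) (touch_o a)
  have h1' := I.col_lt (touch_o a) (touch_x a)
  have h2 := I.row_lt t1 t2
  have h2' := I.row_lt t2 t1
  have hu : I.rowUp r = I.colUp a := I.up (IsCrossing.touch hv)
  have n1 := D.ne a
  have n2 : D.o.symm r ≠ D.x.symm r := fun h => D.ne (D.o.symm r) (by
    rw [Equiv.apply_symm_apply, h, Equiv.apply_symm_apply])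
  change ¬ (D'.x (I.col a) < D'.o (I.col a) ↔ D'.o.symm (I.row r) < D'.x.symm (I.row r)) ↔
    ¬ (D.x a < D.o a ↔ D.o.symm r < D.x.symm r)
  rw [I.o, I.x, ho, hx]
  cases hr : I.rowUp r <;> rw [hr] at hu <;>
    simp only [hr, ← hu, if_true, Bool.false_eq_true, if_false] at h1 h1' h2 h2'
  · rw [← h1', ← h2']
    rcases lt_or_gt_of_ne n1 with k | k <;> rcases lt_or_gt_of_ne n2 with k' | k' <;>
      simp [k, k', k.not_gt, k'.not_gt]
  · rw [← h1, ← h2]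

open Classical in
include I in
theorem nPos_eq : D'.nPos = D.nPos := by
  unfold nPos
  rw [← I.crossing.sum_comp]
  exact Finset.sum_congr rfl fun c _ => if_congr (I.isPositive_iff c) rfl rfl

open Classical in
include I in
theorem nNeg_eq : D'.nNeg = D.nNeg := by
  unfold nNeg
  rw [← I.crossing.sum_comp]
  exact Finset.sum_congr rfl fun c _ => if_congr (I.isPositive_iff c) rfl rfl

theorem out_state (s : D.EState) {v : Fin n × Fin n} (hv : D.Touch v) {d : Dir}
    (h : D.HasEdge v d) :
    (I.state s).Out (I.vert v) (d.rotate (I.rowUp v.2)) ↔ s.Out v d := by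
  obtain ⟨e, he⟩ := (GridDiagram.hasEdge_iff _ _).1 h
  obtain ⟨e', he'⟩ := (GridDiagram.hasEdge_iff _ _).1 (I.hasEdge_vert_of hv h)
  rw [EState.out_iff he, EState.out_iff he']
  have := I.mapOri_isAt s hv he he'
  rw [← this]
  rfl

theorem inTurn_state (s : D.EState) {v : Fin n × Fin n} (hv : D.Touch v) (d : Dir) :
    (I.state s).inTurn (I.vert v) (d.rotate (I.rowUp v.2)) = s.inTurn v d := by
  by_cases h : D.HasEdge v d
  · have ho := I.out_state s hv h
    by_cases hs : s.Out v d
    · rw [EState.inTurn_of_not fun _ => ho.2 hs, EState.inTurn_of_not fun _ => hs]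
    · obtain ⟨e, he⟩ := (GridDiagram.hasEdge_iff _ _).1 h
      obtain ⟨d', e', he', hl⟩ := exists_linked s.res he
      rw [EState.inTurn_of_linked h he'.hasEdge hl hs,
        EState.inTurn_of_linked (I.hasEdge_vert_of hv h) (I.hasEdge_vert_of hv he'.hasEdge)
          (I.linked_vert.2 hl) (ho.not.2 hs)]
      cases I.rowUp v.2 <;> cases d <;> cases d' <;> simp [Dir.rotate, cross, Dir.vec]
  · rw [EState.inTurn_of_not fun h' => absurd h' h,
      EState.inTurn_of_not fun h' => absurd ((I.hasEdge_vert hv d).1 h') h]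

theorem _root_.GridKh.GridDiagram.EState.vertexTurn_of_not_touch (s : D.EState)
    {v : Fin n × Fin n} (hv : ¬ D.Touch v) : s.vertexTurn v = 0 := by
  have key : ∀ d, s.inTurn v d = 0 := by
    intro d
    by_cases h : D.HasEdge v d
    · by_cases hs : s.Out v d
      · exact EState.inTurn_of_not fun _ => hs
      · obtain ⟨e, he⟩ := (GridDiagram.hasEdge_iff _ _).1 h
        obtain ⟨d', e', he', hl⟩ := exists_linked s.res he
        obtain ⟨-, rfl⟩ := sameArc_of_not_touch hv hl.ne he he'
        rw [EState.inTurn_of_linked h he'.hasEdge hl hs]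
        cases d <;> simp [Dir.rotate, cross, Dir.vec]
    · exact EState.inTurn_of_not fun h' => absurd h' h
  simp only [EState.vertexTurn, key, add_zero]

theorem vertexTurn_state (s : D.EState) (v : Fin n × Fin n) :
    (I.state s).vertexTurn (I.vert v) = s.vertexTurn v := by
  by_cases hv : D.Touch v
  · have key := I.inTurn_state s hv
    unfold EState.vertexTurn
    rw [← key .N, ← key .S, ← key .E, ← key .W]
    cases I.rowUp v.2 <;> simp only [Dir.rotate]
    ring
  · rw [EState.vertexTurn_of_not_touch s hv,
      EState.vertexTurn_of_not_touch _ ((I.touch_vert v).not.2 hv)]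

/-- Turning at points of intersection is invariant under half turns and vanishes elsewhere. This
avoids comparing areas, which are not preserved. -/
theorem rot_state (s : D.EState) :
    rot (I.state s).res (I.state s).ori = rot s.res s.ori := by
  have h1 := s.four_mul_rot
  have h2 := (I.state s).four_mul_rot
  rw [EState.sum_vertexTurn] at h1 h2
  rw [← I.vert.sum_comp] at h2
  simp only [I.vertexTurn_state] at h2
  omega

theorem i_state (s : D.EState) : (I.state s).i = s.i := by
  unfold EState.i
  rw [I.ibar_state, I.nNeg_eq]

theorem j_state (s : D.EState) : (I.state s).j = s.j := by
  unfold EState.j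
  rw [I.ibar_state, I.nNeg_eq, I.nPos_eq, I.rot_state]

end DiagramIso
end GridDiagram
end GridKh

namespace GridKh

/-! ### Matrices that agree up to signs of the basis elements -/

/-- Under the bijection `φ` of the index sets, the matrix `M` becomes `M'` after multiplying the basis
elements by the signs `u`. -/
def SignConj {S S' : Type} (φ : S ≃ S') (u : S → ℚ) (M : Matrix S S ℚ) (M' : Matrix S' S' ℚ) :
    Prop := ∀ s t, M' (φ t) (φ s) = u t * u s * M t s

namespace SignConj

variable {S S' : Type} {φ : S ≃ S'} {u : S → ℚ} {M N : Matrix S S ℚ} {M' N' : Matrix S' S' ℚ}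

theorem sub (h : SignConj φ u M M') (k : SignConj φ u N N') : SignConj φ u (M - N) (M' - N') := by
  intro s t
  rw [Matrix.sub_apply, Matrix.sub_apply, h, k]
  ring

theorem sum {ι : Type} {A : ι → Matrix S S ℚ} {A' : ι → Matrix S' S' ℚ} (I : Finset ι)
    (h : ∀ i, SignConj φ u (A i) (A' i)) : SignConj φ u (∑ i ∈ I, A i) (∑ i ∈ I, A' i) := by
  intro s t
  rw [Matrix.sum_apply, Matrix.sum_apply, Finset.mul_sum]
  exact Finset.sum_congr rfl fun i _ => h i s t

theorem mul [Fintype S] [Fintype S'] (hu : ∀ s, u s * u s = 1) (h : SignConj φ u M M') (k : SignConj φ u N N') :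
    SignConj φ u (M * N) (M' * N') := by
  intro s t
  rw [Matrix.mul_apply, Matrix.mul_apply, ← φ.sum_comp, Finset.mul_sum]
  refine Finset.sum_congr rfl fun r _ => ?_
  rw [h, k]
  linear_combination u t * u s * M t r * N r s * hu r

theorem one [DecidableEq S] [DecidableEq S'] (hu : ∀ s, u s * u s = 1) : SignConj φ u (1 : Matrix S S ℚ) (1 : Matrix S' S' ℚ) := by
  intro s t
  by_cases h : t = s
  · subst h
    rw [Matrix.one_apply_eq, Matrix.one_apply_eq, hu, mul_one]
  · rw [Matrix.one_apply_ne h, Matrix.one_apply_ne (φ.injective.ne h), mul_zero]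

theorem pow [Fintype S] [Fintype S'] [DecidableEq S] [DecidableEq S'] (hu : ∀ s, u s * u s = 1) (h : SignConj φ u M M') (k : ℕ) :
    SignConj φ u (M ^ k) (M' ^ k) := by
  induction k with
  | zero => simpa using one hu
  | succ k ih =>
    rw [pow_succ, pow_succ]
    exact ih.mul hu h

end SignConj

namespace GridDiagram

variable {n : ℕ} {D : GridDiagram n}

/-- The coefficient is a function of rotation numbers only, so it is invariant without any
comparison of the labels of single circles. -/
theorem EState.StepAt.edgeCoeff_eq {s t : D.EState} {c : D.Crossing} (h : s.StepAt t c) :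
    edgeCoeff s t c = if GridDiagram.rot t.res t.ori = GridDiagram.rot s.res s.ori - 1 then 1 else 0 := by
  have hr := h.rot
  split_ifs with hc
  · exact h.edgeCoeff_of_touchSgn (by omega)
  · by_contra hne
    have := h.touchSgn_of_edgeCoeff hne
    omega

namespace DiagramIso

variable {m : ℕ} {D' : GridDiagram m} (I : DiagramIso D D')

/-- The isomorphism exchanges the lexicographic order of two crossings. -/
def Inverts (a b : D.Crossing) : Prop :=
  toLex a.1 < toLex b.1 ∧ toLex (I.crossing b).1 < toLex (I.crossing a).1

open Classical in
/-- The sign of the permutation of the `1`-smoothings with respect to the lexicographic orders of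
the crossings of the two diagrams. -/
def orderSign (ρ : D.Resolution) : ℤˣ :=
  ∏ a, ∏ b, if (ρ a = true ∧ ρ b = true) ∧ I.Inverts a b then -1 else 1

/-- The sign by which the basis element of a state is multiplied. -/
def stateSign (s : D.EState) : ℚ := ((I.orderSign s.res : ℤ) : ℚ)

theorem stateSign_mul_self (s : D.EState) : I.stateSign s * I.stateSign s = 1 := by
  unfold stateSign
  rcases Int.units_eq_one_or (I.orderSign s.res) with h | h <;> rw [h] <;> norm_num

open Classical in
-- The pairs not involving `c` occur twice and cancel; there remain the pairs of `c` with a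
-- `1`-smoothed crossing whose order is exchanged.
theorem orderSign_update {ρ : D.Resolution} {c : D.Crossing} (hc : ρ c = false) :
    I.orderSign (Function.update ρ c true) * I.orderSign ρ =
      ∏ b, if ρ b = true ∧ (I.Inverts c b ∨ I.Inverts b c) then -1 else 1 := by
  have hirr : ∀ a, ¬ I.Inverts a a := fun a h => lt_irrefl _ h.1
  have hasym : ∀ a b, I.Inverts a b → ¬ I.Inverts b a := fun a b h h' => lt_asymm h.1 h'.1
  have key : ∀ a b, (if (Function.update ρ c true a = true ∧ Function.update ρ c true b = true) ∧
      I.Inverts a b then (-1 : ℤˣ) else 1) =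
      (if (ρ a = true ∧ ρ b = true) ∧ I.Inverts a b then -1 else 1) *
      ((if a = c then (if ρ b = true ∧ I.Inverts c b then -1 else 1) else 1) *
        if b = c then (if ρ a = true ∧ I.Inverts a c then -1 else 1) else 1) := by
    intro a b
    by_cases ha : a = c <;> by_cases hb : b = c
    · subst ha
      subst hb
      simp [hirr]
    · subst ha
      rw [Function.update_self, Function.update_of_ne hb]
      simp [hb, hc]
    · subst hb
      rw [Function.update_self, Function.update_of_ne ha]
      simp [ha, hc]
    · rw [Function.update_of_ne ha, Function.update_of_ne hb]
      simp [ha, hb]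
  unfold orderSign
  simp only [key, Finset.prod_mul_distrib]
  have e1 : ∏ a, ∏ b, (if a = c then (if ρ b = true ∧ I.Inverts c b then (-1 : ℤˣ) else 1) else 1) =
      ∏ b, if ρ b = true ∧ I.Inverts c b then (-1 : ℤˣ) else 1 := by
    rw [Finset.prod_eq_single c]
    · simp
    · intro a _ ha
      simp [ha]
    · simp
  have e2 : ∏ a, ∏ b, (if b = c then (if ρ a = true ∧ I.Inverts a c then (-1 : ℤˣ) else 1) else 1) =
      ∏ a, if ρ a = true ∧ I.Inverts a c then (-1 : ℤˣ) else 1 := by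
    refine Finset.prod_congr rfl fun a _ => ?_
    rw [Finset.prod_eq_single c]
    · simp
    · intro b _ hb
      simp [hb]
    · simp
  rw [e1, e2, mul_right_comm, Int.units_mul_self, one_mul, ← Finset.prod_mul_distrib]
  refine Finset.prod_congr rfl fun b _ => ?_
  by_cases h1 : ρ b = true <;> by_cases h2 : I.Inverts c b <;> by_cases h3 : I.Inverts b c <;>
    simp [h1, h2, h3]
  exact hasym _ _ h2 h3

/-- The two cube signs differ by the number of `1`-smoothed crossings that lie before `c` in only
one of the two orders. This is the change of `orderSign`. -/
theorem cubeSign_state {s t : D.EState} {c : D.Crossing} (hc : s.res c = false)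
    (ht : t.res = Function.update s.res c true) :
    cubeSign (I.state s).res (I.crossing c) =
      I.stateSign t * I.stateSign s * cubeSign s.res c := by
  classical
  have key : cubeSign (I.state s).res (I.crossing c) * cubeSign s.res c =
      I.stateSign t * I.stateSign s := by
    unfold stateSign
    rw [ht, ← Int.cast_mul, ← Units.val_mul, I.orderSign_update hc]
    unfold cubeSign
    rw [← I.crossing.prod_comp, ← Finset.prod_mul_distrib, Units.coe_prod, Int.cast_prod]
    refine Finset.prod_congr rfl fun b _ => ?_
    rw [I.state_res]
    by_cases hb : s.res b = true
    · have hne : b ≠ c := by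
        rintro rfl
        rw [hc] at hb
        exact absurd hb (by simp)
      have h1 : toLex b.1 ≠ toLex c.1 := fun h => hne (Subtype.ext (toLex.injective h))
      have h2 : toLex (I.crossing b).1 ≠ toLex (I.crossing c).1 := fun h =>
        hne (I.crossing.injective (Subtype.ext (toLex.injective h)))
      unfold Inverts
      rcases lt_or_gt_of_ne h1 with k | k <;> rcases lt_or_gt_of_ne h2 with k' | k' <;>
        simp [hb, k, k', k.not_gt, k'.not_gt]
    · simp [hb]
  rw [← key, mul_assoc, cubeSign_mul_self, mul_one]

theorem signConj_khovanov : SignConj I.state I.stateSign D.khovanov D'.khovanov := by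
  classical
  intro s t
  rw [khovanov_apply, khovanov_apply, ← I.crossing.sum_comp, Finset.mul_sum]
  refine Finset.sum_congr rfl fun c _ => ?_
  by_cases h : s.StepAt t c
  · have h' := (I.stepAt_iff s t c).2 h
    rw [if_pos h, if_pos h', h.edgeCoeff_eq, h'.edgeCoeff_eq, I.rot_state, I.rot_state,
      I.cubeSign_state h.res_eq h.res, mul_assoc]
  · rw [if_neg h, if_neg ((I.stepAt_iff s t c).not.2 h), mul_zero]

theorem signConj_khovanovR : SignConj I.state I.stateSign D.khovanovR D'.khovanovR := by
  intro s t
  by_cases h : ∃ c, s.FlipAt t c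
  · obtain ⟨c, hc⟩ := h
    rw [khovanovR_of_flip hc, khovanovR_of_flip ((I.flipAt_iff s t c).2 hc),
      I.cubeSign_state hc.res_eq hc.res]
  · have h1 : D.khovanovR t s = 0 := by
      by_contra hne
      exact h (exists_flip hne)
    have h2 : D'.khovanovR (I.state t) (I.state s) = 0 := by
      by_contra hne
      obtain ⟨c', hc'⟩ := exists_flip hne
      obtain ⟨c, rfl⟩ := I.crossing.surjective c'
      exact h ⟨c, (I.flipAt_iff s t c).1 hc'⟩
    rw [h1, h2, mul_zero]

theorem signConj_khovanovRest : SignConj I.state I.stateSign D.khovanovRest D'.khovanovRest :=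
  I.signConj_khovanov.sub I.signConj_khovanovR

/-- Entries are inverted and transposed, and signs are their own inverses; so the same conjugation
by signs works as for d_0. -/
theorem signConj_splitHomotopy (c : D.Crossing) :
    SignConj I.state I.stateSign (splitHomotopy c) (splitHomotopy (I.crossing c)) := by
  classical
  intro s t
  have hs : I.stateSign s ≠ 0 := left_ne_zero_of_mul_eq_one (I.stateSign_mul_self s)
  have ht : I.stateSign t ≠ 0 := left_ne_zero_of_mul_eq_one (I.stateSign_mul_self t)
  unfold splitHomotopy
  simp only [I.forbidden_state, I.state_res, I.state_res_update, I.state_ori_eq]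
  by_cases h : s.Forbidden c ∧ s.res c = true ∧ t.res = Function.update s.res c false ∧ t.ori = s.ori
  · rw [if_pos h, if_pos h, I.signConj_khovanovR t s, mul_inv, mul_inv,
      inv_eq_of_mul_eq_one_right (I.stateSign_mul_self s),
      inv_eq_of_mul_eq_one_right (I.stateSign_mul_self t)]
    ring
  · rw [if_neg h, if_neg h, mul_zero]

open Classical in
theorem cubeDim_state (s : D.EState) : (I.state s).cubeDim = s.cubeDim := by
  unfold EState.cubeDim
  refine (Finset.card_equiv I.crossing fun c => ?_).symm
  simp only [Finset.mem_filter, Finset.mem_univ, true_and]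
  exact (I.forbidden_state s c).symm

theorem signConj_averageHomotopy :
    SignConj I.state I.stateSign D.averageHomotopy D'.averageHomotopy := by
  classical
  intro s t
  unfold averageHomotopy
  rw [I.cubeDim_state, Finset.sum_filter, Finset.sum_filter, ← I.crossing.sum_comp,
    mul_left_comm (I.stateSign t * I.stateSign s), Finset.mul_sum (a := I.stateSign t * I.stateSign s)]
  congr 1
  refine Finset.sum_congr rfl fun c _ => ?_
  rw [I.signConj_splitHomotopy c s t, mul_ite, mul_zero]
  exact if_congr (I.forbidden_state s c) rfl rfl

theorem signConj_cancelled : SignConj I.state I.stateSign D.cancelled D'.cancelled := by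
  have hu := I.stateSign_mul_self
  unfold cancelled
  rw [← Fintype.card_congr I.state]
  exact SignConj.sum _ fun k => I.signConj_khovanovRest.mul hu
    ((I.signConj_averageHomotopy.mul hu I.signConj_khovanovRest).pow hu k)

theorem exists_gen_equiv (F : D.FigureEights) (F' : D'.FigureEights) :
    ∃ e : D.Gen ≃ D'.Gen, ∀ g, F'.toState (e g) = I.state (F.toState g) := by
  have h1 : ∀ g, ∃ g', F'.toState g' = I.state (F.toState g) := fun g =>
    exists_toState_eq F' ((I.inH_state _).2 (toState_inH F g))
  choose f hf using h1
  refine ⟨Equiv.ofBijective f ⟨fun g g' h => ?_, fun g' => ?_⟩, hf⟩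
  · exact toState_injective F (I.state.injective (by rw [← hf, ← hf, h]))
  · obtain ⟨s, hs⟩ := I.state.surjective (F'.toState g')
    obtain ⟨g, hg⟩ := exists_toState_eq F ((I.inH_state s).1 (hs ▸ toState_inH F' g'))
    exact ⟨g, toState_injective F' (by rw [hf, hg, hs])⟩

include I in
/-- The differential on Bigelow's generators is invariant up to signs. -/
theorem exists_equiv_differential (F : D.FigureEights) (F' : D'.FigureEights) :
    ∃ (e : D.Gen ≃ D'.Gen) (u : D.Gen → ℤˣ),
      (∀ g, F'.J (e g) = F.J g ∧ F'.P (e g) = F.P g) ∧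
      ∀ g g', F'.differential (e g') (e g) =
        ((u g' : ℤ) : ℚ) * ((u g : ℤ) : ℚ) * F.differential g' g := by
  obtain ⟨e, he⟩ := I.exists_gen_equiv F F'
  refine ⟨e, fun g => I.orderSign (F.toState g).res, fun g => ⟨?_, ?_⟩, fun g g' => ?_⟩
  · rw [J_eq, J_eq, he, I.j_state]
  · rw [P_eq, P_eq, he, I.i_state, I.j_state]
  · change D'.cancelled (F'.toState (e g')) (F'.toState (e g)) = _
    rw [he, he]
    exact I.signConj_cancelled _ _

end DiagramIso
end GridDiagram
end GridKh

namespace GridKh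

/-! ### Diffeomorphisms induce isomorphisms of diagrams -/

/-- The derivative is taken within the interval, where it is unique even at the end points. Corners
of the diagram need this. -/
theorem deriv_sign {g : ℝ → ℝ} {a t x y : ℝ} (hxy : x < y) (ht : t ∈ Set.Icc x y)
    (hd : HasDerivAt g a t) : (StrictMonoOn g (Set.Icc x y) → 0 ≤ a) ∧
      (StrictAntiOn g (Set.Icc x y) → a ≤ 0) ∧
      ∀ k, (∀ u ∈ Set.Icc x y, g u = k) → a = 0 := by
  have h := hd.hasDerivWithinAt.derivWithin (uniqueDiffOn_Icc hxy t ht)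
  have hm : MonotoneOn g (Set.Icc x y) → 0 ≤ a := fun hg => h ▸ hg.derivWithin_nonneg
  have ha : AntitoneOn g (Set.Icc x y) → a ≤ 0 := fun hg => h ▸ hg.derivWithin_nonpos
  refine ⟨fun hg => hm hg.monotoneOn, fun hg => ha hg.antitoneOn, fun k hk => le_antisymm (ha ?_) (hm ?_)⟩
  · exact fun u hu v hv _ => by rw [hk u hu, hk v hv]
  · exact fun u hu v hv _ => by rw [hk u hu, hk v hv]

theorem det_prod (L : (ℝ × ℝ) →L[ℝ] (ℝ × ℝ)) :
    L.det = (L (1, 0)).1 * (L (0, 1)).2 - (L (0, 1)).1 * (L (1, 0)).2 := by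
  rw [ContinuousLinearMap.det, ← LinearMap.det_toMatrix (Module.Basis.finTwoProd ℝ),
    Matrix.det_fin_two]
  simp [LinearMap.toMatrix_apply]

namespace GridDiagram

variable {n : ℕ} {D : GridDiagram n}

/-- A grid point as a point of the plane. -/
def planePt (v : Fin n × Fin n) : ℝ × ℝ := ((v.1.val : ℝ), (v.2.val : ℝ))

theorem planePt_injective : Function.Injective (planePt : Fin n × Fin n → ℝ × ℝ) := by
  rintro ⟨a, b⟩ ⟨c, d⟩ h
  simp only [planePt, Prod.mk.injEq, Nat.cast_inj, Fin.val_inj] at h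
  exact Prod.ext h.1 h.2

theorem hSegment_eq (r : Fin n) : D.hSegment r =
    (fun t : ℝ => (t, (r.val : ℝ))) '' Set.Icc ((D.left r).val : ℝ) ((D.right r).val : ℝ) := by
  unfold hSegment
  rw [← Prod.image_mk_segment_left, segment_eq_Icc]
  exact_mod_cast (D.left_lt_right r).le

theorem vSegment_eq (c : Fin n) : D.vSegment c =
    (fun t : ℝ => ((c.val : ℝ), t)) '' Set.Icc ((D.bot c).val : ℝ) ((D.top c).val : ℝ) := by
  unfold vSegment
  rw [← Prod.image_mk_segment_right, segment_eq_Icc]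
  exact_mod_cast (D.bot_lt_top c).le

theorem mem_hSegment {r : Fin n} {p : ℝ × ℝ} : p ∈ D.hSegment r ↔
    p.2 = r.val ∧ p.1 ∈ Set.Icc ((D.left r).val : ℝ) ((D.right r).val : ℝ) := by
  rw [hSegment_eq]
  constructor
  · rintro ⟨t, ht, rfl⟩
    exact ⟨rfl, ht⟩
  · rintro ⟨h1, h2⟩
    exact ⟨p.1, h2, Prod.ext rfl h1.symm⟩

theorem mem_vSegment {c : Fin n} {p : ℝ × ℝ} : p ∈ D.vSegment c ↔
    p.1 = c.val ∧ p.2 ∈ Set.Icc ((D.bot c).val : ℝ) ((D.top c).val : ℝ) := by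
  rw [vSegment_eq]
  constructor
  · rintro ⟨t, ht, rfl⟩
    exact ⟨rfl, ht⟩
  · rintro ⟨h1, h2⟩
    exact ⟨p.2, h2, Prod.ext h1.symm rfl⟩

theorem touch_iff_mem {v : Fin n × Fin n} :
    D.Touch v ↔ planePt v ∈ D.hSegment v.2 ∧ planePt v ∈ D.vSegment v.1 := by
  rw [mem_hSegment, mem_vSegment]
  unfold Touch planePt
  simp only [true_and, Set.mem_Icc, Nat.cast_le, Fin.le_def]

theorem planePt_eq_of_mem {c r : Fin n} {p : ℝ × ℝ} (h : p ∈ D.hSegment r) (h' : p ∈ D.vSegment c) :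
    p = planePt (c, r) :=
  Prod.ext (mem_vSegment.1 h').1 (mem_hSegment.1 h).1

theorem hSegment_injective : Function.Injective D.hSegment := by
  intro r r' h
  have h1 : planePt (D.left r, r) ∈ D.hSegment r := (touch_iff_mem.1 (touch_corner (.inl rfl))).1
  rw [h] at h1
  have := (mem_hSegment.1 h1).1
  simp only [planePt, Nat.cast_inj] at this
  exact Fin.ext this

theorem vSegment_injective : Function.Injective D.vSegment := by
  intro c c' h
  have h1 : planePt (c, D.o c) ∈ D.vSegment c := (touch_iff_mem.1 (touch_o c)).2
  rw [h] at h1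
  have := (mem_vSegment.1 h1).1
  simp only [planePt, Nat.cast_inj] at this
  exact Fin.ext this

namespace Carries

variable {m : ℕ} {D' : GridDiagram m} {f : (ℝ × ℝ) ≃ₘ[ℝ] (ℝ × ℝ)}

theorem exists_x (h : Carries f D D') (c' : Fin m) : ∃ c, f (planePt (c, D.x c)) = planePt (c', D'.x c') := by
  have h1 : planePt (c', D'.x c') ∈ f '' D.xPoints := by
    rw [h.x]
    exact ⟨c', rfl⟩
  obtain ⟨_, ⟨c, rfl⟩, h2⟩ := h1
  exact ⟨c, h2⟩

/-- Injectivity comes from `f`. Every row of `D'` is reached because it contains an `X`, which is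
the image of an `X` of `D`. -/
theorem exists_row (h : Carries f D D') :
    ∃ ρ : Fin n ≃ Fin m, ∀ r, f '' D.hSegment r = D'.hSegment (ρ r) := by
  choose ρ hρ using h.horizontal
  refine ⟨Equiv.ofBijective ρ ⟨fun r r' hr => ?_, fun r' => ?_⟩, hρ⟩
  · refine hSegment_injective (D := D) (f.injective.image_injective ?_)
    exact (hρ r).trans (hr ▸ (hρ r').symm)
  · obtain ⟨c, hc⟩ := h.exists_x (D'.x.symm r')
    have h1 : f (planePt (c, D.x c)) ∈ D'.hSegment (ρ (D.x c)) := by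
      rw [← hρ]
      exact Set.mem_image_of_mem _ (touch_iff_mem.1 (touch_x c)).1
    rw [hc, Equiv.apply_symm_apply] at h1
    have := (mem_hSegment.1 h1).1
    simp only [planePt, Nat.cast_inj] at this
    exact ⟨D.x c, Fin.ext this.symm⟩

theorem exists_col (h : Carries f D D') :
    ∃ γ : Fin n ≃ Fin m, ∀ c, f '' D.vSegment c = D'.vSegment (γ c) := by
  choose γ hγ using h.vertical
  refine ⟨Equiv.ofBijective γ ⟨fun r r' hr => ?_, fun c' => ?_⟩, hγ⟩
  · refine vSegment_injective (D := D) (f.injective.image_injective ?_)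
    exact (hγ r).trans (hr ▸ (hγ r').symm)
  · obtain ⟨c, hc⟩ := h.exists_x c'
    have h1 : f (planePt (c, D.x c)) ∈ D'.vSegment (γ c) := by
      rw [← hγ]
      exact Set.mem_image_of_mem _ (touch_iff_mem.1 (touch_x c)).2
    rw [hc] at h1
    have := (mem_vSegment.1 h1).1
    simp only [planePt, Nat.cast_inj] at this
    exact ⟨c, Fin.ext this.symm⟩

theorem hasDerivAt_row (p : ℝ × ℝ) : HasDerivAt (fun t => f (t, p.2)) (fderiv ℝ f p (1, 0)) p.1 := by
  have h1 : HasFDerivAt f (fderiv ℝ f p) (p.1, p.2) :=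
    (f.contDiff.differentiable (by simp) p).hasFDerivAt
  exact h1.comp_hasDerivAt p.1 ((hasDerivAt_id p.1).prodMk (hasDerivAt_const p.1 p.2))

theorem hasDerivAt_col (p : ℝ × ℝ) : HasDerivAt (fun t => f (p.1, t)) (fderiv ℝ f p (0, 1)) p.2 := by
  have h1 : HasFDerivAt f (fderiv ℝ f p) (p.1, p.2) :=
    (f.contDiff.differentiable (by simp) p).hasFDerivAt
  exact h1.comp_hasDerivAt p.2 ((hasDerivAt_const p.2 p.1).prodMk (hasDerivAt_id p.2))

/-- On a segment only the coordinate along it can vary, so it is a continuous injective function on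
an interval and hence strictly monotone. -/
theorem row_mono {r : Fin n} {r' : Fin m} (hr : f '' D.hSegment r = D'.hSegment r') :
    let s := Set.Icc ((D.left r).val : ℝ) ((D.right r).val : ℝ)
    (∀ t ∈ s, (f (t, (r.val : ℝ))).2 = r'.val) ∧
      (StrictMonoOn (fun t => (f (t, (r.val : ℝ))).1) s ∨
        StrictAntiOn (fun t => (f (t, (r.val : ℝ))).1) s) := by
  intro s
  have h1 : ∀ t ∈ s, (f (t, (r.val : ℝ))).2 = r'.val := fun t ht => by
    have h2 : f (t, (r.val : ℝ)) ∈ D'.hSegment r' := by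
      rw [← hr]
      exact Set.mem_image_of_mem _ (mem_hSegment.2 ⟨rfl, ht⟩)
    exact (mem_hSegment.1 h2).1
  refine ⟨h1, ContinuousOn.strictMonoOn_of_injOn_Icc' ?_ ?_ ?_⟩
  · exact_mod_cast (D.left_lt_right r).le
  · have := f.continuous
    fun_prop
  · intro t ht u hu htu
    have : f (t, (r.val : ℝ)) = f (u, (r.val : ℝ)) := Prod.ext htu ((h1 t ht).trans (h1 u hu).symm)
    exact congrArg Prod.fst (f.injective this)

theorem col_mono {c : Fin n} {c' : Fin m} (hc : f '' D.vSegment c = D'.vSegment c') :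
    let s := Set.Icc ((D.bot c).val : ℝ) ((D.top c).val : ℝ)
    (∀ t ∈ s, (f ((c.val : ℝ), t)).1 = c'.val) ∧
      (StrictMonoOn (fun t => (f ((c.val : ℝ), t)).2) s ∨
        StrictAntiOn (fun t => (f ((c.val : ℝ), t)).2) s) := by
  intro s
  have h1 : ∀ t ∈ s, (f ((c.val : ℝ), t)).1 = c'.val := fun t ht => by
    have h2 : f ((c.val : ℝ), t) ∈ D'.vSegment c' := by
      rw [← hc]
      exact Set.mem_image_of_mem _ (mem_vSegment.2 ⟨rfl, ht⟩)
    exact (mem_vSegment.1 h2).1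
  refine ⟨h1, ContinuousOn.strictMonoOn_of_injOn_Icc' ?_ ?_ ?_⟩
  · exact_mod_cast (D.bot_lt_top c).le
  · have := f.continuous
    fun_prop
  · intro t ht u hu htu
    have : f ((c.val : ℝ), t) = f ((c.val : ℝ), u) := Prod.ext ((h1 t ht).trans (h1 u hu).symm) htu
    exact congrArg Prod.snd (f.injective this)

open Classical in
theorem nonempty_diagramIso (h : Carries f D D') : Nonempty (DiagramIso D D') := by
  obtain ⟨ρ, hρ⟩ := h.exists_row
  obtain ⟨γ, hγ⟩ := h.exists_col
  have hpt : ∀ c r, D.Touch (c, r) → f (planePt (c, r)) = planePt (γ c, ρ r) := fun c r ht => by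
    refine planePt_eq_of_mem (D := D') ?_ ?_
    · rw [← hρ]
      exact Set.mem_image_of_mem _ (touch_iff_mem.1 ht).1
    · rw [← hγ]
      exact Set.mem_image_of_mem _ (touch_iff_mem.1 ht).2
  have hrow : ∀ {c r}, D.Touch (c, r) → (c.val : ℝ) ∈
      Set.Icc ((D.left r).val : ℝ) ((D.right r).val : ℝ) := fun ht =>
    (mem_hSegment.1 (touch_iff_mem.1 ht).1).2
  have hcol : ∀ {c r}, D.Touch (c, r) → (r.val : ℝ) ∈
      Set.Icc ((D.bot c).val : ℝ) ((D.top c).val : ℝ) := fun ht =>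
    (mem_vSegment.1 (touch_iff_mem.1 ht).2).2
  refine ⟨{ col := γ, row := ρ,
            colUp := fun c => decide (StrictMonoOn (fun t => (f ((c.val : ℝ), t)).2)
              (Set.Icc ((D.bot c).val : ℝ) ((D.top c).val : ℝ)))
            rowUp := fun r => decide (StrictMonoOn (fun t => (f (t, (r.val : ℝ))).1)
              (Set.Icc ((D.left r).val : ℝ) ((D.right r).val : ℝ)))
            o := fun c => ?_, x := fun c => ?_, touch := fun c r => ⟨fun ht => ?_, fun ht => ?_⟩,
            row_lt := fun {r c c'} h1 h2 => ?_, col_lt := fun {c r r'} h1 h2 => ?_,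
            up := fun {c r} ht => ?_ }⟩
  · have h1 : f (planePt (c, D.o c)) ∈ D'.oPoints := by
      rw [← h.o]
      exact Set.mem_image_of_mem _ ⟨c, rfl⟩
    rw [hpt _ _ (touch_o c)] at h1
    obtain ⟨c', hc'⟩ := h1
    have h2 : (c', D'.o c') = (γ c, ρ (D.o c)) := planePt_injective hc'
    rw [Prod.mk.injEq] at h2
    rw [← h2.1, h2.2]
  · have h1 : f (planePt (c, D.x c)) ∈ D'.xPoints := by
      rw [← h.x]
      exact Set.mem_image_of_mem _ ⟨c, rfl⟩
    rw [hpt _ _ (touch_x c)] at h1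
    obtain ⟨c', hc'⟩ := h1
    have h2 : (c', D'.x c') = (γ c, ρ (D.x c)) := planePt_injective hc'
    rw [Prod.mk.injEq] at h2
    rw [← h2.1, h2.2]
  · obtain ⟨h1, h2⟩ := touch_iff_mem.1 ht
    simp only at h1 h2
    rw [← hρ] at h1
    rw [← hγ] at h2
    obtain ⟨p, hp, hp'⟩ := h1
    obtain ⟨q, hq, hq'⟩ := h2
    obtain rfl : p = q := f.injective (hp'.trans hq'.symm)
    obtain rfl := planePt_eq_of_mem hp hq
    exact touch_iff_mem.2 ⟨hp, hq⟩
  · rw [touch_iff_mem, ← hpt c r ht]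
    obtain ⟨h1, h2⟩ := touch_iff_mem.1 ht
    exact ⟨hρ r ▸ Set.mem_image_of_mem _ h1, hγ c ▸ Set.mem_image_of_mem _ h2⟩
  · have e1 : (f ((c.val : ℝ), (r.val : ℝ))).1 = (γ c).val := congrArg Prod.fst (hpt c r h1)
    have e2 : (f ((c'.val : ℝ), (r.val : ℝ))).1 = (γ c').val := congrArg Prod.fst (hpt c' r h2)
    have h3 : c < c' ↔ (c.val : ℝ) < c'.val := by rw [Nat.cast_lt, Fin.lt_def]
    have h4 : ∀ a b : Fin m, a < b ↔ (a.val : ℝ) < b.val := fun a b => by rw [Nat.cast_lt, Fin.lt_def]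
    simp only [decide_eq_true_eq]
    split_ifs with hm
    · rw [h3, h4, ← e1, ← e2]
      exact (hm.lt_iff_lt (hrow h1) (hrow h2)).symm
    · rw [h3, h4, ← e1, ← e2]
      exact (((row_mono (hρ r)).2.resolve_left hm).lt_iff_gt (hrow h2) (hrow h1)).symm
  · have e1 : (f ((c.val : ℝ), (r.val : ℝ))).2 = (ρ r).val := congrArg Prod.snd (hpt c r h1)
    have e2 : (f ((c.val : ℝ), (r'.val : ℝ))).2 = (ρ r').val := congrArg Prod.snd (hpt c r' h2)
    have h3 : r < r' ↔ (r.val : ℝ) < r'.val := by rw [Nat.cast_lt, Fin.lt_def]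
    have h4 : ∀ a b : Fin m, a < b ↔ (a.val : ℝ) < b.val := fun a b => by rw [Nat.cast_lt, Fin.lt_def]
    simp only [decide_eq_true_eq]
    split_ifs with hm
    · rw [h3, h4, ← e1, ← e2]
      exact (hm.lt_iff_lt (hcol h1) (hcol h2)).symm
    · rw [h3, h4, ← e1, ← e2]
      exact (((col_mono (hγ c)).2.resolve_left hm).lt_iff_gt (hcol h2) (hcol h1)).symm
  -- At a point of intersection the derivative along the row is horizontal, so the determinant is
  -- the product of the diagonal entries. Its positivity excludes opposite directions of
  -- monotonicity on the row and the column.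
  · have hdet := h.orientation (planePt (c, r))
    rw [det_prod] at hdet
    have hx : ((D.left r).val : ℝ) < (D.right r).val := by exact_mod_cast D.left_lt_right r
    have hy : ((D.bot c).val : ℝ) < (D.top c).val := by exact_mod_cast D.bot_lt_top c
    have dr := hasDerivAt_row (f := f) (planePt (c, r))
    have dc := hasDerivAt_col (f := f) (planePt (c, r))
    have r1 := deriv_sign hx (hrow ht) (hasFDerivAt_fst.comp_hasDerivAt _ dr)
    have r2 := (deriv_sign hx (hrow ht) (hasFDerivAt_snd.comp_hasDerivAt _ dr)).2.2 _ (row_mono (hρ r)).1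
    have c1 := deriv_sign hy (hcol ht) (hasFDerivAt_snd.comp_hasDerivAt _ dc)
    have c2 := (deriv_sign hy (hcol ht) (hasFDerivAt_fst.comp_hasDerivAt _ dc)).2.2 _ (col_mono (hγ c)).1
    simp only [ContinuousLinearMap.coe_fst', ContinuousLinearMap.coe_snd'] at r1 r2 c1 c2
    rw [r2, mul_zero, sub_zero] at hdet
    rw [decide_eq_decide]
    constructor
    · intro hm
      by_contra hn
      exact absurd hdet (mul_nonpos_of_nonneg_of_nonpos (r1.1 hm)
        (c1.2.1 ((col_mono (hγ c)).2.resolve_left hn))).not_gt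
    · intro hm
      by_contra hn
      exact absurd hdet (mul_nonpos_of_nonpos_of_nonneg
        (r1.2.1 ((row_mono (hρ r)).2.resolve_left hn)) (c1.1 hm)).not_gt

end Carries
end GridDiagram
end GridKh

end

/-! ### The canonical differential on Bigelow's generators -/

theorem mainTheorem6 {n : ℕ} (hn : 2 ≤ n) (D : GridDiagram n) (F : D.FigureEights) :
    -- the part of the Khovanov differential preserving `R` is a differential on the span of the
    -- states with forbidden crossings
    (D.khovanovR * D.khovanovR = 0 ∧
      ∀ s t : D.EState, D.khovanovR t s ≠ 0 → ¬ s.InH ∧ ¬ t.InH) ∧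
    -- each splitting of a hypercube gives a null-homotopy
    (∀ (c : D.Crossing) (s : D.EState), s.Forbidden c → ∀ t,
      (splitHomotopy c * D.khovanovR + D.khovanovR * splitHomotopy c) t s =
        if t = s then -1 else 0) ∧
    -- and so does the average over all splittings
    (∀ s : D.EState, ¬ s.InH → ∀ t,
      (D.averageHomotopy * D.khovanovR + D.khovanovR * D.averageHomotopy) t s =
        if t = s then -1 else 0) ∧
    -- the resulting canonical map on Bigelow's generators is a differential
    F.differential * F.differential = 0 ∧
    -- which respects `J` and increases `P` by one
    (∀ g g', F.differential g' g ≠ 0 → F.J g' = F.J g ∧ F.P g' = F.P g + 1) ∧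
    -- its homology is Khovanov homology, with `P = i - j` and `J = j`
    (∀ i j : ℤ, Nonempty (F.BigelowHomology (i - j) j ≃ₗ[ℚ] D.Kh i j)) ∧
    -- and it depends only on the diagram up to diffeomorphisms of the plane that send horizontal
    -- segments to horizontal segments, up to signs of the generators
    (∀ {m : ℕ} (D' : GridDiagram m) (F' : D'.FigureEights) (f : (ℝ × ℝ) ≃ₘ[ℝ] (ℝ × ℝ)),
      Carries f D D' →
      ∃ (e : D.Gen ≃ D'.Gen) (u : D.Gen → ℤˣ),
        (∀ g, F'.J (e g) = F.J g ∧ F'.P (e g) = F.P g) ∧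
        ∀ g g', F'.differential (e g') (e g) =
          ((u g' : ℤ) : ℚ) * ((u g : ℤ) : ℚ) * F.differential g' g) := by
  refine ⟨⟨khovanovR_mul_khovanovR, fun s t h => not_inH_of_khovanovR h⟩, fun c s hs t => ?_,
    fun s hs t => ?_, differential_mul_differential F,
    fun g g' h => differential_degree F (P_eq F) (J_eq F) g g' h,
    nonempty_bigelowHomology_equiv F (P_eq F) (J_eq F), fun D' F' f hf => ?_⟩
  · rw [splitHomotopy_anticomm]
    by_cases h : t = s <;> simp [h, hs]
  · rw [averageHomotopy_anticomm]
    by_cases h : t = s <;> simp [h, hs]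
  · obtain ⟨I⟩ := hf.nonempty_diagramIso
    exact I.exists_equiv_differential F F'
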